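/- Let $\hbar, m_e, d > 0$, let $\Omega = \{(x,y)\in\mathbb{R}^2 : x,y\ge 0,\ |x-y|\le d\}$ and $\partial\Omega_D = \{(x,y)\in\Omega : |x-y| = d\}$, and let $L^2_a(\Omega) = \{\varphi\in L^2(\Omega) : \varphi(x,y) = -\varphi(y,x)\}$ (complex-valued functions). For a real-valued $\sigma\in L^\infty([0,\infty))$ let $-\Delta^d_\sigma$ be the self-adjoint operator in $L^2_a(\Omega)$ associated with the closed, semi-bounded quadratic form $$q^d_\sigma[\varphi] = \frac{\hbar^2}{2m_e}\int_\Omega |\nabla\varphi|^2\,\mathrm{d}x\,\mathrm{d}y - \int_0^d \sigma(y)\left(|\varphi(y,0)|^2 + |\varphi(0,y)|^2\right)\mathrm{d}y$$ with domain $\mathcal{D}_q = \{\varphi\in H^1(\Omega)\cap L^2_a(\Omega) : \varphi|_{\partial\Omega_D} = 0\}$, where boundary values are understood as traces. (The existence of this operator is part of the claim.) The discrete spectrum $\sigma_d$ of a self-adjoint operator is the set of isolated points of its spectrum that are eigenvalues of finite multiplicity, and its essential spectrum $\sigma_{ess}$ is the rest of the spectrum. Then, for every real-valued $\sigma\in L^\infty([0,\infty))$,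 $$\sigma_{ess}(-\Delta^d_\sigma) = \left[\frac{\hbar^2\pi^2}{m_e d^2},\infty\right).$$ Furthermore, for $\sigma = 0$ one has $\sigma_d(-\Delta^d_{0}) = \{E_0\}$, where $E_0$ is an eigenvalue of multiplicity one, and $$0.25\cdot\frac{\hbar^2\pi^2}{m_e d^2} \le E_0 \le 0.93\cdot\frac{\hbar^2\pi^2}{m_e d^2}.$$ -/

import Mathlib

open MeasureTheory Set Filter Topology
open scoped ENNReal ContDiff ComplexConjugate

noncomputable section

namespace PairModel

/-! ### Spectral notions for (unbounded) linear operators -/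

section Spectrum

variable {H : Type*} [NormedAddCommGroup H] [NormedSpace ℂ H]

/-- The resolvent set: all `z` for which `A - z` maps the domain of `A` bijectively onto `H`,
with bounded inverse. -/
def resolventSet (A : H →ₗ.[ℂ] H) : Set ℂ :=
  {z | Function.Bijective (fun φ : A.domain => A φ - z • (φ : H)) ∧
    ∃ C : ℝ, ∀ φ : A.domain, ‖(φ : H)‖ ≤ C * ‖A φ - z • (φ : H)‖}

/-- The spectrum of `A`. -/
def spec (A : H →ₗ.[ℂ] H) : Set ℂ := (resolventSet A)ᶜ

/-- The space of all `φ` in the domain of `A` with `A φ = z φ`. -/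
def eigenspace (A : H →ₗ.[ℂ] H) (z : ℂ) : Submodule ℂ A.domain :=
  LinearMap.ker (A.toFun - z • A.domain.subtype)

/-- The discrete spectrum: eigenvalues of finite multiplicity that are isolated points of the
spectrum. -/
def discreteSpectrum (A : H →ₗ.[ℂ] H) : Set ℂ :=
  {z | z ∈ spec A ∧ (∃ ε > 0, Metric.ball z ε ∩ spec A = {z}) ∧
    eigenspace A z ≠ ⊥ ∧ FiniteDimensional ℂ (eigenspace A z)}

/-- The essential spectrum: the part of the spectrum that is not discrete. -/
def essentialSpectrum (A : H →ₗ.[ℂ] H) : Set ℂ := spec A \ discreteSpectrum A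

end Spectrum

/-! ### The pencil domain and its antisymmetric Hilbert space -/

/-- The pencil-shaped two-particle configuration space
`Ω = {(x, y) : x, y ≥ 0, |x - y| ≤ d}`. -/
def pencil (d : ℝ) : Set (ℝ × ℝ) := {p | 0 ≤ p.1 ∧ 0 ≤ p.2 ∧ |p.1 - p.2| ≤ d}

/-- Lebesgue measure on `Ω`. -/
abbrev pencilMeasure (d : ℝ) : Measure (ℝ × ℝ) := volume.restrict (pencil d)

/-- The complex Hilbert space `L²(Ω)`. -/
abbrev PencilL2 (d : ℝ) : Type := Lp ℂ 2 (pencilMeasure d)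

lemma measurableSet_pencil (d : ℝ) : MeasurableSet (pencil d) := by
  have h : Continuous fun p : ℝ × ℝ => |p.1 - p.2| := by fun_prop
  refine IsClosed.measurableSet ?_
  exact (isClosed_le continuous_const continuous_fst).inter
    ((isClosed_le continuous_const continuous_snd).inter
      (isClosed_le h continuous_const))

lemma measurePreserving_swap_pencil (d : ℝ) :
    MeasurePreserving (Prod.swap : ℝ × ℝ → ℝ × ℝ) (pencilMeasure d) (pencilMeasure d) := by
  have h := (Measure.measurePreserving_swap (μ := (volume : Measure ℝ))
    (ν := (volume : Measure ℝ))).restrict_preimage (measurableSet_pencil d)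
  have e : Prod.swap ⁻¹' pencil d = pencil d := by
    ext p
    simp only [pencil, mem_preimage, mem_ofPred_eq, Prod.fst_swap, Prod.snd_swap]
    rw [abs_sub_comm]
    tauto
  rw [e] at h
  exact h

/-- The antisymmetric subspace `L²_a(Ω) = {φ ∈ L²(Ω) : φ(x, y) = -φ(y, x)}`. -/
def antisymmetricL2 (d : ℝ) : Submodule ℂ (PencilL2 d) where
  carrier := {φ | ∀ᵐ p ∂pencilMeasure d, φ p = -φ p.swap}
  zero_mem' := by
    have h0 := Lp.coeFn_zero ℂ 2 (pencilMeasure d)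
    have h1 := (measurePreserving_swap_pencil d).quasiMeasurePreserving.ae h0
    filter_upwards [h0, h1] with p hp hp'
    rw [hp, hp']
    simp
  add_mem' := by
    intro f g hf hg
    change ∀ᵐ p ∂pencilMeasure d, (f + g) p = -(f + g) p.swap
    have h0 := Lp.coeFn_add f g
    have h1 := (measurePreserving_swap_pencil d).quasiMeasurePreserving.ae h0
    filter_upwards [h0, h1, hf, hg] with p hp hp' hf hg
    rw [hp, hp', Pi.add_apply, Pi.add_apply, hf, hg]
    ring
  smul_mem' := by
    intro c f hf
    change ∀ᵐ p ∂pencilMeasure d, (c • f) p = -(c • f) p.swap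
    have h0 := Lp.coeFn_smul c f
    have h1 := (measurePreserving_swap_pencil d).quasiMeasurePreserving.ae h0
    filter_upwards [h0, h1, hf] with p hp hp' hf
    rw [hp, hp', Pi.smul_apply, Pi.smul_apply, hf, smul_neg]

lemma isClosed_antisymmetricL2 (d : ℝ) : IsClosed (antisymmetricL2 d : Set (PencilL2 d)) := by
  let U := Lp.compMeasurePreservingₗᵢ ℂ (E := ℂ) (p := 2) (Prod.swap : ℝ × ℝ → ℝ × ℝ)
    (measurePreserving_swap_pencil d)
  have e : (antisymmetricL2 d : Set (PencilL2 d)) = {φ | φ = -U φ} := by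
    ext φ
    have h := Lp.coeFn_compMeasurePreserving φ (measurePreserving_swap_pencil d)
    have h2 := Lp.coeFn_neg (U φ)
    change (∀ᵐ p ∂pencilMeasure d, φ p = -φ p.swap) ↔ φ = -U φ
    rw [Lp.ext_iff]
    constructor
    · intro hφ
      filter_upwards [hφ, h, h2] with p h1 h2 h3
      rw [h3, h1]
      exact congrArg Neg.neg h2.symm
    · intro hφ
      filter_upwards [hφ, h, h2] with p h1 h2 h3
      rw [h1, h3]
      exact congrArg Neg.neg h2
  rw [e]
  exact isClosed_eq continuous_id U.continuous.neg

instance (d : ℝ) : CompleteSpace (antisymmetricL2 d) :=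
  (isClosed_antisymmetricL2 d).completeSpace_coe

/-! ### The Sobolev space `H¹(Ω)` and boundary values -/

/-- `g` is the weak derivative of `φ` in direction `v` in (the interior of) `Ω`. -/
def HasWeakDeriv (d : ℝ) (v : ℝ × ℝ) (φ g : PencilL2 d) : Prop :=
  ∀ ψ : ℝ × ℝ → ℂ, ContDiff ℝ ∞ ψ → HasCompactSupport ψ → tsupport ψ ⊆ interior (pencil d) →
    ∫ p in pencil d, φ p * fderiv ℝ ψ p v = -∫ p in pencil d, g p * ψ p

/-- Membership in `H¹(Ω)`: both first-order weak partial derivatives exist in `L²(Ω)`. -/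
def MemH1 (d : ℝ) (φ : PencilL2 d) : Prop :=
  (∃ g, HasWeakDeriv d (1, 0) φ g) ∧ (∃ g, HasWeakDeriv d (0, 1) φ g)

open Classical in
/-- The weak derivative of `φ` in direction `v` (zero if there is none in `L²(Ω)`). -/
def weakDeriv (d : ℝ) (v : ℝ × ℝ) (φ : PencilL2 d) : PencilL2 d :=
  if h : ∃ g, HasWeakDeriv d v φ g then h.choose else 0

/-- `b` is the trace of `φ ∈ H¹(Ω)` along the boundary piece `t ↦ c t`, `t ∈ I`: there are
functions `u n ∈ C_c^∞(ℝ²)` converging to `φ` in `H¹(Ω)` whose restrictions to the boundary piece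
converge to `b` in `L²`. -/
def HasTrace (d : ℝ) (c : ℝ → ℝ × ℝ) (I : Set ℝ) (φ : PencilL2 d) (b : ℝ → ℂ) : Prop :=
  MemH1 d φ ∧ MemLp b 2 (volume.restrict I) ∧
  ∃ u : ℕ → ℝ × ℝ → ℂ, (∀ n, ContDiff ℝ ∞ (u n)) ∧ (∀ n, HasCompactSupport (u n)) ∧
    Tendsto (fun n => eLpNorm (fun p => u n p - φ p) 2 (pencilMeasure d)) atTop (𝓝 0) ∧
    (∀ v ∈ ({(1, 0), (0, 1)} : Set (ℝ × ℝ)),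
      Tendsto (fun n => eLpNorm (fun p => fderiv ℝ (u n) p v - weakDeriv d v φ p) 2
        (pencilMeasure d)) atTop (𝓝 0)) ∧
    Tendsto (fun n => eLpNorm (fun t => u n (c t) - b t) 2 (volume.restrict I)) atTop (𝓝 0)

open Classical in
/-- The trace of `φ` along a boundary piece (zero if there is none). -/
def trace (d : ℝ) (c : ℝ → ℝ × ℝ) (I : Set ℝ) (φ : PencilL2 d) : ℝ → ℂ :=
  if h : ∃ b, HasTrace d c I φ b then h.choose else 0

/-- The first component `y ↦ φ(y, 0)` of the boundary values `γ(φ)`, `0 ≤ y ≤ d`. -/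
def traceBottom (d : ℝ) (φ : PencilL2 d) : ℝ → ℂ := trace d (fun y => (y, 0)) (Icc 0 d) φ

/-- The second component `y ↦ φ(0, y)` of the boundary values `γ(φ)`, `0 ≤ y ≤ d`. -/
def traceLeft (d : ℝ) (φ : PencilL2 d) : ℝ → ℂ := trace d (fun y => (0, y)) (Icc 0 d) φ

/-! ### The quadratic form and its self-adjoint operator -/

/-- The form domain: all `φ ∈ H¹(Ω) ∩ L²_a(Ω)` with vanishing trace on both half-lines that make up
`∂Ω_D = {(x, y) : x, y ≥ 0, |x - y| = d}`. -/
def formDomain (d : ℝ) : Set (antisymmetricL2 d) :=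
  {φ | MemH1 d (φ : PencilL2 d) ∧
    HasTrace d (fun t => (t, t + d)) (Ici 0) (φ : PencilL2 d) 0 ∧
    HasTrace d (fun t => (t + d, t)) (Ici 0) (φ : PencilL2 d) 0}

/-- The sesquilinear form (antilinear in the first argument) whose diagonal is
`q[φ] = ħ²/(2mₑ) ∫_Ω |∇φ|² - ∫_0^d σ(y) (|φ(y,0)|² + |φ(0,y)|²) dy`. -/
def pairForm (hbar mₑ d : ℝ) (σ : ℝ → ℝ) (φ ψ : antisymmetricL2 d) : ℂ :=
  ((hbar ^ 2 / (2 * mₑ) : ℝ) : ℂ) *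
      (inner ℂ (weakDeriv d (1, 0) (φ : PencilL2 d)) (weakDeriv d (1, 0) (ψ : PencilL2 d)) +
        inner ℂ (weakDeriv d (0, 1) (φ : PencilL2 d)) (weakDeriv d (0, 1) (ψ : PencilL2 d))) -
    ∫ y in Icc 0 d, (σ y : ℂ) *
      (conj (traceBottom d φ y) * traceBottom d ψ y + conj (traceLeft d φ y) * traceLeft d ψ y)

/-- `A` is the two-electron Hamiltonian `-Δ_σ^d`: the self-adjoint operator in `L²_a(Ω)` associated
with the form `pairForm`. It is determined by this property, see `IsPairHamiltonian.unique`. -/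
structure IsPairHamiltonian (hbar mₑ d : ℝ) (σ : ℝ → ℝ)
    (A : antisymmetricL2 d →ₗ.[ℂ] antisymmetricL2 d) : Prop where
  isSelfAdjoint : IsSelfAdjoint A
  mem_graph_iff : ∀ φ f : antisymmetricL2 d, (φ, f) ∈ A.graph ↔
    φ ∈ formDomain d ∧ ∀ ψ ∈ formDomain d, pairForm hbar mₑ d σ φ ψ = inner ℂ f ψ

lemma IsPairHamiltonian.unique {hbar mₑ d : ℝ} {σ : ℝ → ℝ}
    {A B : antisymmetricL2 d →ₗ.[ℂ] antisymmetricL2 d}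
    (hA : IsPairHamiltonian hbar mₑ d σ A) (hB : IsPairHamiltonian hbar mₑ d σ B) : A = B := by
  apply LinearPMap.eq_of_eq_graph
  ext ⟨φ, f⟩
  rw [hA.mem_graph_iff, hB.mem_graph_iff]

end PairModel

end

/-!
The proof works in the coordinates `s = x - y`, `r = x + y`. An antisymmetric function on the pencil is
an odd function of `s`, so it is determined by its values on the half strip `0 ≤ s ≤ d`, `s ≤ r`, where
it vanishes on `s = 0` and on `s = d`, `r ≥ d`, and is subject to the boundary term of the form on the
edge `s = r`. In these coordinates the energy is `2 ∫ |∇f|²` and the mass is `∫ |f|²`, and the strip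
`r ≥ d` of width `d` produces the threshold `2 (π / d)²`, in units of `a = ħ² / (2 mₑ)`.

*The operator.* The form domain is realized as a closed subspace `formTuples` of the Hilbert space
`TupleSpace` of functions together with two derivatives and two boundary values: the closure of the
antisymmetric test functions, with the value on the Dirichlet side equal to zero. An inequality for test
functions that is continuous in these five entries extends to the whole form domain
(`sobolevTuples_induction`). The form is a bounded operator on `formTuples`, it is coercive up to a
multiple of the `L²` norm, and the representation theorem `exists_isSelfAdjoint_of_form` gives the
Hamiltonian (`exists_isPairHamiltonian`). That these tuples describe the same domain as weak derivatives
and traces is the content of `tupleFun_mem_formDomain` and `exists_tuple_of_mem_formDomain`.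

*The essential spectrum.* An operator that is at least `E` up to a form of finite rank has discrete
spectrum below `E` (`mem_discreteSpectrum_of_lt`), because approximate eigenvectors have convergent
subsequences. For `E` below the threshold such a bound holds (`exists_finite_rank_bound`): on `r ≥ d`
by a Friedrichs inequality in `s`, and on a compact part by the Poincaré inequality on a fine mesh, whose
constant exceeds everything that the boundary interaction needs. Above the threshold, wave packets
`sin (π s / d) exp (i k r) χ (r)` far away from the tip are approximate eigenvectors
(`mem_spec_of_threshold_le`).

*The bound state for `σ = 0`.* On the triangle `0 ≤ s ≤ r ≤ d`, the Neumann problem has no eigenvalue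
except zero below `(π / d)²` (`poincare_tipTriangle`), so the form is above the threshold up to a form of
rank one, and there is at most one eigenvalue below it, which is simple (`discreteSpectrum_eq_singleton`).
The infimum of the form lies in the spectrum; it is at least a quarter of the threshold by the Friedrichs
inequality on an interval of length `d` with one Dirichlet end (`mass_le_energy`).

*The upper bound.* Reflecting the half strip in the edge `s = r` shows an L-shaped guide of width `d`,
whose ground state lies only slightly below `0.93` times the threshold. The trial function has to follow
the singularity at the corner `(d, d)`, and is built by matching modes (`exists_trial_of_modes`): for
`Λ = 0.93 (π / d)²` it solves `Δf + Λ f = 0` on both sides of the line `r = d` with common values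
`∑ g n sin (n π s / d)` there. Green's identity then turns `∫ |∇f|² - Λ ∫ |f|²` into an explicit
quadratic form in the amplitudes, which is negative for a suitable choice of 16 of them
(`trialAmplitude_form_neg`).
-/

noncomputable section

namespace PairModel

/-! ### Self-adjoint operators defined by quadratic forms -/

section FormRepresentation

open ContinuousLinearMap

variable {H V : Type*} [NormedAddCommGroup H] [InnerProductSpace ℂ H] [CompleteSpace H]
  [NormedAddCommGroup V] [InnerProductSpace ℂ V] [CompleteSpace V]

/-- The first representation theorem. The form domain is a Hilbert space `V` of its own, embedded
into `H` by `J`, and the form is `⟪B u, v⟫`; it is bounded from below in the sense that it becomes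
coercive on `V` after adding a multiple of the norm of `H`. -/
theorem exists_isSelfAdjoint_of_form (J : V →L[ℂ] H) (hJ : Function.Injective J)
    (hd : DenseRange J) (B : V →L[ℂ] V) (hB : IsSelfAdjoint B) (c κ : ℝ) (hκ : 0 < κ)
    (hco : ∀ u, κ * ‖u‖ ^ 2 ≤ (inner ℂ (B u) u).re + c * ‖J u‖ ^ 2) :
    ∃ A : H →ₗ.[ℂ] H, IsSelfAdjoint A ∧
      ∀ φ f, (φ, f) ∈ A.graph ↔ ∃ u, J u = φ ∧ ∀ v, inner ℂ (B u) v = inner ℂ f (J v) := by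
  have hBi : ∀ u v, inner ℂ (B u) v = inner ℂ u (B v) := fun u v => by
    rw [← ContinuousLinearMap.adjoint_inner_right, hB.adjoint_eq]
  have hweak : ∀ u f, (∀ v, inner ℂ (B u) v = inner ℂ f (J v)) ↔ B u = adjoint J f := by
    intro u f
    constructor
    · intro h
      refine ext_inner_right ℂ fun v => ?_
      rw [h, ContinuousLinearMap.adjoint_inner_left]
    · intro h v
      rw [h, ContinuousLinearMap.adjoint_inner_left]
  -- the shifted form is coercive, hence represented by an invertible operator
  set Bc : V →L[ℂ] V := B + (c : ℂ) • (adjoint J ∘L J) with hBc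
  have hBc_apply : ∀ u, Bc u = B u + (c : ℂ) • adjoint J (J u) := fun u => by simp [hBc]
  have hBci : ∀ u v, inner ℂ (Bc u) v = inner ℂ u (Bc v) := fun u v => by
    simp [hBc_apply, hBi,
      ContinuousLinearMap.adjoint_inner_left, ContinuousLinearMap.adjoint_inner_right]
  have hcoer : ∀ u, κ * ‖u‖ ^ 2 ≤ (inner ℂ (Bc u) u).re := by
    intro u
    have h1 : (inner ℂ (Bc u) u).re = (inner ℂ (B u) u).re + c * ‖J u‖ ^ 2 := by
      rw [hBc_apply, inner_add_left, inner_smul_left, ContinuousLinearMap.adjoint_inner_left,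
        inner_self_eq_norm_sq_to_K]
      simp [← Complex.ofReal_pow]
    rw [h1]
    exact hco u
  have hunit : IsUnit Bc := by
    refine isUnit_of_forall_le_norm_inner_map Bc (c := ⟨κ, hκ.le⟩) hκ fun u => ?_
    calc ‖u‖ ^ 2 * κ = κ * ‖u‖ ^ 2 := mul_comm _ _
      _ ≤ (inner ℂ (Bc u) u).re := hcoer u
      _ ≤ ‖inner ℂ (Bc u) u‖ := Complex.re_le_norm _
  have hsurj : ∀ w, ∃ u, Bc u = w := by
    obtain ⟨R, hR⟩ := hunit.exists_right_inv
    intro w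
    refine ⟨R w, ?_⟩
    have := congrArg (fun T : V →L[ℂ] V => T w) hR
    simpa using this
  have hJinj : ∀ f, adjoint J f = 0 → f = 0 := by
    intro f hf
    refine hd.eq_zero_of_inner_left ℂ fun v => ?_
    rw [← ContinuousLinearMap.adjoint_inner_left, hf, inner_zero_left]
  let g : Submodule ℂ (H × H) :=
    { carrier := {p | ∃ u, J u = p.1 ∧ B u = adjoint J p.2}
      zero_mem' := ⟨0, by simp⟩
      add_mem' := by
        rintro a b ⟨u, hu, hu'⟩ ⟨v, hv, hv'⟩
        exact ⟨u + v, by simp [hu, hv], by simp [hu', hv']⟩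
      smul_mem' := by
        rintro z a ⟨u, hu, hu'⟩
        exact ⟨z • u, by simp [hu], by simp [hu']⟩ }
  have hg : ∀ φ f, (φ, f) ∈ g ↔ ∃ u, J u = φ ∧ B u = adjoint J f := fun φ f => Iff.rfl
  have hgraph : g.toLinearPMap.graph = g := by
    refine g.toLinearPMap_graph_eq ?_
    rintro ⟨φ, f⟩ ⟨u, hu, hu'⟩ h0
    simp only at hu hu' h0
    have hu0 : u = 0 := hJ (by rw [hu, h0, map_zero])
    exact hJinj f (by rw [← hu', hu0, map_zero])
  -- `J u` is in the domain whenever `Bc u` is in the range of `J†`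
  have hmem : ∀ u h, Bc u = adjoint J h → (J u, h - (c : ℂ) • J u) ∈ g := by
    intro u h hu
    refine ⟨u, rfl, ?_⟩
    rw [map_sub, map_smul, ← hu, hBc_apply, add_sub_cancel_right]
  have hdense : Dense (g.toLinearPMap.domain : Set H) := by
    rw [Submodule.dense_iff_topologicalClosure_eq_top,
      Submodule.topologicalClosure_eq_top_iff, Submodule.eq_bot_iff]
    intro y hy
    obtain ⟨u, hu⟩ := hsurj (adjoint J y)
    have hdom : J u ∈ g.toLinearPMap.domain := by
      refine LinearPMap.mem_domain_iff.2 ⟨y - (c : ℂ) • J u, ?_⟩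
      rw [hgraph]
      exact hmem u y hu
    have h1 : inner ℂ (J u) y = 0 := hy _ hdom
    rw [← ContinuousLinearMap.adjoint_inner_right, ← hu, ← hBci] at h1
    have h2 := hcoer u
    rw [h1] at h2
    have hu0 : u = 0 := by
      by_contra hne
      have : 0 < ‖u‖ := norm_pos_iff.2 hne
      have : 0 < κ * ‖u‖ ^ 2 := by positivity
      simp at h2
      linarith
    apply hJinj
    rw [← hu, hu0, map_zero]
  refine ⟨g.toLinearPMap, ?_, ?_⟩
  · rw [LinearPMap.isSelfAdjoint_def]
    apply LinearPMap.eq_of_eq_graph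
    rw [LinearPMap.adjoint_graph_eq_graph_adjoint hdense, hgraph]
    ext ⟨ψ, k⟩
    rw [Submodule.mem_adjoint_iff]
    constructor
    · intro h
      obtain ⟨v, hv⟩ := hsurj (adjoint J (k + (c : ℂ) • ψ))
      have hψ : ψ = J v := by
        refine ext_inner_left ℂ fun y => ?_
        obtain ⟨u, hu⟩ := hsurj (adjoint J y)
        have h1 := h _ _ (hmem u y hu)
        have h2 : inner ℂ y ψ = inner ℂ (J u) (k + (c : ℂ) • ψ) := by
          simp only [inner_sub_left, inner_smul_left, Complex.conj_ofReal] at h1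
          rw [inner_add_right, inner_smul_right]
          linear_combination h1
        rw [h2, ← ContinuousLinearMap.adjoint_inner_right, ← hv, ← hBci, hu,
          ContinuousLinearMap.adjoint_inner_left]
      refine ⟨v, hψ.symm, ?_⟩
      have h3 := hBc_apply v
      rw [hv, map_add, map_smul, ← hψ] at h3
      exact (add_right_cancel h3).symm
    · rintro ⟨v, hv, hv'⟩ a b ⟨u, hu, hu'⟩
      simp only at hv hv' hu hu' ⊢
      rw [← hv, ← ContinuousLinearMap.adjoint_inner_left, ← hu', hBi, hv',
        ContinuousLinearMap.adjoint_inner_right, hu, sub_self]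
  · intro φ f
    rw [hgraph, hg]
    simp only [hweak]

end FormRepresentation

/-! ### Spectra of self-adjoint operators -/

section SelfAdjointSpectrum

variable {H : Type*} [NormedAddCommGroup H] [InnerProductSpace ℂ H]
  {A : H →ₗ.[ℂ] H}

lemma inner_apply_comm [CompleteSpace H] (hA : IsSelfAdjoint A) (φ ψ : A.domain) :
    inner ℂ (A φ) (ψ : H) = inner ℂ (φ : H) (A ψ) := by
  have h := LinearPMap.adjoint_isFormalAdjoint (T := A) hA.dense_domain
  rw [LinearPMap.isSelfAdjoint_def.1 hA] at h
  exact h φ ψ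

lemma mem_graph_of_forall_inner [CompleteSpace H] (hA : IsSelfAdjoint A) {y k : H}
    (h : ∀ φ : A.domain, inner ℂ (A φ) y = inner ℂ (φ : H) k) : (y, k) ∈ A.graph := by
  have h1 := LinearPMap.adjoint_graph_eq_graph_adjoint (T := A) hA.dense_domain
  rw [LinearPMap.isSelfAdjoint_def.1 hA] at h1
  rw [h1, Submodule.mem_adjoint_iff]
  intro a b hab
  obtain ⟨φ, rfl, rfl⟩ := (LinearPMap.mem_graph_iff A).1 hab
  exact sub_eq_zero.2 (h φ)

lemma mem_graph_of_tendsto [CompleteSpace H] (hA : IsSelfAdjoint A) {φ : ℕ → A.domain} {x y : H}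
    (hx : Tendsto (fun n => (φ n : H)) atTop (𝓝 x)) (hy : Tendsto (fun n => A (φ n)) atTop (𝓝 y)) :
    (x, y) ∈ A.graph := by
  have h : IsClosed (A.graph : Set (H × H)) := hA.isClosed
  exact h.mem_of_tendsto (hx.prodMk_nhds hy)
    (Eventually.of_forall fun n => LinearPMap.mem_graph A (φ n))

/-- If `A - z` is bounded from below and `A - z̄` is injective, then `A - z` is onto: its range is
closed, with orthogonal complement the kernel of `A - z̄`. -/
lemma mem_resolventSet_of_le [CompleteSpace H] (hA : IsSelfAdjoint A) {z : ℂ} {c : ℝ} (hc : 0 < c)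
    (h : ∀ φ : A.domain, c * ‖(φ : H)‖ ≤ ‖A φ - z • (φ : H)‖)
    (h' : ∀ φ : A.domain, A φ = conj z • (φ : H) → (φ : H) = 0) : z ∈ resolventSet A := by
  have hsub : ∀ φ ψ : A.domain, A (φ - ψ) - z • ((φ - ψ : A.domain) : H)
      = (A φ - z • (φ : H)) - (A ψ - z • (ψ : H)) := fun φ ψ => by
    rw [LinearPMap.map_sub, Submodule.coe_sub, smul_sub]
    abel
  have hdist : ∀ φ ψ : A.domain, ‖(φ : H) - ψ‖
      ≤ c⁻¹ * ‖(A φ - z • (φ : H)) - (A ψ - z • (ψ : H))‖ := fun φ ψ => by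
    rw [← hsub, le_inv_mul_iff₀ hc]
    exact h (φ - ψ)
  let L : A.domain →ₗ[ℂ] H := A.toFun - z • A.domain.subtype
  have hL : ∀ φ : A.domain, L φ = A φ - z • (φ : H) := fun φ => rfl
  have hclosed : IsClosed (LinearMap.range L : Set H) := by
    refine isClosed_of_closure_subset fun y hy => ?_
    obtain ⟨s, hs, hsy⟩ := mem_closure_iff_seq_limit.1 hy
    choose φ hφ using hs
    have hcauchy : CauchySeq fun n => (φ n : H) := by
      rw [Metric.cauchySeq_iff]
      intro ε hε
      obtain ⟨N, hN⟩ := Metric.cauchySeq_iff.1 hsy.cauchySeq (c * ε) (by positivity)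
      refine ⟨N, fun m hm n hn => ?_⟩
      have h1 := hN m hm n hn
      rw [dist_eq_norm, ← hφ, ← hφ, hL, hL] at h1
      rw [dist_eq_norm]
      calc _ ≤ _ := hdist _ _
        _ < c⁻¹ * (c * ε) := by gcongr
        _ = ε := by field_simp
    obtain ⟨x, hx⟩ := cauchySeq_tendsto_of_complete hcauchy
    have hAx : Tendsto (fun n => A (φ n)) atTop (𝓝 (y + z • x)) := by
      have := hsy.add (hx.const_smul z)
      refine this.congr fun n => ?_
      rw [← hφ, hL, sub_add_cancel]
    obtain ⟨ψ, hψ, hψ'⟩ := (LinearPMap.mem_graph_iff A).1 (mem_graph_of_tendsto hA hx hAx)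
    refine ⟨ψ, ?_⟩
    simp only at hψ hψ'
    rw [hL, hψ, hψ', add_sub_cancel_right]
  have hrange : LinearMap.range L = ⊤ := by
    have : CompleteSpace (LinearMap.range L) := hclosed.completeSpace_coe
    rw [← Submodule.orthogonal_eq_bot_iff, Submodule.eq_bot_iff]
    intro y hy
    have hmem : (y, conj z • y) ∈ A.graph := by
      refine mem_graph_of_forall_inner hA fun φ => ?_
      have h1 : inner ℂ (L φ) y = 0 := hy _ ⟨φ, rfl⟩
      rw [hL, inner_sub_left, inner_smul_left, sub_eq_zero] at h1
      rw [h1, inner_smul_right]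
    obtain ⟨ψ, hψ, hψ'⟩ := (LinearPMap.mem_graph_iff A).1 hmem
    simp only at hψ hψ'
    rw [← hψ]
    apply h'
    rw [hψ, hψ']
  refine ⟨⟨fun φ ψ hφψ => ?_, fun y => ?_⟩, c⁻¹, fun φ => ?_⟩
  · have h1 := hdist φ ψ
    simp only at hφψ
    rw [hφψ, sub_self, norm_zero, mul_zero] at h1
    exact Subtype.ext (sub_eq_zero.1 (norm_le_zero_iff.1 h1))
  · have : y ∈ LinearMap.range L := by rw [hrange]; trivial
    exact this
  · rw [le_inv_mul_iff₀ hc]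
    exact h φ

lemma im_inner_apply_self [CompleteSpace H] (hA : IsSelfAdjoint A) (φ : A.domain) :
    (inner ℂ (A φ) (φ : H)).im = 0 := by
  have h1 := inner_apply_comm hA φ φ
  have h2 := congrArg Complex.im (inner_conj_symm (𝕜 := ℂ) (A φ) (φ : H))
  rw [← h1] at h2
  simp only [Complex.conj_im] at h2
  linarith

lemma abs_im_mul_norm_le [CompleteSpace H] (hA : IsSelfAdjoint A) (z : ℂ) (φ : A.domain) :
    |z.im| * ‖(φ : H)‖ ≤ ‖A φ - z • (φ : H)‖ := by
  have h1 : (inner ℂ (A φ - z • (φ : H)) (φ : H)).im = z.im * ‖(φ : H)‖ ^ 2 := by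
    rw [inner_sub_left, inner_smul_left, inner_self_eq_norm_sq_to_K, Complex.sub_im,
      im_inner_apply_self hA]
    simp [← Complex.ofReal_pow]
  have h2 : |z.im| * ‖(φ : H)‖ ^ 2 ≤ ‖A φ - z • (φ : H)‖ * ‖(φ : H)‖ := by
    calc |z.im| * ‖(φ : H)‖ ^ 2 = |(inner ℂ (A φ - z • (φ : H)) (φ : H)).im| := by
          rw [h1, abs_mul, abs_of_nonneg (sq_nonneg ‖(φ : H)‖)]
      _ ≤ ‖inner ℂ (A φ - z • (φ : H)) (φ : H)‖ := Complex.abs_im_le_norm _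
      _ ≤ _ := norm_inner_le_norm _ _
  rcases (norm_nonneg (φ : H)).eq_or_lt with h0 | h0
  · rw [← h0, mul_zero]
    exact norm_nonneg _
  · rw [pow_two, ← mul_assoc] at h2
    exact le_of_mul_le_mul_right h2 h0

lemma spec_subset_real [CompleteSpace H] (hA : IsSelfAdjoint A) {z : ℂ} (hz : z ∈ spec A) :
    z = (z.re : ℂ) := by
  by_contra hne
  have him : z.im ≠ 0 := fun h => hne (Complex.ext rfl (by simpa using h))
  refine hz (mem_resolventSet_of_le hA (abs_pos.2 him) (abs_im_mul_norm_le hA z) fun φ hφ => ?_)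
  have h1 := abs_im_mul_norm_le hA (conj z) φ
  rw [hφ, sub_self, norm_zero, Complex.conj_im, abs_neg] at h1
  have h2 : 0 < |z.im| := abs_pos.2 him
  exact norm_le_zero_iff.1 (nonpos_of_mul_nonpos_right h1 h2)

/-- Weyl's criterion, necessity. -/
lemma exists_approx_eigenvector [CompleteSpace H] (hA : IsSelfAdjoint A) {μ : ℝ} (hμ : (μ : ℂ) ∈ spec A) {ε : ℝ}
    (hε : 0 < ε) : ∃ φ : A.domain, ‖(φ : H)‖ = 1 ∧ ‖A φ - (μ : ℂ) • (φ : H)‖ ≤ ε := by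
  by_contra! hcon
  have hb : ∀ φ : A.domain, ε * ‖(φ : H)‖ ≤ ‖A φ - (μ : ℂ) • (φ : H)‖ := by
    intro φ
    rcases (norm_nonneg (φ : H)).eq_or_lt with h0 | h0
    · rw [← h0, mul_zero]
      exact norm_nonneg _
    · have hr : ‖((‖(φ : H)‖ : ℂ))⁻¹‖ = ‖(φ : H)‖⁻¹ := by simp
      have h1 := hcon (((‖(φ : H)‖ : ℂ))⁻¹ • φ) (by
        rw [Submodule.coe_smul, norm_smul, hr, inv_mul_cancel₀ h0.ne'])
      rw [LinearPMap.map_smul, Submodule.coe_smul, smul_comm, ← smul_sub, norm_smul, hr,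
        lt_inv_mul_iff₀ h0] at h1
      rw [mul_comm]
      exact h1.le
  refine hμ (mem_resolventSet_of_le hA hε hb fun φ hφ => ?_)
  have h1 := hb φ
  rw [hφ, Complex.conj_ofReal, sub_self, norm_zero] at h1
  exact norm_le_zero_iff.1 (nonpos_of_mul_nonpos_right h1 hε)

/-- Weyl's criterion, sufficiency. -/
lemma mem_spec_of_approx_eigenvector {z : ℂ}
    (h : ∀ ε > 0, ∃ φ : A.domain, ‖(φ : H)‖ = 1 ∧ ‖A φ - z • (φ : H)‖ ≤ ε) : z ∈ spec A := by
  rintro ⟨-, C, hC⟩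
  have hC' : 0 < max C 1 := lt_of_lt_of_le one_pos (le_max_right _ _)
  obtain ⟨φ, hφ, hφ'⟩ := h (2 * max C 1)⁻¹ (by positivity)
  have h1 := hC φ
  rw [hφ] at h1
  have h2 : C * ‖A φ - z • (φ : H)‖ ≤ max C 1 * (2 * max C 1)⁻¹ := by
    gcongr
    exact le_max_left _ _
  have h3 : max C 1 * (2 * max C 1)⁻¹ = 1 / 2 := by field_simp
  linarith

lemma eigenspace_ne_bot_iff {z : ℂ} :
    eigenspace A z ≠ ⊥ ↔ ∃ φ : A.domain, (φ : H) ≠ 0 ∧ A φ = z • (φ : H) := by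
  rw [Submodule.ne_bot_iff]
  constructor
  · rintro ⟨φ, hφ, hne⟩
    exact ⟨φ, fun h => hne (Subtype.ext h), sub_eq_zero.1 hφ⟩
  · rintro ⟨φ, hφ, hne⟩
    exact ⟨φ, sub_eq_zero.2 hne, fun h => hφ (by rw [h]; rfl)⟩

lemma mem_eigenspace_iff {z : ℂ} {φ : A.domain} : φ ∈ eigenspace A z ↔ A φ = z • (φ : H) :=
  sub_eq_zero

lemma inner_eigenvectors_eq_zero [CompleteSpace H] (hA : IsSelfAdjoint A) {μ ν : ℝ} (hne : μ ≠ ν) {φ ψ : A.domain}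
    (hφ : A φ = (μ : ℂ) • (φ : H)) (hψ : A ψ = (ν : ℂ) • (ψ : H)) :
    inner ℂ (φ : H) (ψ : H) = 0 := by
  have h := inner_apply_comm hA φ ψ
  rw [hφ, hψ, inner_smul_left, inner_smul_right, Complex.conj_ofReal] at h
  have h1 : ((μ : ℂ) - ν) * inner ℂ (φ : H) (ψ : H) = 0 := by rw [sub_mul, h, sub_self]
  rcases mul_eq_zero.1 h1 with h2 | h2
  · exact absurd (Complex.ofReal_injective (sub_eq_zero.1 h2)) hne
  · exact h2

/-! ### Operators bounded from below up to a form of finite rank -/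

section FiniteRank

variable {F : Type*} [NormedAddCommGroup F] [NormedSpace ℂ F]
  {ℓ : H →L[ℂ] F} {C E : ℝ}

/-- If `A ≥ E` up to a form of finite rank, then approximate eigenvectors for a point below `E`
have a convergent subsequence. -/
lemma exists_cauchySeq_of_approx_eigenvectors [FiniteDimensional ℂ F]
    (hE : ∀ φ : A.domain, E * ‖(φ : H)‖ ^ 2 ≤ (inner ℂ (A φ) (φ : H)).re + C * ‖ℓ φ‖ ^ 2)
    {μ : ℝ} (hμ : μ < E) {φ : ℕ → A.domain} (h1 : ∀ n, ‖(φ n : H)‖ = 1)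
    (h2 : Tendsto (fun n => ‖A (φ n) - (μ : ℂ) • (φ n : H)‖) atTop (𝓝 0)) :
    ∃ θ : ℕ → ℕ, StrictMono θ ∧ CauchySeq fun n => (φ (θ n) : H) := by
  have : ProperSpace F := FiniteDimensional.proper ℂ F
  have hb : ∀ n, ℓ (φ n) ∈ Metric.closedBall (0 : F) ‖ℓ‖ := fun n => by
    rw [mem_closedBall_zero_iff]
    calc _ ≤ ‖ℓ‖ * ‖(φ n : H)‖ := ℓ.le_opNorm _
      _ = ‖ℓ‖ := by rw [h1, mul_one]
  obtain ⟨y, -, θ, hθ, hy⟩ := (isCompact_closedBall (0 : F) ‖ℓ‖).tendsto_subseq hb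
  refine ⟨θ, hθ, ?_⟩
  have h2θ := h2.comp hθ.tendsto_atTop
  rw [Metric.cauchySeq_iff]
  intro ε hε
  -- the three smallness requirements together bound `(E - μ) ‖φ m - φ n‖²` by `(E - μ) ε²`
  set δ := (E - μ) * ε ^ 2 / 8 with hδ
  have hδ0 : 0 < δ := by
    have : 0 < E - μ := sub_pos.2 hμ
    positivity
  have hC : 0 < |C| + 1 := by positivity
  obtain ⟨N1, hN1⟩ := Metric.cauchySeq_iff.1 hy.cauchySeq (Real.sqrt (δ / (|C| + 1)))
    (by positivity)
  obtain ⟨N2, hN2⟩ := (Metric.tendsto_atTop.1 h2θ) δ hδ0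
  refine ⟨max N1 N2, fun m hm n hn => ?_⟩
  set x : A.domain := φ (θ m) - φ (θ n) with hx
  have hxn : ‖(x : H)‖ ≤ 2 := by
    calc ‖(x : H)‖ = ‖(φ (θ m) : H) - φ (θ n)‖ := rfl
      _ ≤ ‖(φ (θ m) : H)‖ + ‖(φ (θ n) : H)‖ := norm_sub_le _ _
      _ = 2 := by rw [h1, h1]; norm_num
  have hres : ‖A x - (μ : ℂ) • (x : H)‖ ≤ 2 * δ := by
    have e : A x - (μ : ℂ) • (x : H) = (A (φ (θ m)) - (μ : ℂ) • (φ (θ m) : H))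
        - (A (φ (θ n)) - (μ : ℂ) • (φ (θ n) : H)) := by
      rw [hx, LinearPMap.map_sub, Submodule.coe_sub, smul_sub]
      abel
    have hm' := hN2 m (le_trans (le_max_right _ _) hm)
    have hn' := hN2 n (le_trans (le_max_right _ _) hn)
    simp only [Function.comp_apply, dist_zero_right, norm_norm] at hm' hn'
    rw [e]
    exact (norm_sub_le _ _).trans (by linarith)
  have hℓ : C * ‖ℓ x‖ ^ 2 ≤ δ := by
    have h3 := hN1 m (le_trans (le_max_left _ _) hm) n (le_trans (le_max_left _ _) hn)
    simp only [Function.comp_apply, dist_eq_norm] at h3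
    rw [← map_sub] at h3
    have h4 : ‖ℓ x‖ ^ 2 ≤ δ / (|C| + 1) := by
      rw [← Real.sq_sqrt (by positivity : 0 ≤ δ / (|C| + 1))]
      exact pow_le_pow_left₀ (norm_nonneg _) h3.le 2
    calc C * ‖ℓ x‖ ^ 2 ≤ (|C| + 1) * (δ / (|C| + 1)) := by
          gcongr
          linarith [le_abs_self C]
      _ = δ := by field_simp
  have hmain := hE x
  have hre : (inner ℂ (A x) (x : H)).re ≤ μ * ‖(x : H)‖ ^ 2 + 4 * δ := by
    have e : (inner ℂ (A x) (x : H)).re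
        = (inner ℂ (A x - (μ : ℂ) • (x : H)) (x : H)).re + μ * ‖(x : H)‖ ^ 2 := by
      rw [inner_sub_left, inner_smul_left, inner_self_eq_norm_sq_to_K, Complex.sub_re]
      simp [← Complex.ofReal_pow]
    have h5 : (inner ℂ (A x - (μ : ℂ) • (x : H)) (x : H)).re ≤ 2 * δ * 2 :=
      calc _ ≤ ‖inner ℂ (A x - (μ : ℂ) • (x : H)) (x : H)‖ := Complex.re_le_norm _
        _ ≤ _ := norm_inner_le_norm _ _
        _ ≤ _ := by gcongr
    linarith
  have hlt : (E - μ) * ‖(x : H)‖ ^ 2 < (E - μ) * ε ^ 2 := by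
    have : (E - μ) * ε ^ 2 = 8 * δ := by rw [hδ]; ring
    linarith
  have h6 : ‖(x : H)‖ ^ 2 < ε ^ 2 := lt_of_mul_lt_mul_left hlt (sub_pos.2 hμ).le
  rw [dist_eq_norm]
  exact lt_of_pow_lt_pow_left₀ 2 hε.le h6

/-- Below `E`, the limit of approximate eigenvectors is an eigenvector. -/
lemma exists_eigenvector_of_approx [FiniteDimensional ℂ F] [CompleteSpace H] (hA : IsSelfAdjoint A)
    (hE : ∀ φ : A.domain, E * ‖(φ : H)‖ ^ 2 ≤ (inner ℂ (A φ) (φ : H)).re + C * ‖ℓ φ‖ ^ 2)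
    {μ : ℝ} (hμ : μ < E) {φ : ℕ → A.domain} (h1 : ∀ n, ‖(φ n : H)‖ = 1)
    (h2 : Tendsto (fun n => ‖A (φ n) - (μ : ℂ) • (φ n : H)‖) atTop (𝓝 0)) :
    ∃ θ : ℕ → ℕ, ∃ ψ : A.domain, ‖(ψ : H)‖ = 1 ∧ A ψ = (μ : ℂ) • (ψ : H) ∧
      Tendsto (fun n => (φ (θ n) : H)) atTop (𝓝 (ψ : H)) := by
  obtain ⟨θ, hθ, hc⟩ := exists_cauchySeq_of_approx_eigenvectors hE hμ h1 h2
  obtain ⟨x, hx⟩ := cauchySeq_tendsto_of_complete hc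
  have h3 : Tendsto (fun n => A (φ (θ n))) atTop (𝓝 ((μ : ℂ) • x)) := by
    have h4 := (tendsto_zero_iff_norm_tendsto_zero.2 (h2.comp hθ.tendsto_atTop)).add
      (hx.const_smul (μ : ℂ))
    rw [zero_add] at h4
    exact h4.congr fun n => sub_add_cancel _ _
  obtain ⟨ψ, hψ, hψ'⟩ := (LinearPMap.mem_graph_iff A).1 (mem_graph_of_tendsto hA hx h3)
  simp only at hψ hψ'
  refine ⟨θ, ψ, ?_, by rw [hψ', hψ], by rw [hψ]; exact hx⟩
  have h5 : Tendsto (fun n => ‖(φ (θ n) : H)‖) atTop (𝓝 ‖x‖) := hx.norm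
  simp only [h1] at h5
  rw [hψ]
  exact tendsto_nhds_unique h5 tendsto_const_nhds |>.symm ▸ rfl

lemma exists_eigenvector_of_mem_spec [FiniteDimensional ℂ F] [CompleteSpace H] (hA : IsSelfAdjoint A)
    (hE : ∀ φ : A.domain, E * ‖(φ : H)‖ ^ 2 ≤ (inner ℂ (A φ) (φ : H)).re + C * ‖ℓ φ‖ ^ 2)
    {μ : ℝ} (hμ : μ < E) (hs : (μ : ℂ) ∈ spec A) :
    ∃ ψ : A.domain, ‖(ψ : H)‖ = 1 ∧ A ψ = (μ : ℂ) • (ψ : H) := by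
  choose φ h1 h2 using fun n : ℕ =>
    exists_approx_eigenvector hA hs (ε := 1 / ((n : ℝ) + 1)) (by positivity)
  obtain ⟨-, ψ, hψ, hψ', -⟩ := exists_eigenvector_of_approx hA hE hμ h1
    (squeeze_zero (fun _ => norm_nonneg _) h2 tendsto_one_div_add_atTop_nhds_zero_nat)
  exact ⟨ψ, hψ, hψ'⟩

/-- Below `E`, no eigenvector is annihilated by the functionals; hence eigenspaces are finite
dimensional. -/
lemma injective_domRestrict_eigenspace
    (hE : ∀ φ : A.domain, E * ‖(φ : H)‖ ^ 2 ≤ (inner ℂ (A φ) (φ : H)).re + C * ‖ℓ φ‖ ^ 2)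
    {μ : ℝ} (hμ : μ < E) :
    Function.Injective ((ℓ : H →ₗ[ℂ] F) ∘ₗ A.domain.subtype ∘ₗ (eigenspace A (μ : ℂ)).subtype) := by
  rw [injective_iff_map_eq_zero]
  rintro ⟨φ, hφ⟩ h0
  have h0' : ℓ (φ : H) = 0 := h0
  have h1 := hE φ
  rw [mem_eigenspace_iff.1 hφ, h0', inner_smul_left, inner_self_eq_norm_sq_to_K] at h1
  simp [← Complex.ofReal_pow] at h1
  have h2 : ‖(φ : H)‖ ^ 2 ≤ 0 := by nlinarith [sq_nonneg ‖(φ : H)‖]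
  have h3 : (φ : H) = 0 := by
    have := pow_eq_zero_iff (two_ne_zero) |>.1 (le_antisymm h2 (sq_nonneg _))
    exact norm_eq_zero.1 this
  exact Subtype.ext (Subtype.ext h3)

/-- If `A ≥ E` up to a form of finite rank, then the spectrum of `A` below `E` is discrete. -/
theorem mem_discreteSpectrum_of_lt [FiniteDimensional ℂ F] [CompleteSpace H] (hA : IsSelfAdjoint A)
    (hE : ∀ φ : A.domain, E * ‖(φ : H)‖ ^ 2 ≤ (inner ℂ (A φ) (φ : H)).re + C * ‖ℓ φ‖ ^ 2)
    {μ : ℝ} (hμ : μ < E) (hs : (μ : ℂ) ∈ spec A) : (μ : ℂ) ∈ discreteSpectrum A := by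
  refine ⟨hs, ?_, ?_, ?_⟩
  · by_contra! hcon
    have hstep : ∀ n : ℕ, ∃ ν : ℝ, ν ≠ μ ∧ |ν - μ| < 1 / ((n : ℝ) + 1) ∧
        ∃ ψ : A.domain, ‖(ψ : H)‖ = 1 ∧ A ψ = (ν : ℂ) • (ψ : H) := by
      intro n
      set ε : ℝ := min (1 / ((n : ℝ) + 1)) (E - μ) with hε
      have hε0 : 0 < ε := lt_min (by positivity) (sub_pos.2 hμ)
      have h1 := hcon ε hε0
      have h2 : ∃ z ∈ Metric.ball (μ : ℂ) ε ∩ spec A, z ≠ μ := by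
        by_contra! h3
        exact h1 (Set.eq_singleton_iff_unique_mem.2 ⟨⟨Metric.mem_ball_self hε0, hs⟩, h3⟩)
      obtain ⟨z, ⟨hz1, hz2⟩, hz3⟩ := h2
      have hz4 := spec_subset_real hA hz2
      set ν := z.re
      rw [hz4] at hz1 hz2 hz3
      have hν : |ν - μ| < ε := by
        rw [Metric.mem_ball, dist_eq_norm, ← Complex.ofReal_sub, Complex.norm_real] at hz1
        exact hz1
      refine ⟨ν, fun h => hz3 (by rw [h]), hν.trans_le (min_le_left _ _), ?_⟩
      refine exists_eigenvector_of_mem_spec hA hE ?_ hz2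
      have := (le_abs_self _).trans_lt (hν.trans_le (min_le_right _ _))
      linarith
    choose ν hν1 hν2 φ hφ1 hφ2 using hstep
    obtain ⟨θ, ψ, hψ1, hψ2, hlim⟩ := exists_eigenvector_of_approx hA hE hμ hφ1 (by
      refine squeeze_zero (fun _ => norm_nonneg _) (fun n => ?_)
        tendsto_one_div_add_atTop_nhds_zero_nat
      rw [hφ2, ← sub_smul, norm_smul, hφ1, mul_one, ← Complex.ofReal_sub, Complex.norm_real]
      exact (hν2 n).le)
    have h3 : Tendsto (fun n => inner ℂ (φ (θ n) : H) (ψ : H)) atTop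
        (𝓝 (inner ℂ (ψ : H) (ψ : H))) := hlim.inner tendsto_const_nhds
    have h4 : (fun n => inner ℂ (φ (θ n) : H) (ψ : H)) = fun _ => (0 : ℂ) :=
      funext fun n => inner_eigenvectors_eq_zero hA (hν1 _) (hφ2 _) hψ2
    rw [h4] at h3
    have h5 := tendsto_nhds_unique h3 tendsto_const_nhds
    rw [inner_self_eq_zero] at h5
    rw [h5, norm_zero] at hψ1
    exact zero_ne_one hψ1
  · obtain ⟨ψ, h1, h2⟩ := exists_eigenvector_of_mem_spec hA hE hμ hs
    exact eigenspace_ne_bot_iff.2 ⟨ψ, fun h => by simp [h] at h1, h2⟩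
  · exact FiniteDimensional.of_injective _ (injective_domRestrict_eigenspace hE hμ)

end FiniteRank

/-- The essential spectrum is `[t, ∞)` if this half-line consists of spectrum and if, for all
`E < t`, the operator is at least `E` up to a form of finite rank. -/
theorem essentialSpectrum_eq_Ici [CompleteSpace H] (hA : IsSelfAdjoint A) {t : ℝ}
    (h1 : ∀ μ : ℝ, t ≤ μ → (μ : ℂ) ∈ spec A)
    (h2 : ∀ E < t, ∃ (n : ℕ) (ℓ : H →L[ℂ] (Fin n → ℂ)) (C : ℝ), ∀ φ : A.domain,
      E * ‖(φ : H)‖ ^ 2 ≤ (inner ℂ (A φ) (φ : H)).re + C * ‖ℓ φ‖ ^ 2) :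
    essentialSpectrum A = Complex.ofReal '' Ici t := by
  ext z
  constructor
  · rintro ⟨hz, hnd⟩
    have hz' := spec_subset_real hA hz
    refine ⟨z.re, ?_, hz'.symm⟩
    by_contra hlt
    rw [mem_Ici, not_le] at hlt
    obtain ⟨n, ℓ, C, h⟩ := h2 ((z.re + t) / 2) (by linarith)
    rw [hz'] at hz hnd
    exact hnd (mem_discreteSpectrum_of_lt hA h (by linarith) hz)
  · rintro ⟨μ, hμ, rfl⟩
    refine ⟨h1 μ hμ, ?_⟩
    rintro ⟨-, ⟨ε, hε, hball⟩, -⟩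
    have h3 : ((μ + ε / 2 : ℝ) : ℂ) ∈ Metric.ball (μ : ℂ) ε ∩ spec A := by
      refine ⟨?_, h1 _ (by rw [mem_Ici] at hμ; linarith)⟩
      rw [Metric.mem_ball, dist_eq_norm, ← Complex.ofReal_sub, Complex.norm_real, Real.norm_eq_abs,
        add_sub_cancel_left, abs_of_pos (by linarith)]
      linarith
    rw [hball, mem_singleton_iff, Complex.ofReal_inj] at h3
    linarith

section RankOne

variable {ℓ : H →L[ℂ] ℂ} {C t : ℝ}

lemma finrank_eigenspace_eq_one
    (ht : ∀ φ : A.domain, t * ‖(φ : H)‖ ^ 2 ≤ (inner ℂ (A φ) (φ : H)).re + C * ‖ℓ φ‖ ^ 2)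
    {μ : ℝ} (hμ : μ < t) (hne : eigenspace A (μ : ℂ) ≠ ⊥) :
    Module.finrank ℂ (eigenspace A (μ : ℂ)) = 1 := by
  have hinj := injective_domRestrict_eigenspace ht hμ
  have : FiniteDimensional ℂ (eigenspace A (μ : ℂ)) := FiniteDimensional.of_injective _ hinj
  have h1 := LinearMap.finrank_le_finrank_of_injective hinj
  rw [Module.finrank_self] at h1
  have h2 : 0 < Module.finrank ℂ (eigenspace A (μ : ℂ)) := by
    have := Submodule.nontrivial_iff_ne_bot.2 hne
    exact Module.finrank_pos
  omega

/-- If `A ≥ t` up to a form of rank one, then there is at most one eigenvalue below `t`: on the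
span of two orthogonal eigenvectors some nonzero vector is annihilated by the functional. -/
lemma eigenvalue_unique [CompleteSpace H] (hA : IsSelfAdjoint A)
    (ht : ∀ φ : A.domain, t * ‖(φ : H)‖ ^ 2 ≤ (inner ℂ (A φ) (φ : H)).re + C * ‖ℓ φ‖ ^ 2)
    {μ ν : ℝ} (hμ : μ < t) (hν : ν < t) (hμ' : eigenspace A (μ : ℂ) ≠ ⊥)
    (hν' : eigenspace A (ν : ℂ) ≠ ⊥) : μ = ν := by
  by_contra hne
  obtain ⟨φ, hφ0, hφ⟩ := eigenspace_ne_bot_iff.1 hμ'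
  obtain ⟨ψ, hψ0, hψ⟩ := eigenspace_ne_bot_iff.1 hν'
  have hort := inner_eigenvectors_eq_zero hA hne hφ hψ
  have hort' := inner_eigenvectors_eq_zero hA (Ne.symm hne) hψ hφ
  have key : ∀ a b : ℂ, ℓ (a • (φ : H) + b • (ψ : H)) = 0 →
      (t - μ) * (‖a‖ ^ 2 * ‖(φ : H)‖ ^ 2) + (t - ν) * (‖b‖ ^ 2 * ‖(ψ : H)‖ ^ 2) ≤ 0 := by
    intro a b hab
    have h1 := ht (a • φ + b • ψ)
    have e1 : ((a • φ + b • ψ : A.domain) : H) = a • (φ : H) + b • (ψ : H) := rfl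
    rw [e1, hab, LinearPMap.map_add, LinearPMap.map_smul, LinearPMap.map_smul, hφ, hψ] at h1
    have e2 : ‖a • (φ : H) + b • (ψ : H)‖ ^ 2
        = ‖a‖ ^ 2 * ‖(φ : H)‖ ^ 2 + ‖b‖ ^ 2 * ‖(ψ : H)‖ ^ 2 := by
      have h3 := norm_add_sq_eq_norm_sq_add_norm_sq_of_inner_eq_zero (𝕜 := ℂ)
        (a • (φ : H)) (b • (ψ : H)) (by rw [inner_smul_left, inner_smul_right, hort]; simp)
      rw [← pow_two, ← pow_two, ← pow_two, norm_smul, norm_smul, mul_pow, mul_pow] at h3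
      exact h3
    have e3 : (inner ℂ (a • (μ : ℂ) • (φ : H) + b • (ν : ℂ) • (ψ : H))
        (a • (φ : H) + b • (ψ : H))).re
        = μ * (‖a‖ ^ 2 * ‖(φ : H)‖ ^ 2) + ν * (‖b‖ ^ 2 * ‖(ψ : H)‖ ^ 2) := by
      simp only [inner_add_left, inner_add_right, inner_smul_left, inner_smul_right, hort, hort',
        inner_self_eq_norm_sq_to_K, mul_zero, add_zero, zero_add, Complex.conj_ofReal]
      have h4 : ∀ (w : ℂ) (x y : ℝ), w * (conj w * ((x : ℂ) * ((y : ℂ)) ^ 2))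
          = ((x * (‖w‖ ^ 2 * y ^ 2) : ℝ) : ℂ) := by
        intro w x y
        rw [← mul_assoc, Complex.mul_conj, Complex.normSq_eq_norm_sq]
        push_cast
        ring
      have h5 := h4 a μ ‖(φ : H)‖
      have h6 := h4 b ν ‖(ψ : H)‖
      simp only [Complex.coe_algebraMap] at *
      rw [h5, h6, ← Complex.ofReal_add, Complex.ofReal_re]
    rw [e2, e3, norm_zero] at h1
    nlinarith
  have hφn : 0 < ‖(φ : H)‖ := norm_pos_iff.2 hφ0
  have hψn : 0 < ‖(ψ : H)‖ := norm_pos_iff.2 hψ0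
  by_cases hℓ : ℓ (φ : H) = 0
  · have h1 := key 1 0 (by simp [hℓ])
    simp only [norm_one, norm_zero] at h1
    nlinarith [mul_pos (sub_pos.2 hμ) (pow_pos hφn 2)]
  · have h1 := key (ℓ (ψ : H)) (-ℓ (φ : H)) (by simp [mul_comm])
    have h2 : 0 < ‖-ℓ (φ : H)‖ := norm_pos_iff.2 (neg_ne_zero.2 hℓ)
    have h3 : 0 < (t - ν) * (‖-ℓ (φ : H)‖ ^ 2 * ‖(ψ : H)‖ ^ 2) :=
      mul_pos (sub_pos.2 hν) (by positivity)
    have h4 : 0 ≤ (t - μ) * (‖ℓ (ψ : H)‖ ^ 2 * ‖(φ : H)‖ ^ 2) :=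
      mul_nonneg (sub_pos.2 hμ).le (by positivity)
    linarith

end RankOne

end SelfAdjointSpectrum

/-! ### The infimum of a form -/

section GroundState

variable {H V : Type*} [NormedAddCommGroup H] [InnerProductSpace ℂ H]
  [NormedAddCommGroup V] [InnerProductSpace ℂ V]

/-- The infimum of the quadratic form on unit vectors belongs to the spectrum. If the resolvent
existed there, applying the Cauchy-Schwarz inequality of the nonnegative form `q - μ` to a
minimizing sequence and its image under the resolvent would be contradictory. -/
theorem mem_spec_of_form_inf {A : H →ₗ.[ℂ] H} {J : V →L[ℂ] H} {B : V →L[ℂ] V}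
    (hB : ∀ u v, inner ℂ (B u) v = inner ℂ u (B v))
    (hgraph : ∀ φ f, (φ, f) ∈ A.graph ↔ ∃ u, J u = φ ∧ ∀ v, inner ℂ (B u) v = inner ℂ f (J v))
    {μ : ℝ} (hμ : ∀ u, μ * ‖J u‖ ^ 2 ≤ (inner ℂ (B u) u).re)
    (hinf : ∀ ε > 0, ∃ u, ‖J u‖ = 1 ∧ (inner ℂ (B u) u).re ≤ μ + ε) : (μ : ℂ) ∈ spec A := by
  rintro ⟨⟨-, hsurj⟩, C, hC⟩
  have hC' : 0 < max C 1 := lt_of_lt_of_le one_pos (le_max_right _ _)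
  set K := max C 1
  obtain ⟨u, hu1, hu2⟩ := hinf (1 / (2 * K)) (by positivity)
  obtain ⟨ψ, hψ⟩ := hsurj (J u)
  simp only at hψ
  obtain ⟨w, hw1, hw2⟩ := (hgraph _ _).1 (LinearPMap.mem_graph A ψ)
  have hAψ : A ψ = J u + (μ : ℂ) • J w := by rw [hw1, ← hψ, sub_add_cancel]
  have hnorm : ‖J w‖ ≤ K := by
    have := hC ψ
    rw [hψ, hu1, mul_one, ← hw1] at this
    exact this.trans (le_max_left _ _)
  have hsq : ∀ x : H, inner ℂ x x = ((‖x‖ ^ 2 : ℝ) : ℂ) := fun x => by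
    rw [inner_self_eq_norm_sq_to_K]
    simp
  -- the form `q - μ` at `(w, u)` and at `(w, w)`
  have hwu : inner ℂ (B w) u = 1 + (μ : ℂ) * inner ℂ (J w) (J u) := by
    rw [hw2, hAψ, inner_add_left, inner_smul_left, hsq, hu1, Complex.conj_ofReal]
    simp
  have hww : inner ℂ (B w) w = inner ℂ (J u) (J w) + (μ : ℂ) * inner ℂ (J w) (J w) := by
    rw [hw2, hAψ, inner_add_left, inner_smul_left, Complex.conj_ofReal]
  have hre : (inner ℂ (J u) (J w)).re ≤ K :=
    calc _ ≤ ‖inner ℂ (J u) (J w)‖ := Complex.re_le_norm _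
      _ ≤ ‖J u‖ * ‖J w‖ := norm_inner_le_norm _ _
      _ ≤ K := by rw [hu1, one_mul]; exact hnorm
  set s : ℝ := 1 / K with hs
  have hpos := hμ (u - (s : ℂ) • w)
  have e1 : (inner ℂ (B (u - (s : ℂ) • w)) (u - (s : ℂ) • w)).re
      = (inner ℂ (B u) u).re - 2 * s * (inner ℂ (B w) u).re
        + s ^ 2 * (inner ℂ (B w) w).re := by
    have hsymm : (inner ℂ (B u) w).re = (inner ℂ (B w) u).re := by
      rw [hB u w, ← inner_conj_symm, Complex.conj_re]
    simp only [map_sub, map_smul, inner_sub_left, inner_sub_right, inner_smul_left,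
      inner_smul_right, Complex.conj_ofReal, Complex.sub_re, Complex.re_ofReal_mul, hsymm]
    ring
  have e2 : ‖J (u - (s : ℂ) • w)‖ ^ 2
      = 1 - 2 * s * (inner ℂ (J w) (J u)).re + s ^ 2 * ‖J w‖ ^ 2 := by
    have h1 : ‖J (u - (s : ℂ) • w)‖ ^ 2
        = (inner ℂ (J (u - (s : ℂ) • w)) (J (u - (s : ℂ) • w))).re := by
      rw [hsq, Complex.ofReal_re]
    have hsymm : (inner ℂ (J u) (J w)).re = (inner ℂ (J w) (J u)).re := by
      rw [← inner_conj_symm, Complex.conj_re]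
    rw [h1]
    simp only [map_sub, map_smul, inner_sub_left, inner_sub_right, inner_smul_left,
      inner_smul_right, Complex.conj_ofReal, Complex.sub_re, Complex.re_ofReal_mul, hsymm]
    rw [hsq, hsq, Complex.ofReal_re, Complex.ofReal_re, hu1]
    ring
  rw [e1, e2, hwu, hww, hsq] at hpos
  simp only [Complex.add_re, Complex.one_re, Complex.re_ofReal_mul, Complex.ofReal_re] at hpos
  have h3 : s ^ 2 * (inner ℂ (J u) (J w)).re ≤ s := by
    calc s ^ 2 * (inner ℂ (J u) (J w)).re ≤ s ^ 2 * K := by gcongr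
      _ = s := by rw [hs]; field_simp
  have h4 : 1 / (2 * K) = s / 2 := by rw [hs]; field_simp
  have h5 : 0 < s := by positivity
  rw [h4] at hu2
  nlinarith

end GroundState

/-! ### Inequalities on an interval -/

section Interval

variable {F : Type*} [NormedAddCommGroup F] [InnerProductSpace ℝ F] {f f' : ℝ → F} {a b : ℝ}

/-- A Riccati comparison: `w = -k tan (k (t - s))` solves `w' + w² = -k²`, and integrating
`0 ≤ ‖f' - w f‖²` produces the term `k² ‖f‖²` together with boundary terms. -/
lemma sq_mul_integral_add_le_integral_deriv (hab : a ≤ b) (hf : ∀ t, HasDerivAt f (f' t) t)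
    (hf' : Continuous f') {k s : ℝ} (hs : ∀ t ∈ Icc a b, Real.cos (k * (t - s)) ≠ 0) :
    k ^ 2 * (∫ t in a..b, ‖f t‖ ^ 2) + k * Real.tan (k * (a - s)) * ‖f a‖ ^ 2
      - k * Real.tan (k * (b - s)) * ‖f b‖ ^ 2 ≤ ∫ t in a..b, ‖f' t‖ ^ 2 := by
  have hfc : Continuous f := continuous_iff_continuousAt.2 fun t => (hf t).continuousAt
  set w : ℝ → ℝ := fun t => -(k * Real.tan (k * (t - s))) with hw
  have hw' : ∀ t ∈ Icc a b, HasDerivAt w (-k ^ 2 - w t ^ 2) t := by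
    intro t ht
    have h1 : HasDerivAt (fun t => k * (t - s)) k t := by
      simpa using ((hasDerivAt_id t).sub_const s).const_mul k
    have h2 := (((Real.hasDerivAt_tan (hs t ht)).comp t h1).const_mul k).neg
    refine h2.congr_deriv ?_
    have h3 := hs t ht
    have h4 := Real.sin_sq_add_cos_sq (k * (t - s))
    simp only [hw, Real.tan_eq_sin_div_cos]
    field_simp
    linear_combination k ^ 2 * h4
  have hg : ∀ t ∈ Icc a b, HasDerivAt (fun t => w t * ‖f t‖ ^ 2)
      ((-k ^ 2 - w t ^ 2) * ‖f t‖ ^ 2 + w t * (2 * inner ℝ (f t) (f' t))) t :=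
    fun t ht => (hw' t ht).mul (hf t).norm_sq
  have hint : ∀ g : ℝ → F, Continuous g → IntervalIntegrable (fun t => ‖g t‖ ^ 2) volume a b :=
    fun g hg => (hg.norm.pow 2).intervalIntegrable _ _
  have key := intervalIntegral.sub_le_integral_of_hasDeriv_right_of_le hab
    (fun t ht => (hg t ht).continuousAt.continuousWithinAt)
    (fun t ht => (hg t (Ioo_subset_Icc_self ht)).hasDerivWithinAt)
    (φ := fun t => ‖f' t‖ ^ 2 - k ^ 2 * ‖f t‖ ^ 2)
    (((hf'.norm.pow 2).sub ((hfc.norm.pow 2).const_mul _)).continuousOn.integrableOn_Icc)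
    (fun t _ => by
      have h1 := sq_nonneg ‖f' t - w t • f t‖
      rw [norm_sub_sq_real, inner_smul_right, norm_smul, mul_pow, Real.norm_eq_abs, sq_abs,
        real_inner_comm] at h1
      linarith)
  rw [intervalIntegral.integral_sub (hint f' hf') ((hint f hfc).const_mul _),
    intervalIntegral.integral_const_mul] at key
  simp only [hw] at key
  linarith

/-- The one-dimensional Friedrichs inequality with a Dirichlet condition at one end point. -/
lemma sq_mul_integral_le_of_left_eq_zero (hab : a ≤ b) (hf : ∀ t, HasDerivAt f (f' t) t)
    (hf' : Continuous f') (ha : f a = 0) {k : ℝ} (hk : 0 ≤ k) (hkab : k * (b - a) < Real.pi / 2) :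
    k ^ 2 * (∫ t in a..b, ‖f t‖ ^ 2) ≤ ∫ t in a..b, ‖f' t‖ ^ 2 := by
  have h := sq_mul_integral_add_le_integral_deriv hab hf hf' (k := k) (s := b) fun t ht => by
    refine (Real.cos_pos_of_mem_Ioo ⟨?_, ?_⟩).ne'
    · have : k * (b - t) ≤ k * (b - a) := by gcongr; exact ht.1
      linarith
    · have : k * (t - b) ≤ 0 := mul_nonpos_of_nonneg_of_nonpos hk (by linarith [ht.2])
      linarith [Real.pi_pos]
  simpa [ha] using h

/-- The one-dimensional Friedrichs inequality on an interval of length less than `π / k`, with the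
boundary values as error terms. -/
lemma sq_mul_integral_le_add_boundary (hab : a ≤ b) (hf : ∀ t, HasDerivAt f (f' t) t)
    (hf' : Continuous f') {k : ℝ} (hk : 0 ≤ k) (hkab : k * (b - a) < Real.pi) :
    k ^ 2 * (∫ t in a..b, ‖f t‖ ^ 2) ≤ (∫ t in a..b, ‖f' t‖ ^ 2)
      + k * Real.tan (k * ((b - a) / 2)) * (‖f a‖ ^ 2 + ‖f b‖ ^ 2) := by
  have h := sq_mul_integral_add_le_integral_deriv hab hf hf' (k := k) (s := (a + b) / 2)
    fun t ht => by
      refine (Real.cos_pos_of_mem_Ioo ⟨?_, ?_⟩).ne'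
      · have : k * ((a + b) / 2 - t) ≤ k * ((b - a) / 2) := by gcongr; linarith [ht.1]
        linarith
      · have : k * (t - (a + b) / 2) ≤ k * ((b - a) / 2) := by gcongr; linarith [ht.2]
        linarith
  have e1 : k * (a - (a + b) / 2) = -(k * ((b - a) / 2)) := by ring
  have e2 : k * (b - (a + b) / 2) = k * ((b - a) / 2) := by ring
  rw [e1, e2, Real.tan_neg] at h
  linarith

/-- The sharp one-dimensional Friedrichs inequality with Dirichlet conditions. -/
lemma sq_mul_integral_le_of_eq_zero (hab : a < b) (hf : ∀ t, HasDerivAt f (f' t) t)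
    (hf' : Continuous f') (ha : f a = 0) (hb : f b = 0) :
    (Real.pi / (b - a)) ^ 2 * (∫ t in a..b, ‖f t‖ ^ 2) ≤ ∫ t in a..b, ‖f' t‖ ^ 2 := by
  have hL : 0 < b - a := sub_pos.2 hab
  have hπ := Real.pi_pos
  have hlim : Tendsto (fun k : ℝ => k ^ 2 * (∫ t in a..b, ‖f t‖ ^ 2))
      (𝓝[<] (Real.pi / (b - a))) (𝓝 ((Real.pi / (b - a)) ^ 2 * (∫ t in a..b, ‖f t‖ ^ 2))) :=
    ((continuous_id.pow 2).mul continuous_const).continuousAt.tendsto.mono_left nhdsWithin_le_nhds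
  refine le_of_tendsto hlim ?_
  have h0 : (0 : ℝ) < Real.pi / (b - a) := by positivity
  filter_upwards [Ioo_mem_nhdsLT h0] with k hk
  have h := sq_mul_integral_le_add_boundary hab.le hf hf' hk.1.le
    ((lt_div_iff₀ hL).1 hk.2)
  simpa [ha, hb] using h

lemma integral_norm_sub_mean_sq [CompleteSpace F] (hab : a < b) (hfc : Continuous f) :
    ∫ t in a..b, ‖f t - (b - a)⁻¹ • ∫ x in a..b, f x‖ ^ 2
      = (∫ t in a..b, ‖f t‖ ^ 2) - (b - a)⁻¹ * ‖∫ t in a..b, f t‖ ^ 2 := by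
  have hL : 0 < b - a := sub_pos.2 hab
  set I := ∫ t in a..b, f t with hI
  set m : F := (b - a)⁻¹ • I with hm
  have hcont : ∀ v : ℝ → F, Continuous v → IntervalIntegrable (fun t => ‖v t‖ ^ 2) volume a b :=
    fun v hv => (hv.norm.pow 2).intervalIntegrable _ _
  have e : ∀ t, ‖f t - m‖ ^ 2 = ‖f t‖ ^ 2 - 2 * inner ℝ m (f t) + ‖m‖ ^ 2 := fun t => by
    rw [norm_sub_sq_real, real_inner_comm]
  have hi : IntervalIntegrable (fun t => 2 * inner ℝ m (f t)) volume a b :=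
    ((continuous_const.inner hfc).const_mul 2).intervalIntegrable _ _
  simp only [e]
  rw [intervalIntegral.integral_add ((hcont f hfc).sub hi)
    (continuous_const.intervalIntegrable _ _), intervalIntegral.integral_sub (hcont f hfc) hi,
    intervalIntegral.integral_const_mul, intervalIntegral.integral_const]
  have h9 : ∫ t in a..b, inner ℝ m (f t) = inner ℝ m I := by
    have := (innerSL ℝ m).intervalIntegral_comp_comm (hfc.intervalIntegrable (μ := volume) a b)
    simpa using this
  rw [h9, hm, inner_smul_left, real_inner_self_eq_norm_sq, norm_smul, mul_pow,
    Real.norm_eq_abs, sq_abs]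
  simp only [conj_trivial, smul_eq_mul]
  field_simp
  ring

lemma norm_integral_sq_le [CompleteSpace F] (hab : a < b) (hfc : Continuous f) :
    (b - a)⁻¹ * ‖∫ t in a..b, f t‖ ^ 2 ≤ ∫ t in a..b, ‖f t‖ ^ 2 := by
  have h1 : 0 ≤ ∫ t in a..b, ‖f t - (b - a)⁻¹ • ∫ x in a..b, f x‖ ^ 2 :=
    intervalIntegral.integral_nonneg hab.le fun _ _ => sq_nonneg _
  rw [integral_norm_sub_mean_sq hab hfc] at h1
  linarith

/-- The sharp Poincaré inequality with Neumann conditions. The function may have a kink at `ρ`. It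
follows from the Dirichlet case applied to the antiderivative of `f` minus its mean. -/
lemma sq_mul_variance_le [CompleteSpace F] (hab : a < b) (hfc : Continuous f) {ρ : ℝ}
    (hf : ∀ t, t ≠ ρ → HasDerivAt f (f' t) t) (hf' : IntervalIntegrable f' volume a b)
    (hf'2 : IntervalIntegrable (fun t => ‖f' t‖ ^ 2) volume a b) :
    (Real.pi / (b - a)) ^ 2 * ((∫ t in a..b, ‖f t‖ ^ 2) - (b - a)⁻¹ * ‖∫ t in a..b, f t‖ ^ 2)
      ≤ ∫ t in a..b, ‖f' t‖ ^ 2 := by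
  have hL : 0 < b - a := sub_pos.2 hab
  set K := Real.pi / (b - a) with hK
  have hK0 : 0 < K := div_pos Real.pi_pos hL
  set I := ∫ t in a..b, f t with hI
  set m : F := (b - a)⁻¹ • I with hm
  set u : ℝ → F := fun t => f t - m with hu
  have huc : Continuous u := hfc.sub continuous_const
  set g : ℝ → F := fun t => ∫ x in a..t, u x with hg
  have hgd : ∀ t, HasDerivAt g (u t) t := fun t =>
    intervalIntegral.integral_hasDerivAt_right (huc.intervalIntegrable _ _)
      huc.aestronglyMeasurable.stronglyMeasurableAtFilter huc.continuousAt
  have hgc : Continuous g := continuous_iff_continuousAt.2 fun t => (hgd t).continuousAt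
  have hga : g a = 0 := by simp [hg]
  have hgb : g b = 0 := by
    simp only [hg, hu]
    rw [intervalIntegral.integral_sub (hfc.intervalIntegrable _ _)
      (continuous_const.intervalIntegrable _ _), intervalIntegral.integral_const, hm, smul_smul,
      mul_inv_cancel₀ hL.ne', one_smul, sub_self]
  have h1 := sq_mul_integral_le_of_eq_zero hab hgd huc hga hgb
  rw [← hK] at h1
  have hcont : ∀ v : ℝ → F, Continuous v → IntervalIntegrable (fun t => ‖v t‖ ^ 2) volume a b :=
    fun v hv => (hv.norm.pow 2).intervalIntegrable _ _
  have hgf' : IntervalIntegrable (fun t => inner ℝ (g t) (f' t)) volume a b := by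
    refine (((hcont g hgc).add hf'2)).mono_fun' ?_ ?_
    · exact hgc.aestronglyMeasurable.inner hf'.aestronglyMeasurable_restrict_uIoc
    · refine Eventually.of_forall fun t => ?_
      have := abs_real_inner_le_norm (g t) (f' t)
      simp only [Real.norm_eq_abs]
      nlinarith [sq_nonneg (‖g t‖ - ‖f' t‖), norm_nonneg (g t), norm_nonneg (f' t)]
  -- integration by parts, allowing for the kink
  have h2 : ∫ t in a..b, (inner ℝ (g t) (f' t) + ‖u t‖ ^ 2) = 0 := by
    have := MeasureTheory.integral_eq_of_hasDerivAt_off_countable_of_le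
      (fun t => inner ℝ (g t) (u t)) (fun t => inner ℝ (g t) (f' t) + ‖u t‖ ^ 2) hab.le
      (countable_singleton ρ) (hgc.inner huc).continuousOn
      (fun t ht => by
        have h3 := (hgd t).inner ℝ ((hf t ht.2).sub_const m)
        rw [real_inner_self_eq_norm_sq] at h3
        exact h3)
      (hgf'.add (hcont u huc))
    rw [this, hga, hgb]
    simp
  rw [intervalIntegral.integral_add hgf' (hcont u huc)] at h2
  have h3 : -(∫ t in a..b, inner ℝ (g t) (f' t))
      ≤ ∫ t in a..b, (K ^ 2 / 2 * ‖g t‖ ^ 2 + (2 * K ^ 2)⁻¹ * ‖f' t‖ ^ 2) := by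
    rw [← intervalIntegral.integral_neg]
    refine intervalIntegral.integral_mono_on hab.le hgf'.neg
      (((hcont g hgc).const_mul _).add (hf'2.const_mul _)) fun t _ => ?_
    have h4 := sq_nonneg ‖(K : ℝ) • g t + K⁻¹ • f' t‖
    rw [norm_add_sq_real, inner_smul_left, inner_smul_right, norm_smul, norm_smul, mul_pow,
      mul_pow, Real.norm_eq_abs, Real.norm_eq_abs, sq_abs, sq_abs] at h4
    have h5 : (starRingEnd ℝ) K * (K⁻¹ * inner ℝ (g t) (f' t)) = inner ℝ (g t) (f' t) := by
      simp only [conj_trivial]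
      rw [← mul_assoc, mul_inv_cancel₀ hK0.ne', one_mul]
    rw [h5] at h4
    have h6 : (2 * K ^ 2)⁻¹ * ‖f' t‖ ^ 2 = K⁻¹ ^ 2 * ‖f' t‖ ^ 2 / 2 := by
      field_simp
    rw [h6]
    linarith
  rw [intervalIntegral.integral_add ((hcont g hgc).const_mul _) (hf'2.const_mul _),
    intervalIntegral.integral_const_mul, intervalIntegral.integral_const_mul] at h3
  have h7 : ∫ t in a..b, ‖u t‖ ^ 2 ≤ (K ^ 2)⁻¹ * ∫ t in a..b, ‖f' t‖ ^ 2 := by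
    have : (2 * K ^ 2)⁻¹ = (K ^ 2)⁻¹ / 2 := by rw [mul_inv]; ring
    rw [this] at h3
    linarith
  have h8 : ∫ t in a..b, ‖u t‖ ^ 2 = (∫ t in a..b, ‖f t‖ ^ 2) - (b - a)⁻¹ * ‖I‖ ^ 2 :=
    integral_norm_sub_mean_sq hab hfc
  rw [h8, le_inv_mul_iff₀ (by positivity)] at h7
  exact h7

/-- A one-dimensional trace inequality at the left end point. -/
lemma norm_sq_left_le (hf : ∀ t, HasDerivAt f (f' t) t) (hf' : Continuous f') (hab : a < b)
    {ε : ℝ} (hε : 0 < ε) :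
    ‖f a‖ ^ 2 ≤ ((b - a)⁻¹ + ε⁻¹) * (∫ t in a..b, ‖f t‖ ^ 2) + ε * ∫ t in a..b, ‖f' t‖ ^ 2 := by
  have hL : 0 < b - a := sub_pos.2 hab
  have hfc : Continuous f := continuous_iff_continuousAt.2 fun t => (hf t).continuousAt
  have hd : ∀ t, HasDerivAt (fun t => ((t - b) / (b - a)) * ‖f t‖ ^ 2)
      ((b - a)⁻¹ * ‖f t‖ ^ 2 + ((t - b) / (b - a)) * (2 * inner ℝ (f t) (f' t))) t := by
    intro t
    have h1 : HasDerivAt (fun t => (t - b) / (b - a)) (b - a)⁻¹ t := by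
      simpa using ((hasDerivAt_id t).sub_const b).div_const (b - a)
    exact h1.mul (hf t).norm_sq
  have hc : Continuous fun t => ((b - a)⁻¹ + ε⁻¹) * ‖f t‖ ^ 2 + ε * ‖f' t‖ ^ 2 := by fun_prop
  have key := intervalIntegral.sub_le_integral_of_hasDeriv_right_of_le hab.le
    (fun t _ => (hd t).continuousAt.continuousWithinAt)
    (fun t _ => (hd t).hasDerivWithinAt) hc.continuousOn.integrableOn_Icc
    (fun t ht => by
      have h1 : |(t - b) / (b - a)| ≤ 1 := by
        rw [abs_div, abs_of_pos hL, div_le_one hL, abs_le]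
        constructor <;> linarith [ht.1, ht.2]
      have h2 : 2 * |inner ℝ (f t) (f' t)| ≤ ε⁻¹ * ‖f t‖ ^ 2 + ε * ‖f' t‖ ^ 2 := by
        have h3 := abs_real_inner_le_norm (f t) (f' t)
        have h4 : 0 ≤ ε⁻¹ * (‖f t‖ - ε * ‖f' t‖) ^ 2 := by positivity
        have h5 : ε⁻¹ * (‖f t‖ - ε * ‖f' t‖) ^ 2
            = ε⁻¹ * ‖f t‖ ^ 2 - 2 * (‖f t‖ * ‖f' t‖) + ε * ‖f' t‖ ^ 2 := by
          field_simp
          ring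
        linarith
      have h6 : (t - b) / (b - a) * (2 * inner ℝ (f t) (f' t)) ≤ 2 * |inner ℝ (f t) (f' t)| := by
        calc _ ≤ |(t - b) / (b - a) * (2 * inner ℝ (f t) (f' t))| := le_abs_self _
          _ = |(t - b) / (b - a)| * (2 * |inner ℝ (f t) (f' t)|) := by
            rw [abs_mul, abs_mul, abs_two]
          _ ≤ 1 * (2 * |inner ℝ (f t) (f' t)|) := by gcongr
          _ = _ := one_mul _
      linarith)
  rw [intervalIntegral.integral_add
      ((by fun_prop : Continuous fun t => ((b - a)⁻¹ + ε⁻¹) * ‖f t‖ ^ 2).intervalIntegrable _ _)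
      ((by fun_prop : Continuous fun t => ε * ‖f' t‖ ^ 2).intervalIntegrable _ _),
    intervalIntegral.integral_const_mul, intervalIntegral.integral_const_mul] at key
  have e : (a - b) / (b - a) = -1 := by
    rw [div_eq_iff hL.ne']
    ring
  rw [sub_self, zero_div, e] at key
  linarith

/-- A one-dimensional trace inequality at the right end point. -/
lemma norm_sq_right_le (hf : ∀ t, HasDerivAt f (f' t) t) (hf' : Continuous f') (hab : a < b)
    {ε : ℝ} (hε : 0 < ε) :
    ‖f b‖ ^ 2 ≤ ((b - a)⁻¹ + ε⁻¹) * (∫ t in a..b, ‖f t‖ ^ 2) + ε * ∫ t in a..b, ‖f' t‖ ^ 2 := by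
  have h := norm_sq_left_le (f := fun t => f (-t)) (f' := fun t => -f' (-t)) (a := -b) (b := -a)
    (fun t => by simpa [Function.comp_def] using (hf (-t)).scomp t (hasDerivAt_neg t))
    (hf'.comp continuous_neg).neg (neg_lt_neg hab) hε
  have e1 := intervalIntegral.integral_comp_neg (a := -b) (b := -a) fun t => ‖f t‖ ^ 2
  have e2 := intervalIntegral.integral_comp_neg (a := -b) (b := -a) fun t => ‖f' t‖ ^ 2
  simp only [neg_neg, norm_neg] at h e1 e2
  rw [e1, e2] at h
  convert h using 4
  ring

end Interval

/-! ### Iterated integrals over regions between two graphs -/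

section Iterated

variable {E : Type*} [NormedAddCommGroup E] [NormedSpace ℝ E] {I : Set ℝ} {α β : ℝ → ℝ}
  {G : ℝ × ℝ → E}

/-- Fubini for a region whose horizontal slices are intervals. -/
lemma setIntegral_eq_iterated_snd {S : Set (ℝ × ℝ)} (hI : MeasurableSet I) (hα : Measurable α)
    (hβ : Measurable β) (hαβ : ∀ r ∈ I, α r ≤ β r)
    (hS : S = {p | p.2 ∈ I ∧ α p.2 ≤ p.1 ∧ p.1 ≤ β p.2}) (hG : IntegrableOn G S) :
    IntegrableOn (fun r => ∫ s in α r..β r, G (s, r)) I ∧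
      ∫ p in S, G p = ∫ r in I, ∫ s in α r..β r, G (s, r) := by
  have hSm : MeasurableSet S := by
    rw [hS]
    exact (hI.preimage measurable_snd).inter
      ((measurableSet_le (hα.comp measurable_snd) measurable_fst).inter
        (measurableSet_le measurable_fst (hβ.comp measurable_snd)))
  have hint : Integrable (S.indicator G) (volume.prod volume) := (integrable_indicator_iff hSm).2 hG
  have hslice : ∀ r, ∫ s, S.indicator G (s, r)
      = I.indicator (fun r => ∫ s in α r..β r, G (s, r)) r := by
    intro r
    by_cases hr : r ∈ I
    · rw [indicator_of_mem hr, intervalIntegral.integral_of_le (hαβ r hr),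
        ← integral_Icc_eq_integral_Ioc, ← integral_indicator measurableSet_Icc]
      congr 1
      ext s
      by_cases hs : s ∈ Icc (α r) (β r)
      · rw [indicator_of_mem hs, indicator_of_mem]
        rw [hS]
        exact ⟨hr, hs⟩
      · rw [indicator_of_notMem hs, indicator_of_notMem]
        rw [hS]
        exact fun h => hs h.2
    · rw [indicator_of_notMem hr]
      have : ∀ s, S.indicator G (s, r) = 0 := fun s => by
        rw [indicator_of_notMem]
        rw [hS]
        exact fun h => hr h.1
      simp [this]
  constructor
  · rw [← integrable_indicator_iff hI]
    exact (hint.integral_prod_right).congr (Eventually.of_forall hslice)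
  · rw [← integral_indicator hSm, ← integral_indicator hI, Measure.volume_eq_prod,
      integral_prod_symm _ hint]
    exact integral_congr_ae (Eventually.of_forall hslice)

/-- Fubini for a region whose vertical slices are intervals. -/
lemma setIntegral_eq_iterated_fst {S : Set (ℝ × ℝ)} (hI : MeasurableSet I) (hα : Measurable α)
    (hβ : Measurable β) (hαβ : ∀ s ∈ I, α s ≤ β s)
    (hS : S = {p | p.1 ∈ I ∧ α p.1 ≤ p.2 ∧ p.2 ≤ β p.1}) (hG : IntegrableOn G S) :
    IntegrableOn (fun s => ∫ r in α s..β s, G (s, r)) I ∧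
      ∫ p in S, G p = ∫ s in I, ∫ r in α s..β s, G (s, r) := by
  have hmp : MeasurePreserving (Prod.swap : ℝ × ℝ → ℝ × ℝ) volume volume :=
    Measure.measurePreserving_swap
  have hemb : MeasurableEmbedding (Prod.swap : ℝ × ℝ → ℝ × ℝ) :=
    MeasurableEquiv.prodComm.measurableEmbedding
  have hG' : IntegrableOn (fun p : ℝ × ℝ => G p.swap) (Prod.swap ⁻¹' S) :=
    (hmp.integrableOn_comp_preimage hemb).2 hG
  have h := setIntegral_eq_iterated_snd (G := fun p : ℝ × ℝ => G p.swap) (S := Prod.swap ⁻¹' S)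
    hI hα hβ hαβ (by rw [hS]; rfl) hG'
  refine ⟨h.1, ?_⟩
  rw [← hmp.setIntegral_preimage_emb hemb]
  exact h.2

end Iterated

/-! ### The projection inequality on a square -/

section Square

variable {F : ℝ → ℝ → ℂ} {a b h : ℝ}

lemma interval_integral_swap {E : Type*} [NormedAddCommGroup E] [NormedSpace ℝ E] {F : ℝ → ℝ → E}
    (hF : Continuous (Function.uncurry F)) (a b c e : ℝ) :
    ∫ s in a..b, ∫ t in c..e, F s t = ∫ t in c..e, ∫ s in a..b, F s t := by
  refine intervalIntegral_intervalIntegral_swap ?_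
  exact (hF.continuousOn.integrableOn_compact (isCompact_uIcc.prod isCompact_uIcc)).mono_set
    (prod_mono uIoc_subset_uIcc uIoc_subset_uIcc)

/-- For the two commuting projections `P`, `Q` of `L²` of a square onto the functions of one
variable only, `P + Q ≤ 1 + P Q`. -/
lemma projections_add_le (hF : Continuous (Function.uncurry F)) (hh : 0 < h) :
    h⁻¹ * (∫ s in a..a + h, ‖∫ t in b..b + h, F s t‖ ^ 2)
      + h⁻¹ * (∫ t in b..b + h, ‖∫ s in a..a + h, F s t‖ ^ 2)
    ≤ (∫ s in a..a + h, ∫ t in b..b + h, ‖F s t‖ ^ 2)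
      + h⁻¹ ^ 2 * ‖∫ s in a..a + h, ∫ t in b..b + h, F s t‖ ^ 2 := by
  set A : ℝ → ℂ := fun s => ∫ t in b..b + h, F s t with hA
  set B : ℝ → ℂ := fun t => ∫ s in a..a + h, F s t with hB
  have hAc : Continuous A := intervalIntegral.continuous_parametric_intervalIntegral_of_continuous'
    hF _ _
  have hF' : Continuous (Function.uncurry fun t s => F s t) := hF.comp continuous_swap
  have hBc : Continuous B := intervalIntegral.continuous_parametric_intervalIntegral_of_continuous'
    hF' _ _
  have hFs : ∀ s, Continuous (F s) := fun s => hF.comp (by fun_prop : Continuous fun t => (s, t))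
  have hFt : ∀ t, Continuous fun s => F s t :=
    fun t => hF.comp (by fun_prop : Continuous fun s => (s, t))
  have ha : a < a + h := by linarith
  have hb : b < b + h := by linarith
  have eb : b + h - b = h := by ring
  have ea : a + h - a = h := by ring
  have hcu : Continuous (Function.uncurry fun s t => ‖F s t - h⁻¹ • A s‖ ^ 2) := by
    have h1 : Continuous fun p : ℝ × ℝ => F p.1 p.2 := hF
    have : Continuous fun p : ℝ × ℝ => ‖F p.1 p.2 - h⁻¹ • A p.1‖ ^ 2 := by fun_prop
    exact this
  have hcu' : Continuous (Function.uncurry fun t s => ‖F s t - h⁻¹ • A s‖ ^ 2) :=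
    hcu.comp continuous_swap
  have hcF2 : Continuous fun s => ∫ t in b..b + h, ‖F s t‖ ^ 2 := by
    refine intervalIntegral.continuous_parametric_intervalIntegral_of_continuous' ?_ _ _
    have h1 : Continuous fun p : ℝ × ℝ => F p.1 p.2 := hF
    have : Continuous fun p : ℝ × ℝ => ‖F p.1 p.2‖ ^ 2 := by fun_prop
    exact this
  -- the variance of `F s ·`, integrated over `s`
  have h1 : ∫ s in a..a + h, ∫ t in b..b + h, ‖F s t - h⁻¹ • A s‖ ^ 2
      = (∫ s in a..a + h, ∫ t in b..b + h, ‖F s t‖ ^ 2) - h⁻¹ * ∫ s in a..a + h, ‖A s‖ ^ 2 := by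
    have e : ∀ s, ∫ t in b..b + h, ‖F s t - h⁻¹ • A s‖ ^ 2
        = (∫ t in b..b + h, ‖F s t‖ ^ 2) - h⁻¹ * ‖A s‖ ^ 2 := fun s => by
      have := integral_norm_sub_mean_sq hb (hFs s)
      rw [eb] at this
      exact this
    simp only [e]
    rw [intervalIntegral.integral_sub (hcF2.intervalIntegrable _ _)
      ((by fun_prop : Continuous fun s => h⁻¹ * ‖A s‖ ^ 2).intervalIntegrable _ _),
      intervalIntegral.integral_const_mul]
  set M : ℂ := ∫ s in a..a + h, A s with hM
  have hM' : M = ∫ t in b..b + h, B t := interval_integral_swap hF _ _ _ _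
  have h2 : ∫ t in b..b + h, h⁻¹ * ‖B t - h⁻¹ • M‖ ^ 2
      ≤ ∫ t in b..b + h, ∫ s in a..a + h, ‖F s t - h⁻¹ • A s‖ ^ 2 := by
    refine intervalIntegral.integral_mono_on hb.le
      ((by fun_prop : Continuous fun t => h⁻¹ * ‖B t - h⁻¹ • M‖ ^ 2).intervalIntegrable _ _)
      (Continuous.intervalIntegrable
        (intervalIntegral.continuous_parametric_intervalIntegral_of_continuous'
          hcu' _ _) _ _) fun t _ => ?_
    have hAs : Continuous fun s => h⁻¹ • A s := hAc.const_smul h⁻¹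
    have hsub : Continuous fun s => F s t - h⁻¹ • A s := (hFt t).sub hAs
    have h3 := norm_integral_sq_le ha hsub
    rw [ea, intervalIntegral.integral_sub ((hFt t).intervalIntegrable _ _)
      (hAs.intervalIntegrable _ _), intervalIntegral.integral_smul] at h3
    exact h3
  rw [intervalIntegral.integral_const_mul, interval_integral_swap hcu', h1] at h2
  have h4 := integral_norm_sub_mean_sq hb hBc
  rw [eb, ← hM'] at h4
  rw [h4] at h2
  have h5 : h⁻¹ ^ 2 * ‖M‖ ^ 2 = h⁻¹ * (h⁻¹ * ‖M‖ ^ 2) := by ring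
  rw [h5]
  linarith [mul_sub h⁻¹ (∫ t in b..b + h, ‖B t‖ ^ 2) (h⁻¹ * ‖M‖ ^ 2)]

end Square

/-! ### Inequalities on the half strip in the coordinates `s = x - y`, `r = x + y` -/

section HalfStrip

/-- The partial derivative in the first variable. -/
def pd₁ (f : ℝ × ℝ → ℂ) (p : ℝ × ℝ) : ℂ := fderiv ℝ f p (1, 0)

/-- The partial derivative in the second variable. -/
def pd₂ (f : ℝ × ℝ → ℂ) (p : ℝ × ℝ) : ℂ := fderiv ℝ f p (0, 1)

/-- The half `0 ≤ s ≤ d` of the pencil, in the coordinates `s = x - y`, `r = x + y`. -/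
def halfStrip (d : ℝ) : Set (ℝ × ℝ) := {p | 0 ≤ p.1 ∧ p.1 ≤ d ∧ p.1 ≤ p.2}

/-- The part `r ≥ d` of the half strip, which is a product. -/
def outerStrip (d : ℝ) : Set (ℝ × ℝ) := {p | 0 ≤ p.1 ∧ p.1 ≤ d ∧ d ≤ p.2}

/-- The part `r ≤ d` of the half strip. -/
def tipTriangle (d : ℝ) : Set (ℝ × ℝ) := {p | 0 ≤ p.1 ∧ p.1 ≤ p.2 ∧ p.2 ≤ d}

/-- A square in the sheared coordinates `s`, `r - s`. -/
def shearedSquare (a b h : ℝ) : Set (ℝ × ℝ) :=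
  {p | p.1 ∈ Icc a (a + h) ∧ p.1 + b ≤ p.2 ∧ p.2 ≤ p.1 + (b + h)}

variable {f : ℝ × ℝ → ℂ} {d : ℝ}

lemma continuous_pd₁ (hf : ContDiff ℝ ∞ f) : Continuous (pd₁ f) :=
  (hf.continuous_fderiv (by simp)).clm_apply continuous_const

lemma continuous_pd₂ (hf : ContDiff ℝ ∞ f) : Continuous (pd₂ f) :=
  (hf.continuous_fderiv (by simp)).clm_apply continuous_const

lemma hasCompactSupport_pd₁ (hc : HasCompactSupport f) : HasCompactSupport (pd₁ f) :=
  hc.fderiv_apply (𝕜 := ℝ) (1, 0)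

lemma hasCompactSupport_pd₂ (hc : HasCompactSupport f) : HasCompactSupport (pd₂ f) :=
  hc.fderiv_apply (𝕜 := ℝ) (0, 1)

lemma hasDerivAt_fst (hf : ContDiff ℝ ∞ f) (r s : ℝ) :
    HasDerivAt (fun s => f (s, r)) (pd₁ f (s, r)) s := by
  have h1 : HasFDerivAt f (fderiv ℝ f (s, r)) (s, r) :=
    (hf.differentiable (by simp) _).hasFDerivAt
  exact h1.comp_hasDerivAt s ((hasDerivAt_id s).prodMk (hasDerivAt_const s r))

lemma hasDerivAt_snd (hf : ContDiff ℝ ∞ f) (s r : ℝ) :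
    HasDerivAt (fun r => f (s, r)) (pd₂ f (s, r)) r := by
  have h1 : HasFDerivAt f (fderiv ℝ f (s, r)) (s, r) :=
    (hf.differentiable (by simp) _).hasFDerivAt
  exact h1.comp_hasDerivAt r ((hasDerivAt_const r s).prodMk (hasDerivAt_id r))

lemma hasDerivAt_shear_fst (hf : ContDiff ℝ ∞ f) (t s : ℝ) :
    HasDerivAt (fun s => f (s, s + t)) (pd₁ f (s, s + t) + pd₂ f (s, s + t)) s := by
  have h1 : HasFDerivAt f (fderiv ℝ f (s, s + t)) (s, s + t) :=
    (hf.differentiable (by simp) _).hasFDerivAt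
  have h2 := h1.comp_hasDerivAt s ((hasDerivAt_id s).prodMk ((hasDerivAt_id s).add_const t))
  refine h2.congr_deriv ?_
  rw [pd₁, pd₂, ← map_add]
  simp

lemma hasDerivAt_shear_snd (hf : ContDiff ℝ ∞ f) (s t : ℝ) :
    HasDerivAt (fun t => f (s, s + t)) (pd₂ f (s, s + t)) t := by
  have h := (hasDerivAt_snd hf s (s + t)).scomp t ((hasDerivAt_id t).const_add s)
  simpa [Function.comp_def] using h

lemma integrable_norm_sq {X : Type*} [TopologicalSpace X] [MeasurableSpace X]
    [OpensMeasurableSpace X] {μ : Measure X} [IsFiniteMeasureOnCompacts μ] {g : X → ℂ}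
    (hg : Continuous g) (hc : HasCompactSupport g) : Integrable (fun p => ‖g p‖ ^ 2) μ := by
  have h : HasCompactSupport ((fun z : ℂ => ‖z‖ ^ 2) ∘ g) := hc.comp_left (by simp)
  exact Continuous.integrable_of_hasCompactSupport (f := (fun z : ℂ => ‖z‖ ^ 2) ∘ g)
    (by fun_prop) h

lemma setIntegral_Icc {E : Type*} [NormedAddCommGroup E] [NormedSpace ℝ E] {a b : ℝ} (hab : a ≤ b)
    (g : ℝ → E) : ∫ x in Icc a b, g x = ∫ x in a..b, g x := by
  rw [integral_Icc_eq_integral_Ioc, intervalIntegral.integral_of_le hab]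

lemma setIntegral_halfStrip {G : ℝ × ℝ → ℝ} (hd : 0 < d) (hG : Integrable G) :
    IntegrableOn (fun r => ∫ s in (0 : ℝ)..min r d, G (s, r)) (Ici 0) ∧
      ∫ p in halfStrip d, G p = ∫ r in Ici 0, ∫ s in (0 : ℝ)..min r d, G (s, r) := by
  refine setIntegral_eq_iterated_snd measurableSet_Ici measurable_const
    (measurable_id.min measurable_const) (fun r hr => le_min hr hd.le) ?_ hG.integrableOn
  ext p
  simp only [halfStrip, mem_ofPred_eq, mem_Ici, le_min_iff]
  constructor
  · rintro ⟨h1, h2, h3⟩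
    exact ⟨h1.trans h3, h1, h3, h2⟩
  · rintro ⟨-, h1, h3, h2⟩
    exact ⟨h1, h2, h3⟩

lemma setIntegral_outerStrip {E : Type*} [NormedAddCommGroup E] [NormedSpace ℝ E]
    {G : ℝ × ℝ → E} (hd : 0 < d) (hG : Integrable G) :
    IntegrableOn (fun r => ∫ s in (0 : ℝ)..d, G (s, r)) (Ici d) ∧
      ∫ p in outerStrip d, G p = ∫ r in Ici d, ∫ s in (0 : ℝ)..d, G (s, r) := by
  refine setIntegral_eq_iterated_snd measurableSet_Ici measurable_const
    measurable_const (fun r _ => hd.le) ?_ hG.integrableOn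
  ext p
  simp only [outerStrip, mem_ofPred_eq, mem_Ici]
  tauto

lemma setIntegral_tipTriangle_snd {E : Type*} [NormedAddCommGroup E] [NormedSpace ℝ E]
    {G : ℝ × ℝ → E} (hd : 0 < d) (hG : Integrable G) :
    IntegrableOn (fun r => ∫ s in (0 : ℝ)..r, G (s, r)) (Icc 0 d) ∧
      ∫ p in tipTriangle d, G p = ∫ r in (0 : ℝ)..d, ∫ s in (0 : ℝ)..r, G (s, r) := by
  have h := setIntegral_eq_iterated_snd (S := tipTriangle d) (G := G) (measurableSet_Icc (a := 0)
    (b := d)) measurable_const measurable_id (fun r hr => hr.1) (by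
      ext p
      simp only [tipTriangle, mem_ofPred_eq, mem_Icc, id_eq]
      constructor
      · rintro ⟨h1, h2, h3⟩
        exact ⟨⟨h1.trans h2, h3⟩, h1, h2⟩
      · rintro ⟨⟨-, h3⟩, h1, h2⟩
        exact ⟨h1, h2, h3⟩) hG.integrableOn
  refine ⟨h.1, ?_⟩
  rw [h.2, setIntegral_Icc hd.le]
  rfl

lemma setIntegral_tipTriangle_fst {E : Type*} [NormedAddCommGroup E] [NormedSpace ℝ E]
    {G : ℝ × ℝ → E} (hd : 0 < d) (hG : Integrable G) :
    IntegrableOn (fun s => ∫ r in s..d, G (s, r)) (Icc 0 d) ∧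
      ∫ p in tipTriangle d, G p = ∫ s in (0 : ℝ)..d, ∫ r in s..d, G (s, r) := by
  have h := setIntegral_eq_iterated_fst (S := tipTriangle d) (G := G) (measurableSet_Icc (a := 0)
    (b := d)) measurable_id measurable_const (fun r hr => hr.2) (by
      ext p
      simp only [tipTriangle, mem_ofPred_eq, mem_Icc, id_eq]
      constructor
      · rintro ⟨h1, h2, h3⟩
        exact ⟨⟨h1, h2.trans h3⟩, h2, h3⟩
      · rintro ⟨⟨h1, -⟩, h2, h3⟩
        exact ⟨h1, h2, h3⟩) hG.integrableOn
  refine ⟨h.1, ?_⟩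
  rw [h.2, setIntegral_Icc hd.le]
  rfl

lemma setIntegral_shearedSquare {E : Type*} [NormedAddCommGroup E] [NormedSpace ℝ E]
    {G : ℝ × ℝ → E} {a b h : ℝ} (hh : 0 < h) (hG : Integrable G) :
    ∫ p in shearedSquare a b h, G p
      = ∫ s in a..a + h, ∫ t in b..b + h, G (s, s + t) := by
  have h := setIntegral_eq_iterated_fst (S := shearedSquare a b h) (G := G)
    (measurableSet_Icc (a := a) (b := a + h)) (measurable_id.add_const b)
    (measurable_id.add_const (b + h)) (fun r hr => by simp [hh.le]) rfl hG.integrableOn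
  rw [h.2, setIntegral_Icc (by linarith)]
  refine intervalIntegral.integral_congr fun s _ => ?_
  exact (intervalIntegral.integral_comp_add_left (fun r => G (s, r)) s).symm

/-- On the whole half strip: each slice `r = const` has length at most `d`, with a Dirichlet
condition at `s = 0`. -/
lemma friedrichs_halfStrip (hd : 0 < d) (hf : ContDiff ℝ ∞ f) (hc : HasCompactSupport f)
    (h0 : ∀ r, f (0, r) = 0) :
    (Real.pi / (2 * d)) ^ 2 * (∫ p in halfStrip d, ‖f p‖ ^ 2)
      ≤ ∫ p in halfStrip d, ‖pd₁ f p‖ ^ 2 := by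
  have hπ := Real.pi_pos
  have hlim : Tendsto (fun k : ℝ => k ^ 2 * (∫ p in halfStrip d, ‖f p‖ ^ 2))
      (𝓝[<] (Real.pi / (2 * d)))
      (𝓝 ((Real.pi / (2 * d)) ^ 2 * (∫ p in halfStrip d, ‖f p‖ ^ 2))) :=
    ((continuous_id.pow 2).mul continuous_const).continuousAt.tendsto.mono_left nhdsWithin_le_nhds
  refine le_of_tendsto hlim ?_
  have h1 : (0 : ℝ) < Real.pi / (2 * d) := by positivity
  filter_upwards [Ioo_mem_nhdsLT h1] with k hk
  obtain ⟨i1, e1⟩ := setIntegral_halfStrip hd (integrable_norm_sq hf.continuous hc)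
  obtain ⟨i2, e2⟩ := setIntegral_halfStrip hd
    (integrable_norm_sq (continuous_pd₁ hf) (hasCompactSupport_pd₁ hc))
  rw [e1, e2, ← integral_const_mul]
  refine setIntegral_mono_on (i1.const_mul _) i2 measurableSet_Ici fun r hr => ?_
  refine sq_mul_integral_le_of_left_eq_zero (le_min hr hd.le) (hasDerivAt_fst hf r)
    ((continuous_pd₁ hf).comp (by fun_prop : Continuous fun s : ℝ => (s, r))) (h0 r) hk.1.le ?_
  have h2 : k * (2 * d) < Real.pi := (lt_div_iff₀ (by positivity)).1 hk.2
  have h3 : k * (min r d - 0) ≤ k * d := by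
    have := hk.1
    gcongr
    rw [sub_zero]
    exact min_le_right _ _
  linarith

/-- On the outer strip: each slice `r = const` carries Dirichlet conditions at both ends. -/
lemma friedrichs_outerStrip (hd : 0 < d) (hf : ContDiff ℝ ∞ f) (hc : HasCompactSupport f)
    (h0 : ∀ r, f (0, r) = 0) {k : ℝ} (hk : 0 ≤ k) (hkd : k * d < Real.pi) :
    k ^ 2 * (∫ p in outerStrip d, ‖f p‖ ^ 2) ≤ (∫ p in outerStrip d, ‖pd₁ f p‖ ^ 2)
      + k * Real.tan (k * (d / 2)) * ∫ r in Ici d, ‖f (d, r)‖ ^ 2 := by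
  obtain ⟨i1, e1⟩ := setIntegral_outerStrip hd (integrable_norm_sq hf.continuous hc)
  obtain ⟨i2, e2⟩ := setIntegral_outerStrip hd
    (integrable_norm_sq (continuous_pd₁ hf) (hasCompactSupport_pd₁ hc))
  have i3 : Integrable fun r => ‖f (d, r)‖ ^ 2 := by
    have hcl : Topology.IsClosedEmbedding fun r : ℝ => (d, r) := by
      refine Topology.IsClosedEmbedding.of_continuous_injective_isClosedMap (by fun_prop)
        (fun a b h => (Prod.ext_iff.1 h).2) ?_
      intro S hS
      have : (fun r : ℝ => (d, r)) '' S = {d} ×ˢ S := by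
        ext ⟨x, y⟩
        simp only [mem_image, Prod.mk.injEq, mem_prod, mem_singleton_iff]
        constructor
        · rintro ⟨r, hr, rfl, rfl⟩
          exact ⟨rfl, hr⟩
        · rintro ⟨rfl, hy⟩
          exact ⟨y, hy, rfl, rfl⟩
      rw [this]
      exact isClosed_singleton.prod hS
    have hc' : HasCompactSupport fun r : ℝ => f (d, r) := hc.comp_isClosedEmbedding hcl
    have hcont : Continuous fun r : ℝ => f (d, r) := hf.continuous.comp (by fun_prop)
    exact integrable_norm_sq hcont hc'
  rw [e1, e2, ← integral_const_mul, ← integral_const_mul,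
    ← integral_add i2 (i3.integrableOn.const_mul _)]
  refine setIntegral_mono_on (i1.const_mul _) (i2.add (i3.integrableOn.const_mul _))
    measurableSet_Ici fun r _ => ?_
  have h := sq_mul_integral_le_add_boundary hd.le (hasDerivAt_fst hf r)
    ((continuous_pd₁ hf).comp (by fun_prop : Continuous fun s : ℝ => (s, r))) hk
    (by rwa [sub_zero])
  rw [h0, norm_zero, sub_zero] at h
  simpa using h

lemma trace_outerStrip (hd : 0 < d) (hf : ContDiff ℝ ∞ f) (hc : HasCompactSupport f) :
    ∫ r in Ici d, ‖f (d, r)‖ ^ 2 ≤ (d⁻¹ + 1) * (∫ p in outerStrip d, ‖f p‖ ^ 2)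
      + ∫ p in outerStrip d, ‖pd₁ f p‖ ^ 2 := by
  obtain ⟨i1, e1⟩ := setIntegral_outerStrip hd (integrable_norm_sq hf.continuous hc)
  obtain ⟨i2, e2⟩ := setIntegral_outerStrip hd
    (integrable_norm_sq (continuous_pd₁ hf) (hasCompactSupport_pd₁ hc))
  rw [e1, e2, ← integral_const_mul, ← integral_add (i1.const_mul _) i2]
  refine integral_mono_of_nonneg (Eventually.of_forall fun r => sq_nonneg _)
    ((i1.const_mul _).add i2) (Eventually.of_forall fun r => ?_)
  have h := norm_sq_right_le (hasDerivAt_fst hf r)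
    ((continuous_pd₁ hf).comp (by fun_prop : Continuous fun s : ℝ => (s, r))) hd one_pos
  simpa using h

/-- The trace on the edge `r = s` is controlled by a bounded part of the half strip, with an
arbitrarily small constant in front of the derivative. -/
lemma trace_shearedSquare (hd : 0 < d) (hf : ContDiff ℝ ∞ f) (hc : HasCompactSupport f) {ε : ℝ}
    (hε : 0 < ε) :
    ∫ s in Icc 0 d, ‖f (s, s)‖ ^ 2 ≤ (d⁻¹ + ε⁻¹) * (∫ p in shearedSquare 0 0 d, ‖f p‖ ^ 2)
      + ε * ∫ p in shearedSquare 0 0 d, ‖pd₂ f p‖ ^ 2 := by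
  have h2 := continuous_pd₂ hf
  have h1 := hf.continuous
  rw [setIntegral_shearedSquare hd (integrable_norm_sq h1 hc),
    setIntegral_shearedSquare hd (integrable_norm_sq h2 (hasCompactSupport_pd₂ hc)),
    setIntegral_Icc hd.le]
  simp only [zero_add]
  have hcont : ∀ g : ℝ × ℝ → ℂ, Continuous g →
      Continuous fun s => ∫ t in (0 : ℝ)..d, ‖g (s, s + t)‖ ^ 2 := fun g hg =>
    intervalIntegral.continuous_parametric_intervalIntegral_of_continuous'
      (by fun_prop : Continuous fun q : ℝ × ℝ => ‖g (q.1, q.1 + q.2)‖ ^ 2) _ _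
  rw [← intervalIntegral.integral_const_mul, ← intervalIntegral.integral_const_mul,
    ← intervalIntegral.integral_add ((continuous_const.fun_mul (hcont f h1)).intervalIntegrable _ _)
      ((continuous_const.fun_mul (hcont _ h2)).intervalIntegrable _ _)]
  refine intervalIntegral.integral_mono_on hd.le
    ((by fun_prop : Continuous fun s => ‖f (s, s)‖ ^ 2).intervalIntegrable _ _)
    (((continuous_const.fun_mul (hcont f h1)).fun_add
      (continuous_const.fun_mul (hcont _ h2))).intervalIntegrable _ _) fun s _ => ?_
  have h := norm_sq_left_le (hasDerivAt_shear_snd hf s)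
    (h2.comp (by fun_prop : Continuous fun t : ℝ => (s, s + t))) hd hε
  simpa using h

lemma interval_integral_ite {E : Type*} [NormedAddCommGroup E] [NormedSpace ℝ E] {g₁ g₂ : ℝ → E}
    (h₁ : Continuous g₁) (h₂ : Continuous g₂) {ρ : ℝ} (hρ : ρ ∈ Icc 0 d) :
    IntervalIntegrable (fun τ => if τ ≤ ρ then g₁ τ else g₂ τ) volume 0 d ∧
      ∫ τ in (0 : ℝ)..d, (if τ ≤ ρ then g₁ τ else g₂ τ)
        = (∫ τ in (0 : ℝ)..ρ, g₁ τ) + ∫ τ in ρ..d, g₂ τ := by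
  have c1 : EqOn g₁ (fun τ => if τ ≤ ρ then g₁ τ else g₂ τ) (Ioc 0 ρ) := fun τ hτ =>
    (if_pos hτ.2).symm
  have c2 : EqOn g₂ (fun τ => if τ ≤ ρ then g₁ τ else g₂ τ) (Ioc ρ d) := fun τ hτ =>
    (if_neg (not_le.2 hτ.1)).symm
  have i1 : IntervalIntegrable (fun τ => if τ ≤ ρ then g₁ τ else g₂ τ) volume 0 ρ :=
    (h₁.intervalIntegrable 0 ρ).congr (by rw [uIoc_of_le hρ.1]; exact c1)
  have i2 : IntervalIntegrable (fun τ => if τ ≤ ρ then g₁ τ else g₂ τ) volume ρ d :=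
    (h₂.intervalIntegrable ρ d).congr (by rw [uIoc_of_le hρ.2]; exact c2)
  refine ⟨i1.trans i2, ?_⟩
  rw [← intervalIntegral.integral_add_adjacent_intervals i1 i2]
  congr 1
  · rw [intervalIntegral.integral_of_le hρ.1, intervalIntegral.integral_of_le hρ.1]
    exact (setIntegral_congr_fun measurableSet_Ioc c1).symm
  · rw [intervalIntegral.integral_of_le hρ.2, intervalIntegral.integral_of_le hρ.2]
    exact (setIntegral_congr_fun measurableSet_Ioc c2).symm

/-- The Poincaré inequality on the triangle at the tip, whose Neumann Laplacian has second
eigenvalue `(π / d)²`. The function is unfolded across the edge `r = s` to a symmetric function on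
a square; each of its slices is a function of one variable with a kink at the diagonal. -/
lemma poincare_tipTriangle (hd : 0 < d) (hf : ContDiff ℝ ∞ f) (hc : HasCompactSupport f) :
    (Real.pi / d) ^ 2 * ((∫ p in tipTriangle d, ‖f p‖ ^ 2)
        - 2 * d⁻¹ ^ 2 * ‖∫ p in tipTriangle d, f p‖ ^ 2)
      ≤ (∫ p in tipTriangle d, ‖pd₁ f p‖ ^ 2) + ∫ p in tipTriangle d, ‖pd₂ f p‖ ^ 2 := by
  have hfc := hf.continuous
  have h1 := continuous_pd₁ hf
  have h2 := continuous_pd₂ hf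
  set K := Real.pi / d
  -- `U` is the symmetric extension of `f` to the square; its slice at `ρ` follows the segment `r = ρ` up to
  -- the diagonal and then the segment `s = ρ`
  set U : ℝ → ℝ → ℂ := fun ρ τ => f (min τ ρ, max τ ρ) with hU
  have hUc : Continuous (Function.uncurry U) :=
    hfc.comp (by fun_prop : Continuous fun q : ℝ × ℝ => (min q.2 q.1, max q.2 q.1))
  have hUs : ∀ ρ τ, U ρ τ = if τ ≤ ρ then f (τ, ρ) else f (ρ, τ) := by
    intro ρ τ
    simp only [hU]
    split_ifs with h
    · rw [min_eq_left h, max_eq_right h]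
    · rw [min_eq_right (le_of_not_ge h), max_eq_left (le_of_not_ge h)]
  set U' : ℝ → ℝ → ℂ := fun ρ τ => if τ ≤ ρ then pd₁ f (τ, ρ) else pd₂ f (ρ, τ) with hU'
  have hc1 : ∀ g : ℝ × ℝ → ℂ, Continuous g → ∀ ρ, Continuous fun τ => g (τ, ρ) :=
    fun g hg ρ => hg.comp (by fun_prop)
  have hc2 : ∀ g : ℝ × ℝ → ℂ, Continuous g → ∀ ρ, Continuous fun τ => g (ρ, τ) :=
    fun g hg ρ => hg.comp (by fun_prop)
  -- the Wirtinger inequality on each slice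
  have hslice : ∀ ρ ∈ Icc 0 d, K ^ 2 * ((∫ τ in (0 : ℝ)..d, ‖U ρ τ‖ ^ 2)
      - d⁻¹ * ‖∫ τ in (0 : ℝ)..d, U ρ τ‖ ^ 2)
      ≤ (∫ τ in (0 : ℝ)..ρ, ‖pd₁ f (τ, ρ)‖ ^ 2) + ∫ τ in ρ..d, ‖pd₂ f (ρ, τ)‖ ^ 2 := by
    intro ρ hρ
    have e : (fun τ => ‖U' ρ τ‖ ^ 2)
        = fun τ => if τ ≤ ρ then ‖pd₁ f (τ, ρ)‖ ^ 2 else ‖pd₂ f (ρ, τ)‖ ^ 2 := by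
      ext τ
      simp only [hU']
      split_ifs <;> rfl
    have i1 := interval_integral_ite (hc1 _ h1 ρ) (hc2 _ h2 ρ) hρ
    have i2 := interval_integral_ite ((hc1 _ h1 ρ).norm.fun_pow 2) ((hc2 _ h2 ρ).norm.fun_pow 2) hρ
    have hder : ∀ τ, τ ≠ ρ → HasDerivAt (U ρ) (U' ρ τ) τ := by
      intro τ hτ
      rcases lt_or_gt_of_ne hτ with hlt | hgt
      · have : U' ρ τ = pd₁ f (τ, ρ) := if_pos hlt.le
        rw [this]
        refine (hasDerivAt_fst hf ρ τ).congr_of_eventuallyEq ?_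
        filter_upwards [Iio_mem_nhds hlt] with x hx
        rw [hUs, if_pos (le_of_lt hx)]
      · have : U' ρ τ = pd₂ f (ρ, τ) := if_neg (not_le.2 hgt)
        rw [this]
        refine (hasDerivAt_snd hf ρ τ).congr_of_eventuallyEq ?_
        filter_upwards [Ioi_mem_nhds hgt] with x hx
        rw [hUs, if_neg (not_le.2 hx)]
    have h := sq_mul_variance_le hd
      (hUc.comp (by fun_prop : Continuous fun τ : ℝ => (ρ, τ))) hder i1.1 (by rw [e]; exact i2.1)
    rw [e, i2.2, sub_zero] at h
    exact h
  have hA : Continuous fun ρ => ∫ τ in (0 : ℝ)..d, U ρ τ :=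
    intervalIntegral.continuous_parametric_intervalIntegral_of_continuous' hUc _ _
  have hU2 : Continuous fun ρ => ∫ τ in (0 : ℝ)..d, ‖U ρ τ‖ ^ 2 := by
    refine intervalIntegral.continuous_parametric_intervalIntegral_of_continuous' ?_ _ _
    exact hUc.norm.fun_pow 2
  have t1 := setIntegral_tipTriangle_snd hd (integrable_norm_sq h1 (hasCompactSupport_pd₁ hc))
  have t2 := setIntegral_tipTriangle_fst hd (integrable_norm_sq h2 (hasCompactSupport_pd₂ hc))
  have toInt : ∀ {E : Type} [NormedAddCommGroup E] {g : ℝ → E}, IntegrableOn g (Icc 0 d) →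
      IntervalIntegrable g volume 0 d := fun h =>
    (intervalIntegrable_iff_integrableOn_Icc_of_le hd.le).2 h
  have hmain : K ^ 2 * ((∫ ρ in (0 : ℝ)..d, ∫ τ in (0 : ℝ)..d, ‖U ρ τ‖ ^ 2)
      - d⁻¹ * ∫ ρ in (0 : ℝ)..d, ‖∫ τ in (0 : ℝ)..d, U ρ τ‖ ^ 2)
      ≤ (∫ p in tipTriangle d, ‖pd₁ f p‖ ^ 2) + ∫ p in tipTriangle d, ‖pd₂ f p‖ ^ 2 := by
    rw [t1.2, t2.2, ← intervalIntegral.integral_add (toInt t1.1) (toInt t2.1),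
      ← intervalIntegral.integral_const_mul,
      ← intervalIntegral.integral_sub (hU2.intervalIntegrable _ _)
        ((continuous_const.fun_mul (hA.norm.fun_pow 2)).intervalIntegrable _ _),
      ← intervalIntegral.integral_const_mul]
    refine intervalIntegral.integral_mono_on hd.le
      ((continuous_const.fun_mul (hU2.fun_sub
        (continuous_const.fun_mul (hA.norm.fun_pow 2)))).intervalIntegrable _ _)
      ((toInt t1.1).add (toInt t2.1)) hslice
  have hproj := projections_add_le hUc hd (a := 0) (b := 0)
  have hsymm : ∀ τ, (fun s => U s τ) = U τ := fun τ => by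
    ext s
    simp only [hU]
    rw [min_comm, max_comm]
  have hsymm' : ∀ τ, ∫ s in (0 : ℝ)..d, U s τ = ∫ s in (0 : ℝ)..d, U τ s := fun τ => by
    rw [hsymm]
  simp only [zero_add, hsymm'] at hproj
  -- both integrals over the square are twice the integrals over the triangle
  have e1 : ∫ ρ in (0 : ℝ)..d, ∫ τ in (0 : ℝ)..d, ‖U ρ τ‖ ^ 2
      = 2 * ∫ p in tipTriangle d, ‖f p‖ ^ 2 := by
    have s1 := setIntegral_tipTriangle_snd hd (integrable_norm_sq hfc hc)
    have s2 := setIntegral_tipTriangle_fst hd (integrable_norm_sq hfc hc)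
    rw [two_mul]
    nth_rewrite 1 [s1.2]
    rw [s2.2, ← intervalIntegral.integral_add (toInt s1.1) (toInt s2.1)]
    refine intervalIntegral.integral_congr fun ρ hρ => ?_
    rw [uIcc_of_le hd.le] at hρ
    have := (interval_integral_ite ((hc1 _ hfc ρ).norm.fun_pow 2) ((hc2 _ hfc ρ).norm.fun_pow 2) hρ).2
    refine Eq.trans (intervalIntegral.integral_congr fun τ _ => ?_) this
    simp only [hUs]
    split_ifs <;> rfl
  have hfi : Integrable f := hfc.integrable_of_hasCompactSupport hc
  have e2 : ∫ ρ in (0 : ℝ)..d, ∫ τ in (0 : ℝ)..d, U ρ τ = 2 * ∫ p in tipTriangle d, f p := by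
    have s1 := setIntegral_tipTriangle_snd hd hfi
    have s2 := setIntegral_tipTriangle_fst hd hfi
    rw [two_mul]
    nth_rewrite 1 [s1.2]
    rw [s2.2, ← intervalIntegral.integral_add (toInt s1.1) (toInt s2.1)]
    refine intervalIntegral.integral_congr fun ρ hρ => ?_
    rw [uIcc_of_le hd.le] at hρ
    have := (interval_integral_ite (hc1 _ hfc ρ) (hc2 _ hfc ρ) hρ).2
    exact Eq.trans (intervalIntegral.integral_congr fun τ _ => hUs ρ τ) this
  rw [e1, e2, norm_mul, mul_pow, Complex.norm_ofNat] at hproj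
  rw [e1] at hmain
  refine le_trans ?_ hmain
  have hK : 0 ≤ K ^ 2 := sq_nonneg _
  refine mul_le_mul_of_nonneg_left ?_ hK
  linarith

/-- The Poincaré inequality on a square in the sheared coordinates. -/
lemma poincare_shearedSquare (hf : ContDiff ℝ ∞ f) (hc : HasCompactSupport f) {a b h : ℝ}
    (hh : 0 < h) :
    (Real.pi / h) ^ 2 * ((∫ p in shearedSquare a b h, ‖f p‖ ^ 2)
        - h⁻¹ ^ 2 * ‖∫ p in shearedSquare a b h, f p‖ ^ 2)
      ≤ 3 * ∫ p in shearedSquare a b h, (‖pd₁ f p‖ ^ 2 + ‖pd₂ f p‖ ^ 2) := by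
  have hfc := hf.continuous
  have h1 := continuous_pd₁ hf
  have h2 := continuous_pd₂ hf
  have ha : a < a + h := by linarith
  have hb : b < b + h := by linarith
  have ea : a + h - a = h := by ring
  have eb : b + h - b = h := by ring
  set K := Real.pi / h
  set g : ℝ → ℝ → ℂ := fun s t => f (s, s + t) with hg
  have hsh : Continuous fun q : ℝ × ℝ => (q.1, q.1 + q.2) := by fun_prop
  have hgc : Continuous (Function.uncurry g) := hfc.comp hsh
  have hgc' : Continuous (Function.uncurry fun t s => g s t) := hgc.comp continuous_swap
  set g₁ : ℝ → ℝ → ℂ := fun s t => pd₁ f (s, s + t) + pd₂ f (s, s + t) with hg₁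
  set g₂ : ℝ → ℝ → ℂ := fun s t => pd₂ f (s, s + t) with hg₂
  have hg₁c : Continuous (Function.uncurry g₁) := (h1.add h2).comp hsh
  have hg₁c' : Continuous (Function.uncurry fun t s => g₁ s t) := hg₁c.comp continuous_swap
  have hg₂c : Continuous (Function.uncurry g₂) := h2.comp hsh
  have param : ∀ {E : Type} [NormedAddCommGroup E] [NormedSpace ℝ E] {G : ℝ → ℝ → E}
      (_ : Continuous (Function.uncurry G)) (x y : ℝ), Continuous fun s => ∫ t in x..y, G s t :=
    fun hG x y => intervalIntegral.continuous_parametric_intervalIntegral_of_continuous' hG x y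
  have nsq : ∀ {G : ℝ → ℝ → ℂ}, Continuous (Function.uncurry G) →
      Continuous (Function.uncurry fun s t => ‖G s t‖ ^ 2) := fun hG => hG.norm.fun_pow 2
  have row : K ^ 2 * ((∫ s in a..a + h, ∫ t in b..b + h, ‖g s t‖ ^ 2)
      - h⁻¹ * ∫ s in a..a + h, ‖∫ t in b..b + h, g s t‖ ^ 2)
      ≤ ∫ s in a..a + h, ∫ t in b..b + h, ‖g₂ s t‖ ^ 2 := by
    rw [← intervalIntegral.integral_const_mul, ← intervalIntegral.integral_sub
        ((param (nsq hgc) _ _).intervalIntegrable _ _)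
        ((continuous_const.fun_mul ((param hgc _ _).norm.fun_pow 2)).intervalIntegrable _ _),
      ← intervalIntegral.integral_const_mul]
    refine intervalIntegral.integral_mono_on ha.le
      ((continuous_const.fun_mul ((param (nsq hgc) _ _).fun_sub
        (continuous_const.fun_mul ((param hgc _ _).norm.fun_pow 2)))).intervalIntegrable _ _)
      ((param (nsq hg₂c) _ _).intervalIntegrable _ _) fun s _ => ?_
    have hl : Continuous fun t : ℝ => (s, t) := by fun_prop
    have := sq_mul_variance_le hb (hgc.comp hl) (ρ := 0) (f' := g₂ s)
      (fun t _ => hasDerivAt_shear_snd hf s t)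
      ((hg₂c.comp hl).intervalIntegrable _ _) (((hg₂c.comp hl).norm.fun_pow 2).intervalIntegrable _ _)
    rw [eb] at this
    exact this
  have col : K ^ 2 * ((∫ s in a..a + h, ∫ t in b..b + h, ‖g s t‖ ^ 2)
      - h⁻¹ * ∫ t in b..b + h, ‖∫ s in a..a + h, g s t‖ ^ 2)
      ≤ ∫ s in a..a + h, ∫ t in b..b + h, ‖g₁ s t‖ ^ 2 := by
    rw [interval_integral_swap (nsq hgc), interval_integral_swap (nsq hg₁c),
      ← intervalIntegral.integral_const_mul, ← intervalIntegral.integral_sub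
        ((param (nsq hgc') _ _).intervalIntegrable _ _)
        ((continuous_const.fun_mul ((param hgc' _ _).norm.fun_pow 2)).intervalIntegrable _ _),
      ← intervalIntegral.integral_const_mul]
    refine intervalIntegral.integral_mono_on hb.le
      ((continuous_const.fun_mul ((param (nsq hgc') _ _).fun_sub
        (continuous_const.fun_mul ((param hgc' _ _).norm.fun_pow 2)))).intervalIntegrable _ _)
      ((param (nsq hg₁c') _ _).intervalIntegrable _ _) fun t _ => ?_
    have hl : Continuous fun s : ℝ => (t, s) := by fun_prop
    have := sq_mul_variance_le ha (hgc'.comp hl) (ρ := 0) (f' := fun s => g₁ s t)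
      (fun s _ => hasDerivAt_shear_fst hf t s)
      ((hg₁c'.comp hl).intervalIntegrable _ _) (((hg₁c'.comp hl).norm.fun_pow 2).intervalIntegrable _ _)
    rw [ea] at this
    exact this
  have hproj := projections_add_le hgc hh (a := a) (b := b)
  have hfi : Integrable f := hfc.integrable_of_hasCompactSupport hc
  have i1 := integrable_norm_sq (μ := volume) h1 (hasCompactSupport_pd₁ hc)
  have i2 := integrable_norm_sq (μ := volume) h2 (hasCompactSupport_pd₂ hc)
  rw [setIntegral_shearedSquare hh (integrable_norm_sq hfc hc), setIntegral_shearedSquare hh hfi,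
    setIntegral_shearedSquare hh (i1.fun_add i2)]
  have hlast : (∫ s in a..a + h, ∫ t in b..b + h, ‖g₁ s t‖ ^ 2)
      + (∫ s in a..a + h, ∫ t in b..b + h, ‖g₂ s t‖ ^ 2)
      ≤ 3 * ∫ s in a..a + h, ∫ t in b..b + h,
        (‖pd₁ f (s, s + t)‖ ^ 2 + ‖pd₂ f (s, s + t)‖ ^ 2) := by
    have hc3 : Continuous (Function.uncurry fun s t : ℝ =>
        ‖pd₁ f (s, s + t)‖ ^ 2 + ‖pd₂ f (s, s + t)‖ ^ 2) :=
      ((h1.norm.fun_pow 2).fun_add (h2.norm.fun_pow 2)).comp hsh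
    have hl : ∀ s : ℝ, Continuous fun t : ℝ => (s, t) := fun s => by fun_prop
    rw [← intervalIntegral.integral_add ((param (nsq hg₁c) _ _).intervalIntegrable _ _)
      ((param (nsq hg₂c) _ _).intervalIntegrable _ _), ← intervalIntegral.integral_const_mul]
    refine intervalIntegral.integral_mono_on ha.le
      (((param (nsq hg₁c) _ _).fun_add (param (nsq hg₂c) _ _)).intervalIntegrable _ _)
      ((continuous_const.fun_mul (param hc3 _ _)).intervalIntegrable _ _) fun s _ => ?_
    have q1 : Continuous fun t => ‖g₁ s t‖ ^ 2 := (nsq hg₁c).comp (hl s)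
    have q2 : Continuous fun t => ‖g₂ s t‖ ^ 2 := (nsq hg₂c).comp (hl s)
    rw [← intervalIntegral.integral_add (q1.intervalIntegrable _ _) (q2.intervalIntegrable _ _),
      ← intervalIntegral.integral_const_mul]
    refine intervalIntegral.integral_mono_on hb.le ((q1.fun_add q2).intervalIntegrable _ _)
      ((continuous_const.fun_mul (hc3.comp (hl s))).intervalIntegrable _ _) fun t _ => ?_
    simp only [hg₁, hg₂]
    have h3 := norm_add_le (pd₁ f (s, s + t)) (pd₂ f (s, s + t))
    have h4 : ‖pd₁ f (s, s + t) + pd₂ f (s, s + t)‖ ^ 2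
        ≤ (‖pd₁ f (s, s + t)‖ + ‖pd₂ f (s, s + t)‖) ^ 2 :=
      pow_le_pow_left₀ (norm_nonneg _) h3 2
    nlinarith [sq_nonneg (‖pd₁ f (s, s + t)‖ - ‖pd₂ f (s, s + t)‖), sq_nonneg ‖pd₁ f (s, s + t)‖]
  have hK : 0 ≤ K ^ 2 := sq_nonneg _
  have hcomb := mul_le_mul_of_nonneg_left hproj hK
  simp only [mul_add] at hcomb
  simp only [mul_sub] at row col ⊢
  linarith

/-- The sheared square of side `d` is cut into `N ^ 2` sheared squares of side `d / N`. -/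
lemma sum_shearedSquare {G : ℝ × ℝ → ℝ} (hG : Continuous G) (hGi : Integrable G) (hd : 0 < d)
    {N : ℕ} (hN : 0 < N) :
    ∑ i ∈ Finset.range N, ∑ j ∈ Finset.range N,
        ∫ p in shearedSquare (i * (d / N)) (j * (d / N)) (d / N), G p
      = ∫ p in shearedSquare 0 0 d, G p := by
  have hN' : (0 : ℝ) < N := by exact_mod_cast hN
  have hh : 0 < d / N := by positivity
  have hsh : Continuous fun q : ℝ × ℝ => (q.1, q.1 + q.2) := by fun_prop
  have hGs : Continuous (Function.uncurry fun s t => G (s, s + t)) := hG.comp hsh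
  rw [setIntegral_shearedSquare hd hGi]
  simp only [setIntegral_shearedSquare hh hGi, zero_add]
  have step : ∀ k : ℕ, (k : ℝ) * (d / N) + d / N = ((k + 1 : ℕ) : ℝ) * (d / N) := fun k => by
    push_cast
    ring
  have eN : (N : ℝ) * (d / N) = d := by field_simp
  simp only [step]
  have param : ∀ x y : ℝ, Continuous fun s => ∫ t in x..y, G (s, s + t) := fun x y =>
    intervalIntegral.continuous_parametric_intervalIntegral_of_continuous' hGs x y
  have h1 : ∀ i : ℕ, ∑ j ∈ Finset.range N,
      ∫ s in (i : ℝ) * (d / N)..((i + 1 : ℕ) : ℝ) * (d / N),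
        ∫ t in (j : ℝ) * (d / N)..((j + 1 : ℕ) : ℝ) * (d / N), G (s, s + t)
      = ∫ s in (i : ℝ) * (d / N)..((i + 1 : ℕ) : ℝ) * (d / N), ∫ t in (0 : ℝ)..d, G (s, s + t) := by
    intro i
    rw [← intervalIntegral.integral_finsetSum
      fun j _ => (param _ _).intervalIntegrable _ _]
    refine intervalIntegral.integral_congr fun s _ => ?_
    have := intervalIntegral.sum_integral_adjacent_intervals (μ := volume)
      (f := fun t => G (s, s + t)) (a := fun k : ℕ => (k : ℝ) * (d / N)) (n := N)
      fun k _ => (hGs.comp (by fun_prop : Continuous fun t : ℝ => (s, t))).intervalIntegrable _ _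
    simp only [Nat.cast_zero, zero_mul, eN] at this
    exact this
  simp only [h1]
  have := intervalIntegral.sum_integral_adjacent_intervals (μ := volume)
    (f := fun s => ∫ t in (0 : ℝ)..d, G (s, s + t)) (a := fun k : ℕ => (k : ℝ) * (d / N)) (n := N)
    fun k _ => (param _ _).intervalIntegrable _ _
  simp only [Nat.cast_zero, zero_mul, eN] at this
  exact this

/-- A Poincaré inequality with an arbitrarily large constant, at the price of finitely many mean
values. -/
lemma poincare_mesh (hd : 0 < d) (hf : ContDiff ℝ ∞ f) (hc : HasCompactSupport f)
    {N : ℕ} (hN : 0 < N) :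
    (Real.pi / (d / N)) ^ 2 * ((∫ p in shearedSquare 0 0 d, ‖f p‖ ^ 2)
        - (d / N)⁻¹ ^ 2 * ∑ i ∈ Finset.range N, ∑ j ∈ Finset.range N,
          ‖∫ p in shearedSquare (i * (d / N)) (j * (d / N)) (d / N), f p‖ ^ 2)
      ≤ 3 * ∫ p in shearedSquare 0 0 d, (‖pd₁ f p‖ ^ 2 + ‖pd₂ f p‖ ^ 2) := by
  have hN' : (0 : ℝ) < N := by exact_mod_cast hN
  have hh : 0 < d / N := by positivity
  have h1 := continuous_pd₁ hf
  have h2 := continuous_pd₂ hf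
  rw [← sum_shearedSquare (hf.continuous.norm.fun_pow 2) (integrable_norm_sq hf.continuous hc) hd hN,
    ← sum_shearedSquare ((h1.norm.fun_pow 2).fun_add (h2.norm.fun_pow 2))
      ((integrable_norm_sq h1 (hasCompactSupport_pd₁ hc)).fun_add
        (integrable_norm_sq h2 (hasCompactSupport_pd₂ hc))) hd hN]
  simp only [Finset.mul_sum, ← Finset.sum_sub_distrib]
  exact Finset.sum_le_sum fun i _ => Finset.sum_le_sum fun j _ =>
    poincare_shearedSquare hf hc hh

end HalfStrip

/-! ### Change of variables between the pencil and the half strip -/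

section Rotation

/-- The linear map `(s, r) ↦ (x, y) = ((r + s) / 2, (r - s) / 2)`. -/
def rotCLM : ℝ × ℝ →L[ℝ] ℝ × ℝ :=
  ((2⁻¹ : ℝ) • (ContinuousLinearMap.snd ℝ ℝ ℝ + ContinuousLinearMap.fst ℝ ℝ ℝ)).prod
    ((2⁻¹ : ℝ) • (ContinuousLinearMap.snd ℝ ℝ ℝ - ContinuousLinearMap.fst ℝ ℝ ℝ))

@[simp] lemma rotCLM_apply (p : ℝ × ℝ) :
    rotCLM p = (2⁻¹ * (p.2 + p.1), 2⁻¹ * (p.2 - p.1)) := rfl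

/-- The inverse `(x, y) ↦ (s, r) = (x - y, x + y)`. -/
def rotInv (p : ℝ × ℝ) : ℝ × ℝ := (p.1 - p.2, p.1 + p.2)

lemma rotInv_rotCLM (p : ℝ × ℝ) : rotInv (rotCLM p) = p := by
  ext <;> simp [rotInv] <;> ring

lemma rotCLM_rotInv (p : ℝ × ℝ) : rotCLM (rotInv p) = p := by
  ext <;> simp [rotInv] <;> ring

lemma continuous_rotInv : Continuous rotInv := by
  unfold rotInv; fun_prop

lemma contDiff_rotInv : ContDiff ℝ ∞ rotInv := by
  unfold rotInv; fun_prop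

lemma rotCLM_image_eq (S : Set (ℝ × ℝ)) : rotCLM '' S = rotInv ⁻¹' S := by
  ext p
  constructor
  · rintro ⟨q, hq, rfl⟩
    rw [mem_preimage, rotInv_rotCLM]
    exact hq
  · intro hp
    exact ⟨rotInv p, hp, rotCLM_rotInv p⟩

lemma det_rotCLM : rotCLM.det = 2⁻¹ := by
  have h : (rotCLM : ℝ × ℝ →ₗ[ℝ] ℝ × ℝ) = Matrix.toLin (Module.Basis.finTwoProd ℝ)
      (Module.Basis.finTwoProd ℝ) !![2⁻¹, 2⁻¹; -2⁻¹, 2⁻¹] := by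
    rw [Matrix.toLin_finTwoProd]
    ext <;> simp [rotCLM]
  rw [ContinuousLinearMap.det, h, LinearMap.det_toLin, Matrix.det_fin_two_of]
  norm_num

lemma setIntegral_rotCLM_image {E : Type*} [NormedAddCommGroup E] [NormedSpace ℝ E]
    {S : Set (ℝ × ℝ)} (hS : MeasurableSet S) (G : ℝ × ℝ → E) :
    ∫ p in rotCLM '' S, G p = (2⁻¹ : ℝ) • ∫ p in S, G (rotCLM p) := by
  rw [integral_image_eq_integral_abs_det_fderiv_smul volume hS
    (fun x _ => rotCLM.hasFDerivAt.hasFDerivWithinAt)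
    (Function.LeftInverse.injective rotInv_rotCLM).injOn]
  rw [det_rotCLM, integral_smul]
  norm_num

/-- The half `x ≥ y` of the pencil. -/
def lowerPencil (d : ℝ) : Set (ℝ × ℝ) := {p | 0 ≤ p.2 ∧ p.2 ≤ p.1 ∧ p.1 - p.2 ≤ d}

lemma measurableSet_halfStrip (d : ℝ) : MeasurableSet (halfStrip d) :=
  ((isClosed_le continuous_const continuous_fst).inter
    ((isClosed_le continuous_fst continuous_const).inter
      (isClosed_le continuous_fst continuous_snd))).measurableSet

lemma measurableSet_lowerPencil (d : ℝ) : MeasurableSet (lowerPencil d) :=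
  ((isClosed_le continuous_const continuous_snd).inter
    ((isClosed_le continuous_snd continuous_fst).inter
      (isClosed_le (by fun_prop : Continuous fun p : ℝ × ℝ => p.1 - p.2)
        continuous_const))).measurableSet

lemma rotCLM_image_halfStrip (d : ℝ) : rotCLM '' halfStrip d = lowerPencil d := by
  rw [rotCLM_image_eq]
  ext p
  simp only [mem_preimage, rotInv, halfStrip, lowerPencil, mem_ofPred_eq]
  constructor <;> rintro ⟨h1, h2, h3⟩ <;> refine ⟨?_, ?_, ?_⟩ <;> linarith

lemma lowerPencil_subset (d : ℝ) : lowerPencil d ⊆ pencil d := by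
  rintro p ⟨h1, h2, h3⟩
  exact ⟨h1.trans h2, h1, by rw [abs_of_nonneg (by linarith)]; exact h3⟩

lemma pencil_eq_union (d : ℝ) : pencil d = lowerPencil d ∪ Prod.swap ⁻¹' lowerPencil d := by
  ext p
  simp only [pencil, lowerPencil, mem_union, mem_preimage, mem_ofPred_eq, Prod.fst_swap,
    Prod.snd_swap, abs_le]
  constructor
  · rintro ⟨h1, h2, h3, h4⟩
    rcases le_total p.1 p.2 with h | h
    · exact Or.inr ⟨h1, h, by linarith⟩
    · exact Or.inl ⟨h2, h, by linarith⟩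
  · rintro (⟨h1, h2, h3⟩ | ⟨h1, h2, h3⟩) <;> refine ⟨?_, ?_, ?_, ?_⟩ <;> linarith

lemma volume_diagonal : volume {p : ℝ × ℝ | p.1 = p.2} = 0 := by
  have hm : MeasurableSet {p : ℝ × ℝ | p.1 = p.2} :=
    (isClosed_eq continuous_fst continuous_snd).measurableSet
  rw [Measure.volume_eq_prod, Measure.measure_prod_null hm]
  filter_upwards with x
  have : Prod.mk x ⁻¹' {p : ℝ × ℝ | p.1 = p.2} = {x} := by
    ext y; simp [eq_comm]
  rw [this]; simp

lemma setIntegral_swap {E : Type*} [NormedAddCommGroup E] [NormedSpace ℝ E] (S : Set (ℝ × ℝ))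
    (G : ℝ × ℝ → E) : ∫ p in Prod.swap ⁻¹' S, G p.swap = ∫ p in S, G p :=
  (Measure.measurePreserving_swap (μ := (volume : Measure ℝ))
    (ν := (volume : Measure ℝ))).setIntegral_preimage_emb
      (MeasurableEquiv.prodComm (α := ℝ) (β := ℝ)).measurableEmbedding G S

/-- Integrals of symmetric functions over the pencil are integrals over the half strip. -/
lemma setIntegral_pencil_of_symm {E : Type*} [NormedAddCommGroup E] [NormedSpace ℝ E] {d : ℝ}
    {G : ℝ × ℝ → E} (hG : Integrable G)
    (hs : ∀ p, G p.swap = G p) :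
    ∫ p in pencil d, G p = ∫ p in halfStrip d, G (rotCLM p) := by
  have h1 := setIntegral_rotCLM_image (measurableSet_halfStrip d) G
  rw [rotCLM_image_halfStrip] at h1
  have h2 := setIntegral_swap (lowerPencil d) G
  simp only [hs] at h2
  have h3 : AEDisjoint volume (lowerPencil d) (Prod.swap ⁻¹' lowerPencil d) := by
    refine measure_mono_null ?_ volume_diagonal
    rintro p ⟨⟨_, h, _⟩, ⟨_, h', _⟩⟩
    exact le_antisymm h' h
  rw [pencil_eq_union, setIntegral_union₀ h3
    ((measurableSet_lowerPencil d).preimage measurable_swap).nullMeasurableSet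
    hG.integrableOn hG.integrableOn, h2, h1, ← add_smul]
  norm_num

lemma setIntegral_halfStrip_le {d : ℝ} {G : ℝ × ℝ → ℝ} (hG : Integrable G) (h0 : ∀ p, 0 ≤ G p) :
    ∫ p in halfStrip d, G (rotCLM p) ≤ 2 * ∫ p in pencil d, G p := by
  have h1 := setIntegral_rotCLM_image (measurableSet_halfStrip d) G
  rw [rotCLM_image_halfStrip, smul_eq_mul] at h1
  have h2 : ∫ p in lowerPencil d, G p ≤ ∫ p in pencil d, G p :=
    setIntegral_mono_set hG.integrableOn (ae_of_all _ h0) (lowerPencil_subset d).eventuallyLE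
  linarith

variable {u : ℝ × ℝ → ℂ}

lemma contDiff_rot (hu : ContDiff ℝ ∞ u) : ContDiff ℝ ∞ (fun p => u (rotCLM p)) :=
  hu.comp rotCLM.contDiff

/-- The homeomorphism underlying the change of variables. -/
def rotHomeo : ℝ × ℝ ≃ₜ ℝ × ℝ where
  toFun := rotCLM
  invFun := rotInv
  left_inv := rotInv_rotCLM
  right_inv := rotCLM_rotInv
  continuous_toFun := rotCLM.continuous
  continuous_invFun := continuous_rotInv

lemma hasCompactSupport_rot (hc : HasCompactSupport u) :
    HasCompactSupport (fun p => u (rotCLM p)) :=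
  hc.comp_homeomorph rotHomeo

lemma hasCompactSupport_rotInv (hc : HasCompactSupport u) :
    HasCompactSupport (fun p => u (rotInv p)) :=
  hc.comp_homeomorph rotHomeo.symm

lemma pd₁_rot (hu : ContDiff ℝ ∞ u) (p : ℝ × ℝ) :
    pd₁ (fun p => u (rotCLM p)) p = 2⁻¹ * (pd₁ u (rotCLM p) - pd₂ u (rotCLM p)) := by
  have h : HasFDerivAt u (fderiv ℝ u (rotCLM p)) (rotCLM p) :=
    (hu.differentiable (by simp) _).hasFDerivAt
  have h2 := (h.comp p rotCLM.hasFDerivAt).fderiv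
  rw [pd₁, pd₁, pd₂, ← map_sub]
  change fderiv ℝ (u ∘ rotCLM) p (1, 0) = _
  rw [h2]
  have e : rotCLM (1, 0) = (2⁻¹ : ℝ) • (((1 : ℝ), (0 : ℝ)) - (0, 1)) := by
    ext <;> simp
  rw [ContinuousLinearMap.comp_apply, e, map_smul]
  simp

lemma pd₂_rot (hu : ContDiff ℝ ∞ u) (p : ℝ × ℝ) :
    pd₂ (fun p => u (rotCLM p)) p = 2⁻¹ * (pd₁ u (rotCLM p) + pd₂ u (rotCLM p)) := by
  have h : HasFDerivAt u (fderiv ℝ u (rotCLM p)) (rotCLM p) :=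
    (hu.differentiable (by simp) _).hasFDerivAt
  have h2 := (h.comp p rotCLM.hasFDerivAt).fderiv
  rw [pd₂, pd₁, pd₂, ← map_add]
  change fderiv ℝ (u ∘ rotCLM) p (0, 1) = _
  rw [h2]
  have e : rotCLM (0, 1) = (2⁻¹ : ℝ) • (((1 : ℝ), (0 : ℝ)) + (0, 1)) := by
    ext <;> simp
  rw [ContinuousLinearMap.comp_apply, e, map_smul]
  simp

lemma norm_pd_rot_sq (hu : ContDiff ℝ ∞ u) (p : ℝ × ℝ) :
    ‖pd₁ (fun p => u (rotCLM p)) p‖ ^ 2 + ‖pd₂ (fun p => u (rotCLM p)) p‖ ^ 2 =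
      2⁻¹ * (‖pd₁ u (rotCLM p)‖ ^ 2 + ‖pd₂ u (rotCLM p)‖ ^ 2) := by
  rw [pd₁_rot hu, pd₂_rot hu, norm_mul, norm_mul, mul_pow, mul_pow]
  have h := parallelogram_law_with_norm ℝ (pd₁ u (rotCLM p)) (pd₂ u (rotCLM p))
  have e : ‖(2⁻¹ : ℂ)‖ = 2⁻¹ := by simp
  rw [e]
  nlinarith

lemma contDiff_swap (hu : ContDiff ℝ ∞ u) : ContDiff ℝ ∞ (fun p : ℝ × ℝ => u p.swap) :=
  hu.comp (contDiff_snd.prodMk contDiff_fst)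

lemma hasCompactSupport_swap (hc : HasCompactSupport u) :
    HasCompactSupport (fun p : ℝ × ℝ => u p.swap) :=
  hc.comp_homeomorph (Homeomorph.prodComm ℝ ℝ)

lemma fderiv_swap (hu : ContDiff ℝ ∞ u) (p v : ℝ × ℝ) :
    fderiv ℝ (fun p : ℝ × ℝ => u p.swap) p v = fderiv ℝ u p.swap v.swap := by
  have h : HasFDerivAt u (fderiv ℝ u p.swap) p.swap :=
    (hu.differentiable (by simp) _).hasFDerivAt
  have h2 := (h.comp p (ContinuousLinearEquiv.prodComm ℝ ℝ ℝ).hasFDerivAt).fderiv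
  change fderiv ℝ (u ∘ Prod.swap) p v = _
  rw [h2]
  rfl

lemma pd₁_swap (hu : ContDiff ℝ ∞ u) (p : ℝ × ℝ) :
    pd₁ (fun p : ℝ × ℝ => u p.swap) p = pd₂ u p.swap := fderiv_swap hu p _

lemma pd₂_swap (hu : ContDiff ℝ ∞ u) (p : ℝ × ℝ) :
    pd₂ (fun p : ℝ × ℝ => u p.swap) p = pd₁ u p.swap := fderiv_swap hu p _

end Rotation

/-! ### Form inequalities for smooth functions on the pencil -/

section FormInequalities

variable {f : ℝ × ℝ → ℂ} {d : ℝ}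

lemma volume_horizontal_line (c : ℝ) : volume {p : ℝ × ℝ | p.2 = c} = 0 := by
  have e : {p : ℝ × ℝ | p.2 = c} = (univ : Set ℝ) ×ˢ {c} := by
    ext p; simp
  rw [e, Measure.volume_eq_prod, Measure.prod_prod]
  simp

lemma measurableSet_outerStrip (d : ℝ) : MeasurableSet (outerStrip d) :=
  ((isClosed_le continuous_const continuous_fst).inter
    ((isClosed_le continuous_fst continuous_const).inter
      (isClosed_le continuous_const continuous_snd))).measurableSet

lemma measurableSet_tipTriangle (d : ℝ) : MeasurableSet (tipTriangle d) :=
  ((isClosed_le continuous_const continuous_fst).inter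
    ((isClosed_le continuous_fst continuous_snd).inter
      (isClosed_le continuous_snd continuous_const))).measurableSet

lemma measurableSet_shearedSquare (a b h : ℝ) : MeasurableSet (shearedSquare a b h) :=
  ((isClosed_Icc.preimage continuous_fst).inter
    ((isClosed_le (by fun_prop : Continuous fun p : ℝ × ℝ => p.1 + b) continuous_snd).inter
      (isClosed_le continuous_snd
        (by fun_prop : Continuous fun p : ℝ × ℝ => p.1 + (b + h))))).measurableSet

lemma tipTriangle_subset_halfStrip : tipTriangle d ⊆ halfStrip d :=
  fun _ h => ⟨h.1, h.2.1.trans h.2.2, h.2.1⟩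

lemma outerStrip_subset_halfStrip : outerStrip d ⊆ halfStrip d :=
  fun _ h => ⟨h.1, h.2.1, h.2.1.trans h.2.2⟩

lemma shearedSquare_subset_halfStrip : shearedSquare 0 0 d ⊆ halfStrip d := by
  rintro p ⟨⟨h1, h2⟩, h3, -⟩
  exact ⟨h1, by linarith, by linarith⟩

lemma tipTriangle_subset_shearedSquare : tipTriangle d ⊆ shearedSquare 0 0 d := by
  rintro p ⟨h1, h2, h3⟩
  exact ⟨⟨h1, by linarith⟩, by linarith, by linarith⟩

lemma setIntegral_halfStrip_eq_add {E : Type*} [NormedAddCommGroup E] [NormedSpace ℝ E]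
    {G : ℝ × ℝ → E} (hG : Integrable G) :
    ∫ p in halfStrip d, G p = (∫ p in tipTriangle d, G p) + ∫ p in outerStrip d, G p := by
  have e : halfStrip d = tipTriangle d ∪ outerStrip d := by
    ext p
    simp only [halfStrip, tipTriangle, outerStrip, mem_union, mem_ofPred_eq]
    constructor
    · rintro ⟨h1, h2, h3⟩
      rcases le_total p.2 d with h | h
      · exact Or.inl ⟨h1, h3, h⟩
      · exact Or.inr ⟨h1, h2, h⟩
    · rintro (⟨h1, h2, h3⟩ | ⟨h1, h2, h3⟩) <;> refine ⟨?_, ?_, ?_⟩ <;> linarith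
  have h3 : AEDisjoint volume (tipTriangle d) (outerStrip d) := by
    refine measure_mono_null ?_ (volume_horizontal_line d)
    rintro p ⟨⟨_, _, h⟩, ⟨_, _, h'⟩⟩
    exact le_antisymm h h'
  rw [e, setIntegral_union₀ h3 (measurableSet_outerStrip d).nullMeasurableSet
    hG.integrableOn hG.integrableOn]

/-- Below the threshold of the outer strip, the energy controls the mass up to the values on the
Dirichlet side and the mean over the tip. -/
lemma halfStrip_le_energy_add_mean (hd : 0 < d) {k : ℝ} (hk : 0 ≤ k) (hkd : k * d < Real.pi) :
    ∃ C : ℝ, 0 ≤ C ∧ ∀ f : ℝ × ℝ → ℂ, ContDiff ℝ ∞ f → HasCompactSupport f →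
      (∀ r, f (0, r) = 0) →
      k ^ 2 * (∫ p in halfStrip d, ‖f p‖ ^ 2)
        ≤ (∫ p in halfStrip d, (‖pd₁ f p‖ ^ 2 + ‖pd₂ f p‖ ^ 2))
          + C * (∫ r in Ici d, ‖f (d, r)‖ ^ 2) + C * ‖∫ p in tipTriangle d, f p‖ ^ 2 := by
  have ht : 0 ≤ k * Real.tan (k * (d / 2)) := by
    refine mul_nonneg hk (Real.tan_nonneg_of_nonneg_of_le_pi_div_two (by positivity) ?_)
    nlinarith
  have hq : 0 ≤ (Real.pi / d) ^ 2 * (2 * d⁻¹ ^ 2) := by positivity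
  refine ⟨k * Real.tan (k * (d / 2)) + (Real.pi / d) ^ 2 * (2 * d⁻¹ ^ 2), add_nonneg ht hq, ?_⟩
  intro f hf hc h0
  have h1 := friedrichs_outerStrip hd hf hc h0 hk hkd
  have h2 := poincare_tipTriangle hd hf hc
  have i0 := integrable_norm_sq (μ := volume) hf.continuous hc
  have i1 := integrable_norm_sq (μ := volume) (continuous_pd₁ hf) (hasCompactSupport_pd₁ hc)
  have i2 := integrable_norm_sq (μ := volume) (continuous_pd₂ hf) (hasCompactSupport_pd₂ hc)
  rw [integral_add i1.integrableOn i2.integrableOn, setIntegral_halfStrip_eq_add i0,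
    setIntegral_halfStrip_eq_add i1, setIntegral_halfStrip_eq_add i2]
  have hkK : k ^ 2 ≤ (Real.pi / d) ^ 2 := by
    refine pow_le_pow_left₀ hk ?_ 2
    rw [le_div_iff₀ hd]; exact hkd.le
  have n1 : 0 ≤ ∫ p in tipTriangle d, ‖f p‖ ^ 2 := integral_nonneg fun _ => sq_nonneg _
  have n2 : 0 ≤ ∫ p in outerStrip d, ‖pd₂ f p‖ ^ 2 := integral_nonneg fun _ => sq_nonneg _
  have n3 : 0 ≤ ∫ r in Ici d, ‖f (d, r)‖ ^ 2 := integral_nonneg fun _ => sq_nonneg _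
  have n4 : 0 ≤ ‖∫ p in tipTriangle d, f p‖ ^ 2 := sq_nonneg _
  have m1 := mul_le_mul_of_nonneg_right hkK n1
  have m2 := mul_nonneg ht n4
  have m3 := mul_nonneg hq n3
  nlinarith

/-- The boundary values on the bottom side are form bounded with arbitrarily small bound. -/
lemma bottom_le_energy_add_mass (hd : 0 < d) {ε : ℝ} (hε : 0 < ε) (hf : ContDiff ℝ ∞ f)
    (hc : HasCompactSupport f) :
    ∫ s in Icc 0 d, ‖f (s, s)‖ ^ 2
      ≤ ε * (∫ p in halfStrip d, (‖pd₁ f p‖ ^ 2 + ‖pd₂ f p‖ ^ 2))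
        + (d⁻¹ + ε⁻¹) * ∫ p in halfStrip d, ‖f p‖ ^ 2 := by
  have h := trace_shearedSquare hd hf hc hε
  have i0 := integrable_norm_sq (μ := volume) hf.continuous hc
  have i1 := integrable_norm_sq (μ := volume) (continuous_pd₁ hf) (hasCompactSupport_pd₁ hc)
  have i2 := integrable_norm_sq (μ := volume) (continuous_pd₂ hf) (hasCompactSupport_pd₂ hc)
  have m0 : ∫ p in shearedSquare 0 0 d, ‖f p‖ ^ 2 ≤ ∫ p in halfStrip d, ‖f p‖ ^ 2 :=
    setIntegral_mono_set i0.integrableOn (ae_of_all _ fun _ => sq_nonneg _)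
      shearedSquare_subset_halfStrip.eventuallyLE
  have m1 : ∫ p in shearedSquare 0 0 d, ‖pd₂ f p‖ ^ 2 ≤ ∫ p in halfStrip d, ‖pd₂ f p‖ ^ 2 :=
    setIntegral_mono_set i2.integrableOn (ae_of_all _ fun _ => sq_nonneg _)
      shearedSquare_subset_halfStrip.eventuallyLE
  have n1 : 0 ≤ ∫ p in halfStrip d, ‖pd₁ f p‖ ^ 2 := integral_nonneg fun _ => sq_nonneg _
  rw [integral_add i1.integrableOn i2.integrableOn]
  have c : 0 ≤ d⁻¹ + ε⁻¹ := by positivity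
  have := mul_le_mul_of_nonneg_left m0 c
  have := mul_le_mul_of_nonneg_left m1 hε.le
  nlinarith

lemma side_le_energy_add_mass (hd : 0 < d) (hf : ContDiff ℝ ∞ f) (hc : HasCompactSupport f) :
    ∫ r in Ici d, ‖f (d, r)‖ ^ 2
      ≤ (∫ p in halfStrip d, (‖pd₁ f p‖ ^ 2 + ‖pd₂ f p‖ ^ 2))
        + (d⁻¹ + 1) * ∫ p in halfStrip d, ‖f p‖ ^ 2 := by
  have h := trace_outerStrip hd hf hc
  have i0 := integrable_norm_sq (μ := volume) hf.continuous hc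
  have i1 := integrable_norm_sq (μ := volume) (continuous_pd₁ hf) (hasCompactSupport_pd₁ hc)
  have i2 := integrable_norm_sq (μ := volume) (continuous_pd₂ hf) (hasCompactSupport_pd₂ hc)
  have m0 : ∫ p in outerStrip d, ‖f p‖ ^ 2 ≤ ∫ p in halfStrip d, ‖f p‖ ^ 2 :=
    setIntegral_mono_set i0.integrableOn (ae_of_all _ fun _ => sq_nonneg _)
      outerStrip_subset_halfStrip.eventuallyLE
  have m1 : ∫ p in outerStrip d, ‖pd₁ f p‖ ^ 2 ≤ ∫ p in halfStrip d, ‖pd₁ f p‖ ^ 2 :=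
    setIntegral_mono_set i1.integrableOn (ae_of_all _ fun _ => sq_nonneg _)
      outerStrip_subset_halfStrip.eventuallyLE
  have n1 : 0 ≤ ∫ p in halfStrip d, ‖pd₂ f p‖ ^ 2 := integral_nonneg fun _ => sq_nonneg _
  rw [integral_add i1.integrableOn i2.integrableOn]
  have c : 0 ≤ d⁻¹ + 1 := by positivity
  have := mul_le_mul_of_nonneg_left m0 c
  nlinarith

set_option maxHeartbeats 800000 in
/-- Below the threshold of the outer strip, the energy controls the mass and any multiple of the
bottom values, up to the values on the Dirichlet side and finitely many local means. -/
lemma halfStrip_add_bottom_le (hd : 0 < d) {K M : ℝ} (hK : 0 ≤ K) (hKd : K * d < Real.pi)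
    (hM : 0 ≤ M) :
    ∃ (N : ℕ) (C : ℝ), 0 < N ∧ 0 ≤ C ∧ ∀ f : ℝ × ℝ → ℂ, ContDiff ℝ ∞ f → HasCompactSupport f →
      (∀ r, f (0, r) = 0) →
      K ^ 2 * (∫ p in halfStrip d, ‖f p‖ ^ 2) + M * (∫ s in Icc 0 d, ‖f (s, s)‖ ^ 2)
        ≤ (∫ p in halfStrip d, (‖pd₁ f p‖ ^ 2 + ‖pd₂ f p‖ ^ 2))
          + C * (∫ r in Ici d, ‖f (d, r)‖ ^ 2)
          + C * ∑ i ∈ Finset.range N, ∑ j ∈ Finset.range N,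
            ‖∫ p in shearedSquare (i * (d / N)) (j * (d / N)) (d / N), f p‖ ^ 2 := by
  -- the energy on the outer strip gets the weight `θ`, the one on the square the weight `1 - θ`
  obtain ⟨k, hKk, hkπ⟩ := exists_between ((lt_div_iff₀ hd).2 hKd)
  have hk : 0 < k := hK.trans_lt hKk
  have hkd : k * d < Real.pi := (lt_div_iff₀ hd).1 hkπ
  set θ := K ^ 2 / k ^ 2 with hθ
  have hθk : θ * k ^ 2 = K ^ 2 := by rw [hθ]; field_simp
  have hθ0 : 0 ≤ θ := by positivity
  have hθ1 : θ < 1 := by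
    rw [hθ, div_lt_one (by positivity)]
    exact pow_lt_pow_left₀ hKk hK (by norm_num)
  set ε := (1 - θ) / (2 * (M + 1)) with hε
  have hε0 : 0 < ε := div_pos (by linarith) (by positivity)
  have hMε : M * ε ≤ (1 - θ) / 2 := by
    rw [hε, ← mul_div_assoc, div_le_div_iff₀ (by positivity) (by positivity)]
    nlinarith
  set L := K ^ 2 + M * (d⁻¹ + ε⁻¹) with hL
  have hL0 : 0 ≤ L := by positivity
  obtain ⟨N, hN⟩ := exists_nat_gt (6 * L / ((1 - θ) * (Real.pi / d) ^ 2) + 1)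
  have hq0 : 0 ≤ 6 * L / ((1 - θ) * (Real.pi / d) ^ 2) := by
    have : 0 < 1 - θ := by linarith
    positivity
  have hN1 : (1 : ℝ) ≤ N := by linarith
  have hN0 : 0 < N := by
    have : (0 : ℝ) < N := by linarith
    exact_mod_cast this
  set A := (Real.pi / (d / N)) ^ 2 with hA
  have hAL : L ≤ A * (1 - θ) / 6 := by
    have hp : 0 < (1 - θ) * (Real.pi / d) ^ 2 := mul_pos (by linarith) (by positivity)
    have h1 : 6 * L / ((1 - θ) * (Real.pi / d) ^ 2) ≤ N ^ 2 := by nlinarith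
    rw [div_le_iff₀ hp] at h1
    have h2 : A = N ^ 2 * (Real.pi / d) ^ 2 := by rw [hA]; field_simp
    rw [h2]
    nlinarith
  have ht : 0 ≤ k * Real.tan (k * (d / 2)) := by
    refine mul_nonneg hk.le (Real.tan_nonneg_of_nonneg_of_le_pi_div_two (by positivity) ?_)
    nlinarith
  have hC2 : 0 ≤ A * (d / N)⁻¹ ^ 2 := by positivity
  refine ⟨N, k * Real.tan (k * (d / 2)) + A * (d / N)⁻¹ ^ 2, hN0, add_nonneg ht hC2, ?_⟩
  intro f hf hc h0
  have h1 := friedrichs_outerStrip hd hf hc h0 hk.le hkd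
  have h2 := poincare_mesh hd hf hc hN0
  have h3 := trace_shearedSquare hd hf hc hε0
  have i0 := integrable_norm_sq (μ := volume) hf.continuous hc
  have i1 := integrable_norm_sq (μ := volume) (continuous_pd₁ hf) (hasCompactSupport_pd₁ hc)
  have i2 := integrable_norm_sq (μ := volume) (continuous_pd₂ hf) (hasCompactSupport_pd₂ hc)
  have i12 : Integrable fun p => ‖pd₁ f p‖ ^ 2 + ‖pd₂ f p‖ ^ 2 := i1.fun_add i2
  have hnn : ∀ p, 0 ≤ ‖pd₁ f p‖ ^ 2 + ‖pd₂ f p‖ ^ 2 := fun p => by positivity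
  rw [setIntegral_halfStrip_eq_add i0]
  set S := ∑ i ∈ Finset.range N, ∑ j ∈ Finset.range N,
    ‖∫ p in shearedSquare (i * (d / N)) (j * (d / N)) (d / N), f p‖ ^ 2
  have hS : 0 ≤ S := Finset.sum_nonneg fun _ _ => Finset.sum_nonneg fun _ _ => sq_nonneg _
  have mT : ∫ p in tipTriangle d, ‖f p‖ ^ 2 ≤ ∫ p in shearedSquare 0 0 d, ‖f p‖ ^ 2 :=
    setIntegral_mono_set i0.integrableOn (ae_of_all _ fun _ => sq_nonneg _)
      tipTriangle_subset_shearedSquare.eventuallyLE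
  have m2 : ∫ p in shearedSquare 0 0 d, ‖pd₂ f p‖ ^ 2
      ≤ ∫ p in shearedSquare 0 0 d, (‖pd₁ f p‖ ^ 2 + ‖pd₂ f p‖ ^ 2) :=
    integral_mono i2.integrableOn i12.integrableOn fun p => by
      have := sq_nonneg ‖pd₁ f p‖
      simp only
      linarith
  have m1 : ∫ p in outerStrip d, ‖pd₁ f p‖ ^ 2
      ≤ ∫ p in halfStrip d, (‖pd₁ f p‖ ^ 2 + ‖pd₂ f p‖ ^ 2) :=
    (integral_mono i1.integrableOn i12.integrableOn fun p => by
      have := sq_nonneg ‖pd₂ f p‖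
      simp only
      linarith).trans (setIntegral_mono_set i12.integrableOn (ae_of_all _ hnn)
        outerStrip_subset_halfStrip.eventuallyLE)
  have m3 : ∫ p in shearedSquare 0 0 d, (‖pd₁ f p‖ ^ 2 + ‖pd₂ f p‖ ^ 2)
      ≤ ∫ p in halfStrip d, (‖pd₁ f p‖ ^ 2 + ‖pd₂ f p‖ ^ 2) :=
    setIntegral_mono_set i12.integrableOn (ae_of_all _ hnn)
        shearedSquare_subset_halfStrip.eventuallyLE
  have n0 : 0 ≤ ∫ p in shearedSquare 0 0 d, ‖f p‖ ^ 2 := integral_nonneg fun _ => sq_nonneg _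
  have n1 : 0 ≤ ∫ p in shearedSquare 0 0 d, (‖pd₁ f p‖ ^ 2 + ‖pd₂ f p‖ ^ 2) :=
    integral_nonneg hnn
  have n3 : 0 ≤ ∫ r in Ici d, ‖f (d, r)‖ ^ 2 := integral_nonneg fun _ => sq_nonneg _
  set NT := ∫ p in tipTriangle d, ‖f p‖ ^ 2
  set NO := ∫ p in outerStrip d, ‖f p‖ ^ 2
  set NS := ∫ p in shearedSquare 0 0 d, ‖f p‖ ^ 2
  set DS := ∫ p in shearedSquare 0 0 d, (‖pd₁ f p‖ ^ 2 + ‖pd₂ f p‖ ^ 2)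
  set DH := ∫ p in halfStrip d, (‖pd₁ f p‖ ^ 2 + ‖pd₂ f p‖ ^ 2)
  set DO := ∫ p in outerStrip d, ‖pd₁ f p‖ ^ 2
  set D2 := ∫ p in shearedSquare 0 0 d, ‖pd₂ f p‖ ^ 2
  set B := ∫ s in Icc 0 d, ‖f (s, s)‖ ^ 2
  set Dt := ∫ r in Ici d, ‖f (d, r)‖ ^ 2
  set τ := k * Real.tan (k * (d / 2))
  set q := (d / N : ℝ)⁻¹ ^ 2
  -- outer part
  have e1 : K ^ 2 * NO ≤ θ * DH + τ * Dt := by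
    have := mul_le_mul_of_nonneg_left h1 hθ0
    have := mul_le_mul_of_nonneg_left m1 hθ0
    have := mul_le_mul_of_nonneg_right hθ1.le (mul_nonneg ht n3)
    rw [← hθk]
    linarith
  -- square part
  have e2 : M * B ≤ M * (d⁻¹ + ε⁻¹) * NS + (1 - θ) / 2 * DS := by
    have a1 := mul_le_mul_of_nonneg_left h3 hM
    have a2 := mul_le_mul_of_nonneg_left m2 (mul_nonneg hM hε0.le)
    have a3 := mul_le_mul_of_nonneg_right hMε n1
    linarith
  have e3 : L * NS ≤ (1 - θ) / 2 * DS + A * q * S := by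
    have a1 := mul_le_mul_of_nonneg_right hAL n0
    rw [← hA] at h2
    have a2 := mul_le_mul_of_nonneg_left h2 (by linarith : 0 ≤ (1 - θ) / 6)
    have a3 := mul_le_mul_of_nonneg_right (by linarith : (1 - θ) / 6 ≤ 1) (mul_nonneg hC2 hS)
    linarith
  have e4 : (1 - θ) * DS ≤ (1 - θ) * DH := mul_le_mul_of_nonneg_left m3 (by linarith)
  have e5 := mul_le_mul_of_nonneg_left mT (sq_nonneg K)
  have e6 := mul_nonneg ht hS
  have e7 := mul_nonneg hC2 n3
  rw [hL] at e3
  linarith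

end FormInequalities

/-! ### Form inequalities in the original coordinates -/

section Transfer

variable {u : ℝ × ℝ → ℂ} {d : ℝ}

/-- The integral of `|u|²` over the pencil. -/
def mass (d : ℝ) (u : ℝ × ℝ → ℂ) : ℝ := ∫ p in pencil d, ‖u p‖ ^ 2

/-- The Dirichlet integral of `u` over the pencil. -/
def energy (d : ℝ) (u : ℝ × ℝ → ℂ) : ℝ := ∫ p in pencil d, (‖pd₁ u p‖ ^ 2 + ‖pd₂ u p‖ ^ 2)

/-- The integral of `|u|²` over the boundary piece `(y, 0)`, `0 ≤ y ≤ d`. -/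
def bottomMass (d : ℝ) (u : ℝ × ℝ → ℂ) : ℝ := ∫ y in Icc 0 d, ‖u (y, 0)‖ ^ 2

/-- The integral of `|u|²` over the boundary piece `(t + d, t)`, `0 ≤ t`. -/
def sideMass (d : ℝ) (u : ℝ × ℝ → ℂ) : ℝ := ∫ t in Ici (0 : ℝ), ‖u (t + d, t)‖ ^ 2

lemma pd₁_of_antisymm (hu : ContDiff ℝ ∞ u) (ha : ∀ p, u p.swap = -u p) (p : ℝ × ℝ) :
    pd₁ u p.swap = -pd₂ u p := by
  rw [← pd₂_swap hu]
  simp only [ha]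
  rw [pd₂, pd₂, fderiv_fun_neg]
  rfl

lemma pd₂_of_antisymm (hu : ContDiff ℝ ∞ u) (ha : ∀ p, u p.swap = -u p) (p : ℝ × ℝ) :
    pd₂ u p.swap = -pd₁ u p := by
  rw [← pd₁_swap hu]
  simp only [ha]
  rw [pd₁, pd₁, fderiv_fun_neg]
  rfl

lemma integrable_energy (hu : ContDiff ℝ ∞ u) (hc : HasCompactSupport u) :
    Integrable fun p => ‖pd₁ u p‖ ^ 2 + ‖pd₂ u p‖ ^ 2 :=
  (integrable_norm_sq (μ := volume) (continuous_pd₁ hu) (hasCompactSupport_pd₁ hc)).fun_add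
    (integrable_norm_sq (μ := volume) (continuous_pd₂ hu) (hasCompactSupport_pd₂ hc))

lemma mass_nonneg : 0 ≤ mass d u := integral_nonneg fun _ => sq_nonneg _

lemma energy_nonneg : 0 ≤ energy d u := integral_nonneg fun _ => by positivity

lemma mass_eq (hu : ContDiff ℝ ∞ u) (hc : HasCompactSupport u) (ha : ∀ p, u p.swap = -u p) :
    mass d u = ∫ p in halfStrip d, ‖u (rotCLM p)‖ ^ 2 :=
  setIntegral_pencil_of_symm (integrable_norm_sq hu.continuous hc) fun p => by rw [ha, norm_neg]

lemma energy_eq (hu : ContDiff ℝ ∞ u) (hc : HasCompactSupport u) (ha : ∀ p, u p.swap = -u p) :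
    energy d u = 2 * ∫ p in halfStrip d, (‖pd₁ (fun p => u (rotCLM p)) p‖ ^ 2
      + ‖pd₂ (fun p => u (rotCLM p)) p‖ ^ 2) := by
  simp only [norm_pd_rot_sq hu]
  rw [integral_const_mul, energy, setIntegral_pencil_of_symm (integrable_energy hu hc)]
  · ring
  · intro p
    rw [pd₁_of_antisymm hu ha, pd₂_of_antisymm hu ha, norm_neg, norm_neg, add_comm]

lemma mass_ge (hu : ContDiff ℝ ∞ u) (hc : HasCompactSupport u) :
    ∫ p in halfStrip d, ‖u (rotCLM p)‖ ^ 2 ≤ 2 * mass d u :=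
  setIntegral_halfStrip_le (integrable_norm_sq hu.continuous hc) fun _ => sq_nonneg _

lemma energy_ge (hu : ContDiff ℝ ∞ u) (hc : HasCompactSupport u) :
    ∫ p in halfStrip d, (‖pd₁ (fun p => u (rotCLM p)) p‖ ^ 2
      + ‖pd₂ (fun p => u (rotCLM p)) p‖ ^ 2) ≤ energy d u := by
  simp only [norm_pd_rot_sq hu]
  rw [integral_const_mul]
  have h := setIntegral_halfStrip_le (d := d) (integrable_energy hu hc) fun _ => by positivity
  rw [energy]
  linarith

lemma bottomMass_eq : bottomMass d u = ∫ s in Icc 0 d, ‖u (rotCLM (s, s))‖ ^ 2 := by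
  refine integral_congr_ae (ae_of_all _ fun s => ?_)
  have : rotCLM (s, s) = (s, 0) := by
    ext
    · simp
      ring
    · simp
  simp only [this]

lemma setIntegral_side {E : Type*} [NormedAddCommGroup E] [NormedSpace ℝ E] (G : ℝ × ℝ → E) :
    ∫ r in Ici d, G (d, r) = (2 : ℝ) • ∫ t in Ici (0 : ℝ), G (d, 2 * t + d) := by
  have h := integral_comp_mul_left_Ioi (fun r => G (d, r + d)) 0 (by norm_num : (0 : ℝ) < 2)
  have h3 : ∫ r in Ioi (0 : ℝ), G (d, r + d) = ∫ r in Ioi d, G (d, r) := by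
    have := (measurePreserving_add_right (volume : Measure ℝ) d).setIntegral_preimage_emb
      (measurableEmbedding_addRight d) (fun r => G (d, r)) (Ioi d)
    rw [← this]
    congr 2
    ext r
    simp
  rw [integral_Ici_eq_integral_Ioi, integral_Ici_eq_integral_Ioi, ← h3, h, smul_smul]
  simp

lemma rotCLM_side (t : ℝ) : rotCLM (d, 2 * t + d) = (t + d, t) := by
  ext
  · simp
    ring
  · simp

lemma sideMass_eq : ∫ r in Ici d, ‖u (rotCLM (d, r))‖ ^ 2 = 2 * sideMass d u := by
  rw [setIntegral_side fun p => ‖u (rotCLM p)‖ ^ 2]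
  simp only [rotCLM_side]
  rfl

lemma antisymm_zero (ha : ∀ p, u p.swap = -u p) (r : ℝ) : u (rotCLM (0, r)) = 0 := by
  have h := ha (rotCLM (0, r))
  have e : (rotCLM (0, r)).swap = rotCLM (0, r) := by simp
  rw [e] at h
  exact self_eq_neg.1 h

lemma norm_setIntegral_rot {S : Set (ℝ × ℝ)} (hS : MeasurableSet S) :
    ‖∫ p in S, u (rotCLM p)‖ ^ 2 = 4 * ‖∫ p in rotCLM '' S, u p‖ ^ 2 := by
  rw [setIntegral_rotCLM_image hS, norm_smul, mul_pow]
  norm_num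
  ring

lemma measurableSet_rotCLM_image {S : Set (ℝ × ℝ)} (hS : MeasurableSet S) :
    MeasurableSet (rotCLM '' S) := by
  rw [rotCLM_image_eq]
  exact hS.preimage continuous_rotInv.measurable

/-- An antisymmetric function vanishes on the diagonal, while the side `s = d` is free here; this
accounts for the width `2 d`. -/
lemma mass_le_energy (hd : 0 < d) (hu : ContDiff ℝ ∞ u) (hc : HasCompactSupport u)
    (ha : ∀ p, u p.swap = -u p) :
    2 * (Real.pi / (2 * d)) ^ 2 * mass d u ≤ energy d u := by
  have h := friedrichs_halfStrip hd (contDiff_rot hu) (hasCompactSupport_rot hc)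
    (antisymm_zero ha)
  rw [mass_eq hu hc ha, energy_eq hu hc ha]
  have i1 := integrable_norm_sq (μ := volume) (continuous_pd₁ (contDiff_rot hu))
    (hasCompactSupport_pd₁ (hasCompactSupport_rot hc))
  have i2 := integrable_norm_sq (μ := volume) (continuous_pd₂ (contDiff_rot hu))
    (hasCompactSupport_pd₂ (hasCompactSupport_rot hc))
  rw [integral_add i1.integrableOn i2.integrableOn]
  have : 0 ≤ ∫ p in halfStrip d, ‖pd₂ (fun p => u (rotCLM p)) p‖ ^ 2 :=
    integral_nonneg fun _ => sq_nonneg _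
  linarith

/-- The inequality behind the uniqueness of the bound state: up to the side term, which vanishes on
the form domain, a single mean value suffices for every constant below the threshold. -/
lemma mass_le_energy_add_mean (hd : 0 < d) {k : ℝ} (hk : 0 ≤ k) (hkd : k * d < Real.pi) :
    ∃ C : ℝ, 0 ≤ C ∧ ∀ u : ℝ × ℝ → ℂ, ContDiff ℝ ∞ u → HasCompactSupport u →
      (∀ p, u p.swap = -u p) →
      2 * k ^ 2 * mass d u ≤ energy d u + C * sideMass d u
        + C * ‖∫ p in rotCLM '' tipTriangle d, u p‖ ^ 2 := by
  obtain ⟨C, hC, h⟩ := halfStrip_le_energy_add_mean hd hk hkd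
  refine ⟨8 * C, by positivity, fun u hu hc ha => ?_⟩
  have h := h _ (contDiff_rot hu) (hasCompactSupport_rot hc) (antisymm_zero ha)
  rw [sideMass_eq, norm_setIntegral_rot (measurableSet_tipTriangle d)] at h
  rw [mass_eq hu hc ha, energy_eq hu hc ha]
  have : 0 ≤ C * sideMass d u := mul_nonneg hC (integral_nonneg fun _ => sq_nonneg _)
  linarith

/-- The inequality behind the essential spectrum: the interaction on the bottom edge, however strong,
is compensated by finitely many mean values. -/
lemma mass_add_bottom_le (hd : 0 < d) {K M : ℝ} (hK : 0 ≤ K) (hKd : K * d < Real.pi)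
    (hM : 0 ≤ M) :
    ∃ (n : ℕ) (S : Fin n → Set (ℝ × ℝ)) (C : ℝ), (∀ i, MeasurableSet (S i) ∧ S i ⊆ pencil d
      ∧ volume (S i) ≠ ⊤) ∧ 0 ≤ C ∧
      ∀ u : ℝ × ℝ → ℂ, ContDiff ℝ ∞ u → HasCompactSupport u → (∀ p, u p.swap = -u p) →
      2 * K ^ 2 * mass d u + M * bottomMass d u ≤ energy d u + C * sideMass d u
        + C * ∑ i, ‖∫ p in S i, u p‖ ^ 2 := by
  obtain ⟨N, C, hN, hC, h⟩ := halfStrip_add_bottom_le hd hK hKd (by linarith : 0 ≤ M / 2)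
  have hN' : (0 : ℝ) < N := by exact_mod_cast hN
  let S : Fin N × Fin N → Set (ℝ × ℝ) := fun q =>
    rotCLM '' shearedSquare (q.1 * (d / N)) (q.2 * (d / N)) (d / N)
  have hsub : ∀ q, shearedSquare ((q : Fin N × Fin N).1 * (d / N)) (q.2 * (d / N)) (d / N)
      ⊆ halfStrip d ∩ (Icc 0 d ×ˢ Icc 0 (2 * d)) := by
    rintro ⟨i, j⟩ p ⟨⟨h1, h2⟩, h3, h4⟩
    have hh : 0 < d / N := by positivity
    have hi : ((i : ℕ) : ℝ) + 1 ≤ N := by exact_mod_cast i.2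
    have hj : ((j : ℕ) : ℝ) + 1 ≤ N := by exact_mod_cast j.2
    have hi' : ((i : ℕ) : ℝ) * (d / N) + d / N ≤ d := by
      calc ((i : ℕ) : ℝ) * (d / N) + d / N = (((i : ℕ) : ℝ) + 1) * (d / N) := by ring
        _ ≤ N * (d / N) := by gcongr
        _ = d := by field_simp
    have hj' : ((j : ℕ) : ℝ) * (d / N) + d / N ≤ d := by
      calc ((j : ℕ) : ℝ) * (d / N) + d / N = (((j : ℕ) : ℝ) + 1) * (d / N) := by ring
        _ ≤ N * (d / N) := by gcongr
        _ = d := by field_simp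
    have hi0 : 0 ≤ ((i : ℕ) : ℝ) * (d / N) := by positivity
    have hj0 : 0 ≤ ((j : ℕ) : ℝ) * (d / N) := by positivity
    simp only at h1 h2 h3 h4
    exact ⟨⟨by linarith, by linarith, by linarith⟩, ⟨by linarith, by linarith⟩,
      ⟨by linarith, by linarith⟩⟩
  refine ⟨N * N, fun i => S (finProdFinEquiv.symm i), 8 * C, fun i => ⟨?_, ?_, ?_⟩, by positivity,
    fun u hu hc ha => ?_⟩
  · exact measurableSet_rotCLM_image (measurableSet_shearedSquare _ _ _)
  · refine (image_mono ((hsub _).trans inter_subset_left)).trans ?_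
    rw [rotCLM_image_halfStrip]
    exact lowerPencil_subset d
  · refine ((measure_mono (image_mono ((hsub _).trans inter_subset_right))).trans_lt
      ((isCompact_Icc.prod isCompact_Icc).image rotCLM.continuous).measure_lt_top).ne
  · have h := h _ (contDiff_rot hu) (hasCompactSupport_rot hc) (antisymm_zero ha)
    rw [sideMass_eq, ← bottomMass_eq] at h
    simp only [norm_setIntegral_rot (measurableSet_shearedSquare _ _ _)] at h
    have e : ∑ i, ‖∫ p in S (finProdFinEquiv.symm i), u p‖ ^ 2
        = ∑ i ∈ Finset.range N, ∑ j ∈ Finset.range N,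
        ‖∫ p in rotCLM '' shearedSquare (i * (d / N)) (j * (d / N)) (d / N), u p‖ ^ 2 := by
      rw [Equiv.sum_comp finProdFinEquiv.symm (fun q => ‖∫ p in S q, u p‖ ^ 2),
        Fintype.sum_prod_type]
      simp only [Finset.sum_range]
      rfl
    simp only [e, ← Finset.mul_sum] at h ⊢
    rw [mass_eq hu hc ha, energy_eq hu hc ha]
    have : 0 ≤ C * sideMass d u := mul_nonneg hC (integral_nonneg fun _ => sq_nonneg _)
    linarith

lemma bottomMass_le (hd : 0 < d) {ε : ℝ} (hε : 0 < ε) (hu : ContDiff ℝ ∞ u)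
    (hc : HasCompactSupport u) :
    bottomMass d u ≤ ε * energy d u + 2 * (d⁻¹ + ε⁻¹) * mass d u := by
  have h := bottom_le_energy_add_mass hd hε (contDiff_rot hu) (hasCompactSupport_rot hc)
  rw [← bottomMass_eq] at h
  have h1 := mul_le_mul_of_nonneg_left (energy_ge (d := d) hu hc) hε.le
  have h2 := mul_le_mul_of_nonneg_left (mass_ge (d := d) hu hc)
    (by positivity : 0 ≤ d⁻¹ + ε⁻¹)
  linarith

lemma sideMass_le (hd : 0 < d) (hu : ContDiff ℝ ∞ u) (hc : HasCompactSupport u) :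
    sideMass d u ≤ energy d u + (d⁻¹ + 1) * mass d u := by
  have h := side_le_energy_add_mass hd (contDiff_rot hu) (hasCompactSupport_rot hc)
  rw [sideMass_eq] at h
  have h1 := energy_ge (d := d) hu hc
  have h2 := mul_le_mul_of_nonneg_left (mass_ge (d := d) hu hc)
    (by positivity : 0 ≤ d⁻¹ + 1)
  have : 0 ≤ energy d u := energy_nonneg
  linarith

lemma swap_preimage_pencil : Prod.swap ⁻¹' pencil d = pencil d := by
  ext p
  simp only [pencil, mem_preimage, mem_ofPred_eq, Prod.fst_swap, Prod.snd_swap]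
  rw [abs_sub_comm]
  tauto

lemma mass_swap : mass d (fun p => u p.swap) = mass d u := by
  have h := setIntegral_swap (pencil d) (fun p => ‖u p‖ ^ 2)
  rw [swap_preimage_pencil] at h
  exact h

lemma energy_swap (hu : ContDiff ℝ ∞ u) : energy d (fun p => u p.swap) = energy d u := by
  have h := setIntegral_swap (pencil d) (fun p => ‖pd₁ u p‖ ^ 2 + ‖pd₂ u p‖ ^ 2)
  rw [swap_preimage_pencil] at h
  rw [energy, energy, ← h]
  simp only [pd₁_swap hu, pd₂_swap hu]
  refine integral_congr_ae (ae_of_all _ fun p => ?_)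
  simp only
  ring

end Transfer

/-! ### The space of functions with their derivatives and boundary values -/

section Lebesgue

variable {α : Type*} [MeasurableSpace α] {μ : Measure α}

open Classical in
/-- The class of `g` in `L²`, and zero if `g` is not square integrable. -/
def toL2 (μ : Measure α) (g : α → ℂ) : Lp ℂ 2 μ := if h : MemLp g 2 μ then h.toLp g else 0

lemma coeFn_toL2 {g : α → ℂ} (h : MemLp g 2 μ) : toL2 μ g =ᵐ[μ] g := by
  rw [toL2, dif_pos h]
  exact h.coeFn_toLp

lemma eq_toL2 {φ : Lp ℂ 2 μ} {g : α → ℂ} (h : φ =ᵐ[μ] g) : φ = toL2 μ g := by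
  have hg : MemLp g 2 μ := (memLp_congr_ae h).1 (Lp.memLp φ)
  exact Lp.ext (h.trans (coeFn_toL2 hg).symm)

lemma norm_sq_eq_integral (φ : Lp ℂ 2 μ) : ‖φ‖ ^ 2 = ∫ x, ‖φ x‖ ^ 2 ∂μ := by
  have h := L2.inner_def (𝕜 := ℂ) φ φ
  rw [inner_self_eq_norm_sq_to_K] at h
  have e : (fun x => inner ℂ (φ x) (φ x)) = fun x => ((‖φ x‖ ^ 2 : ℝ) : ℂ) := by
    ext x
    rw [inner_self_eq_norm_sq_to_K]
    push_cast
    rfl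
  rw [e, integral_complex_ofReal] at h
  have h' : ((‖φ‖ ^ 2 : ℝ) : ℂ) = ((∫ x, ‖φ x‖ ^ 2 ∂μ : ℝ) : ℂ) := by
    rw [← h]; push_cast; rfl
  exact_mod_cast h'

lemma norm_sq_eq_of_ae {φ : Lp ℂ 2 μ} {g : α → ℂ} (h : φ =ᵐ[μ] g) :
    ‖φ‖ ^ 2 = ∫ x, ‖g x‖ ^ 2 ∂μ := by
  rw [norm_sq_eq_integral]
  refine integral_congr_ae ?_
  filter_upwards [h] with x hx
  rw [hx]

lemma toL2_sub {f g : α → ℂ} (hf : MemLp f 2 μ) (hg : MemLp g 2 μ) :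
    toL2 μ (fun x => f x - g x) = toL2 μ f - toL2 μ g := by
  symm
  refine eq_toL2 ?_
  filter_upwards [Lp.coeFn_sub (toL2 μ f) (toL2 μ g), coeFn_toL2 hf, coeFn_toL2 hg] with x h1 h2 h3
  rw [h1, Pi.sub_apply, h2, h3]

lemma toL2_const_mul {f : α → ℂ} (c : ℂ) (hf : MemLp f 2 μ) :
    toL2 μ (fun x => c * f x) = c • toL2 μ f := by
  symm
  refine eq_toL2 ?_
  filter_upwards [Lp.coeFn_smul c (toL2 μ f), coeFn_toL2 hf] with x h1 h2
  rw [h1, Pi.smul_apply, h2, smul_eq_mul]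

/-- Convergence in `L²` of classes of functions, in terms of the functions. -/
lemma tendsto_toL2_iff {u : ℕ → α → ℂ} {φ : Lp ℂ 2 μ} {g : α → ℂ} (hu : ∀ n, MemLp (u n) 2 μ)
    (hg : φ =ᵐ[μ] g) :
    Tendsto (fun n => toL2 μ (u n)) atTop (𝓝 φ) ↔
      Tendsto (fun n => eLpNorm (fun x => u n x - g x) 2 μ) atTop (𝓝 0) := by
  rw [Lp.tendsto_Lp_iff_tendsto_eLpNorm']
  refine tendsto_congr fun n => eLpNorm_congr_ae ?_
  filter_upwards [coeFn_toL2 (hu n), hg] with x h1 h2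
  rw [Pi.sub_apply, h1, h2]

end Lebesgue

section FormSpace

variable {d : ℝ}

/-- The `L²` space of the boundary piece `0 ≤ y ≤ d`. -/
abbrev BottomL2 (d : ℝ) : Type := Lp ℂ 2 ((volume : Measure ℝ).restrict (Icc 0 d))

/-- The `L²` space of the boundary half-line. -/
abbrev SideL2 : Type := Lp ℂ 2 ((volume : Measure ℝ).restrict (Ici 0))

/-- Pairs of boundary values on the bottom side and on the half-line `x - y = d`. -/
abbrev BoundaryPairs (d : ℝ) : Type := WithLp 2 (BottomL2 d × SideL2)

/-- Pairs of a function and boundary values. -/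
abbrev BoundaryTriples (d : ℝ) : Type := WithLp 2 (PencilL2 d × BoundaryPairs d)

/-- Pairs of functions together with boundary values. -/
abbrev BoundaryQuadruples (d : ℝ) : Type := WithLp 2 (PencilL2 d × BoundaryTriples d)

/-- Tuples of an antisymmetric function, its two partial derivatives, and its boundary values on
the bottom side and on the half-line `x - y = d`. -/
def TupleSpace (d : ℝ) : Type := WithLp 2 (antisymmetricL2 d × BoundaryQuadruples d)

instance : NormedAddCommGroup (TupleSpace d) :=
  inferInstanceAs (NormedAddCommGroup (WithLp 2 (antisymmetricL2 d × BoundaryQuadruples d)))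

instance : InnerProductSpace ℂ (TupleSpace d) :=
  inferInstanceAs (InnerProductSpace ℂ (WithLp 2 (antisymmetricL2 d × BoundaryQuadruples d)))

instance : CompleteSpace (TupleSpace d) :=
  inferInstanceAs (CompleteSpace (WithLp 2 (antisymmetricL2 d × BoundaryQuadruples d)))

/-- The function of a tuple. -/
def tupleFun (d : ℝ) : TupleSpace d →L[ℂ] antisymmetricL2 d :=
  WithLp.fstL 2 ℂ (antisymmetricL2 d) (BoundaryQuadruples d)

/-- All entries of a tuple but the function. -/
def tupleTail (d : ℝ) : TupleSpace d →L[ℂ] BoundaryQuadruples d :=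
  WithLp.sndL 2 ℂ (antisymmetricL2 d) (BoundaryQuadruples d)

/-- The first partial derivative of a tuple. -/
def tupleD₁ (d : ℝ) : TupleSpace d →L[ℂ] PencilL2 d :=
  (WithLp.fstL 2 ℂ (PencilL2 d) (BoundaryTriples d)).comp (tupleTail d)

/-- The last three entries of a tuple. -/
def tupleTail₂ (d : ℝ) : TupleSpace d →L[ℂ] BoundaryTriples d :=
  (WithLp.sndL 2 ℂ (PencilL2 d) (BoundaryTriples d)).comp (tupleTail d)

/-- The second partial derivative of a tuple. -/
def tupleD₂ (d : ℝ) : TupleSpace d →L[ℂ] PencilL2 d :=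
  (WithLp.fstL 2 ℂ (PencilL2 d) (BoundaryPairs d)).comp (tupleTail₂ d)

/-- The boundary values of a tuple. -/
def tupleTail₃ (d : ℝ) : TupleSpace d →L[ℂ] BoundaryPairs d :=
  (WithLp.sndL 2 ℂ (PencilL2 d) (BoundaryPairs d)).comp (tupleTail₂ d)

/-- The boundary values on the bottom side of a tuple. -/
def tupleBottom (d : ℝ) : TupleSpace d →L[ℂ] BottomL2 d :=
  (WithLp.fstL 2 ℂ (BottomL2 d) SideL2).comp (tupleTail₃ d)

/-- The boundary values on the half-line `x - y = d` of a tuple. -/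
def tupleSide (d : ℝ) : TupleSpace d →L[ℂ] SideL2 :=
  (WithLp.sndL 2 ℂ (BottomL2 d) SideL2).comp (tupleTail₃ d)

/-- The tuple with given entries. -/
def mkTuple (a : antisymmetricL2 d) (b c : PencilL2 d) (e : BottomL2 d) (f : SideL2) :
    TupleSpace d :=
  WithLp.toLp 2 (a, WithLp.toLp 2 (b, WithLp.toLp 2 (c, WithLp.toLp 2 (e, f))))

section

variable (a : antisymmetricL2 d) (b c : PencilL2 d) (e : BottomL2 d) (f : SideL2)


end

lemma norm_sq_tuple (w : TupleSpace d) :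
    ‖w‖ ^ 2 = ‖tupleFun d w‖ ^ 2 + (‖tupleD₁ d w‖ ^ 2 + (‖tupleD₂ d w‖ ^ 2 +
      (‖tupleBottom d w‖ ^ 2 + ‖tupleSide d w‖ ^ 2))) := by
  have h1 : ‖w‖ ^ 2 = ‖tupleFun d w‖ ^ 2 + ‖tupleTail d w‖ ^ 2 :=
    WithLp.prod_norm_sq_eq_of_L2 (α := antisymmetricL2 d) (β := BoundaryQuadruples d) w
  have h2 : ‖tupleTail d w‖ ^ 2 = ‖tupleD₁ d w‖ ^ 2 + ‖tupleTail₂ d w‖ ^ 2 :=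
    WithLp.prod_norm_sq_eq_of_L2 (tupleTail d w)
  have h3 : ‖tupleTail₂ d w‖ ^ 2 = ‖tupleD₂ d w‖ ^ 2 + ‖tupleTail₃ d w‖ ^ 2 :=
    WithLp.prod_norm_sq_eq_of_L2 (tupleTail₂ d w)
  have h4 : ‖tupleTail₃ d w‖ ^ 2 = ‖tupleBottom d w‖ ^ 2 + ‖tupleSide d w‖ ^ 2 :=
    WithLp.prod_norm_sq_eq_of_L2 (tupleTail₃ d w)
  rw [h1, h2, h3, h4]

/-- `w` is the tuple of the antisymmetric test function `u`. -/
structure IsTupleOf (w : TupleSpace d) (u : ℝ × ℝ → ℂ) : Prop where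
  contDiff : ContDiff ℝ ∞ u
  hasCompactSupport : HasCompactSupport u
  antisymm : ∀ p, u p.swap = -u p
  fun_ae : (tupleFun d w : PencilL2 d) =ᵐ[pencilMeasure d] u
  d₁_ae : tupleD₁ d w =ᵐ[pencilMeasure d] pd₁ u
  d₂_ae : tupleD₂ d w =ᵐ[pencilMeasure d] pd₂ u
  bottom_ae : tupleBottom d w =ᵐ[volume.restrict (Icc 0 d)] fun y => u (y, 0)
  side_ae : tupleSide d w =ᵐ[volume.restrict (Ici 0)] fun t => u (t + d, t)

namespace IsTupleOf

variable {w w' : TupleSpace d} {u u' : ℝ × ℝ → ℂ}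

lemma pd₁_add (hu : ContDiff ℝ ∞ u) (hu' : ContDiff ℝ ∞ u') (p : ℝ × ℝ) :
    pd₁ (fun p => u p + u' p) p = pd₁ u p + pd₁ u' p := by
  rw [pd₁, fderiv_fun_add (hu.differentiable (by simp) _) (hu'.differentiable (by simp) _)]
  rfl

lemma pd₂_add (hu : ContDiff ℝ ∞ u) (hu' : ContDiff ℝ ∞ u') (p : ℝ × ℝ) :
    pd₂ (fun p => u p + u' p) p = pd₂ u p + pd₂ u' p := by
  rw [pd₂, fderiv_fun_add (hu.differentiable (by simp) _) (hu'.differentiable (by simp) _)]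
  rfl

lemma pd₁_const_mul (hu : ContDiff ℝ ∞ u) (c : ℂ) (p : ℝ × ℝ) :
    pd₁ (fun p => c * u p) p = c * pd₁ u p := by
  rw [pd₁, fderiv_const_mul (hu.differentiable (by simp) _)]
  rfl

lemma pd₂_const_mul (hu : ContDiff ℝ ∞ u) (c : ℂ) (p : ℝ × ℝ) :
    pd₂ (fun p => c * u p) p = c * pd₂ u p := by
  rw [pd₂, fderiv_const_mul (hu.differentiable (by simp) _)]
  rfl

protected lemma add (h : IsTupleOf w u) (h' : IsTupleOf w' u') :
    IsTupleOf (w + w') (fun p => u p + u' p) where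
  contDiff := h.contDiff.add h'.contDiff
  hasCompactSupport := h.hasCompactSupport.add h'.hasCompactSupport
  antisymm p := by rw [h.antisymm, h'.antisymm]; ring
  fun_ae := by
    rw [map_add, Submodule.coe_add]
    filter_upwards [Lp.coeFn_add (tupleFun d w : PencilL2 d) (tupleFun d w'), h.fun_ae, h'.fun_ae]
      with p h1 h2 h3
    rw [h1, Pi.add_apply, h2, h3]
  d₁_ae := by
    rw [map_add]
    filter_upwards [Lp.coeFn_add (tupleD₁ d w) (tupleD₁ d w'), h.d₁_ae, h'.d₁_ae] with p h1 h2 h3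
    rw [h1, Pi.add_apply, h2, h3, pd₁_add h.contDiff h'.contDiff]
  d₂_ae := by
    rw [map_add]
    filter_upwards [Lp.coeFn_add (tupleD₂ d w) (tupleD₂ d w'), h.d₂_ae, h'.d₂_ae] with p h1 h2 h3
    rw [h1, Pi.add_apply, h2, h3, pd₂_add h.contDiff h'.contDiff]
  bottom_ae := by
    rw [map_add]
    filter_upwards [Lp.coeFn_add (tupleBottom d w) (tupleBottom d w'), h.bottom_ae, h'.bottom_ae]
      with p h1 h2 h3
    rw [h1, Pi.add_apply, h2, h3]
  side_ae := by
    rw [map_add]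
    filter_upwards [Lp.coeFn_add (tupleSide d w) (tupleSide d w'), h.side_ae, h'.side_ae]
      with p h1 h2 h3
    rw [h1, Pi.add_apply, h2, h3]

protected lemma smul (c : ℂ) (h : IsTupleOf w u) : IsTupleOf (c • w) (fun p => c * u p) where
  contDiff := contDiff_const.mul h.contDiff
  hasCompactSupport := h.hasCompactSupport.mul_left
  antisymm p := by rw [h.antisymm]; ring
  fun_ae := by
    rw [map_smul, Submodule.coe_smul]
    filter_upwards [Lp.coeFn_smul c (tupleFun d w : PencilL2 d), h.fun_ae] with p h1 h2
    rw [h1, Pi.smul_apply, h2, smul_eq_mul]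
  d₁_ae := by
    rw [map_smul]
    filter_upwards [Lp.coeFn_smul c (tupleD₁ d w), h.d₁_ae] with p h1 h2
    rw [h1, Pi.smul_apply, h2, smul_eq_mul, pd₁_const_mul h.contDiff]
  d₂_ae := by
    rw [map_smul]
    filter_upwards [Lp.coeFn_smul c (tupleD₂ d w), h.d₂_ae] with p h1 h2
    rw [h1, Pi.smul_apply, h2, smul_eq_mul, pd₂_const_mul h.contDiff]
  bottom_ae := by
    rw [map_smul]
    filter_upwards [Lp.coeFn_smul c (tupleBottom d w), h.bottom_ae] with p h1 h2
    rw [h1, Pi.smul_apply, h2, smul_eq_mul]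
  side_ae := by
    rw [map_smul]
    filter_upwards [Lp.coeFn_smul c (tupleSide d w), h.side_ae] with p h1 h2
    rw [h1, Pi.smul_apply, h2, smul_eq_mul]

lemma mass_eq (h : IsTupleOf w u) : mass d u = ‖tupleFun d w‖ ^ 2 := by
  rw [Submodule.coe_norm, norm_sq_eq_of_ae h.fun_ae]
  rfl

lemma energy_eq (h : IsTupleOf w u) :
    energy d u = ‖tupleD₁ d w‖ ^ 2 + ‖tupleD₂ d w‖ ^ 2 := by
  rw [norm_sq_eq_of_ae h.d₁_ae, norm_sq_eq_of_ae h.d₂_ae, energy, integral_add]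
  · exact (integrable_norm_sq (μ := volume) (continuous_pd₁ h.contDiff)
      (hasCompactSupport_pd₁ h.hasCompactSupport)).integrableOn
  · exact (integrable_norm_sq (μ := volume) (continuous_pd₂ h.contDiff)
      (hasCompactSupport_pd₂ h.hasCompactSupport)).integrableOn

lemma bottomMass_eq (h : IsTupleOf w u) : bottomMass d u = ‖tupleBottom d w‖ ^ 2 := by
  rw [norm_sq_eq_of_ae h.bottom_ae]
  rfl

lemma sideMass_eq (h : IsTupleOf w u) : sideMass d u = ‖tupleSide d w‖ ^ 2 := by
  rw [norm_sq_eq_of_ae h.side_ae]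
  rfl

end IsTupleOf

lemma memLp_of_test {u : ℝ × ℝ → ℂ} (hu : Continuous u) (hc : HasCompactSupport u) :
    MemLp u 2 (pencilMeasure d) :=
  (hu.memLp_of_hasCompactSupport hc (μ := volume)).restrict _

lemma memLp_comp_curve {u : ℝ × ℝ → ℂ} (hu : Continuous u) (hc : HasCompactSupport u)
    {c : ℝ → ℝ × ℝ} (hcl : Topology.IsClosedEmbedding c) (I : Set ℝ) :
    MemLp (fun t => u (c t)) 2 (volume.restrict I) :=
  ((hu.comp hcl.continuous).memLp_of_hasCompactSupport (hc.comp_isClosedEmbedding hcl)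
    (μ := volume)).restrict _

/-- A continuous curve with a continuous left inverse. -/
lemma isClosedEmbedding_curve {c : ℝ → ℝ × ℝ} (hc : Continuous c) {g : ℝ × ℝ → ℝ}
    (hg : Continuous g) (h : ∀ t, g (c t) = t) : Topology.IsClosedEmbedding c :=
  Function.LeftInverse.isClosedEmbedding h hg hc

lemma isClosedEmbedding_bottom : Topology.IsClosedEmbedding fun y : ℝ => (y, (0 : ℝ)) :=
  isClosedEmbedding_curve (by fun_prop) continuous_fst fun _ => rfl

lemma isClosedEmbedding_left : Topology.IsClosedEmbedding fun y : ℝ => ((0 : ℝ), y) :=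
  isClosedEmbedding_curve (by fun_prop) continuous_snd fun _ => rfl

lemma isClosedEmbedding_side : Topology.IsClosedEmbedding fun t : ℝ => (t + d, t) :=
  isClosedEmbedding_curve (by fun_prop) continuous_snd fun _ => rfl

lemma isClosedEmbedding_side' : Topology.IsClosedEmbedding fun t : ℝ => (t, t + d) :=
  isClosedEmbedding_curve (by fun_prop) continuous_fst fun _ => rfl

/-- The tuple of an antisymmetric test function. -/
lemma exists_isTupleOf {u : ℝ × ℝ → ℂ} (hu : ContDiff ℝ ∞ u) (hc : HasCompactSupport u)
    (ha : ∀ p, u p.swap = -u p) : ∃ w : TupleSpace d, IsTupleOf w u := by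
  have h0 := coeFn_toL2 (memLp_of_test (d := d) hu.continuous hc)
  have ha' : toL2 (pencilMeasure d) u ∈ antisymmetricL2 d := by
    change ∀ᵐ p ∂pencilMeasure d, toL2 (pencilMeasure d) u p = -toL2 (pencilMeasure d) u p.swap
    filter_upwards [h0, (measurePreserving_swap_pencil d).quasiMeasurePreserving.ae h0]
      with p h1 h2
    rw [h1, h2, ha, neg_neg]
  exact ⟨mkTuple ⟨_, ha'⟩ (toL2 _ (pd₁ u)) (toL2 _ (pd₂ u)) (toL2 _ fun y => u (y, 0))
    (toL2 _ fun t => u (t + d, t)), hu, hc, ha, h0,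
    coeFn_toL2 (memLp_of_test (continuous_pd₁ hu) (hasCompactSupport_pd₁ hc)),
    coeFn_toL2 (memLp_of_test (continuous_pd₂ hu) (hasCompactSupport_pd₂ hc)),
    coeFn_toL2 (memLp_comp_curve hu.continuous hc isClosedEmbedding_bottom _),
    coeFn_toL2 (memLp_comp_curve hu.continuous hc isClosedEmbedding_side _)⟩

variable (d) in
/-- The tuples of antisymmetric test functions. -/
def testTuples : Submodule ℂ (TupleSpace d) where
  carrier := {w | ∃ u, IsTupleOf w u}
  zero_mem' := by
    obtain ⟨w, hw⟩ := exists_isTupleOf (d := d) (u := fun _ => 0) contDiff_const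
      (HasCompactSupport.zero) (fun _ => by simp)
    have := hw.smul 0
    rw [zero_smul] at this
    exact ⟨_, this⟩
  add_mem' := fun ⟨_, h⟩ ⟨_, h'⟩ => ⟨_, h.add h'⟩
  smul_mem' := fun c _ ⟨_, h⟩ => ⟨_, h.smul c⟩

variable (d) in
/-- The antisymmetric part of `H¹`, as a space of tuples: the closure of the test functions. -/
def sobolevTuples : Submodule ℂ (TupleSpace d) := (testTuples d).topologicalClosure

variable (d) in
/-- The form domain as a space of tuples: the Dirichlet condition on the half-line is imposed. -/
def formTuples : Submodule ℂ (TupleSpace d) :=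
  sobolevTuples d ⊓ LinearMap.ker (tupleSide d : TupleSpace d →ₗ[ℂ] SideL2)

lemma isClosed_formTuples : IsClosed (formTuples d : Set (TupleSpace d)) :=
  (Submodule.isClosed_topologicalClosure _).inter (tupleSide d).isClosed_ker

instance : CompleteSpace (formTuples d) := isClosed_formTuples.completeSpace_coe

lemma mem_formTuples {w : TupleSpace d} :
    w ∈ formTuples d ↔ w ∈ sobolevTuples d ∧ tupleSide d w = 0 := Iff.rfl

/-- A closed condition that holds for test functions holds on the closure. -/
lemma sobolevTuples_induction {P : TupleSpace d → Prop} (hP : IsClosed {w | P w})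
    (h : ∀ w u, IsTupleOf w u → P w) {w : TupleSpace d} (hw : w ∈ sobolevTuples d) : P w := by
  have : closure (testTuples d : Set (TupleSpace d)) ⊆ {w | P w} :=
    closure_minimal (fun w ⟨u, hu⟩ => h w u hu) hP
  exact this hw

end FormSpace

/-! ### Form inequalities on the space of tuples -/

section TupleInequalities

variable {d : ℝ}

/-- The Dirichlet integral of a tuple. -/
def tupleEnergy (w : TupleSpace d) : ℝ := ‖tupleD₁ d w‖ ^ 2 + ‖tupleD₂ d w‖ ^ 2

lemma tupleEnergy_nonneg (w : TupleSpace d) : 0 ≤ tupleEnergy w := by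
  unfold tupleEnergy; positivity

lemma continuous_tupleEnergy : Continuous (tupleEnergy (d := d)) := by
  unfold tupleEnergy; fun_prop

lemma mass_le_tupleEnergy (hd : 0 < d) {w : TupleSpace d} (hw : w ∈ sobolevTuples d) :
    2 * (Real.pi / (2 * d)) ^ 2 * ‖tupleFun d w‖ ^ 2 ≤ tupleEnergy w := by
  refine sobolevTuples_induction (P := fun w => 2 * (Real.pi / (2 * d)) ^ 2 * ‖tupleFun d w‖ ^ 2
    ≤ tupleEnergy w) (isClosed_le (by fun_prop) continuous_tupleEnergy) (fun w u h => ?_) hw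
  rw [← h.mass_eq, tupleEnergy, ← h.energy_eq]
  exact mass_le_energy hd h.contDiff h.hasCompactSupport h.antisymm

lemma bottom_le_tupleEnergy (hd : 0 < d) {ε : ℝ} (hε : 0 < ε) {w : TupleSpace d}
    (hw : w ∈ sobolevTuples d) :
    ‖tupleBottom d w‖ ^ 2 ≤ ε * tupleEnergy w + 2 * (d⁻¹ + ε⁻¹) * ‖tupleFun d w‖ ^ 2 := by
  refine sobolevTuples_induction (P := fun w => ‖tupleBottom d w‖ ^ 2 ≤ ε * tupleEnergy w +
    2 * (d⁻¹ + ε⁻¹) * ‖tupleFun d w‖ ^ 2) (isClosed_le (by fun_prop)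
      ((continuous_tupleEnergy.const_mul _).add (by fun_prop))) (fun w u h => ?_) hw
  rw [← h.mass_eq, tupleEnergy, ← h.energy_eq, ← h.bottomMass_eq]
  exact bottomMass_le hd hε h.contDiff h.hasCompactSupport

lemma side_le_tupleEnergy (hd : 0 < d) {w : TupleSpace d} (hw : w ∈ sobolevTuples d) :
    ‖tupleSide d w‖ ^ 2 ≤ tupleEnergy w + (d⁻¹ + 1) * ‖tupleFun d w‖ ^ 2 := by
  refine sobolevTuples_induction (P := fun w => ‖tupleSide d w‖ ^ 2 ≤ tupleEnergy w +
    (d⁻¹ + 1) * ‖tupleFun d w‖ ^ 2) (isClosed_le (by fun_prop)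
      (continuous_tupleEnergy.add (by fun_prop))) (fun w u h => ?_) hw
  rw [← h.mass_eq, tupleEnergy, ← h.energy_eq, ← h.sideMass_eq]
  exact sideMass_le hd h.contDiff h.hasCompactSupport

/-- The norm on the closure of the test functions is equivalent to the `H¹` norm. -/
lemma norm_sq_le_of_mem_sobolevTuples (hd : 0 < d) : ∃ K : ℝ, 0 < K ∧ ∀ w ∈ sobolevTuples d,
    ‖w‖ ^ 2 ≤ K * (‖tupleFun d w‖ ^ 2 + tupleEnergy w) := by
  refine ⟨3 + (2 * (d⁻¹ + 1⁻¹) + (d⁻¹ + 1)), by positivity, fun w hw => ?_⟩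
  have h1 := bottom_le_tupleEnergy hd one_pos hw
  have h2 := side_le_tupleEnergy hd hw
  have h3 := norm_sq_tuple w
  have h4 := tupleEnergy_nonneg w
  have h5 : ‖tupleD₁ d w‖ ^ 2 + ‖tupleD₂ d w‖ ^ 2 = tupleEnergy w := rfl
  have h6 : 0 ≤ (2 * (d⁻¹ + 1⁻¹) + (d⁻¹ + 1)) * tupleEnergy w := by positivity
  have h7 : 0 ≤ ‖tupleFun d w‖ ^ 2 := by positivity
  linarith

/-- A mean value extends from test functions to a bounded functional. -/
lemma exists_mean_functional {S : Set (ℝ × ℝ)} (hS : MeasurableSet S) (hsub : S ⊆ pencil d)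
    (hfin : volume S ≠ ⊤) : ∃ ℓ : antisymmetricL2 d →L[ℂ] ℂ, ∀ (w : TupleSpace d) u,
      IsTupleOf w u → ℓ (tupleFun d w) = ∫ p in S, u p := by
  have hfin' : pencilMeasure d S ≠ ⊤ := by
    rw [Measure.restrict_apply hS, inter_eq_left.2 hsub]
    exact hfin
  refine ⟨(innerSL ℂ (indicatorConstLp 2 hS hfin' (1 : ℂ))).comp (antisymmetricL2 d).subtypeL,
    fun w u h => ?_⟩
  change inner ℂ (indicatorConstLp 2 hS hfin' (1 : ℂ)) (tupleFun d w : PencilL2 d) = _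
  rw [L2.inner_indicatorConstLp_one, Measure.restrict_restrict hS, inter_eq_left.2 hsub]
  refine integral_congr_ae ?_
  exact ae_restrict_of_ae_restrict_of_subset hsub h.fun_ae

lemma mass_le_tupleEnergy_add_mean (hd : 0 < d) {k : ℝ} (hk : 0 ≤ k) (hkd : k * d < Real.pi) :
    ∃ (ℓ : antisymmetricL2 d →L[ℂ] ℂ) (C : ℝ), ∀ w ∈ formTuples d,
      2 * k ^ 2 * ‖tupleFun d w‖ ^ 2 ≤ tupleEnergy w + C * ‖ℓ (tupleFun d w)‖ ^ 2 := by
  obtain ⟨C, hC, h⟩ := mass_le_energy_add_mean hd hk hkd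
  obtain ⟨ℓ, hℓ⟩ := exists_mean_functional (d := d)
    (measurableSet_rotCLM_image (measurableSet_tipTriangle d)) ((image_mono
      tipTriangle_subset_halfStrip).trans ((rotCLM_image_halfStrip d).trans_subset
        (lowerPencil_subset d))) (by
      have hsub : tipTriangle d ⊆ Icc 0 d ×ˢ Icc 0 d := by
        rintro p ⟨h1, h2, h3⟩
        exact ⟨⟨h1, h2.trans h3⟩, ⟨h1.trans h2, h3⟩⟩
      exact ((measure_mono (image_mono hsub)).trans_lt
        ((isCompact_Icc.prod isCompact_Icc).image rotCLM.continuous).measure_lt_top).ne)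
  refine ⟨ℓ, C, fun w hw => ?_⟩
  have h1 := sobolevTuples_induction (P := fun w => 2 * k ^ 2 * ‖tupleFun d w‖ ^ 2
    ≤ tupleEnergy w + C * ‖tupleSide d w‖ ^ 2 + C * ‖ℓ (tupleFun d w)‖ ^ 2)
    (isClosed_le (by fun_prop) ((continuous_tupleEnergy.add (by fun_prop)).add (by fun_prop)))
    (fun w u hu => by
      rw [← hu.mass_eq, tupleEnergy, ← hu.energy_eq, ← hu.sideMass_eq, hℓ w u hu]
      exact h u hu.contDiff hu.hasCompactSupport hu.antisymm) hw.1
  rw [(mem_formTuples.1 hw).2] at h1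
  simpa using h1

lemma mass_add_bottom_le_tupleEnergy (hd : 0 < d) {K M : ℝ} (hK : 0 ≤ K) (hKd : K * d < Real.pi)
    (hM : 0 ≤ M) : ∃ (n : ℕ) (ℓ : antisymmetricL2 d →L[ℂ] (Fin n → ℂ)) (C : ℝ),
      ∀ w ∈ formTuples d, 2 * K ^ 2 * ‖tupleFun d w‖ ^ 2 + M * ‖tupleBottom d w‖ ^ 2
        ≤ tupleEnergy w + C * ‖ℓ (tupleFun d w)‖ ^ 2 := by
  obtain ⟨n, S, C, hS, hC, h⟩ := mass_add_bottom_le hd hK hKd hM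
  choose ℓ hℓ using fun i => exists_mean_functional (d := d) (hS i).1 (hS i).2.1 (hS i).2.2
  refine ⟨n, ContinuousLinearMap.pi ℓ, C * n, fun w hw => ?_⟩
  have h1 := sobolevTuples_induction (P := fun w => 2 * K ^ 2 * ‖tupleFun d w‖ ^ 2
    + M * ‖tupleBottom d w‖ ^ 2
    ≤ tupleEnergy w + C * ‖tupleSide d w‖ ^ 2 + C * ∑ i, ‖ℓ i (tupleFun d w)‖ ^ 2)
    (isClosed_le (by fun_prop) ((continuous_tupleEnergy.add (by fun_prop)).add (by fun_prop)))
    (fun w u hu => by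
      simp only [hℓ _ w u hu]
      rw [← hu.mass_eq, tupleEnergy, ← hu.energy_eq, ← hu.sideMass_eq, ← hu.bottomMass_eq]
      exact h u hu.contDiff hu.hasCompactSupport hu.antisymm) hw.1
  rw [(mem_formTuples.1 hw).2] at h1
  have h2 : ∑ i, ‖ℓ i (tupleFun d w)‖ ^ 2
      ≤ n * ‖ContinuousLinearMap.pi ℓ (tupleFun d w)‖ ^ 2 := by
    calc ∑ i, ‖ℓ i (tupleFun d w)‖ ^ 2
        ≤ ∑ _i : Fin n, ‖ContinuousLinearMap.pi ℓ (tupleFun d w)‖ ^ 2 := by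
          refine Finset.sum_le_sum fun i _ => ?_
          have := norm_le_pi_norm (ContinuousLinearMap.pi ℓ (tupleFun d w)) i
          exact pow_le_pow_left₀ (norm_nonneg _) this 2
      _ = _ := by simp
  have h3 := mul_le_mul_of_nonneg_left h2 hC
  simp only [norm_zero, ne_eq, OfNat.ofNat_ne_zero, not_false_eq_true, zero_pow, mul_zero,
    add_zero] at h1
  linarith

end TupleInequalities

/-! ### Weak derivatives -/

section WeakDerivative

variable {d : ℝ}

lemma convex_pencil (d : ℝ) : Convex ℝ (pencil d) := by
  intro p hp q hq a b ha hb hab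
  obtain ⟨p1, p2, p3⟩ := hp
  obtain ⟨q1, q2, q3⟩ := hq
  refine ⟨?_, ?_, ?_⟩
  · simp only [Prod.fst_add, Prod.smul_fst, smul_eq_mul]; positivity
  · simp only [Prod.snd_add, Prod.smul_snd, smul_eq_mul]; positivity
  · simp only [Prod.fst_add, Prod.smul_fst, smul_eq_mul, Prod.snd_add, Prod.smul_snd]
    rw [abs_le] at *
    constructor <;> nlinarith

lemma interior_pencil_ae_eq (d : ℝ) : (interior (pencil d) : Set (ℝ × ℝ)) =ᵐ[volume] pencil d :=
  interior_ae_eq_of_null_frontier ((convex_pencil d).addHaar_frontier volume)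

/-- The fundamental lemma of the calculus of variations on the pencil. -/
lemma eq_zero_of_integral_mul_eq_zero {g : PencilL2 d}
    (h : ∀ ψ : ℝ × ℝ → ℝ, ContDiff ℝ ∞ ψ → HasCompactSupport ψ → tsupport ψ ⊆ interior (pencil d) →
      ∫ p in pencil d, g p * (ψ p : ℂ) = 0) : g = 0 := by
  have hloc : LocallyIntegrable g (pencilMeasure d) := by
    have h1 : LocallyIntegrable g (pencilMeasure d) :=
      (Lp.memLp g).locallyIntegrable (by norm_num)
    exact h1
  have hloc' : LocallyIntegrableOn g (interior (pencil d)) volume := by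
    rw [locallyIntegrableOn_iff isOpen_interior.isLocallyClosed]
    intro k hk hkc
    have := hloc.integrableOn_isCompact hkc
    rw [IntegrableOn, Measure.restrict_restrict hkc.measurableSet,
      inter_eq_left.2 (hk.trans interior_subset)] at this
    exact this
  have h0 := isOpen_interior.ae_eq_zero_of_integral_contDiff_smul_eq_zero (μ := volume) hloc'
    (fun ψ hψ hc hs => by
      have h1 := h ψ hψ hc hs
      rw [← h1, setIntegral_eq_integral_of_forall_compl_eq_zero]
      · refine integral_congr_ae (ae_of_all _ fun p => ?_)
        simp only [Complex.real_smul]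
        ring
      · intro p hp
        have : p ∉ tsupport ψ := fun hp' => hp (interior_subset (hs hp'))
        rw [image_eq_zero_of_notMem_tsupport this]
        simp)
  rw [Lp.eq_zero_iff_ae_eq_zero]
  have h1 : ∀ᵐ p ∂volume, p ∈ pencil d → g p = 0 := by
    filter_upwards [h0, interior_pencil_ae_eq d] with p hp he hpp
    refine hp ?_
    have : (p ∈ interior (pencil d)) = (p ∈ pencil d) := he
    rw [this]
    exact hpp
  exact (ae_restrict_iff' (measurableSet_pencil d)).2 h1

lemma integral_mul_eq_inner {φ : PencilL2 d} {h : ℝ × ℝ → ℂ} (hh : Continuous h)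
    (hc : HasCompactSupport h) :
    ∫ p in pencil d, φ p * h p = inner ℂ (toL2 (pencilMeasure d) fun p => conj (h p)) φ := by
  rw [L2.inner_def]
  refine integral_congr_ae ?_
  have : MemLp (fun p => conj (h p)) 2 (pencilMeasure d) :=
    memLp_of_test (Complex.continuous_conj.comp hh) (hc.comp_left (map_zero _))
  filter_upwards [coeFn_toL2 this] with p hp
  rw [hp]
  simp [mul_comm]

lemma integrable_mul_test (φ : PencilL2 d) {h : ℝ × ℝ → ℂ} (hh : Continuous h)
    (hc : HasCompactSupport h) : Integrable (fun p => φ p * h p) (pencilMeasure d) :=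
  (Lp.memLp φ).integrable_mul (memLp_of_test hh hc)

lemma HasWeakDeriv.unique {v : ℝ × ℝ} {φ g g' : PencilL2 d} (h : HasWeakDeriv d v φ g)
    (h' : HasWeakDeriv d v φ g') : g = g' := by
  rw [← sub_eq_zero]
  refine eq_zero_of_integral_mul_eq_zero fun ψ hψ hc hs => ?_
  have hψ' : ContDiff ℝ ∞ fun p => (ψ p : ℂ) := Complex.ofRealCLM.contDiff.comp hψ
  have hc' : HasCompactSupport fun p => (ψ p : ℂ) := hc.comp_left (g := Complex.ofReal) rfl
  have hs' : tsupport (fun p => (ψ p : ℂ)) ⊆ interior (pencil d) :=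
    (tsupport_comp_subset (g := Complex.ofReal) rfl ψ).trans hs
  have e := (h _ hψ' hc' hs').symm.trans (h' _ hψ' hc' hs')
  have e2 : ∫ p in pencil d, (g - g') p * (ψ p : ℂ)
      = (∫ p in pencil d, g p * (ψ p : ℂ)) - ∫ p in pencil d, g' p * (ψ p : ℂ) := by
    rw [← integral_sub (integrable_mul_test g hψ'.continuous hc')
      (integrable_mul_test g' hψ'.continuous hc')]
    refine integral_congr_ae ?_
    filter_upwards [Lp.coeFn_sub g g'] with p hp
    rw [hp, Pi.sub_apply, sub_mul]
  rw [e2, neg_injective e, sub_self]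

lemma weakDeriv_eq {v : ℝ × ℝ} {φ g : PencilL2 d} (h : HasWeakDeriv d v φ g) :
    weakDeriv d v φ = g := by
  have hex : ∃ g, HasWeakDeriv d v φ g := ⟨g, h⟩
  rw [weakDeriv, dif_pos hex]
  exact hex.choose_spec.unique h

lemma integral_test_mul_fderiv {u ψ : ℝ × ℝ → ℂ} (hu : ContDiff ℝ ∞ u) (hψ : ContDiff ℝ ∞ ψ)
    (hc : HasCompactSupport ψ) (hs : tsupport ψ ⊆ interior (pencil d)) (v : ℝ × ℝ) :
    ∫ p in pencil d, u p * fderiv ℝ ψ p v = -∫ p in pencil d, fderiv ℝ u p v * ψ p := by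
  have hd1 : Continuous fun p => fderiv ℝ u p v :=
    (hu.continuous_fderiv (by simp)).clm_apply continuous_const
  have hd2 : Continuous fun p => fderiv ℝ ψ p v :=
    (hψ.continuous_fderiv (by simp)).clm_apply continuous_const
  have hcd : HasCompactSupport fun p => fderiv ℝ ψ p v := hc.fderiv_apply (𝕜 := ℝ) v
  have hz : ∀ p, p ∉ pencil d → p ∉ tsupport ψ := fun p hp hp' => hp (interior_subset (hs hp'))
  rw [setIntegral_eq_integral_of_forall_compl_eq_zero, setIntegral_eq_integral_of_forall_compl_eq_zero]
  · exact integral_mul_fderiv_eq_neg_fderiv_mul_of_integrable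
      (((hd1.mul hψ.continuous).integrable_of_hasCompactSupport hc.mul_left))
      (((hu.continuous.mul hd2).integrable_of_hasCompactSupport hcd.mul_left))
      (((hu.continuous.mul hψ.continuous).integrable_of_hasCompactSupport hc.mul_left))
      (fun x _ => hu.differentiable (by simp) x) (fun x _ => hψ.differentiable (by simp) x)
  · intro p hp
    rw [image_eq_zero_of_notMem_tsupport (hz p hp), mul_zero]
  · intro p hp
    have h1 : p ∉ tsupport fun p => fderiv ℝ ψ p v := fun h =>
      hz p hp (closure_mono ((fun x hx => by
        have := support_fderiv_subset ℝ (f := ψ) (show x ∈ Function.support (fderiv ℝ ψ) from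
          fun h0 => hx (by simp [h0]))
        exact this) : Function.support (fun p => fderiv ℝ ψ p v) ⊆ tsupport ψ)
        h |> fun h => by rwa [isClosed_tsupport ψ |>.closure_eq] at h)
    have := image_eq_zero_of_notMem_tsupport h1
    rw [this, mul_zero]

/-- Integration by parts passes to the closure of the test functions. -/
lemma hasWeakDeriv_of_mem {v : ℝ × ℝ} {E : TupleSpace d →L[ℂ] PencilL2 d}
    (hE : ∀ w u, IsTupleOf w u → E w =ᵐ[pencilMeasure d] fun p => fderiv ℝ u p v)
    {w : TupleSpace d} (hw : w ∈ sobolevTuples d) :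
    HasWeakDeriv d v (tupleFun d w : PencilL2 d) (E w) := by
  intro ψ hψ hc hs
  have hd2 : Continuous fun p => fderiv ℝ ψ p v :=
    (hψ.continuous_fderiv (by simp)).clm_apply continuous_const
  have hcd : HasCompactSupport fun p => fderiv ℝ ψ p v := hc.fderiv_apply (𝕜 := ℝ) v
  refine sobolevTuples_induction (P := fun w => ∫ p in pencil d,
    (tupleFun d w : PencilL2 d) p * fderiv ℝ ψ p v = -∫ p in pencil d, E w p * ψ p) ?_
    (fun w u h => ?_) hw
  · simp only [integral_mul_eq_inner hd2 hcd, integral_mul_eq_inner hψ.continuous hc]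
    refine isClosed_eq ?_ ?_
    · exact continuous_const.inner (continuous_subtype_val.comp (tupleFun d).continuous)
    · exact (continuous_const.inner E.continuous).neg
  · have h1 : ∫ p in pencil d, (tupleFun d w : PencilL2 d) p * fderiv ℝ ψ p v
        = ∫ p in pencil d, u p * fderiv ℝ ψ p v := by
      refine integral_congr_ae ?_
      filter_upwards [h.fun_ae] with p hp
      rw [hp]
    have h2 : ∫ p in pencil d, E w p * ψ p = ∫ p in pencil d, fderiv ℝ u p v * ψ p := by
      refine integral_congr_ae ?_
      filter_upwards [hE w u h] with p hp
      rw [hp]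
    rw [h1, h2, integral_test_mul_fderiv h.contDiff hψ hc hs]

variable {w : TupleSpace d}

lemma hasWeakDeriv_fst (hw : w ∈ sobolevTuples d) :
    HasWeakDeriv d (1, 0) (tupleFun d w : PencilL2 d) (tupleD₁ d w) :=
  hasWeakDeriv_of_mem (fun _ _ h => h.d₁_ae) hw

lemma hasWeakDeriv_snd (hw : w ∈ sobolevTuples d) :
    HasWeakDeriv d (0, 1) (tupleFun d w : PencilL2 d) (tupleD₂ d w) :=
  hasWeakDeriv_of_mem (fun _ _ h => h.d₂_ae) hw

lemma memH1_of_mem (hw : w ∈ sobolevTuples d) : MemH1 d (tupleFun d w : PencilL2 d) :=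
  ⟨⟨_, hasWeakDeriv_fst hw⟩, ⟨_, hasWeakDeriv_snd hw⟩⟩

end WeakDerivative

/-! ### Traces -/

section Traces

variable {d : ℝ}

/-- The restriction of test functions to the curve `c` is bounded in the `H¹` norm. -/
def TraceBounded (d : ℝ) (c : ℝ → ℝ × ℝ) (I : Set ℝ) : Prop :=
  ∃ K : ℝ, ∀ u : ℝ × ℝ → ℂ, ContDiff ℝ ∞ u → HasCompactSupport u →
    ∫ t in I, ‖u (c t)‖ ^ 2 ≤ K * (energy d u + mass d u)

lemma traceBounded_bottom (hd : 0 < d) : TraceBounded d (fun y => (y, 0)) (Icc 0 d) := by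
  refine ⟨1 + 2 * (d⁻¹ + 1⁻¹), fun u hu hc => ?_⟩
  have h := bottomMass_le hd one_pos hu hc
  have h1 : 0 ≤ 2 * (d⁻¹ + 1⁻¹) * energy d u := mul_nonneg (by positivity) energy_nonneg
  have h2 : 0 ≤ mass d u := mass_nonneg
  rw [bottomMass] at h
  linarith

lemma traceBounded_side (hd : 0 < d) : TraceBounded d (fun t => (t + d, t)) (Ici 0) := by
  refine ⟨1 + (d⁻¹ + 1), fun u hu hc => ?_⟩
  have h := sideMass_le hd hu hc
  have h1 : 0 ≤ (d⁻¹ + 1) * energy d u := mul_nonneg (by positivity) energy_nonneg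
  have h2 : 0 ≤ mass d u := mass_nonneg
  rw [sideMass] at h
  linarith

lemma TraceBounded.swap {c : ℝ → ℝ × ℝ} {I : Set ℝ} (h : TraceBounded d c I) :
    TraceBounded d (fun t => (c t).swap) I := by
  obtain ⟨K, hK⟩ := h
  refine ⟨K, fun u hu hc => ?_⟩
  have h := hK _ (contDiff_swap hu) (hasCompactSupport_swap hc)
  rwa [energy_swap hu, mass_swap] at h

lemma traceBounded_left (hd : 0 < d) : TraceBounded d (fun y => (0, y)) (Icc 0 d) :=
  (traceBounded_bottom hd).swap

lemma traceBounded_side' (hd : 0 < d) : TraceBounded d (fun t => (t, t + d)) (Ici 0) :=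
  (traceBounded_side hd).swap

lemma mass_eq_norm_sq {u : ℝ × ℝ → ℂ} (hu : Continuous u) (hc : HasCompactSupport u) :
    mass d u = ‖toL2 (pencilMeasure d) u‖ ^ 2 :=
  (norm_sq_eq_of_ae (coeFn_toL2 (memLp_of_test hu hc))).symm

lemma energy_eq_norm_sq {u : ℝ × ℝ → ℂ} (hu : ContDiff ℝ ∞ u) (hc : HasCompactSupport u) :
    energy d u = ‖toL2 (pencilMeasure d) (pd₁ u)‖ ^ 2 + ‖toL2 (pencilMeasure d) (pd₂ u)‖ ^ 2 := by
  rw [← mass_eq_norm_sq (continuous_pd₁ hu) (hasCompactSupport_pd₁ hc),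
    ← mass_eq_norm_sq (continuous_pd₂ hu) (hasCompactSupport_pd₂ hc), energy]
  exact integral_add
    (integrable_norm_sq (μ := volume) (continuous_pd₁ hu) (hasCompactSupport_pd₁ hc)).integrableOn
    (integrable_norm_sq (μ := volume) (continuous_pd₂ hu) (hasCompactSupport_pd₂ hc)).integrableOn

lemma pd₁_sub {u v : ℝ × ℝ → ℂ} (hu : ContDiff ℝ ∞ u) (hv : ContDiff ℝ ∞ v) :
    pd₁ (fun p => u p - v p) = fun p => pd₁ u p - pd₁ v p := by
  ext p
  rw [pd₁, fderiv_fun_sub (hu.differentiable (by simp) _) (hv.differentiable (by simp) _)]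
  rfl

lemma pd₂_sub {u v : ℝ × ℝ → ℂ} (hu : ContDiff ℝ ∞ u) (hv : ContDiff ℝ ∞ v) :
    pd₂ (fun p => u p - v p) = fun p => pd₂ u p - pd₂ v p := by
  ext p
  rw [pd₂, fderiv_fun_sub (hu.differentiable (by simp) _) (hv.differentiable (by simp) _)]
  rfl

/-- Test functions that converge in `H¹` to the given limits. -/
structure TendstoH1 (d : ℝ) (u : ℕ → ℝ × ℝ → ℂ) (φ g₁ g₂ : PencilL2 d) : Prop where
  contDiff : ∀ n, ContDiff ℝ ∞ (u n)
  hasCompactSupport : ∀ n, HasCompactSupport (u n)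
  tendsto_fun : Tendsto (fun n => toL2 (pencilMeasure d) (u n)) atTop (𝓝 φ)
  tendsto_pd₁ : Tendsto (fun n => toL2 (pencilMeasure d) (pd₁ (u n))) atTop (𝓝 g₁)
  tendsto_pd₂ : Tendsto (fun n => toL2 (pencilMeasure d) (pd₂ (u n))) atTop (𝓝 g₂)

/-- Two sequences with the same limit in `H¹` have the same boundary values in the limit. -/
lemma TendstoH1.tendsto_sub_trace {u u' : ℕ → ℝ × ℝ → ℂ} {φ g₁ g₂ : PencilL2 d}
    (h : TendstoH1 d u φ g₁ g₂) (h' : TendstoH1 d u' φ g₁ g₂) {c : ℝ → ℝ × ℝ} {I : Set ℝ}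
    (hc : Topology.IsClosedEmbedding c) (hI : TraceBounded d c I) :
    Tendsto (fun n => toL2 (volume.restrict I) (fun t => u n (c t))
      - toL2 (volume.restrict I) fun t => u' n (c t)) atTop (𝓝 0) := by
  obtain ⟨K, hK⟩ := hI
  have e0 : Tendsto (fun n => ‖toL2 (pencilMeasure d) (u n) - toL2 (pencilMeasure d) (u' n)‖ ^ 2)
      atTop (𝓝 0) := by
    simpa using ((h.tendsto_fun.sub h'.tendsto_fun).norm.pow 2)
  have e1 : Tendsto (fun n => ‖toL2 (pencilMeasure d) (pd₁ (u n))
      - toL2 (pencilMeasure d) (pd₁ (u' n))‖ ^ 2) atTop (𝓝 0) := by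
    simpa using ((h.tendsto_pd₁.sub h'.tendsto_pd₁).norm.pow 2)
  have e2 : Tendsto (fun n => ‖toL2 (pencilMeasure d) (pd₂ (u n))
      - toL2 (pencilMeasure d) (pd₂ (u' n))‖ ^ 2) atTop (𝓝 0) := by
    simpa using ((h.tendsto_pd₂.sub h'.tendsto_pd₂).norm.pow 2)
  have e3 := ((e1.add e2).add e0).const_mul K
  simp only [add_zero, mul_zero] at e3
  have e4 : Tendsto (fun n => ‖toL2 (volume.restrict I) (fun t => u n (c t))
      - toL2 (volume.restrict I) fun t => u' n (c t)‖ ^ 2) atTop (𝓝 0) := by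
    refine squeeze_zero (fun n => sq_nonneg _) (fun n => ?_) e3
    have hu := h.contDiff n
    have hu' := h'.contDiff n
    have hs := h.hasCompactSupport n
    have hs' := h'.hasCompactSupport n
    have hv : ContDiff ℝ ∞ fun p => u n p - u' n p := hu.sub hu'
    have hvs : HasCompactSupport fun p => u n p - u' n p := hs.sub hs'
    have := hK _ hv hvs
    rw [energy_eq_norm_sq hv hvs, mass_eq_norm_sq hv.continuous hvs, pd₁_sub hu hu', pd₂_sub hu hu',
      toL2_sub (memLp_of_test hu.continuous hs) (memLp_of_test hu'.continuous hs'),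
      toL2_sub (memLp_of_test (continuous_pd₁ hu) (hasCompactSupport_pd₁ hs))
        (memLp_of_test (continuous_pd₁ hu') (hasCompactSupport_pd₁ hs')),
      toL2_sub (memLp_of_test (continuous_pd₂ hu) (hasCompactSupport_pd₂ hs))
        (memLp_of_test (continuous_pd₂ hu') (hasCompactSupport_pd₂ hs'))] at this
    rw [← toL2_sub (memLp_comp_curve hu.continuous hs hc I)
      (memLp_comp_curve hu'.continuous hs' hc I), norm_sq_eq_of_ae (coeFn_toL2
        (memLp_comp_curve hv.continuous hvs hc I))]
    exact this
  have e5 := (Real.continuous_sqrt.tendsto 0).comp e4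
  simp only [Real.sqrt_zero] at e5
  refine tendsto_zero_iff_norm_tendsto_zero.2 (e5.congr fun n => ?_)
  simp [Real.sqrt_sq]

/-- The definition of a trace, in terms of convergence in the Banach spaces `L²`. -/
lemma hasTrace_iff {c : ℝ → ℝ × ℝ} {I : Set ℝ} (hcl : Topology.IsClosedEmbedding c)
    {φ : PencilL2 d} {b : ℝ → ℂ} :
    HasTrace d c I φ b ↔ MemH1 d φ ∧ MemLp b 2 (volume.restrict I) ∧ ∃ u : ℕ → ℝ × ℝ → ℂ,
      TendstoH1 d u φ (weakDeriv d (1, 0) φ) (weakDeriv d (0, 1) φ) ∧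
      Tendsto (fun n => toL2 (volume.restrict I) fun t => u n (c t)) atTop
        (𝓝 (toL2 (volume.restrict I) b)) := by
  unfold HasTrace
  refine and_congr_right fun _ => and_congr_right fun hb => exists_congr fun u => ?_
  constructor
  · rintro ⟨h1, h2, h3, h4, h5⟩
    refine ⟨⟨h1, h2, ?_, ?_, ?_⟩, ?_⟩
    · exact (tendsto_toL2_iff (fun n => memLp_of_test (h1 n).continuous (h2 n)) ae_eq_rfl).2 h3
    · exact (tendsto_toL2_iff (fun n => memLp_of_test (continuous_pd₁ (h1 n))
        (hasCompactSupport_pd₁ (h2 n))) ae_eq_rfl).2 (h4 (1, 0) (by simp))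
    · exact (tendsto_toL2_iff (fun n => memLp_of_test (continuous_pd₂ (h1 n))
        (hasCompactSupport_pd₂ (h2 n))) ae_eq_rfl).2 (h4 (0, 1) (by simp))
    · exact (tendsto_toL2_iff (fun n => memLp_comp_curve (h1 n).continuous (h2 n) hcl I)
        (coeFn_toL2 hb)).2 h5
  · rintro ⟨h, h5⟩
    refine ⟨h.contDiff, h.hasCompactSupport, ?_, ?_, ?_⟩
    · exact (tendsto_toL2_iff (fun n => memLp_of_test (h.contDiff n).continuous
        (h.hasCompactSupport n)) ae_eq_rfl).1 h.tendsto_fun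
    · intro v hv
      rcases hv with rfl | rfl
      · exact (tendsto_toL2_iff (fun n => memLp_of_test (continuous_pd₁ (h.contDiff n))
          (hasCompactSupport_pd₁ (h.hasCompactSupport n))) ae_eq_rfl).1 h.tendsto_pd₁
      · exact (tendsto_toL2_iff (fun n => memLp_of_test (continuous_pd₂ (h.contDiff n))
          (hasCompactSupport_pd₂ (h.hasCompactSupport n))) ae_eq_rfl).1 h.tendsto_pd₂
    · exact (tendsto_toL2_iff (fun n => memLp_comp_curve (h.contDiff n).continuous
        (h.hasCompactSupport n) hcl I) (coeFn_toL2 hb)).1 h5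

lemma HasTrace.unique {c : ℝ → ℝ × ℝ} {I : Set ℝ} (hcl : Topology.IsClosedEmbedding c)
    (hI : TraceBounded d c I) {φ : PencilL2 d} {b b' : ℝ → ℂ} (h : HasTrace d c I φ b)
    (h' : HasTrace d c I φ b') : b =ᵐ[volume.restrict I] b' := by
  obtain ⟨-, hb, u, hu, htr⟩ := (hasTrace_iff hcl).1 h
  obtain ⟨-, hb', u', hu', htr'⟩ := (hasTrace_iff hcl).1 h'
  have h0 := hu.tendsto_sub_trace hu' hcl hI
  have h1 := tendsto_nhds_unique h0 (htr.sub htr')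
  have h2 : toL2 (volume.restrict I) b = toL2 (volume.restrict I) b' :=
    (sub_eq_zero.1 h1.symm)
  exact (coeFn_toL2 hb).symm.trans ((by rw [h2] : (toL2 (volume.restrict I) b : ℝ → ℂ)
    =ᵐ[volume.restrict I] toL2 (volume.restrict I) b').trans (coeFn_toL2 hb'))

lemma trace_ae_eq {c : ℝ → ℝ × ℝ} {I : Set ℝ} (hcl : Topology.IsClosedEmbedding c)
    (hI : TraceBounded d c I) {φ : PencilL2 d} {b : ℝ → ℂ} (h : HasTrace d c I φ b) :
    trace d c I φ =ᵐ[volume.restrict I] b := by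
  have hex : ∃ b, HasTrace d c I φ b := ⟨b, h⟩
  rw [trace, dif_pos hex]
  exact hex.choose_spec.unique hcl hI h

variable {w : TupleSpace d}

/-- The entries of a tuple in the closure of the test functions are limits of test functions. -/
lemma exists_tendsto_of_mem (hw : w ∈ sobolevTuples d) :
    ∃ (W : ℕ → TupleSpace d) (u : ℕ → ℝ × ℝ → ℂ), (∀ n, IsTupleOf (W n) (u n)) ∧
      Tendsto W atTop (𝓝 w) ∧ TendstoH1 d u (tupleFun d w) (weakDeriv d (1, 0) (tupleFun d w))
        (weakDeriv d (0, 1) (tupleFun d w)) := by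
  obtain ⟨W, hW, hlim⟩ := mem_closure_iff_seq_limit.1
    (show w ∈ closure (testTuples d : Set (TupleSpace d)) from hw)
  choose u hu using hW
  refine ⟨W, u, hu, hlim, fun n => (hu n).contDiff, fun n => (hu n).hasCompactSupport, ?_, ?_, ?_⟩
  · have := ((continuous_subtype_val.comp (tupleFun d).continuous).tendsto w).comp hlim
    refine this.congr fun n => eq_toL2 (hu n).fun_ae
  · rw [weakDeriv_eq (hasWeakDeriv_fst hw)]
    exact (((tupleD₁ d).continuous.tendsto w).comp hlim).congr fun n => eq_toL2 (hu n).d₁_ae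
  · rw [weakDeriv_eq (hasWeakDeriv_snd hw)]
    exact (((tupleD₂ d).continuous.tendsto w).comp hlim).congr fun n => eq_toL2 (hu n).d₂_ae

lemma toL2_coe {α : Type*} [MeasurableSpace α] {μ : Measure α} (φ : Lp ℂ 2 μ) : toL2 μ φ = φ :=
  (eq_toL2 ae_eq_rfl).symm

lemma toL2_neg {α : Type*} [MeasurableSpace α] {μ : Measure α} {f : α → ℂ} (hf : MemLp f 2 μ) :
    toL2 μ (fun x => -f x) = -toL2 μ f := by
  symm
  refine eq_toL2 ?_
  filter_upwards [Lp.coeFn_neg (toL2 μ f), coeFn_toL2 hf] with x h1 h2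
  rw [h1, Pi.neg_apply, h2]

lemma hasTrace_bottom (hw : w ∈ sobolevTuples d) :
    HasTrace d (fun y => (y, 0)) (Icc 0 d) (tupleFun d w : PencilL2 d) (tupleBottom d w) := by
  obtain ⟨W, u, hu, hlim, hH⟩ := exists_tendsto_of_mem hw
  refine (hasTrace_iff isClosedEmbedding_bottom).2 ⟨memH1_of_mem hw, Lp.memLp _, u, hH, ?_⟩
  rw [toL2_coe]
  exact (((tupleBottom d).continuous.tendsto w).comp hlim).congr
    fun n => eq_toL2 (hu n).bottom_ae

lemma hasTrace_left (hw : w ∈ sobolevTuples d) :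
    HasTrace d (fun y => (0, y)) (Icc 0 d) (tupleFun d w : PencilL2 d)
      (fun y => -tupleBottom d w y) := by
  obtain ⟨W, u, hu, hlim, hH⟩ := exists_tendsto_of_mem hw
  refine (hasTrace_iff isClosedEmbedding_left).2
    ⟨memH1_of_mem hw, (Lp.memLp (tupleBottom d w)).neg, u, hH, ?_⟩
  rw [toL2_neg (Lp.memLp _), toL2_coe]
  refine (((tupleBottom d).continuous.tendsto w).comp hlim).neg.congr fun n => ?_
  have e : (fun y : ℝ => u n (0, y)) = fun y => -u n (y, 0) := by
    ext y
    exact (hu n).antisymm (y, 0)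
  rw [e, toL2_neg (memLp_comp_curve (hu n).contDiff.continuous (hu n).hasCompactSupport
    isClosedEmbedding_bottom _)]
  exact congrArg Neg.neg (eq_toL2 (hu n).bottom_ae)

lemma toL2_zero {α : Type*} [MeasurableSpace α] {μ : Measure α} :
    toL2 μ (0 : α → ℂ) = 0 := (eq_toL2 (Lp.coeFn_zero ℂ 2 μ)).symm

lemma hasTrace_side (hw : w ∈ formTuples d) :
    HasTrace d (fun t => (t + d, t)) (Ici 0) (tupleFun d w : PencilL2 d) 0 := by
  obtain ⟨W, u, hu, hlim, hH⟩ := exists_tendsto_of_mem hw.1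
  refine (hasTrace_iff isClosedEmbedding_side).2 ⟨memH1_of_mem hw.1, MemLp.zero, u, hH, ?_⟩
  rw [toL2_zero, ← (mem_formTuples.1 hw).2]
  exact (((tupleSide d).continuous.tendsto w).comp hlim).congr fun n => eq_toL2 (hu n).side_ae

lemma hasTrace_side' (hw : w ∈ formTuples d) :
    HasTrace d (fun t => (t, t + d)) (Ici 0) (tupleFun d w : PencilL2 d) 0 := by
  obtain ⟨W, u, hu, hlim, hH⟩ := exists_tendsto_of_mem hw.1
  refine (hasTrace_iff isClosedEmbedding_side').2 ⟨memH1_of_mem hw.1, MemLp.zero, u, hH, ?_⟩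
  rw [toL2_zero, show (0 : SideL2) = -tupleSide d w by rw [(mem_formTuples.1 hw).2, neg_zero]]
  refine (((tupleSide d).continuous.tendsto w).comp hlim).neg.congr fun n => ?_
  have e : (fun t : ℝ => u n (t, t + d)) = fun t => -u n (t + d, t) := by
    ext t
    exact (hu n).antisymm (t + d, t)
  rw [e, toL2_neg (memLp_comp_curve (hu n).contDiff.continuous (hu n).hasCompactSupport
    isClosedEmbedding_side _)]
  exact congrArg Neg.neg (eq_toL2 (hu n).side_ae)

lemma tupleFun_mem_formDomain (hw : w ∈ formTuples d) : tupleFun d w ∈ formDomain d :=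
  ⟨memH1_of_mem hw.1, hasTrace_side' hw, hasTrace_side hw⟩

lemma traceBottom_ae_eq (hd : 0 < d) (hw : w ∈ sobolevTuples d) :
    traceBottom d (tupleFun d w : PencilL2 d) =ᵐ[volume.restrict (Icc 0 d)] tupleBottom d w :=
  trace_ae_eq isClosedEmbedding_bottom (traceBounded_bottom hd) (hasTrace_bottom hw)

lemma traceLeft_ae_eq (hd : 0 < d) (hw : w ∈ sobolevTuples d) :
    traceLeft d (tupleFun d w : PencilL2 d) =ᵐ[volume.restrict (Icc 0 d)]
      fun y => -tupleBottom d w y :=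
  trace_ae_eq isClosedEmbedding_left (traceBounded_left hd) (hasTrace_left hw)

/-! ### Every function in the form domain is the entry of a tuple -/

lemma memLp_fun_sub {α : Type*} [MeasurableSpace α] {μ : Measure α} {f g : α → ℂ}
    (hf : MemLp f 2 μ) (hg : MemLp g 2 μ) : MemLp (fun x => f x - g x) 2 μ := hf.sub hg

/-- The swap of the two particles on `L²`. -/
def swapL2 (d : ℝ) : PencilL2 d →ₗᵢ[ℂ] PencilL2 d :=
  Lp.compMeasurePreservingₗᵢ ℂ (E := ℂ) (p := 2) (Prod.swap : ℝ × ℝ → ℝ × ℝ)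
    (measurePreserving_swap_pencil d)

lemma swapL2_toL2 {u : ℝ × ℝ → ℂ} (hu : MemLp u 2 (pencilMeasure d)) :
    swapL2 d (toL2 (pencilMeasure d) u) = toL2 (pencilMeasure d) fun p => u p.swap := by
  refine eq_toL2 ?_
  filter_upwards [Lp.coeFn_compMeasurePreserving (toL2 (pencilMeasure d) u)
    (measurePreserving_swap_pencil d),
    (measurePreserving_swap_pencil d).quasiMeasurePreserving.ae (coeFn_toL2 hu)] with p h1 h2
  exact h1.trans h2

lemma swapL2_of_antisymm (φ : antisymmetricL2 d) : swapL2 d (φ : PencilL2 d) = -(φ : PencilL2 d) := by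
  refine Lp.ext ?_
  have h : ∀ᵐ p ∂pencilMeasure d, (φ : PencilL2 d) p = -(φ : PencilL2 d) p.swap := φ.2
  filter_upwards [Lp.coeFn_compMeasurePreserving (φ : PencilL2 d)
    (measurePreserving_swap_pencil d), Lp.coeFn_neg (φ : PencilL2 d), h] with p h1 h2 h3
  refine h1.trans ?_
  rw [h2, Pi.neg_apply, h3, neg_neg]
  rfl

/-- The two traces of a function in the form domain come with two approximating sequences, neither of
which need be antisymmetric. By the trace inequality the first sequence also converges on the other
side, and antisymmetrizing it gives test functions whose tuples converge. -/
lemma exists_tuple_of_mem_formDomain (hd : 0 < d) {φ : antisymmetricL2 d} (hφ : φ ∈ formDomain d) :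
    ∃ w ∈ formTuples d, tupleFun d w = φ := by
  obtain ⟨-, h', h⟩ := hφ
  obtain ⟨-, -, u, hu, hs⟩ := (hasTrace_iff isClosedEmbedding_side).1 h
  obtain ⟨-, -, u', hu', hs'⟩ := (hasTrace_iff isClosedEmbedding_side').1 h'
  rw [toL2_zero] at hs hs'
  have hs2 : Tendsto (fun n => toL2 (volume.restrict (Ici 0)) fun t => u n (t, t + d)) atTop
      (𝓝 0) := by
    have := (hu.tendsto_sub_trace hu' isClosedEmbedding_side' (traceBounded_side' hd)).add hs'
    simpa using this
  -- antisymmetrize the approximating sequence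
  set v : ℕ → ℝ × ℝ → ℂ := fun n p => 2⁻¹ * (u n p - u n p.swap) with hv
  have hdsub : ∀ n, ContDiff ℝ ∞ fun p => u n p - u n p.swap := fun n =>
    (hu.contDiff n).sub (contDiff_swap (hu.contDiff n))
  have hvd : ∀ n, ContDiff ℝ ∞ (v n) := fun n => contDiff_const.mul (hdsub n)
  have hcsub : ∀ n, HasCompactSupport fun p => u n p - u n p.swap := fun n =>
    (hu.hasCompactSupport n).sub (hasCompactSupport_swap (hu.hasCompactSupport n))
  have hvc : ∀ n, HasCompactSupport (v n) := fun n => (hcsub n).mul_left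
  have hva : ∀ n p, v n p.swap = -v n p := by
    intro n p
    simp only [hv, Prod.swap_swap]
    ring
  choose W hW using fun n => exists_isTupleOf (d := d) (hvd n) (hvc n) (hva n)
  have m0 : ∀ n, MemLp (u n) 2 (pencilMeasure d) := fun n =>
    memLp_of_test (hu.contDiff n).continuous (hu.hasCompactSupport n)
  have m1 : ∀ n, MemLp (pd₁ (u n)) 2 (pencilMeasure d) := fun n =>
    memLp_of_test (continuous_pd₁ (hu.contDiff n)) (hasCompactSupport_pd₁ (hu.hasCompactSupport n))
  have m2 : ∀ n, MemLp (pd₂ (u n)) 2 (pencilMeasure d) := fun n =>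
    memLp_of_test (continuous_pd₂ (hu.contDiff n)) (hasCompactSupport_pd₂ (hu.hasCompactSupport n))
  have ms : ∀ {f : ℝ × ℝ → ℂ}, MemLp f 2 (pencilMeasure d) →
      MemLp (fun p : ℝ × ℝ => f p.swap) 2 (pencilMeasure d) := fun hf =>
    hf.comp_measurePreserving (measurePreserving_swap_pencil d)
  have e0 : ∀ n, (tupleFun d (W n) : PencilL2 d) = (2⁻¹ : ℂ) • (toL2 (pencilMeasure d) (u n)
      - swapL2 d (toL2 (pencilMeasure d) (u n))) := by
    intro n
    rw [eq_toL2 (hW n).fun_ae, swapL2_toL2 (m0 n), ← toL2_sub (m0 n) (ms (m0 n)),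
      ← toL2_const_mul _ (memLp_fun_sub (m0 n) (ms (m0 n)))]
  have e1 : ∀ n, tupleD₁ d (W n) = (2⁻¹ : ℂ) • (toL2 (pencilMeasure d) (pd₁ (u n))
      - swapL2 d (toL2 (pencilMeasure d) (pd₂ (u n)))) := by
    intro n
    rw [eq_toL2 (hW n).d₁_ae, swapL2_toL2 (m2 n), ← toL2_sub (m1 n) (ms (m2 n)),
      ← toL2_const_mul _ (memLp_fun_sub (m1 n) (ms (m2 n)))]
    congr 1
    ext p
    rw [IsTupleOf.pd₁_const_mul (hdsub n), pd₁_sub (hu.contDiff n) (contDiff_swap (hu.contDiff n))]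
    simp only [pd₁_swap (hu.contDiff n)]
  have e2 : ∀ n, tupleD₂ d (W n) = (2⁻¹ : ℂ) • (toL2 (pencilMeasure d) (pd₂ (u n))
      - swapL2 d (toL2 (pencilMeasure d) (pd₁ (u n)))) := by
    intro n
    rw [eq_toL2 (hW n).d₂_ae, swapL2_toL2 (m1 n), ← toL2_sub (m2 n) (ms (m1 n)),
      ← toL2_const_mul _ (memLp_fun_sub (m2 n) (ms (m1 n)))]
    congr 1
    ext p
    rw [IsTupleOf.pd₂_const_mul (hdsub n), pd₂_sub (hu.contDiff n) (contDiff_swap (hu.contDiff n))]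
    simp only [pd₂_swap (hu.contDiff n)]
  have e3 : ∀ n, tupleSide d (W n) = (2⁻¹ : ℂ) • (toL2 (volume.restrict (Ici 0))
      (fun t => u n (t + d, t)) - toL2 (volume.restrict (Ici 0)) fun t => u n (t, t + d)) := by
    intro n
    have n1 := memLp_comp_curve (hu.contDiff n).continuous (hu.hasCompactSupport n)
      (isClosedEmbedding_side (d := d)) (Ici 0)
    have n2 := memLp_comp_curve (hu.contDiff n).continuous (hu.hasCompactSupport n)
      (isClosedEmbedding_side' (d := d)) (Ici 0)
    rw [eq_toL2 (hW n).side_ae, ← toL2_sub n1 n2, ← toL2_const_mul _ (memLp_fun_sub n1 n2)]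
    rfl
  have l0 : Tendsto (fun n => (tupleFun d (W n) : PencilL2 d)) atTop (𝓝 φ) := by
    have := (hu.tendsto_fun.sub (((swapL2 d).continuous.tendsto _).comp hu.tendsto_fun)).const_smul
      (2⁻¹ : ℂ)
    rw [swapL2_of_antisymm, sub_neg_eq_add, ← two_smul ℂ, smul_smul] at this
    simp only [ne_eq, OfNat.ofNat_ne_zero, not_false_eq_true, inv_mul_cancel₀, one_smul] at this
    exact this.congr fun n => (e0 n).symm
  have l1 := ((hu.tendsto_pd₁.sub (((swapL2 d).continuous.tendsto _).comp
    hu.tendsto_pd₂)).const_smul (2⁻¹ : ℂ)).congr fun n => (e1 n).symm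
  have l2 := ((hu.tendsto_pd₂.sub (((swapL2 d).continuous.tendsto _).comp
    hu.tendsto_pd₁)).const_smul (2⁻¹ : ℂ)).congr fun n => (e2 n).symm
  have l3 : Tendsto (fun n => tupleSide d (W n)) atTop (𝓝 0) := by
    have := (hs.sub hs2).const_smul (2⁻¹ : ℂ)
    simp only [sub_zero, smul_zero] at this
    exact this.congr fun n => (e3 n).symm
  -- the tuples form a Cauchy sequence since their norm is controlled by the `H¹` norm
  obtain ⟨K, hK, hle⟩ := norm_sq_le_of_mem_sobolevTuples hd
  have hcau : CauchySeq W := by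
    have c0 := l0.cauchySeq
    have c1 := l1.cauchySeq
    have c2 := l2.cauchySeq
    rw [cauchySeq_iff_tendsto_dist_atTop_0] at c0 c1 c2 ⊢
    have hsum := (((c0.pow 2).add ((c1.pow 2).add (c2.pow 2))).const_mul K).sqrt
    simp only [ne_eq, OfNat.ofNat_ne_zero, not_false_eq_true, zero_pow, add_zero, mul_zero,
      Real.sqrt_zero] at hsum
    refine squeeze_zero (fun _ => dist_nonneg) (fun n => ?_) hsum
    have hmem : W n.1 - W n.2 ∈ sobolevTuples d :=
      Submodule.sub_mem _ (Submodule.le_topologicalClosure _ ⟨_, hW n.1⟩)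
        (Submodule.le_topologicalClosure _ ⟨_, hW n.2⟩)
    have := hle _ hmem
    refine Real.le_sqrt_of_sq_le ?_
    rw [dist_eq_norm, dist_eq_norm, dist_eq_norm, dist_eq_norm]
    rw [tupleEnergy, map_sub, map_sub, map_sub, Submodule.coe_norm, Submodule.coe_sub] at this
    exact this
  obtain ⟨w, hw⟩ := cauchySeq_tendsto_of_complete hcau
  refine ⟨w, mem_formTuples.2 ⟨?_, ?_⟩, ?_⟩
  · exact (Submodule.isClosed_topologicalClosure _).mem_of_tendsto hw
      (Eventually.of_forall fun n => Submodule.le_topologicalClosure _ ⟨_, hW n⟩)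
  · exact tendsto_nhds_unique (((tupleSide d).continuous.tendsto w).comp hw) l3
  · refine Subtype.ext (tendsto_nhds_unique
      (((continuous_subtype_val.comp (tupleFun d).continuous).tendsto w).comp hw) l0)

end Traces

/-! ### The operator of the quadratic form -/

section Hamiltonian

variable {d : ℝ}

/-- Multiplication by a bounded real function on the bottom side. -/
lemma exists_multiplication {σ : ℝ → ℝ} (hσ : MemLp σ ∞ (volume.restrict (Ici (0 : ℝ)))) :
    ∃ T : BottomL2 d →L[ℂ] BottomL2 d,
      ∀ b, T b =ᵐ[volume.restrict (Icc 0 d)] fun y => (σ y : ℂ) * b y := by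
  have h1 : MemLp σ ∞ (volume.restrict (Icc 0 d)) :=
    hσ.mono_measure (Measure.restrict_mono Icc_subset_Ici_self le_rfl)
  have h2 : MemLp (fun y => (σ y : ℂ)) ∞ (volume.restrict (Icc 0 d)) := h1.ofReal
  refine ⟨(ContinuousLinearMap.mul ℂ ℂ).holderL (volume.restrict (Icc 0 d)) ∞ 2 2 h2.toLp,
    fun b => ?_⟩
  have h3 := (ContinuousLinearMap.mul ℂ ℂ).coeFn_holder (r := 2) h2.toLp b
  filter_upwards [h3, h2.coeFn_toLp] with y hy hy2
  rw [ContinuousLinearMap.holderL_apply_apply, hy, hy2]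
  rfl

lemma inner_multiplication {σ : ℝ → ℝ} {T : BottomL2 d →L[ℂ] BottomL2 d}
    (hT : ∀ b, T b =ᵐ[volume.restrict (Icc 0 d)] fun y => (σ y : ℂ) * b y) (b c : BottomL2 d) :
    inner ℂ (T b) c = ∫ y in Icc 0 d, (σ y : ℂ) * (conj (b y) * c y) := by
  rw [L2.inner_def]
  refine integral_congr_ae ?_
  filter_upwards [hT b] with y hy
  rw [hy]
  simp
  ring

lemma inner_multiplication_comm {σ : ℝ → ℝ} {T : BottomL2 d →L[ℂ] BottomL2 d}
    (hT : ∀ b, T b =ᵐ[volume.restrict (Icc 0 d)] fun y => (σ y : ℂ) * b y) (b c : BottomL2 d) :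
    inner ℂ (T b) c = inner ℂ b (T c) := by
  rw [inner_multiplication hT, L2.inner_def]
  refine integral_congr_ae ?_
  filter_upwards [hT c] with y hy
  rw [hy]
  simp
  ring

/-- The function of a tuple in the form domain. -/
def formFun (d : ℝ) : formTuples d →L[ℂ] antisymmetricL2 d := (tupleFun d).comp (formTuples d).subtypeL

/-- The sesquilinear form of the Hamiltonian, on tuples. -/
def tupleForm (a : ℝ) (T : BottomL2 d →L[ℂ] BottomL2 d) (w w' : TupleSpace d) : ℂ :=
  (a : ℂ) * (inner ℂ (tupleD₁ d w) (tupleD₁ d w') + inner ℂ (tupleD₂ d w) (tupleD₂ d w'))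
    - 2 * inner ℂ (T (tupleBottom d w)) (tupleBottom d w')

/-- The bounded operator on the space of tuples that represents the form. -/
lemma exists_operator (a : ℝ) (T : BottomL2 d →L[ℂ] BottomL2 d) :
    ∃ B : formTuples d →L[ℂ] formTuples d, ∀ w w' : formTuples d,
      inner ℂ (B w) w' = tupleForm a T w w' := by
  let G₁ := (tupleD₁ d).comp (formTuples d).subtypeL
  let G₂ := (tupleD₂ d).comp (formTuples d).subtypeL
  let b := (tupleBottom d).comp (formTuples d).subtypeL
  refine ⟨(a : ℂ) • (G₁.adjoint.comp G₁ + G₂.adjoint.comp G₂)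
    - (2 : ℂ) • b.adjoint.comp (T.comp b), fun w w' => ?_⟩
  simp only [sub_apply, smul_apply,
    add_apply, ContinuousLinearMap.comp_apply, inner_sub_left, inner_smul_left,
    inner_add_left, ContinuousLinearMap.adjoint_inner_left, Complex.conj_ofReal, map_ofNat]
  rfl

lemma tupleForm_symm (a : ℝ) {σ : ℝ → ℝ} {T : BottomL2 d →L[ℂ] BottomL2 d}
    (hT : ∀ b, T b =ᵐ[volume.restrict (Icc 0 d)] fun y => (σ y : ℂ) * b y) (w w' : TupleSpace d) :
    tupleForm a T w w' = conj (tupleForm a T w' w) := by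
  unfold tupleForm
  rw [map_sub, map_mul, map_mul, map_add, inner_conj_symm, inner_conj_symm, inner_conj_symm,
    Complex.conj_ofReal, map_ofNat, inner_multiplication_comm hT]

lemma tupleForm_self_re (a : ℝ) (T : BottomL2 d →L[ℂ] BottomL2 d) (w : TupleSpace d) :
    (tupleForm a T w w).re
      = a * tupleEnergy w - 2 * (inner ℂ (T (tupleBottom d w)) (tupleBottom d w)).re := by
  unfold tupleForm tupleEnergy
  rw [inner_self_eq_norm_sq_to_K, inner_self_eq_norm_sq_to_K]
  have : (a : ℂ) * (((‖tupleD₁ d w‖ : ℝ) : ℂ) ^ 2 + ((‖tupleD₂ d w‖ : ℝ) : ℂ) ^ 2)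
      = ((a * (‖tupleD₁ d w‖ ^ 2 + ‖tupleD₂ d w‖ ^ 2) : ℝ) : ℂ) := by push_cast; ring
  rw [Complex.sub_re]
  have h2 : ((2 : ℂ) * inner ℂ (T (tupleBottom d w)) (tupleBottom d w)).re
      = 2 * (inner ℂ (T (tupleBottom d w)) (tupleBottom d w)).re := by simp
  rw [h2]
  congr 1
  exact (congrArg Complex.re this).trans (Complex.ofReal_re _)

lemma tupleForm_self_re_ge (a : ℝ) (T : BottomL2 d →L[ℂ] BottomL2 d) (w : TupleSpace d) :
    a * tupleEnergy w - 2 * ‖T‖ * ‖tupleBottom d w‖ ^ 2 ≤ (tupleForm a T w w).re := by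
  rw [tupleForm_self_re]
  have h1 := Complex.re_le_norm (inner ℂ (T (tupleBottom d w)) (tupleBottom d w))
  have h2 := norm_inner_le_norm (𝕜 := ℂ) (T (tupleBottom d w)) (tupleBottom d w)
  have h3 := mul_le_mul_of_nonneg_right (T.le_opNorm (tupleBottom d w))
    (norm_nonneg (tupleBottom d w))
  nlinarith

lemma pairForm_eq_tupleForm (hd : 0 < d) {hbar mₑ : ℝ} {σ : ℝ → ℝ} {T : BottomL2 d →L[ℂ] BottomL2 d}
    (hT : ∀ b, T b =ᵐ[volume.restrict (Icc 0 d)] fun y => (σ y : ℂ) * b y)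
    {w w' : TupleSpace d} (hw : w ∈ sobolevTuples d) (hw' : w' ∈ sobolevTuples d) :
    pairForm hbar mₑ d σ (tupleFun d w) (tupleFun d w')
      = tupleForm (hbar ^ 2 / (2 * mₑ)) T w w' := by
  unfold pairForm tupleForm
  rw [weakDeriv_eq (hasWeakDeriv_fst hw), weakDeriv_eq (hasWeakDeriv_fst hw'),
    weakDeriv_eq (hasWeakDeriv_snd hw), weakDeriv_eq (hasWeakDeriv_snd hw'),
    inner_multiplication hT, ← integral_const_mul]
  congr 1
  refine integral_congr_ae ?_
  filter_upwards [traceBottom_ae_eq hd hw, traceBottom_ae_eq hd hw', traceLeft_ae_eq hd hw,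
    traceLeft_ae_eq hd hw'] with y h1 h2 h3 h4
  rw [h1, h2, h3, h4, map_neg]
  ring

/-- The interaction is form bounded with respect to the Laplacian with relative bound zero, so the
form is bounded from below and closed. -/
lemma exists_coercive (hd : 0 < d) {a : ℝ} (ha : 0 < a) (T : BottomL2 d →L[ℂ] BottomL2 d) :
    ∃ c κ : ℝ, 0 < κ ∧ ∀ w ∈ sobolevTuples d,
      κ * ‖w‖ ^ 2 ≤ (tupleForm a T w w).re + c * ‖tupleFun d w‖ ^ 2 := by
  obtain ⟨K, hK, hle⟩ := norm_sq_le_of_mem_sobolevTuples hd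
  set ε := a / (4 * (‖T‖ + 1)) with hε
  have hT := norm_nonneg T
  have hε0 : 0 < ε := by positivity
  have hTε : 2 * ‖T‖ * ε ≤ a / 2 := by
    rw [hε, ← mul_div_assoc, div_le_div_iff₀ (by positivity) (by positivity)]
    nlinarith
  refine ⟨a / 2 + 2 * ‖T‖ * (2 * (d⁻¹ + ε⁻¹)), a / 2 / K, by positivity, fun w hw => ?_⟩
  have h1 := tupleForm_self_re_ge a T w
  have h2 := bottom_le_tupleEnergy hd hε0 hw
  have h3 := hle w hw
  have h4 : a / 2 / K * ‖w‖ ^ 2 ≤ a / 2 * (‖tupleFun d w‖ ^ 2 + tupleEnergy w) := by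
    have := mul_le_mul_of_nonneg_left h3 (by positivity : 0 ≤ a / 2 / K)
    refine this.trans_eq ?_
    field_simp
  have h5 := mul_le_mul_of_nonneg_left h2 (by positivity : 0 ≤ 2 * ‖T‖)
  have h6 := mul_le_mul_of_nonneg_right hTε (tupleEnergy_nonneg w)
  linarith

/-- A tuple is determined by its function: the derivatives are weak derivatives, and they control the
boundary values. -/
lemma injective_formFun (hd : 0 < d) : Function.Injective (formFun d) := by
  rw [injective_iff_map_eq_zero]
  intro w h0
  obtain ⟨K, hK, hle⟩ := norm_sq_le_of_mem_sobolevTuples hd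
  have hw := w.2.1
  have h0' : tupleFun d (w : TupleSpace d) = 0 := h0
  have hz : ∀ v, HasWeakDeriv d v (0 : PencilL2 d) 0 := by
    intro v ψ _ _ _
    have e : ∀ h : ℝ × ℝ → ℂ, ∫ p in pencil d, (0 : PencilL2 d) p * h p = 0 := by
      intro h
      rw [← integral_zero (ℝ × ℝ) ℂ (μ := pencilMeasure d)]
      refine integral_congr_ae ?_
      filter_upwards [Lp.coeFn_zero ℂ 2 (pencilMeasure d)] with p hp
      rw [hp]
      simp
    rw [e, e, neg_zero]
  have d1 := hasWeakDeriv_fst hw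
  have d2 := hasWeakDeriv_snd hw
  rw [h0'] at d1 d2
  have e1 : tupleD₁ d (w : TupleSpace d) = 0 := d1.unique (hz _)
  have e2 : tupleD₂ d (w : TupleSpace d) = 0 := d2.unique (hz _)
  have := hle w hw
  rw [tupleEnergy, e1, e2, h0'] at this
  simp only [norm_zero, ne_eq, OfNat.ofNat_ne_zero, not_false_eq_true, zero_pow, add_zero,
    mul_zero] at this
  have h1 : ‖(w : TupleSpace d)‖ = 0 := by
    have := le_antisymm this (sq_nonneg _)
    exact pow_eq_zero_iff (by norm_num) |>.1 this
  exact Subtype.ext (norm_eq_zero.1 h1)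

/-- Density of the form domain: it contains the antisymmetrized test functions supported in the
interior of the pencil. -/
lemma denseRange_formFun : DenseRange (formFun d) := by
  have hd : (LinearMap.range (formFun d : formTuples d →ₗ[ℂ] antisymmetricL2 d)).topologicalClosure
      = ⊤ := by
    rw [Submodule.topologicalClosure_eq_top_iff, Submodule.eq_bot_iff]
    intro f hf
    rw [Submodule.mem_orthogonal'] at hf
    have h0 : (f : PencilL2 d) = 0 := by
      refine eq_zero_of_integral_mul_eq_zero fun ψ hψ hc hs => ?_
      have hψ' : ContDiff ℝ ∞ fun p => (ψ p : ℂ) := Complex.ofRealCLM.contDiff.comp hψ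
      have hc' : HasCompactSupport fun p => (ψ p : ℂ) := hc.comp_left (g := Complex.ofReal) rfl
      have hv : ContDiff ℝ ∞ fun p => (ψ p : ℂ) - ψ p.swap := hψ'.sub (contDiff_swap hψ')
      have hvc : HasCompactSupport fun p => (ψ p : ℂ) - ψ p.swap :=
        hc'.sub (hasCompactSupport_swap hc')
      obtain ⟨w, hw⟩ := exists_isTupleOf (d := d) hv hvc (fun p => by simp)
      -- `ψ` vanishes on the boundary of the pencil
      have hzero : ∀ p : ℝ × ℝ, |p.1 - p.2| = d → ψ p = 0 := by
        intro p hp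
        refine image_eq_zero_of_notMem_tsupport fun hmem => ?_
        have hint := hs hmem
        rw [mem_interior_iff_mem_nhds, Metric.mem_nhds_iff] at hint
        obtain ⟨ε, hε, hball⟩ := hint
        rcases abs_cases (p.1 - p.2) with ⟨h1, -⟩ | ⟨h1, -⟩
        · have : (p.1 + ε / 2, p.2) ∈ pencil d := hball (by
            rw [Metric.mem_ball, Prod.dist_eq]
            simp [abs_of_pos hε, hε])
          have h2 := (le_abs_self _).trans this.2.2
          simp only at h2
          linarith
        · have : (p.1, p.2 + ε / 2) ∈ pencil d := hball (by
            rw [Metric.mem_ball, Prod.dist_eq]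
            simp [abs_of_pos hε, hε])
          have h2 := (neg_abs_le _).trans' (neg_le_neg this.2.2)
          simp only at h2
          linarith
      have hmem : w ∈ formTuples d := by
        refine mem_formTuples.2 ⟨Submodule.le_topologicalClosure _ ⟨_, hw⟩, ?_⟩
        rw [Lp.eq_zero_iff_ae_eq_zero]
        filter_upwards [hw.side_ae] with t ht
        rw [ht]
        by_cases hd0 : 0 ≤ d
        · rw [hzero (t + d, t) (by simp [abs_of_nonneg hd0]),
            Prod.swap_prod_mk, hzero (t, t + d) (by simp [abs_of_nonneg hd0])]
          simp
        · have hemp : ∀ p : ℝ × ℝ, ψ p = 0 := fun p =>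
            image_eq_zero_of_notMem_tsupport fun hm =>
              hd0 ((abs_nonneg _).trans (interior_subset (hs hm)).2.2)
          simp [hemp]
      have h1 : inner ℂ (f : PencilL2 d) (tupleFun d w : PencilL2 d) = (0 : ℂ) :=
        hf _ ⟨⟨w, hmem⟩, rfl⟩
      rw [← inner_conj_symm, map_eq_zero, L2.inner_def] at h1
      have h2 : ∫ p in pencil d, (f : PencilL2 d) p * ((ψ p : ℂ) - ψ p.swap) = 0 := by
        rw [← h1]
        refine integral_congr_ae ?_
        filter_upwards [hw.fun_ae] with p hp
        rw [hp]
        simp [mul_comm]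
      have i1 := integrable_mul_test (f : PencilL2 d) hψ'.continuous hc'
      have i2 := integrable_mul_test (f : PencilL2 d) (contDiff_swap hψ').continuous
        (hasCompactSupport_swap hc')
      have h3 : ∫ p in pencil d, (f : PencilL2 d) p * (ψ p.swap : ℂ)
          = -∫ p in pencil d, (f : PencilL2 d) p * (ψ p : ℂ) := by
        have hs := setIntegral_swap (pencil d) (fun p => (f : PencilL2 d) p * (ψ p : ℂ))
        rw [swap_preimage_pencil] at hs
        rw [← hs, ← integral_neg]
        refine integral_congr_ae ?_
        have ha : ∀ᵐ p ∂pencilMeasure d, (f : PencilL2 d) p = -(f : PencilL2 d) p.swap := f.2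
        filter_upwards [ha] with p hp
        rw [hp]
        ring
      have h4 : ∫ p in pencil d, (f : PencilL2 d) p * ((ψ p : ℂ) - ψ p.swap)
          = (∫ p in pencil d, (f : PencilL2 d) p * (ψ p : ℂ))
            - ∫ p in pencil d, (f : PencilL2 d) p * (ψ p.swap : ℂ) := by
        rw [← integral_sub i1 i2]
        refine integral_congr_ae (ae_of_all _ fun p => ?_)
        simp only
        ring
      rw [h4, h3, sub_neg_eq_add, ← two_mul] at h2
      simpa using h2
    exact Subtype.ext h0
  intro x
  have : x ∈ (LinearMap.range (formFun d : formTuples d →ₗ[ℂ] antisymmetricL2 d)).topologicalClosure :=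
    hd ▸ Submodule.mem_top
  exact this

/-- Existence of the Hamiltonian, together with the description of its graph by tuples. -/
lemma exists_isPairHamiltonian (hd : 0 < d) {hbar mₑ : ℝ} (hhbar : 0 < hbar) (hmₑ : 0 < mₑ)
    {σ : ℝ → ℝ} {T : BottomL2 d →L[ℂ] BottomL2 d}
    (hT : ∀ b, T b =ᵐ[volume.restrict (Icc 0 d)] fun y => (σ y : ℂ) * b y)
    {B : formTuples d →L[ℂ] formTuples d}
    (hB : ∀ w w' : formTuples d, inner ℂ (B w) w' = tupleForm (hbar ^ 2 / (2 * mₑ)) T w w') :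
    ∃ A : antisymmetricL2 d →ₗ.[ℂ] antisymmetricL2 d, IsPairHamiltonian hbar mₑ d σ A ∧
      ∀ φ f, (φ, f) ∈ A.graph ↔ ∃ u, formFun d u = φ ∧
        ∀ v, inner ℂ (B u) v = inner ℂ f (formFun d v) := by
  have hBs : IsSelfAdjoint B := by
    rw [ContinuousLinearMap.isSelfAdjoint_iff_isSymmetric]
    intro u v
    change inner ℂ (B u) v = inner ℂ u (B v)
    rw [← inner_conj_symm u (B v), hB, hB, tupleForm_symm _ hT]
  obtain ⟨c, κ, hκ, hco⟩ := exists_coercive hd (by positivity : 0 < hbar ^ 2 / (2 * mₑ)) T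
  obtain ⟨A, hA, hgraph⟩ := exists_isSelfAdjoint_of_form (formFun d) (injective_formFun hd)
    denseRange_formFun B hBs c κ hκ (fun u => by
      rw [hB]
      exact hco u u.2.1)
  refine ⟨A, ⟨hA, fun φ f => ?_⟩, hgraph⟩
  rw [hgraph]
  constructor
  · rintro ⟨u, rfl, hu⟩
    refine ⟨tupleFun_mem_formDomain u.2, fun ψ hψ => ?_⟩
    obtain ⟨w, hw, rfl⟩ := exists_tuple_of_mem_formDomain hd hψ
    have := hu ⟨w, hw⟩
    rw [hB] at this
    rw [show formFun d u = tupleFun d (u : TupleSpace d) from rfl,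
      pairForm_eq_tupleForm hd hT u.2.1 hw.1]
    exact this
  · rintro ⟨hφ, h⟩
    obtain ⟨u, hu, rfl⟩ := exists_tuple_of_mem_formDomain hd hφ
    refine ⟨⟨u, hu⟩, rfl, fun v => ?_⟩
    have := h _ (tupleFun_mem_formDomain v.2)
    rw [pairForm_eq_tupleForm hd hT hu.1 v.2.1] at this
    rw [hB]
    exact this

end Hamiltonian

/-! ### The spectrum below the threshold -/

section BelowThreshold

variable {d a : ℝ} {T : BottomL2 d →L[ℂ] BottomL2 d} {B : formTuples d →L[ℂ] formTuples d}
  {A : antisymmetricL2 d →ₗ.[ℂ] antisymmetricL2 d}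

/-- The quadratic form of the operator, evaluated by tuples. -/
lemma exists_tuple_of_domain
    (hB : ∀ w w' : formTuples d, inner ℂ (B w) w' = tupleForm a T w w')
    (hA : ∀ φ f, (φ, f) ∈ A.graph ↔ ∃ u, formFun d u = φ ∧
      ∀ v, inner ℂ (B u) v = inner ℂ f (formFun d v)) (φ : A.domain) :
    ∃ w ∈ formTuples d, tupleFun d w = φ ∧
      (inner ℂ (A φ) (φ : antisymmetricL2 d)).re = (tupleForm a T w w).re := by
  obtain ⟨u, hu, h⟩ := (hA _ _).1 (LinearPMap.mem_graph A φ)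
  refine ⟨u, u.2, hu, ?_⟩
  rw [← hB, h u, hu]

/-- Below the threshold, the form of the Hamiltonian is bounded from below up to finitely many
functionals. -/
lemma exists_finite_rank_bound (hd : 0 < d) (ha : 0 < a)
    (hB : ∀ w w' : formTuples d, inner ℂ (B w) w' = tupleForm a T w w')
    (hA : ∀ φ f, (φ, f) ∈ A.graph ↔ ∃ u, formFun d u = φ ∧
      ∀ v, inner ℂ (B u) v = inner ℂ f (formFun d v))
    {E : ℝ} (hE : E < a * (2 * (Real.pi / d) ^ 2)) :
    ∃ (n : ℕ) (ℓ : antisymmetricL2 d →L[ℂ] (Fin n → ℂ)) (C : ℝ), ∀ φ : A.domain,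
      E * ‖(φ : antisymmetricL2 d)‖ ^ 2
        ≤ (inner ℂ (A φ) (φ : antisymmetricL2 d)).re + C * ‖ℓ φ‖ ^ 2 := by
  set K := Real.sqrt (max E 0 / (2 * a)) with hK
  have hK2 : K ^ 2 = max E 0 / (2 * a) := Real.sq_sqrt (by positivity)
  have hKd : K * d < Real.pi := by
    rw [← lt_div_iff₀ hd]
    refine lt_of_pow_lt_pow_left₀ 2 (by positivity) ?_
    rw [hK2, div_lt_iff₀ (by positivity)]
    have : max E 0 < a * (2 * (Real.pi / d) ^ 2) := max_lt hE (by positivity)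
    linarith
  obtain ⟨n, ℓ, C, h⟩ := mass_add_bottom_le_tupleEnergy hd (Real.sqrt_nonneg _) hKd
    (by positivity : 0 ≤ 2 * ‖T‖ / a)
  refine ⟨n, ℓ, a * C, fun φ => ?_⟩
  obtain ⟨w, hw, hwφ, hre⟩ := exists_tuple_of_domain hB hA φ
  rw [hre, ← hwφ]
  have h1 := mul_le_mul_of_nonneg_left (h w hw) ha.le
  have h2 := tupleForm_self_re_ge a T w
  have h3 : a * (2 * K ^ 2) = max E 0 := by rw [hK2]; field_simp
  have h4 : E * ‖tupleFun d w‖ ^ 2 ≤ a * (2 * K ^ 2) * ‖tupleFun d w‖ ^ 2 := by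
    rw [h3]
    exact mul_le_mul_of_nonneg_right (le_max_left _ _) (sq_nonneg _)
  have h5 : a * (2 * ‖T‖ / a * ‖tupleBottom d w‖ ^ 2) = 2 * ‖T‖ * ‖tupleBottom d w‖ ^ 2 := by
    field_simp
  rw [mul_add, h5] at h1
  linarith

/-- Without interaction, one functional suffices. -/
lemma exists_rank_one_bound (hd : 0 < d) (ha : 0 < a)
    (hB : ∀ w w' : formTuples d,
      inner ℂ (B w) w' = tupleForm a (0 : BottomL2 d →L[ℂ] BottomL2 d) w w')
    (hA : ∀ φ f, (φ, f) ∈ A.graph ↔ ∃ u, formFun d u = φ ∧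
      ∀ v, inner ℂ (B u) v = inner ℂ f (formFun d v))
    {E : ℝ} (hE : E < a * (2 * (Real.pi / d) ^ 2)) :
    ∃ (ℓ : antisymmetricL2 d →L[ℂ] ℂ) (C : ℝ), ∀ φ : A.domain,
      E * ‖(φ : antisymmetricL2 d)‖ ^ 2
        ≤ (inner ℂ (A φ) (φ : antisymmetricL2 d)).re + C * ‖ℓ φ‖ ^ 2 := by
  set K := Real.sqrt (max E 0 / (2 * a)) with hK
  have hK2 : K ^ 2 = max E 0 / (2 * a) := Real.sq_sqrt (by positivity)
  have hKd : K * d < Real.pi := by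
    rw [← lt_div_iff₀ hd]
    refine lt_of_pow_lt_pow_left₀ 2 (by positivity) ?_
    rw [hK2, div_lt_iff₀ (by positivity)]
    have : max E 0 < a * (2 * (Real.pi / d) ^ 2) := max_lt hE (by positivity)
    linarith
  obtain ⟨ℓ, C, h⟩ := mass_le_tupleEnergy_add_mean hd (Real.sqrt_nonneg _) hKd
  refine ⟨ℓ, a * C, fun φ => ?_⟩
  obtain ⟨w, hw, hwφ, hre⟩ := exists_tuple_of_domain hB hA φ
  rw [hre, ← hwφ]
  have h1 := mul_le_mul_of_nonneg_left (h w hw) ha.le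
  have h2 := tupleForm_self_re a 0 w
  simp only [zero_apply, inner_zero_left, Complex.zero_re, mul_zero, sub_zero] at h2
  have h3 : a * (2 * K ^ 2) = max E 0 := by rw [hK2]; field_simp
  have h4 : E * ‖tupleFun d w‖ ^ 2 ≤ a * (2 * K ^ 2) * ‖tupleFun d w‖ ^ 2 := by
    rw [h3]
    exact mul_le_mul_of_nonneg_right (le_max_left _ _) (sq_nonneg _)
  rw [h2]
  linarith

/-- Without interaction, the infimum of the form is the only point of the discrete spectrum, and
it is a simple eigenvalue, provided that it lies below the threshold. -/
lemma discreteSpectrum_eq_singleton (hd : 0 < d) (ha : 0 < a)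
    (hB : ∀ w w' : formTuples d,
      inner ℂ (B w) w' = tupleForm a (0 : BottomL2 d →L[ℂ] BottomL2 d) w w')
    (hA : ∀ φ f, (φ, f) ∈ A.graph ↔ ∃ u, formFun d u = φ ∧
      ∀ v, inner ℂ (B u) v = inner ℂ f (formFun d v))
    (hsa : IsSelfAdjoint A)
    (hess : essentialSpectrum A = Complex.ofReal '' Ici (a * (2 * (Real.pi / d) ^ 2)))
    {Λ : ℝ} (hΛ : Λ < a * (2 * (Real.pi / d) ^ 2))
    (htrial : ∃ w ∈ formTuples d, tupleFun d w ≠ 0 ∧ a * tupleEnergy w ≤ Λ * ‖tupleFun d w‖ ^ 2) :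
    ∃ E₀ : ℝ, discreteSpectrum A = {(E₀ : ℂ)} ∧ Module.finrank ℂ (eigenspace A (E₀ : ℂ)) = 1 ∧
      a * (2 * (Real.pi / (2 * d)) ^ 2) ≤ E₀ ∧ E₀ ≤ Λ := by
  have hre : ∀ u : formTuples d, (inner ℂ (B u) u).re = a * tupleEnergy (u : TupleSpace d) := by
    intro u
    rw [hB, tupleForm_self_re]
    simp
  set S : Set ℝ := {x | ∃ u : formTuples d, ‖formFun d u‖ = 1 ∧ x = (inner ℂ (B u) u).re} with hS
  have hnormalize : ∀ u : formTuples d, formFun d u ≠ 0 →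
      (inner ℂ (B u) u).re / ‖formFun d u‖ ^ 2 ∈ S := by
    intro u hu
    have hn : ‖formFun d u‖ ≠ 0 := norm_ne_zero_iff.2 hu
    refine ⟨((‖formFun d u‖⁻¹ : ℝ) : ℂ) • u, ?_, ?_⟩
    · rw [map_smul, norm_smul, Complex.norm_real, norm_inv, norm_norm, inv_mul_cancel₀ hn]
    · rw [map_smul, inner_smul_left, inner_smul_right, Complex.conj_ofReal, Complex.re_ofReal_mul,
        Complex.re_ofReal_mul]
      field_simp
  have hlow : ∀ x ∈ S, a * (2 * (Real.pi / (2 * d)) ^ 2) ≤ x := by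
    rintro x ⟨u, hu, rfl⟩
    have h1 := mul_le_mul_of_nonneg_left (mass_le_tupleEnergy hd u.2.1) ha.le
    rw [hre]
    have hu' : ‖tupleFun d (u : TupleSpace d)‖ = 1 := hu
    rw [hu'] at h1
    linarith
  have hbdd : BddBelow S := ⟨_, hlow⟩
  obtain ⟨w, hw, hw0, hwΛ⟩ := htrial
  have hmemw := hnormalize ⟨w, hw⟩ hw0
  have hne : S.Nonempty := ⟨_, hmemw⟩
  set E₀ := sInf S with hE₀
  have hE₀low : a * (2 * (Real.pi / (2 * d)) ^ 2) ≤ E₀ := le_csInf hne hlow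
  have hE₀Λ : E₀ ≤ Λ := by
    refine (csInf_le hbdd hmemw).trans ?_
    have hn : 0 < ‖tupleFun d w‖ := norm_pos_iff.2 hw0
    rw [hre]
    change a * tupleEnergy w / ‖tupleFun d w‖ ^ 2 ≤ Λ
    rw [div_le_iff₀ (by positivity)]
    exact hwΛ
  have hBs : ∀ u v : formTuples d, inner ℂ (B u) v = inner ℂ u (B v) := by
    intro u v
    rw [← inner_conj_symm u (B v), hB, hB, tupleForm_symm (σ := fun _ => 0)]
    intro b
    filter_upwards [Lp.coeFn_zero ℂ 2 (volume.restrict (Icc 0 d))] with y hy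
    rw [zero_apply, hy]
    simp
  have hspec : (E₀ : ℂ) ∈ spec A := by
    refine mem_spec_of_form_inf hBs hA (fun u => ?_) (fun ε hε => ?_)
    · by_cases hu : formFun d u = 0
      · rw [hu, hre, norm_zero]
        have := mul_nonneg ha.le (tupleEnergy_nonneg (u : TupleSpace d))
        simpa using this
      · have hn : 0 < ‖formFun d u‖ := norm_pos_iff.2 hu
        have h1 := csInf_le hbdd (hnormalize u hu)
        rw [le_div_iff₀ (by positivity)] at h1
        exact h1
    · obtain ⟨x, ⟨u, hu, rfl⟩, hx⟩ := Real.lt_sInf_add_pos hne hε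
      exact ⟨u, hu, hx.le⟩
  have hthr : E₀ < a * (2 * (Real.pi / d) ^ 2) := hE₀Λ.trans_lt hΛ
  have key : ∀ ν : ℝ, (ν : ℂ) ∈ spec A → ν < a * (2 * (Real.pi / d) ^ 2) →
      (ν : ℂ) ∈ discreteSpectrum A ∧ Module.finrank ℂ (eigenspace A (ν : ℂ)) = 1 ∧
        ((E₀ : ℂ) ∈ discreteSpectrum A → ν = E₀) := by
    intro ν hν hlt
    obtain ⟨t, ht1, ht2⟩ := exists_between (max_lt hlt hthr)
    obtain ⟨ℓ, C, h⟩ := exists_rank_one_bound hd ha hB hA ht2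
    have hνt : ν < t := (le_max_left _ _).trans_lt ht1
    have hEt : E₀ < t := (le_max_right _ _).trans_lt ht1
    have hdisc := mem_discreteSpectrum_of_lt hsa h hνt hν
    exact ⟨hdisc, finrank_eigenspace_eq_one h hνt hdisc.2.2.1, fun hE =>
      eigenvalue_unique hsa h hνt hEt hdisc.2.2.1 hE.2.2.1⟩
  obtain ⟨h1, h2, -⟩ := key E₀ hspec hthr
  refine ⟨E₀, ?_, h2, hE₀low, hE₀Λ⟩
  refine Subset.antisymm (fun z hz => ?_) (singleton_subset_iff.2 h1)
  have hzr := spec_subset_real hsa hz.1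
  have hlt : z.re < a * (2 * (Real.pi / d) ^ 2) := by
    by_contra hle
    have : z ∈ essentialSpectrum A := by
      rw [hess, hzr]
      exact ⟨z.re, not_lt.1 hle, rfl⟩
    exact this.2 hz
  rw [hzr] at hz ⊢
  rw [(key z.re hz.1 hlt).2.2 h1]
  rfl

end BelowThreshold

/-! ### The spectrum above the threshold -/

section Weyl

variable {d : ℝ}

/-- A test function in the coordinates `s`, `r` that is odd in `s` gives a tuple. -/
lemma exists_isTupleOf_rotInv {F : ℝ × ℝ → ℂ} (hF : ContDiff ℝ ∞ F) (hc : HasCompactSupport F)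
    (hodd : ∀ s r, F (-s, r) = -F (s, r)) :
    ∃ w : TupleSpace d, IsTupleOf w (fun p => F (rotInv p)) := by
  refine exists_isTupleOf (hF.comp contDiff_rotInv) (hasCompactSupport_rotInv hc) fun p => ?_
  rw [rotInv, rotInv, ← hodd]
  congr 1
  ext
  · simp
  · simp [add_comm]

lemma exists_even_cutoff {ρ : ℝ} (hρ : 0 < ρ) : ∃ η : ℝ → ℝ, ContDiff ℝ ∞ η ∧
    HasCompactSupport η ∧ (∀ s, η (-s) = η s) ∧ ∀ s, |s| ≤ ρ → η s = 1 := by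
  let b : ContDiffBump (0 : ℝ) := ⟨ρ, ρ + 1, hρ, by linarith⟩
  refine ⟨b, b.contDiff, b.hasCompactSupport, b.neg, fun s hs => ?_⟩
  exact b.one_of_mem_closedBall (by simpa using hs)

/-- The product of a sine cut off away from the strip and a function of `r`. -/
lemma exists_cut_sine (hd : 0 < d) : ∃ S : ℝ → ℝ, ContDiff ℝ ∞ S ∧ HasCompactSupport S ∧
    (∀ s, S (-s) = -S s) ∧ ∀ s, |s| ≤ 2 * d → S s = Real.sin (Real.pi / d * s) := by
  obtain ⟨η, h1, h2, h3, h4⟩ := exists_even_cutoff (by positivity : 0 < 2 * d)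
  refine ⟨fun s => Real.sin (Real.pi / d * s) * η s, ?_, h2.mul_left, fun s => ?_, fun s hs => ?_⟩
  · exact (Real.contDiff_sin.comp (contDiff_const.mul contDiff_id)).mul h1
  · simp only [h3, mul_neg, Real.sin_neg]
    ring
  · simp only [h4 s hs, mul_one]

lemma deriv_eq_zero_of_lt {R : ℝ → ℂ} {c : ℝ} (h : ∀ r < c, R r = 0) {r : ℝ} (hr : r < c) :
    deriv R r = 0 := by
  have : R =ᶠ[𝓝 r] fun _ => 0 := by
    filter_upwards [Iio_mem_nhds hr] with x hx using h x hx
  rw [this.deriv_eq, deriv_const]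

lemma inner_eq_integral_of_ae {φ ψ : PencilL2 d} {f g : ℝ × ℝ → ℂ}
    (hf : φ =ᵐ[pencilMeasure d] f) (hg : ψ =ᵐ[pencilMeasure d] g) :
    inner ℂ φ ψ = ∫ p in pencil d, conj (f p) * g p := by
  rw [L2.inner_def]
  refine integral_congr_ae ?_
  filter_upwards [hf, hg] with p h1 h2
  rw [h1, h2]
  simp [mul_comm]

lemma outerStrip_eq_prod : outerStrip d = Icc 0 d ×ˢ Ici d := by
  ext p
  simp only [outerStrip, mem_ofPred_eq, mem_prod, mem_Icc, mem_Ici]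
  tauto

/-- The Dirichlet form in the coordinates `s`, `r`. -/
lemma tuple_inner_eq {w v : TupleSpace d} {F : ℝ × ℝ → ℂ} {v' : ℝ × ℝ → ℂ}
    (hw : IsTupleOf w (fun p => F (rotInv p))) (hv : IsTupleOf v v') :
    inner ℂ (tupleD₁ d w) (tupleD₁ d v) + inner ℂ (tupleD₂ d w) (tupleD₂ d v)
      = 2 * ∫ q in halfStrip d, (conj (pd₁ F q) * pd₁ (fun q => v' (rotCLM q)) q
        + conj (pd₂ F q) * pd₂ (fun q => v' (rotCLM q)) q) := by
  set u : ℝ × ℝ → ℂ := fun p => F (rotInv p) with hu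
  have e : (fun q => u (rotCLM q)) = F := by
    ext q
    rw [hu]
    simp only
    rw [rotInv_rotCLM]
  have c1 := continuous_pd₁ hw.contDiff
  have c2 := continuous_pd₂ hw.contDiff
  have c3 := continuous_pd₁ hv.contDiff
  have c4 := continuous_pd₂ hv.contDiff
  have i1 : Integrable fun p => conj (pd₁ u p) * pd₁ v' p :=
    ((Complex.continuous_conj.comp c1).mul c3).integrable_of_hasCompactSupport
      (hasCompactSupport_pd₁ hv.hasCompactSupport).mul_left
  have i2 : Integrable fun p => conj (pd₂ u p) * pd₂ v' p :=
    ((Complex.continuous_conj.comp c2).mul c4).integrable_of_hasCompactSupport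
      (hasCompactSupport_pd₂ hv.hasCompactSupport).mul_left
  rw [inner_eq_integral_of_ae hw.d₁_ae hv.d₁_ae, inner_eq_integral_of_ae hw.d₂_ae hv.d₂_ae,
    ← integral_add i1.integrableOn i2.integrableOn, ← integral_const_mul,
    setIntegral_pencil_of_symm (i1.fun_add i2)]
  · refine integral_congr_ae (ae_of_all _ fun q => ?_)
    have h1 := pd₁_rot hw.contDiff q
    have h2 := pd₂_rot hw.contDiff q
    rw [e] at h1 h2
    simp only
    rw [h1, h2, pd₁_rot hv.contDiff,
      pd₂_rot hv.contDiff]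
    simp only [map_mul, map_sub, map_add, map_inv₀, map_ofNat]
    ring
  · intro p
    rw [pd₁_of_antisymm hw.contDiff hw.antisymm, pd₂_of_antisymm hw.contDiff hw.antisymm,
      pd₁_of_antisymm hv.contDiff hv.antisymm, pd₂_of_antisymm hv.contDiff hv.antisymm]
    simp only [map_neg]
    ring

lemma tuple_inner_fun_eq {w v : TupleSpace d} {F : ℝ × ℝ → ℂ} {v' : ℝ × ℝ → ℂ}
    (hw : IsTupleOf w (fun p => F (rotInv p))) (hv : IsTupleOf v v') :
    inner ℂ (tupleFun d w) (tupleFun d v) = ∫ q in halfStrip d, conj (F q) * v' (rotCLM q) := by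
  change inner ℂ (tupleFun d w : PencilL2 d) (tupleFun d v : PencilL2 d) = _
  have i1 : Integrable fun p => conj (F (rotInv p)) * v' p :=
    ((Complex.continuous_conj.comp hw.contDiff.continuous).mul
      hv.contDiff.continuous).integrable_of_hasCompactSupport hv.hasCompactSupport.mul_left
  rw [inner_eq_integral_of_ae hw.fun_ae hv.fun_ae, setIntegral_pencil_of_symm i1]
  · simp only [rotInv_rotCLM]
  · intro p
    rw [hw.antisymm, hv.antisymm, map_neg]
    ring

section Product

variable {S : ℝ → ℝ} {R : ℝ → ℂ}

lemma contDiff_product (hS : ContDiff ℝ ∞ S) (hR : ContDiff ℝ ∞ R) :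
    ContDiff ℝ ∞ fun q : ℝ × ℝ => (S q.1 : ℂ) * R q.2 :=
  (Complex.ofRealCLM.contDiff.comp (hS.comp contDiff_fst)).mul (hR.comp contDiff_snd)

lemma hasCompactSupport_product (hS : HasCompactSupport S) (hR : HasCompactSupport R) :
    HasCompactSupport fun q : ℝ × ℝ => (S q.1 : ℂ) * R q.2 := by
  refine HasCompactSupport.of_support_subset_isCompact (hS.isCompact.prod hR.isCompact) ?_
  intro q hq
  have h := mul_ne_zero_iff.1 (Function.mem_support.1 hq)
  exact ⟨subset_tsupport _ (fun h0 => h.1 (by rw [h0]; rfl)), subset_tsupport _ h.2⟩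

lemma pd₁_product (hS : ContDiff ℝ ∞ S) (hR : ContDiff ℝ ∞ R) (s r : ℝ) :
    pd₁ (fun q : ℝ × ℝ => (S q.1 : ℂ) * R q.2) (s, r) = ((deriv S s : ℝ) : ℂ) * R r := by
  have h := hasDerivAt_fst (contDiff_product hS hR) r s
  have h2 : HasDerivAt (fun s => (S s : ℂ) * R r) (((deriv S s : ℝ) : ℂ) * R r) s :=
    (((hS.differentiable (by simp) s).hasDerivAt).ofReal_comp).mul_const _
  exact h.unique h2

lemma pd₂_product (hS : ContDiff ℝ ∞ S) (hR : ContDiff ℝ ∞ R) (s r : ℝ) :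
    pd₂ (fun q : ℝ × ℝ => (S q.1 : ℂ) * R q.2) (s, r) = (S s : ℂ) * deriv R r := by
  have h := hasDerivAt_snd (contDiff_product hS hR) s r
  have h2 : HasDerivAt (fun r => (S s : ℂ) * R r) ((S s : ℂ) * deriv R r) r :=
    ((hR.differentiable (by simp) r).hasDerivAt).const_mul _
  exact h.unique h2

lemma deriv_cut_sine (hd : 0 < d)
    (hSs : ∀ s, |s| ≤ 2 * d → S s = Real.sin (Real.pi / d * s)) {s : ℝ} (hs : s ∈ Icc 0 d) :
    deriv S s = Real.pi / d * Real.cos (Real.pi / d * s) := by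
  have h1 : S =ᶠ[𝓝 s] fun s => Real.sin (Real.pi / d * s) := by
    have : {x : ℝ | |x| < 2 * d} ∈ 𝓝 s := by
      refine (isOpen_lt continuous_abs continuous_const).mem_nhds ?_
      change |s| < 2 * d
      rw [abs_of_nonneg hs.1]
      linarith [hs.2]
    filter_upwards [this] with x hx using hSs x (le_of_lt hx)
  rw [h1.deriv_eq]
  have h2 : HasDerivAt (fun s => Real.sin (Real.pi / d * s))
      (Real.cos (Real.pi / d * s) * (Real.pi / d * 1)) s :=
    ((hasDerivAt_id s).const_mul (Real.pi / d)).sin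
  rw [h2.deriv]
  ring

/-- Integration by parts for a product of the sine of the lowest mode and a function of `r`. The
boundary term lives on the side `s = d` only. -/
lemma dirichlet_form_product (hd : 0 < d) (hS : ContDiff ℝ ∞ S)
    (hSs : ∀ s, |s| ≤ 2 * d → S s = Real.sin (Real.pi / d * s)) (hR : ContDiff ℝ ∞ R)
    (hR0 : ∀ r < 2 * d, R r = 0) {g : ℝ × ℝ → ℂ} (hg : ContDiff ℝ ∞ g)
    (hgc : HasCompactSupport g) (hg0 : ∀ r, g (0, r) = 0) :
    ∫ q in halfStrip d, (conj (pd₁ (fun q : ℝ × ℝ => (S q.1 : ℂ) * R q.2) q) * pd₁ g q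
        + conj (pd₂ (fun q : ℝ × ℝ => (S q.1 : ℂ) * R q.2) q) * pd₂ g q)
      = (∫ q in halfStrip d, conj ((S q.1 : ℂ) *
          (((Real.pi / d : ℝ) : ℂ) ^ 2 * R q.2 - deriv (deriv R) q.2)) * g q)
        - ((Real.pi / d : ℝ) : ℂ) * ∫ r in Ici d, conj (R r) * g (d, r) := by
  set p : ℝ := Real.pi / d with hp
  have hpd : p * d = Real.pi := by rw [hp]; field_simp
  have hR1 : ContDiff ℝ ∞ (deriv R) := (contDiff_infty_iff_deriv.1 hR).2
  have hR2 : ContDiff ℝ ∞ (deriv (deriv R)) := (contDiff_infty_iff_deriv.1 hR1).2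
  have hR10 : ∀ r < 2 * d, deriv R r = 0 := fun r hr => deriv_eq_zero_of_lt hR0 hr
  have hR20 : ∀ r < 2 * d, deriv (deriv R) r = 0 := fun r hr => deriv_eq_zero_of_lt hR10 hr
  have cS := hS.continuous
  have cR := hR.continuous
  have cR1 := hR1.continuous
  have cR2 := hR2.continuous
  have cg := hg.continuous
  have cg1 := continuous_pd₁ hg
  have cg2 := continuous_pd₂ hg
  have cF1 := continuous_pd₁ (contDiff_product hS hR)
  have cF2 := continuous_pd₂ (contDiff_product hS hR)
  have hgc1 := hasCompactSupport_pd₁ hgc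
  have hgc2 := hasCompactSupport_pd₂ hgc
  have zeroT : ∀ G : ℝ × ℝ → ℂ, (∀ s r, r < 2 * d → G (s, r) = 0) → Integrable G →
      ∫ q in halfStrip d, G q = ∫ q in outerStrip d, G q := by
    intro G hG hi
    rw [setIntegral_halfStrip_eq_add hi, setIntegral_eq_zero_of_forall_eq_zero, zero_add]
    rintro ⟨s, r⟩ ⟨-, -, hr⟩
    exact hG s r (by simp only at hr; linarith)
  have I1 : Integrable fun q : ℝ × ℝ => (p : ℂ) * Real.cos (p * q.1) * conj (R q.2) * pd₁ g q :=
    (by fun_prop : Continuous fun q : ℝ × ℝ =>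
      (p : ℂ) * Real.cos (p * q.1) * conj (R q.2) * pd₁ g q).integrable_of_hasCompactSupport
      hgc1.mul_left
  have I2 : Integrable fun q : ℝ × ℝ => (Real.sin (p * q.1) : ℂ) * conj (deriv R q.2) * pd₂ g q :=
    (by fun_prop : Continuous fun q : ℝ × ℝ =>
      (Real.sin (p * q.1) : ℂ) * conj (deriv R q.2) * pd₂ g q).integrable_of_hasCompactSupport
      hgc2.mul_left
  have I3 : Integrable fun q : ℝ × ℝ => (Real.sin (p * q.1) : ℂ) * conj (R q.2) * g q :=
    (by fun_prop : Continuous fun q : ℝ × ℝ =>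
      (Real.sin (p * q.1) : ℂ) * conj (R q.2) * g q).integrable_of_hasCompactSupport
      hgc.mul_left
  have I4 : Integrable fun q : ℝ × ℝ =>
      (Real.sin (p * q.1) : ℂ) * conj (deriv (deriv R) q.2) * g q :=
    (by fun_prop : Continuous fun q : ℝ × ℝ => (Real.sin (p * q.1) : ℂ) *
      conj (deriv (deriv R) q.2) * g q).integrable_of_hasCompactSupport hgc.mul_left
  have hsin : ∀ q ∈ outerStrip d, S q.1 = Real.sin (p * q.1) := fun q hq =>
    hSs q.1 (by rw [abs_of_nonneg hq.1]; linarith [hq.2.1])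
  have L : ∫ q in halfStrip d, (conj (pd₁ (fun q : ℝ × ℝ => (S q.1 : ℂ) * R q.2) q) * pd₁ g q
        + conj (pd₂ (fun q : ℝ × ℝ => (S q.1 : ℂ) * R q.2) q) * pd₂ g q)
      = (∫ q in outerStrip d, (p : ℂ) * Real.cos (p * q.1) * conj (R q.2) * pd₁ g q)
        + ∫ q in outerStrip d, (Real.sin (p * q.1) : ℂ) * conj (deriv R q.2) * pd₂ g q := by
    rw [zeroT, ← integral_add I1.integrableOn I2.integrableOn]
    · refine setIntegral_congr_fun (measurableSet_outerStrip d) fun q hq => ?_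
      obtain ⟨s, r⟩ := q
      simp only
      rw [pd₁_product hS hR, pd₂_product hS hR, hsin (s, r) hq,
        deriv_cut_sine hd hSs ⟨hq.1, hq.2.1⟩]
      simp only [map_mul, Complex.conj_ofReal, Complex.ofReal_mul]
      ring
    · intro s r hr
      rw [pd₁_product hS hR, pd₂_product hS hR, hR0 r hr, hR10 r hr]
      simp
    · exact (((Complex.continuous_conj.comp cF1).fun_mul cg1).integrable_of_hasCompactSupport
        hgc1.mul_left).fun_add
        (((Complex.continuous_conj.comp cF2).fun_mul cg2).integrable_of_hasCompactSupport
        hgc2.mul_left)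
  have Rt : ∫ q in halfStrip d, conj ((S q.1 : ℂ) * ((p : ℂ) ^ 2 * R q.2 - deriv (deriv R) q.2))
        * g q
      = (p : ℂ) ^ 2 * (∫ q in outerStrip d, (Real.sin (p * q.1) : ℂ) * conj (R q.2) * g q)
        - ∫ q in outerStrip d, (Real.sin (p * q.1) : ℂ) * conj (deriv (deriv R) q.2) * g q := by
    rw [zeroT, ← integral_const_mul, ← integral_sub (I3.integrableOn.const_mul _) I4.integrableOn]
    · refine setIntegral_congr_fun (measurableSet_outerStrip d) fun q hq => ?_
      rw [hsin q hq]
      simp only [map_mul, map_sub, map_pow, Complex.conj_ofReal]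
      ring
    · intro s r hr
      rw [hR0 r hr, hR20 r hr]
      simp
    · refine (by fun_prop : Continuous fun q : ℝ × ℝ => conj ((S q.1 : ℂ) *
        ((p : ℂ) ^ 2 * R q.2 - deriv (deriv R) q.2)) * g q).integrable_of_hasCompactSupport
        hgc.mul_left
  -- integration by parts in `s`
  have E1 : ∫ q in outerStrip d, (p : ℂ) * Real.cos (p * q.1) * conj (R q.2) * pd₁ g q
      = (p : ℂ) ^ 2 * (∫ q in outerStrip d, (Real.sin (p * q.1) : ℂ) * conj (R q.2) * g q)
        - (p : ℂ) * ∫ r in Ici d, conj (R r) * g (d, r) := by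
    obtain ⟨-, e1⟩ := setIntegral_outerStrip hd I1
    obtain ⟨j3, e3⟩ := setIntegral_outerStrip hd I3
    have j4 : IntegrableOn (fun r => conj (R r) * g (d, r)) (Ici d) := by
      have hcl : Topology.IsClosedEmbedding fun r : ℝ => (d, r) :=
        isClosedEmbedding_curve (by fun_prop) continuous_snd fun _ => rfl
      exact ((by fun_prop : Continuous fun r : ℝ =>
        conj (R r) * g (d, r)).integrable_of_hasCompactSupport
          (hgc.comp_isClosedEmbedding hcl).mul_left).integrableOn
    rw [e1, e3, ← integral_const_mul, ← integral_const_mul, ← integral_sub (j3.const_mul _)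
      (j4.const_mul _)]
    refine integral_congr_ae (ae_of_all _ fun r => ?_)
    simp only
    have hcos : ∀ s ∈ uIcc 0 d, HasDerivAt (fun s : ℝ => (p : ℂ) * (Real.cos (p * s) : ℂ))
        (-((p : ℂ) ^ 2 * (Real.sin (p * s) : ℂ))) s := by
      intro s _
      have h1 : HasDerivAt (fun s => Real.cos (p * s)) (-Real.sin (p * s) * (p * 1)) s :=
        ((hasDerivAt_id s).const_mul p).cos
      refine (h1.ofReal_comp.const_mul (p : ℂ)).congr_deriv ?_
      push_cast
      ring
    have h := intervalIntegral.integral_mul_deriv_eq_deriv_mul hcos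
      (fun s _ => hasDerivAt_fst hg r s)
      ((by fun_prop : Continuous fun s : ℝ =>
        -((p : ℂ) ^ 2 * (Real.sin (p * s) : ℂ))).intervalIntegrable _ _)
      ((cg1.comp (by fun_prop : Continuous fun s : ℝ => (s, r))).intervalIntegrable _ _)
    rw [hg0, hpd, Real.cos_pi, mul_zero, sub_zero] at h
    calc ∫ s in (0 : ℝ)..d, (p : ℂ) * Real.cos (p * s) * conj (R r) * pd₁ g (s, r)
        = conj (R r) * ∫ s in (0 : ℝ)..d, (p : ℂ) * Real.cos (p * s) * pd₁ g (s, r) := by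
          rw [← intervalIntegral.integral_const_mul]
          congr 1; ext s; ring
      _ = conj (R r) * ((p : ℂ) * ((-1 : ℝ) : ℂ) * g (d, r)
          - ∫ s in (0 : ℝ)..d, -((p : ℂ) ^ 2 * (Real.sin (p * s) : ℂ)) * g (s, r)) := by rw [h]
      _ = (p : ℂ) ^ 2 * (conj (R r) * ∫ s in (0 : ℝ)..d, (Real.sin (p * s) : ℂ) * g (s, r))
          - (p : ℂ) * (conj (R r) * g (d, r)) := by
          have : ∫ s in (0 : ℝ)..d, -((p : ℂ) ^ 2 * (Real.sin (p * s) : ℂ)) * g (s, r)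
              = -(p : ℂ) ^ 2 * ∫ s in (0 : ℝ)..d, (Real.sin (p * s) : ℂ) * g (s, r) := by
            rw [← intervalIntegral.integral_const_mul]
            congr 1; ext s; ring
          rw [this]
          push_cast
          ring
      _ = _ := by
          rw [← intervalIntegral.integral_const_mul]
          congr 4
          ext s
          ring
  -- integration by parts in `r`
  have E2 : ∫ q in outerStrip d, (Real.sin (p * q.1) : ℂ) * conj (deriv R q.2) * pd₂ g q
      = -∫ q in outerStrip d, (Real.sin (p * q.1) : ℂ) * conj (deriv (deriv R) q.2) * g q := by
    rw [eq_neg_iff_add_eq_zero, ← integral_add I2.integrableOn I4.integrableOn, outerStrip_eq_prod,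
      Measure.volume_eq_prod, setIntegral_prod _ (I2.fun_add I4).integrableOn]
    refine setIntegral_eq_zero_of_forall_eq_zero fun s _ => ?_
    have hcl : Topology.IsClosedEmbedding fun r : ℝ => (s, r) :=
      isClosedEmbedding_curve (by fun_prop) continuous_snd fun _ => rfl
    have hcR : ContDiff ℝ ∞ fun r => conj (deriv R r) :=
      (Complex.conjCLE : ℂ ≃L[ℝ] ℂ).contDiff.comp hR1
    have hgs : ContDiff ℝ ∞ fun r => g (s, r) := hg.comp (contDiff_const.prodMk contDiff_id)
    have hΨ : ContDiff ℝ ∞ fun r => (Real.sin (p * s) : ℂ) * conj (deriv R r) * g (s, r) :=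
      (contDiff_const.mul hcR).mul hgs
    have hΨc : HasCompactSupport fun r => (Real.sin (p * s) : ℂ) * conj (deriv R r) * g (s, r) :=
      (hgc.comp_isClosedEmbedding hcl).mul_left
    have hder : ∀ r, deriv (fun r => (Real.sin (p * s) : ℂ) * conj (deriv R r) * g (s, r)) r
        = (Real.sin (p * s) : ℂ) * conj (deriv R r) * pd₂ g (s, r)
          + (Real.sin (p * s) : ℂ) * conj (deriv (deriv R) r) * g (s, r) := by
      intro r
      have h1 : HasDerivAt (fun r => conj (deriv R r)) (conj (deriv (deriv R) r)) r :=
        (Complex.conjCLE : ℂ ≃L[ℝ] ℂ).hasFDerivAt.comp_hasDerivAt r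
          (hR1.differentiable (by simp) r).hasDerivAt
      have h2 := ((h1.const_mul (Real.sin (p * s) : ℂ)).mul (hasDerivAt_snd hg s r)).deriv
      refine Eq.trans h2 ?_
      ring
    have h := hΨc.integral_Ioi_deriv_eq (hΨ.of_le (by simp)) d
    simp only [hder] at h
    rw [hR10 d (by linarith), map_zero, mul_zero, zero_mul, neg_zero] at h
    rw [integral_Ici_eq_integral_Ioi]
    exact h
  rw [L, Rt, E1, E2]
  ring

end Product

end Weyl

section WeylSequence

variable {d : ℝ}

/-- The product of the lowest mode with a function of `r` satisfies the eigenvalue equation up to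
the equation for the function of `r`, in the weak sense on the form domain. -/
lemma tuple_inner_product_eq (hd : 0 < d) {S : ℝ → ℝ} {R : ℝ → ℂ} (hS : ContDiff ℝ ∞ S)
    (hSs : ∀ s, |s| ≤ 2 * d → S s = Real.sin (Real.pi / d * s)) (hR : ContDiff ℝ ∞ R)
    (hRc : HasCompactSupport R) (hR0 : ∀ r < 2 * d, R r = 0) {w g : TupleSpace d}
    (hw : IsTupleOf w (fun p => (S (rotInv p).1 : ℂ) * R (rotInv p).2))
    (hg : IsTupleOf g (fun p => (S (rotInv p).1 : ℂ) *
      (((Real.pi / d : ℝ) : ℂ) ^ 2 * R (rotInv p).2 - deriv (deriv R) (rotInv p).2)))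
    {v : TupleSpace d} (hv : v ∈ formTuples d) :
    inner ℂ (tupleD₁ d w) (tupleD₁ d v) + inner ℂ (tupleD₂ d w) (tupleD₂ d v)
      = 2 * inner ℂ (tupleFun d g) (tupleFun d v) := by
  set p : ℂ := ((Real.pi / d : ℝ) : ℂ) with hp
  have hcl : Topology.IsClosedEmbedding fun t : ℝ => 2 * t + d :=
    Function.LeftInverse.isClosedEmbedding (f := fun t : ℝ => (t - d) / 2)
      (fun t => by ring) (by fun_prop) (by fun_prop)
  have hm : MemLp (fun t => -4 * p * R (2 * t + d)) 2 (volume.restrict (Ici 0)) := by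
    have h1 : MemLp (fun t => R (2 * t + d)) 2 (volume.restrict (Ici (0 : ℝ))) :=
      ((hR.continuous.comp hcl.continuous).memLp_of_hasCompactSupport
        (hRc.comp_isClosedEmbedding hcl) (μ := volume)).restrict _
    exact h1.const_mul _
  have key := sobolevTuples_induction (P := fun v =>
    inner ℂ (tupleD₁ d w) (tupleD₁ d v) + inner ℂ (tupleD₂ d w) (tupleD₂ d v)
      = 2 * inner ℂ (tupleFun d g) (tupleFun d v)
        + inner ℂ (toL2 (volume.restrict (Ici 0)) fun t => -4 * p * R (2 * t + d)) (tupleSide d v))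
    (isClosed_eq (by fun_prop) ((continuous_const.mul
      (continuous_const.inner (tupleFun d).continuous)).add
      (continuous_const.inner (tupleSide d).continuous))) (fun v v' h => ?_) hv.1
  · rw [key, (mem_formTuples.1 hv).2, inner_zero_right, add_zero]
  · have e1 := tuple_inner_eq (F := fun q => (S q.1 : ℂ) * R q.2) hw h
    have e2 := tuple_inner_fun_eq (F := fun q => (S q.1 : ℂ) * (p ^ 2 * R q.2 - deriv (deriv R) q.2))
      hg h
    rw [e1, e2, dirichlet_form_product hd hS hSs hR hR0 (contDiff_rot h.contDiff)
      (hasCompactSupport_rot h.hasCompactSupport) (antisymm_zero h.antisymm)]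
    have e3 : inner ℂ (toL2 (volume.restrict (Ici 0)) fun t => -4 * p * R (2 * t + d))
        (tupleSide d v) = -4 * p * ∫ t in Ici (0 : ℝ), conj (R (2 * t + d)) * v' (t + d, t) := by
      rw [L2.inner_def, ← integral_const_mul]
      refine integral_congr_ae ?_
      filter_upwards [coeFn_toL2 hm, h.side_ae] with t h1 h2
      rw [h1, h2, RCLike.inner_apply]
      simp only [map_mul, map_neg, map_ofNat, hp, Complex.conj_ofReal]
      ring
    have e4 := setIntegral_side (d := d) fun q => conj (R q.2) * v' (rotCLM q)
    simp only [rotCLM_side] at e4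
    rw [e3, e4, Complex.real_smul, ← hp]
    push_cast
    ring

/-- The mass of a product, for an amplitude supported in the outer strip. -/
lemma mass_product (hd : 0 < d) {S : ℝ → ℝ} {R : ℝ → ℂ} (hR0 : ∀ r < 2 * d, R r = 0)
    {w : TupleSpace d} (hw : IsTupleOf w (fun p => (S (rotInv p).1 : ℂ) * R (rotInv p).2)) :
    ‖tupleFun d w‖ ^ 2 = (∫ s in Icc 0 d, S s ^ 2) * ∫ r, ‖R r‖ ^ 2 := by
  have hi : Integrable fun q : ℝ × ℝ => ‖(S q.1 : ℂ) * R q.2‖ ^ 2 := by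
    have := integrable_norm_sq (μ := volume) (contDiff_rot hw.contDiff).continuous
      (hasCompactSupport_rot hw.hasCompactSupport)
    simpa only [rotInv_rotCLM] using this
  rw [← hw.mass_eq, mass_eq hw.contDiff hw.hasCompactSupport hw.antisymm]
  simp only [rotInv_rotCLM]
  rw [setIntegral_halfStrip_eq_add hi, setIntegral_eq_zero_of_forall_eq_zero (t := tipTriangle d),
    zero_add, outerStrip_eq_prod]
  · have e : ∀ q : ℝ × ℝ, ‖(S q.1 : ℂ) * R q.2‖ ^ 2 = S q.1 ^ 2 * ‖R q.2‖ ^ 2 := by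
      intro q
      rw [norm_mul, mul_pow, Complex.norm_real, Real.norm_eq_abs, sq_abs]
    simp only [e]
    rw [Measure.volume_eq_prod, setIntegral_prod_mul (fun s => S s ^ 2) (fun r => ‖R r‖ ^ 2)]
    congr 1
    refine setIntegral_eq_integral_of_forall_compl_eq_zero fun r hr => ?_
    have : r < d := not_le.1 hr
    rw [hR0 r (by linarith)]
    simp
  · rintro ⟨s, r⟩ ⟨-, -, hr⟩
    simp only at hr
    simp only
    rw [hR0 r (by linarith)]
    simp

/-- A wave packet: a plane wave `exp (i k r)` cut off on a long interval solves `R″ + k² R = 0` up to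
a small relative error. -/
lemma exists_plane_packet (d k : ℝ) {ε : ℝ} (hε : 0 < ε) :
    ∃ R : ℝ → ℂ, ContDiff ℝ ∞ R ∧ HasCompactSupport R ∧ (∀ r < 2 * d, R r = 0) ∧
      0 < ∫ r, ‖R r‖ ^ 2 ∧
      ∫ r, ‖deriv (deriv R) r + (k : ℂ) ^ 2 * R r‖ ^ 2 ≤ ε * ∫ r, ‖R r‖ ^ 2 := by
  let b : ContDiffBump (4 : ℝ) := ⟨1, 2, one_pos, one_lt_two⟩
  have hb : ContDiff ℝ ∞ (b : ℝ → ℝ) := b.contDiff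
  have hb1 : ContDiff ℝ ∞ (deriv b) := (contDiff_infty_iff_deriv.1 hb).2
  have hb2 : ContDiff ℝ ∞ (deriv (deriv b)) := (contDiff_infty_iff_deriv.1 hb1).2
  have hbc : HasCompactSupport (b : ℝ → ℝ) := b.hasCompactSupport
  have hbc1 : HasCompactSupport (deriv b) := hbc.deriv
  have hbc2 : HasCompactSupport (deriv (deriv b)) := hbc1.deriv
  have hsq : ∀ {h : ℝ → ℝ}, Continuous h → HasCompactSupport h →
      Integrable fun x => h x ^ 2 := fun {h} hh hhc =>
    (hh.pow 2).integrable_of_hasCompactSupport (by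
      have : (h ^ 2) = fun x => h x * h x := by ext x; simp [sq]
      rw [this]
      exact hhc.mul_left)
  set I0 := ∫ x, b x ^ 2 with hI0
  set I1 := ∫ x, deriv b x ^ 2 with hI1
  set I2 := ∫ x, deriv (deriv b) x ^ 2 with hI2
  have hI0pos : 0 < I0 := by
    rw [hI0]
    refine (integral_pos_iff_support_of_nonneg (fun x => sq_nonneg _) (hsq hb.continuous hbc)).2 ?_
    refine lt_of_lt_of_le ?_ (measure_mono (show Metric.ball (4 : ℝ) 2 ⊆ _ from fun x hx => ?_))
    · exact Metric.measure_ball_pos _ _ two_pos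
    · exact (pow_pos (b.pos_of_mem_ball hx) 2).ne'
  have hI1n : 0 ≤ I1 := integral_nonneg fun _ => sq_nonneg _
  have hI2n : 0 ≤ I2 := integral_nonneg fun _ => sq_nonneg _
  -- the packet is spread over a length of order `L`
  obtain ⟨L, hL⟩ := exists_gt (max (max 1 d) ((2 * I2 + 8 * k ^ 2 * I1) / (ε * I0)))
  have hL1 : 1 < L := ((le_max_left _ _).trans (le_max_left _ _)).trans_lt hL
  have hLd : d < L := ((le_max_right _ _).trans (le_max_left _ _)).trans_lt hL
  have hLε : 2 * I2 + 8 * k ^ 2 * I1 < L * (ε * I0) :=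
    (div_lt_iff₀ (by positivity)).1 ((le_max_right _ _).trans_lt hL)
  have hL0 : 0 < L := by linarith
  set e : ℝ → ℂ := fun r => Complex.exp (((k * r : ℝ) : ℂ) * Complex.I) with he
  have he1 : ∀ r, HasDerivAt e (((k : ℂ) * Complex.I) * e r) r := by
    intro r
    have h1 : HasDerivAt (fun r : ℝ => ((k * r : ℝ) : ℂ) * Complex.I) ((k : ℂ) * Complex.I) r := by
      have := (((hasDerivAt_id r).const_mul k).ofReal_comp).mul_const Complex.I
      simpa using this
    refine h1.cexp.congr_deriv ?_
    rw [he]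
    ring
  have heC : ContDiff ℝ ∞ e := by
    have : ContDiff ℝ ∞ fun r : ℝ => ((k * r : ℝ) : ℂ) * Complex.I :=
      (Complex.ofRealCLM.contDiff.comp (contDiff_const.mul contDiff_id)).mul contDiff_const
    exact this.cexp
  have hen : ∀ r, ‖e r‖ = 1 := fun r => Complex.norm_exp_ofReal_mul_I _
  set β : ℝ → ℝ := fun r => b (L⁻¹ * r) with hβ
  have hβC : ContDiff ℝ ∞ β := hb.comp (contDiff_const.mul contDiff_id)
  have hβ1 : ∀ r, HasDerivAt β (L⁻¹ * deriv b (L⁻¹ * r)) r := by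
    intro r
    have h1 := (hb.differentiable (by simp) (L⁻¹ * r)).hasDerivAt
    have h2 := h1.comp r ((hasDerivAt_id r).const_mul L⁻¹)
    refine h2.congr_deriv ?_
    ring
  have hβ2 : ∀ r, HasDerivAt (fun r => L⁻¹ * deriv b (L⁻¹ * r))
      (L⁻¹ ^ 2 * deriv (deriv b) (L⁻¹ * r)) r := by
    intro r
    have h1 := (hb1.differentiable (by simp) (L⁻¹ * r)).hasDerivAt
    have h2 := (h1.comp r ((hasDerivAt_id r).const_mul L⁻¹)).const_mul L⁻¹
    refine h2.congr_deriv ?_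
    ring
  set R : ℝ → ℂ := fun r => (β r : ℂ) * e r with hRdef
  have hR1 : deriv R = fun r => ((L⁻¹ * deriv b (L⁻¹ * r) : ℝ) : ℂ) * e r
      + (β r : ℂ) * (((k : ℂ) * Complex.I) * e r) := by
    ext r
    exact ((hβ1 r).ofReal_comp.mul (he1 r)).deriv
  have hR2 : ∀ r, deriv (deriv R) r + (k : ℂ) ^ 2 * R r
      = (((L⁻¹ ^ 2 * deriv (deriv b) (L⁻¹ * r) : ℝ) : ℂ)
        + ((2 * k * (L⁻¹ * deriv b (L⁻¹ * r)) : ℝ) : ℂ) * Complex.I) * e r := by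
    intro r
    rw [hR1, (((hβ2 r).ofReal_comp.fun_mul (he1 r)).fun_add
      ((hβ1 r).ofReal_comp.fun_mul ((he1 r).const_mul ((k : ℂ) * Complex.I)))).deriv, hRdef]
    have hI := Complex.I_sq
    push_cast
    linear_combination (β r : ℂ) * (k : ℂ) ^ 2 * e r * hI
  have hRn : ∀ r, ‖R r‖ ^ 2 = b (L⁻¹ * r) ^ 2 := by
    intro r
    rw [hRdef]
    simp only
    rw [norm_mul, hen, mul_one, Complex.norm_real, Real.norm_eq_abs, sq_abs]
  have hscale : ∀ h : ℝ → ℝ, ∫ r, h (L⁻¹ * r) = L * ∫ x, h x := by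
    intro h
    rw [Measure.integral_comp_mul_left, smul_eq_mul, inv_inv, abs_of_pos hL0]
  have hRmass : ∫ r, ‖R r‖ ^ 2 = L * I0 := by
    simp only [hRn]
    exact hscale fun x => b x ^ 2
  refine ⟨R, (Complex.ofRealCLM.contDiff.comp hβC).mul heC, ?_, ?_, ?_, ?_⟩
  · have h1 : HasCompactSupport β :=
      hbc.comp_homeomorph (Homeomorph.mulLeft₀ L⁻¹ (inv_ne_zero hL0.ne'))
    exact (h1.comp_left (g := Complex.ofReal) rfl).mul_right
  · intro r hr
    have h1 : b (L⁻¹ * r) = 0 := by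
      refine b.zero_of_le_dist ?_
      have h2 : L⁻¹ * r ≤ 2 := by
        rw [inv_mul_le_iff₀ hL0]
        linarith
      rw [Real.dist_eq, abs_of_nonpos (by linarith)]
      change (2 : ℝ) ≤ _
      linarith
    rw [hRdef]
    simp only [hβ, h1]
    simp
  · rw [hRmass]
    positivity
  · have hbound : ∀ r, ‖deriv (deriv R) r + (k : ℂ) ^ 2 * R r‖ ^ 2
        = L⁻¹ ^ 4 * deriv (deriv b) (L⁻¹ * r) ^ 2
          + 4 * k ^ 2 * L⁻¹ ^ 2 * deriv b (L⁻¹ * r) ^ 2 := by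
      intro r
      rw [hR2, norm_mul, hen, mul_one, Complex.sq_norm, Complex.normSq_add_mul_I]
      ring
    simp only [hbound]
    have j1 := (hsq hb1.continuous hbc1)
    have j2 := (hsq hb2.continuous hbc2)
    rw [hscale fun x => L⁻¹ ^ 4 * deriv (deriv b) x ^ 2 + 4 * k ^ 2 * L⁻¹ ^ 2 * deriv b x ^ 2,
      integral_add (j2.const_mul _) (j1.const_mul _), integral_const_mul, integral_const_mul, hRmass]
    have hinv : L⁻¹ ≤ 1 := inv_le_one_of_one_le₀ hL1.le
    have hinv0 : 0 < L⁻¹ := by positivity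
    have hLL : L * L⁻¹ = 1 := mul_inv_cancel₀ hL0.ne'
    have h4 : L⁻¹ ^ 4 ≤ L⁻¹ ^ 2 := pow_le_pow_of_le_one hinv0.le hinv (by norm_num)
    calc L * (L⁻¹ ^ 4 * I2 + 4 * k ^ 2 * L⁻¹ ^ 2 * I1)
        ≤ L * (L⁻¹ ^ 2 * I2 + 4 * k ^ 2 * L⁻¹ ^ 2 * I1) := by gcongr
      _ = L⁻¹ * (I2 + 4 * k ^ 2 * I1) := by field_simp
      _ ≤ 1 * (I2 + 4 * k ^ 2 * I1) := by gcongr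
      _ ≤ 2 * I2 + 8 * k ^ 2 * I1 := by nlinarith [mul_nonneg (sq_nonneg k) hI1n]
      _ ≤ ε * (L * I0) := by linarith

variable {a : ℝ} {T : BottomL2 d →L[ℂ] BottomL2 d} {B : formTuples d →L[ℂ] formTuples d}
  {A : antisymmetricL2 d →ₗ.[ℂ] antisymmetricL2 d}

/-- Wave packets that run away along the strip show that the spectrum contains the half-line above
the threshold. -/
lemma mem_spec_of_threshold_le (hd : 0 < d) (ha : 0 < a)
    (hB : ∀ w w' : formTuples d, inner ℂ (B w) w' = tupleForm a T w w')
    (hA : ∀ φ f, (φ, f) ∈ A.graph ↔ ∃ u, formFun d u = φ ∧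
      ∀ v, inner ℂ (B u) v = inner ℂ f (formFun d v))
    {μ : ℝ} (hμ : a * (2 * (Real.pi / d) ^ 2) ≤ μ) : (μ : ℂ) ∈ spec A := by
  set p := Real.pi / d with hp
  set k := Real.sqrt (μ / (2 * a) - p ^ 2) with hk
  have hk2 : k ^ 2 = μ / (2 * a) - p ^ 2 := by
    refine Real.sq_sqrt (sub_nonneg.2 ?_)
    rw [le_div_iff₀ (by positivity)]
    linarith
  have hμk : μ = 2 * a * (p ^ 2 + k ^ 2) := by
    rw [hk2]
    field_simp
    ring
  obtain ⟨S, hS, hSc, hSodd, hSs⟩ := exists_cut_sine hd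
  refine mem_spec_of_approx_eigenvector fun ε hε => ?_
  obtain ⟨R, hR, hRc, hR0, hRpos, hRle⟩ := exists_plane_packet d k
    (by positivity : 0 < (ε / (2 * a)) ^ 2)
  have hR1 : ContDiff ℝ ∞ (deriv R) := (contDiff_infty_iff_deriv.1 hR).2
  have hR2 : ContDiff ℝ ∞ (deriv (deriv R)) := (contDiff_infty_iff_deriv.1 hR1).2
  have hRc2 : HasCompactSupport (deriv (deriv R)) := hRc.deriv.deriv
  have hR20 : ∀ r < 2 * d, deriv (deriv R) r = 0 := fun r hr =>
    deriv_eq_zero_of_lt (fun r hr => deriv_eq_zero_of_lt hR0 hr) hr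
  have mk : ∀ Q : ℝ → ℂ, ContDiff ℝ ∞ Q → HasCompactSupport Q →
      ∃ w : TupleSpace d, IsTupleOf w (fun p => (S (rotInv p).1 : ℂ) * Q (rotInv p).2) :=
    fun Q hQ hQc => exists_isTupleOf_rotInv (contDiff_product hS hQ)
      (hasCompactSupport_product hSc hQc) (fun s r => by simp only [hSodd]; push_cast; ring)
  obtain ⟨w, hw⟩ := mk R hR hRc
  obtain ⟨g, hg⟩ := mk (fun r => ((p : ℝ) : ℂ) ^ 2 * R r - deriv (deriv R) r)
    ((contDiff_const.mul hR).sub hR2) (hRc.mul_left.sub hRc2)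
  have hside : w ∈ formTuples d := by
    refine mem_formTuples.2 ⟨Submodule.le_topologicalClosure _ ⟨_, hw⟩, ?_⟩
    rw [Lp.eq_zero_iff_ae_eq_zero]
    filter_upwards [hw.side_ae] with t ht
    have e : S (rotInv (t + d, t)).1 = 0 := by
      rw [hSs]
      · simp only [rotInv, add_sub_cancel_left]
        rw [div_mul_cancel₀ _ hd.ne', Real.sin_pi]
      · simp only [rotInv, add_sub_cancel_left]
        rw [abs_of_pos hd]
        linarith
    rw [ht, e]
    simp
  have hbot : tupleBottom d w = 0 := by
    rw [Lp.eq_zero_iff_ae_eq_zero]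
    filter_upwards [hw.bottom_ae, ae_restrict_mem measurableSet_Icc] with y hy hyd
    have e : R (rotInv (y, 0)).2 = 0 := by
      refine hR0 _ ?_
      simp only [rotInv, add_zero]
      linarith [hyd.2]
    rw [hy, e]
    simp
  -- `A` acts on the packet as the differential expression
  have hgraph : (tupleFun d w, ((2 * a : ℝ) : ℂ) • tupleFun d g) ∈ A.graph := by
    refine (hA _ _).2 ⟨⟨w, hside⟩, rfl, fun v => ?_⟩
    have h := tuple_inner_product_eq hd hS hSs hR hRc hR0 hw hg v.2
    rw [hB, tupleForm, hbot, map_zero, inner_zero_left, mul_zero, sub_zero, h]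
    refine Eq.trans ?_ (inner_smul_left (tupleFun d g) (formFun d v) ((2 * a : ℝ) : ℂ)).symm
    rw [Complex.conj_ofReal]
    change _ = ((2 * a : ℝ) : ℂ) * inner ℂ (tupleFun d g) (tupleFun d v)
    push_cast
    ring
  obtain ⟨φ, hφ1, hφ2⟩ := (LinearPMap.mem_graph_iff A).1 hgraph
  -- the residual is again a product
  have hres : IsTupleOf (g - (((p ^ 2 + k ^ 2 : ℝ) : ℂ)) • w) (fun q => (S (rotInv q).1 : ℂ) *
      ((fun r => -(deriv (deriv R) r + (k : ℂ) ^ 2 * R r)) (rotInv q).2)) := by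
    have h := hg.add (hw.smul (-((p ^ 2 + k ^ 2 : ℝ) : ℂ)))
    have e1 : g + -((p ^ 2 + k ^ 2 : ℝ) : ℂ) • w = g - ((p ^ 2 + k ^ 2 : ℝ) : ℂ) • w := by
      rw [neg_smul, sub_eq_add_neg]
    rw [e1] at h
    convert h using 1
    ext q
    push_cast
    ring
  have hresmass := mass_product hd
    (R := fun r => -(deriv (deriv R) r + (k : ℂ) ^ 2 * R r)) (fun r hr => by
      simp only [hR20 r hr, hR0 r hr, mul_zero, add_zero, neg_zero]) hres
  have hwmass := mass_product hd hR0 hw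
  simp only [norm_neg] at hresmass
  set c := ∫ s in Icc 0 d, S s ^ 2 with hc
  have hcpos : 0 < c := by
    have h1 : c = ∫ s in (0 : ℝ)..d, Real.sin (p * s) ^ 2 := by
      rw [hc, setIntegral_Icc hd.le]
      refine intervalIntegral.integral_congr fun s hs => ?_
      rw [uIcc_of_le hd.le] at hs
      rw [hSs s (by rw [abs_of_nonneg hs.1]; linarith [hs.2])]
    rw [h1]
    refine intervalIntegral.intervalIntegral_pos_of_pos_on
      ((by fun_prop : Continuous fun s => Real.sin (p * s) ^ 2).intervalIntegrable _ _) ?_ hd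
    intro s hs
    refine pow_pos (Real.sin_pos_of_pos_of_lt_pi ?_ ?_) 2
    · have := hs.1
      positivity
    · have h2 : p * d = Real.pi := by rw [hp]; field_simp
      rw [← h2]
      exact mul_lt_mul_of_pos_left hs.2 (by positivity)
  have hwpos : 0 < ‖tupleFun d w‖ := by
    have : 0 < ‖tupleFun d w‖ ^ 2 := by rw [hwmass]; positivity
    exact lt_of_le_of_ne (norm_nonneg _) fun h => by simp [← h] at this
  have hle : ‖A φ - (μ : ℂ) • (φ : antisymmetricL2 d)‖ ≤ ε * ‖tupleFun d w‖ := by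
    have e : A φ - (μ : ℂ) • (φ : antisymmetricL2 d)
        = ((2 * a : ℝ) : ℂ) • tupleFun d (g - (((p ^ 2 + k ^ 2 : ℝ) : ℂ)) • w) := by
      rw [hφ2, hφ1, map_sub, map_smul, smul_sub, smul_smul, ← Complex.ofReal_mul, ← hμk]
    rw [e, norm_smul, Complex.norm_real, Real.norm_eq_abs, abs_of_pos (by positivity)]
    have h1 : ‖tupleFun d (g - (((p ^ 2 + k ^ 2 : ℝ) : ℂ)) • w)‖
        ≤ ε / (2 * a) * ‖tupleFun d w‖ := by
      refine (sq_le_sq₀ (norm_nonneg _) (by positivity)).1 ?_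
      rw [hresmass, mul_pow, hwmass]
      have := mul_le_mul_of_nonneg_left hRle hcpos.le
      linarith
    calc 2 * a * ‖tupleFun d (g - (((p ^ 2 + k ^ 2 : ℝ) : ℂ)) • w)‖
        ≤ 2 * a * (ε / (2 * a) * ‖tupleFun d w‖) := by gcongr
      _ = ε * ‖tupleFun d w‖ := by field_simp
  refine ⟨((‖tupleFun d w‖⁻¹ : ℝ) : ℂ) • φ, ?_, ?_⟩
  · rw [Submodule.coe_smul, norm_smul, hφ1, Complex.norm_real, norm_inv, norm_norm,
      inv_mul_cancel₀ hwpos.ne']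
  · rw [LinearPMap.map_smul, Submodule.coe_smul, smul_comm, ← smul_sub, norm_smul,
      Complex.norm_real, norm_inv, norm_norm, inv_mul_le_iff₀ hwpos, mul_comm]
    exact hle

end WeylSequence

/-! ### Cutting off trial functions -/

section Regularization

variable {d Λ : ℝ} {F G H : ℝ × ℝ → ℂ}

/-- The density of the quadratic form `∫ |∇F|² - Λ ∫ |F|²`. -/
def formDensity (Λ : ℝ) (F : ℝ × ℝ → ℂ) (q : ℝ × ℝ) : ℝ :=
  ‖pd₁ F q‖ ^ 2 + ‖pd₂ F q‖ ^ 2 - Λ * ‖F q‖ ^ 2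

lemma continuous_formDensity (Λ : ℝ) (hF : ContDiff ℝ ∞ F) : Continuous (formDensity Λ F) := by
  have h1 := continuous_pd₁ hF
  have h2 := continuous_pd₂ hF
  have h3 := hF.continuous
  unfold formDensity
  fun_prop

lemma formDensity_congr {q : ℝ × ℝ} (h : F =ᶠ[𝓝 q] G) : formDensity Λ F q = formDensity Λ G q := by
  rw [formDensity, formDensity, pd₁, pd₁, pd₂, pd₂, h.fderiv_eq, h.eq_of_nhds]

/-- The function that is `0` for `r ≥ r₀` and `1` for `r ≤ r₀ - ε`. -/
def smoothStep (r₀ ε r : ℝ) : ℝ := Real.smoothTransition ((r₀ - r) / ε)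

lemma contDiff_smoothStep (r₀ ε : ℝ) : ContDiff ℝ ∞ (smoothStep r₀ ε) :=
  Real.smoothTransition.contDiff.comp ((contDiff_const.sub contDiff_id).div_const ε)

lemma smoothStep_of_le {r₀ ε r : ℝ} (hε : 0 < ε) (h : r₀ ≤ r) : smoothStep r₀ ε r = 0 :=
  Real.smoothTransition.zero_of_nonpos (div_nonpos_of_nonpos_of_nonneg (by linarith) hε.le)

lemma smoothStep_of_le_sub {r₀ ε r : ℝ} (hε : 0 < ε) (h : r ≤ r₀ - ε) : smoothStep r₀ ε r = 1 :=
  Real.smoothTransition.one_of_one_le ((one_le_div hε).2 (by linarith))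

lemma contDiff_step_mul (hG : ContDiff ℝ ∞ G) (r₀ ε : ℝ) :
    ContDiff ℝ ∞ fun q : ℝ × ℝ => (smoothStep r₀ ε q.2 : ℂ) * G q :=
  (Complex.ofRealCLM.contDiff.comp ((contDiff_smoothStep r₀ ε).comp contDiff_snd)).mul hG

/-- Although the derivative of the step is unbounded as `ε → 0`, its product with `r₀ - r` is
bounded, because the derivative lives on `r₀ - ε ≤ r ≤ r₀`. -/
lemma exists_bound_mul_deriv_smoothTransition :
    ∃ Z, 0 ≤ Z ∧ ∀ x, 0 ≤ x → |x * deriv Real.smoothTransition x| ≤ Z := by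
  have hc : Continuous fun x => x * deriv Real.smoothTransition x :=
    continuous_id.mul ((Real.smoothTransition.contDiff (n := 1)).continuous_deriv le_rfl)
  obtain ⟨Z, hZ⟩ := (isCompact_Icc (a := (0 : ℝ)) (b := 1)).exists_bound_of_continuousOn
    hc.continuousOn
  refine ⟨max Z 0, le_max_right _ _, fun x hx => ?_⟩
  rcases le_or_gt x 1 with h | h
  · exact (hZ x ⟨hx, h⟩).trans (le_max_left _ _)
  · have e : Real.smoothTransition =ᶠ[𝓝 x] fun _ => 1 := by
      filter_upwards [lt_mem_nhds h] with y hy using Real.smoothTransition.one_of_one_le hy.le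
    rw [e.deriv_eq, deriv_const, mul_zero, abs_zero]
    exact le_max_right _ _

lemma ae_snd_ne (c : ℝ) : ∀ᵐ q : ℝ × ℝ, q.2 ≠ c :=
  compl_mem_ae_iff.2 (volume_horizontal_line c)

lemma pd₁_add_step (hH : ContDiff ℝ ∞ H) (hG : ContDiff ℝ ∞ G) (r₀ ε : ℝ) (q : ℝ × ℝ) :
    pd₁ (fun q => H q + (smoothStep r₀ ε q.2 : ℂ) * G q) q
      = pd₁ H q + (smoothStep r₀ ε q.2 : ℂ) * pd₁ G q := by
  have h1 := hasDerivAt_fst (hH.add (contDiff_step_mul hG r₀ ε)) q.2 q.1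
  exact h1.unique ((hasDerivAt_fst hH q.2 q.1).add ((hasDerivAt_fst hG q.2 q.1).const_mul
    (smoothStep r₀ ε q.2 : ℂ)))

/-- The term with the derivative of the step is the one that needs the vanishing of `G` on `r = r₀`. -/
lemma pd₂_add_step (hH : ContDiff ℝ ∞ H) (hG : ContDiff ℝ ∞ G) (r₀ ε : ℝ) (q : ℝ × ℝ) :
    pd₂ (fun q => H q + (smoothStep r₀ ε q.2 : ℂ) * G q) q
      = pd₂ H q + ((-(deriv Real.smoothTransition ((r₀ - q.2) / ε) / ε) : ℝ) * G q
        + (smoothStep r₀ ε q.2 : ℂ) * pd₂ G q) := by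
  have h1 := hasDerivAt_snd (hH.add (contDiff_step_mul hG r₀ ε)) q.1 q.2
  have h2 : HasDerivAt (smoothStep r₀ ε)
      (-(deriv Real.smoothTransition ((r₀ - q.2) / ε) / ε)) q.2 := by
    have h3 := ((Real.smoothTransition.contDiff (n := 1)).differentiable one_ne_zero
      ((r₀ - q.2) / ε)).hasDerivAt
    have h4 := h3.comp q.2 (((hasDerivAt_id q.2).const_sub r₀).div_const ε)
    refine h4.congr_deriv ?_
    ring
  exact h1.unique ((hasDerivAt_snd hH q.1 q.2).add (h2.ofReal_comp.mul (hasDerivAt_snd hG q.1 q.2)))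

/-- A function that vanishes on the line `r = r₀` can be cut off there at no cost in energy. -/
lemma tendsto_integral_formDensity_step (hH : ContDiff ℝ ∞ H) (hG : ContDiff ℝ ∞ G) {r₀ r₁ : ℝ}
    (h0 : ∀ s, G (s, r₀) = 0) {S : Set (ℝ × ℝ)} (hS : MeasurableSet S)
    (hSK : S ⊆ Icc 0 d ×ˢ Icc r₁ r₀) :
    Tendsto (fun ε => ∫ q in S, formDensity Λ (fun q => H q + (smoothStep r₀ ε q.2 : ℂ) * G q) q)
      (𝓝[>] 0) (𝓝 (∫ q in S, formDensity Λ (fun q => H q + G q) q)) := by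
  have hK : IsCompact (Icc 0 d ×ˢ Icc r₁ r₀) := isCompact_Icc.prod isCompact_Icc
  have hbd : ∀ f : ℝ × ℝ → ℂ, Continuous f →
      ∃ M, 0 ≤ M ∧ ∀ q ∈ Icc 0 d ×ˢ Icc r₁ r₀, ‖f q‖ ≤ M := fun f hf => by
    obtain ⟨M, hM⟩ := hK.exists_bound_of_continuousOn hf.continuousOn
    exact ⟨max M 0, le_max_right _ _, fun q hq => (hM q hq).trans (le_max_left _ _)⟩
  obtain ⟨M0, hM0, hb0⟩ := hbd H hH.continuous
  obtain ⟨M1, hM1, hb1⟩ := hbd _ (continuous_pd₁ hH)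
  obtain ⟨M2, hM2, hb2⟩ := hbd _ (continuous_pd₂ hH)
  obtain ⟨N0, hN0, hc0⟩ := hbd G hG.continuous
  obtain ⟨N1, hN1, hc1⟩ := hbd _ (continuous_pd₁ hG)
  obtain ⟨N2, hN2, hc2⟩ := hbd _ (continuous_pd₂ hG)
  obtain ⟨Z, hZ0, hZ⟩ := exists_bound_mul_deriv_smoothTransition
  have hlip : ∀ q ∈ Icc 0 d ×ˢ Icc r₁ r₀, ‖G q‖ ≤ N2 * (r₀ - q.2) := by
    rintro ⟨s, r⟩ ⟨hs, hr⟩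
    have h := (convex_Icc r₁ r₀).norm_image_sub_le_of_norm_hasDerivWithin_le
      (f := fun r => G (s, r)) (fun x _ => (hasDerivAt_snd hG s x).hasDerivWithinAt)
      (fun x hx => hc2 (s, x) ⟨hs, hx⟩) ⟨hr.1.trans hr.2, le_rfl⟩ hr
    simp only [h0, sub_zero] at h
    rwa [Real.norm_eq_abs, abs_sub_comm, abs_of_nonneg (sub_nonneg.2 hr.2)] at h
  have hstep : ∀ ε r, ‖(smoothStep r₀ ε r : ℂ)‖ ≤ 1 := fun ε r => by
    rw [Complex.norm_real, Real.norm_eq_abs, smoothStep,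
      abs_of_nonneg (Real.smoothTransition.nonneg _)]
    exact Real.smoothTransition.le_one _
  have hmul : ∀ ε r (z : ℂ), ‖(smoothStep r₀ ε r : ℂ) * z‖ ≤ ‖z‖ := fun ε r z => by
    rw [norm_mul]
    exact mul_le_of_le_one_left (norm_nonneg _) (hstep ε r)
  refine tendsto_integral_filter_of_dominated_convergence
    (fun _ => (M1 + N1) ^ 2 + (M2 + (N2 * Z + N2)) ^ 2 + |Λ| * (M0 + N0) ^ 2)
    (Eventually.of_forall fun ε => (continuous_formDensity Λ
      (hH.add (contDiff_step_mul hG r₀ ε))).aestronglyMeasurable) ?_ ?_ ?_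
  · filter_upwards [self_mem_nhdsWithin] with ε hε
    have hε : 0 < ε := hε
    filter_upwards [ae_restrict_mem hS] with q hq
    have hqK := hSK hq
    have e1 : ‖pd₁ (fun q => H q + (smoothStep r₀ ε q.2 : ℂ) * G q) q‖ ≤ M1 + N1 := by
      rw [pd₁_add_step hH hG]
      exact (norm_add_le _ _).trans (add_le_add (hb1 q hqK) ((hmul _ _ _).trans (hc1 q hqK)))
    have e2 : ‖pd₂ (fun q => H q + (smoothStep r₀ ε q.2 : ℂ) * G q) q‖ ≤ M2 + (N2 * Z + N2) := by
      rw [pd₂_add_step hH hG]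
      refine (norm_add_le _ _).trans (add_le_add (hb2 q hqK) ((norm_add_le _ _).trans
        (add_le_add ?_ ((hmul _ _ _).trans (hc2 q hqK)))))
      have hx : 0 ≤ (r₀ - q.2) / ε := div_nonneg (sub_nonneg.2 hqK.2.2) hε.le
      have hz := hZ _ hx
      rw [abs_mul, abs_of_nonneg hx] at hz
      rw [norm_mul, Complex.norm_real, norm_neg, norm_div, Real.norm_eq_abs, Real.norm_eq_abs,
        abs_of_pos hε]
      calc |deriv Real.smoothTransition ((r₀ - q.2) / ε)| / ε * ‖G q‖
          ≤ |deriv Real.smoothTransition ((r₀ - q.2) / ε)| / ε * (N2 * (r₀ - q.2)) := by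
            gcongr
            exact hlip q hqK
        _ = N2 * ((r₀ - q.2) / ε * |deriv Real.smoothTransition ((r₀ - q.2) / ε)|) := by ring
        _ ≤ N2 * Z := by gcongr
    have e0 : ‖H q + (smoothStep r₀ ε q.2 : ℂ) * G q‖ ≤ M0 + N0 :=
      (norm_add_le _ _).trans (add_le_add (hb0 q hqK) ((hmul _ _ _).trans (hc0 q hqK)))
    rw [formDensity, Real.norm_eq_abs]
    refine (abs_sub _ _).trans (add_le_add ?_ ?_)
    · rw [abs_of_nonneg (by positivity)]
      gcongr
    · rw [abs_mul, abs_of_nonneg (sq_nonneg ‖_‖)]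
      gcongr
  · refine integrable_const_iff.2 (Or.inr ?_)
    rw [isFiniteMeasure_restrict]
    exact ((measure_mono hSK).trans_lt hK.measure_lt_top).ne
  · filter_upwards [ae_restrict_mem hS, ae_restrict_of_ae (ae_snd_ne r₀)] with q hq hne
    have hlt : q.2 < r₀ := lt_of_le_of_ne (hSK hq).2.2 hne
    refine tendsto_const_nhds.congr' ?_
    filter_upwards [self_mem_nhdsWithin, nhdsWithin_le_nhds (gt_mem_nhds (sub_pos.2 hlt))]
      with ε hε hε2
    refine formDensity_congr ?_
    filter_upwards [continuous_snd.continuousAt.preimage_mem_nhds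
      (gt_mem_nhds (show q.2 < r₀ - ε by linarith))] with y hy
    have hy : y.2 < r₀ - ε := hy
    rw [smoothStep_of_le_sub hε hy.le, Complex.ofReal_one, one_mul]

end Regularization

section Gluing

variable {d Λ : ℝ}

/-- The factor `2` comes from the change of variables, which is a rotation up to the factor `√2`. -/
lemma tupleEnergy_sub_mass {w : TupleSpace d} {F : ℝ × ℝ → ℂ} (hF : ContDiff ℝ ∞ F)
    (hc : HasCompactSupport F) (hw : IsTupleOf w (fun p => F (rotInv p))) (Λ : ℝ) :
    tupleEnergy w - 2 * Λ * ‖tupleFun d w‖ ^ 2 = 2 * ∫ q in halfStrip d, formDensity Λ F q := by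
  have i1 := integrable_norm_sq (μ := volume) (continuous_pd₁ hF) (hasCompactSupport_pd₁ hc)
  have i2 := integrable_norm_sq (μ := volume) (continuous_pd₂ hF) (hasCompactSupport_pd₂ hc)
  have i0 := integrable_norm_sq (μ := volume) hF.continuous hc
  rw [tupleEnergy, ← hw.energy_eq, ← hw.mass_eq,
    energy_eq hw.contDiff hw.hasCompactSupport hw.antisymm,
    mass_eq hw.contDiff hw.hasCompactSupport hw.antisymm]
  simp only [rotInv_rotCLM, formDensity]
  rw [integral_sub (i1.fun_add i2).integrableOn (i0.const_mul Λ).integrableOn, integral_const_mul]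
  ring

/-- Two functions which agree on the line `r = d`, one for the tip and one for the rectangle
`d ≤ r ≤ R`, form together a trial function. Its kinks on `r = d` and `r = R` are smoothed by two steps, at an
arbitrarily small cost in energy. -/
lemma exists_trial_of_glue (hd : 0 < d) {R : ℝ} (hR : d < R) {F₁ F₂ : ℝ × ℝ → ℂ}
    (h₁ : ContDiff ℝ ∞ F₁) (h₂ : ContDiff ℝ ∞ F₂) (hodd₁ : ∀ s r, F₁ (-s, r) = -F₁ (s, r))
    (hodd₂ : ∀ s r, F₂ (-s, r) = -F₂ (s, r)) (hglue : ∀ s, F₁ (s, d) = F₂ (s, d))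
    (hside : ∀ r, F₂ (d, r) = 0) (hend : ∀ s, F₂ (s, R) = 0)
    (hneg : (∫ q in tipTriangle d, formDensity Λ F₁ q)
      + ∫ q in Icc 0 d ×ˢ Icc d R, formDensity Λ F₂ q < 0) :
    ∃ w ∈ formTuples d, tupleFun d w ≠ 0 ∧ tupleEnergy w < 2 * Λ * ‖tupleFun d w‖ ^ 2 := by
  have hm : MeasurableSet (Icc 0 d ×ˢ Icc d R) := measurableSet_Icc.prod measurableSet_Icc
  have t1 := tendsto_integral_formDensity_step (Λ := Λ) (d := d) (r₀ := d) (r₁ := 0) h₂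
    (h₁.sub h₂) (fun s => sub_eq_zero.2 (hglue s)) (measurableSet_tipTriangle d)
    (fun q hq => ⟨⟨hq.1, hq.2.1.trans hq.2.2⟩, hq.1.trans hq.2.1, hq.2.2⟩)
  have t2 := tendsto_integral_formDensity_step (Λ := Λ) (d := d) (r₀ := R) (r₁ := d)
    (contDiff_const (c := (0 : ℂ))) h₂ hend hm subset_rfl
  simp only [add_sub_cancel, zero_add] at t1 t2
  have hεR : ∀ᶠ ε in 𝓝[>] (0 : ℝ), ε < R - d :=
    nhdsWithin_le_nhds (gt_mem_nhds (sub_pos.2 hR))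
  have hεpos : ∀ᶠ ε in 𝓝[>] (0 : ℝ), 0 < ε := self_mem_nhdsWithin
  obtain ⟨ε, hεneg, hε, hεR⟩ := (((t1.add t2).eventually_lt_const hneg).and
    (hεpos.and hεR)).exists
  obtain ⟨η, hη, hηc, hηe, hη1⟩ := exists_even_cutoff (ρ := R + 1) (by linarith)
  set W : ℝ × ℝ → ℂ := fun q => (smoothStep R ε q.2 : ℂ) * F₂ q
    + (smoothStep d ε q.2 : ℂ) * (F₁ q - F₂ q) with hW
  set F : ℝ × ℝ → ℂ := fun q => ((η q.1 * η q.2 : ℝ) : ℂ) * W q with hF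
  have hWC : ContDiff ℝ ∞ W :=
    (contDiff_step_mul h₂ R ε).add (contDiff_step_mul (h₁.sub h₂) d ε)
  have hFC : ContDiff ℝ ∞ F := (Complex.ofRealCLM.contDiff.comp
    ((hη.comp contDiff_fst).mul (hη.comp contDiff_snd))).mul hWC
  have hFc : HasCompactSupport F := by
    refine HasCompactSupport.intro (K := tsupport η ×ˢ tsupport η) (hηc.prod hηc) fun q hq => ?_
    have : η q.1 * η q.2 = 0 := by
      by_contra h
      exact hq ⟨subset_tsupport _ (left_ne_zero_of_mul h),
        subset_tsupport _ (right_ne_zero_of_mul h)⟩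
    simp only [hF, this, Complex.ofReal_zero, zero_mul]
  have hFodd : ∀ s r, F (-s, r) = -F (s, r) := fun s r => by
    simp only [hF, hW, hηe, hodd₁, hodd₂]
    ring
  have hFside : ∀ r, d ≤ r → F (d, r) = 0 := fun r hr => by
    simp only [hF, hW, hside, smoothStep_of_le hε hr]
    simp
  have hloc : ∀ q : ℝ × ℝ, |q.1| < R + 1 → |q.2| < R + 1 → F =ᶠ[𝓝 q] W := fun q hq1 hq2 => by
    filter_upwards [continuous_fst.abs.continuousAt.preimage_mem_nhds (gt_mem_nhds hq1),
      continuous_snd.abs.continuousAt.preimage_mem_nhds (gt_mem_nhds hq2)] with y hy1 hy2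
    have e1 : η y.1 = 1 := hη1 _ (le_of_lt hy1)
    have e2 : η y.2 = 1 := hη1 _ (le_of_lt hy2)
    simp only [hF, e1, e2, mul_one, Complex.ofReal_one, one_mul]
  obtain ⟨w, hw⟩ := exists_isTupleOf_rotInv (d := d) hFC hFc hFodd
  have hwmem : w ∈ formTuples d := by
    refine mem_formTuples.2 ⟨Submodule.le_topologicalClosure _ ⟨_, hw⟩, ?_⟩
    rw [Lp.eq_zero_iff_ae_eq_zero]
    filter_upwards [hw.side_ae, ae_restrict_mem measurableSet_Ici] with t ht ht0
    have ht0 : 0 ≤ t := ht0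
    have e : F (rotInv (t + d, t)) = 0 := by
      simp only [rotInv, add_sub_cancel_left]
      exact hFside _ (by linarith)
    rw [ht, e]
    rfl
  have hint : Integrable (formDensity Λ F) := by
    unfold formDensity
    exact ((integrable_norm_sq (continuous_pd₁ hFC) (hasCompactSupport_pd₁ hFc)).fun_add
      (integrable_norm_sq (continuous_pd₂ hFC) (hasCompactSupport_pd₂ hFc))).sub
      ((integrable_norm_sq hFC.continuous hFc).const_mul Λ)
  have htip : ∫ q in tipTriangle d, formDensity Λ F q = ∫ q in tipTriangle d,
      formDensity Λ (fun q => F₂ q + (smoothStep d ε q.2 : ℂ) * (F₁ q - F₂ q)) q := by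
    refine integral_congr_ae ?_
    filter_upwards [ae_restrict_mem (measurableSet_tipTriangle d)] with q hq
    obtain ⟨hq1, hq2, hq3⟩ := hq
    refine formDensity_congr ?_
    filter_upwards [hloc q (by rw [abs_of_nonneg hq1]; linarith)
      (by rw [abs_of_nonneg (by linarith)]; linarith),
      continuous_snd.continuousAt.preimage_mem_nhds
        (gt_mem_nhds (show q.2 < R - ε by linarith))] with y hy hy2
    have hy2 : y.2 < R - ε := hy2
    rw [hy]
    simp only [hW]
    rw [smoothStep_of_le_sub hε hy2.le, Complex.ofReal_one, one_mul]
  have hout : ∫ q in outerStrip d, formDensity Λ F q = ∫ q in Icc 0 d ×ˢ Icc d R,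
      formDensity Λ (fun q => (smoothStep R ε q.2 : ℂ) * F₂ q) q := by
    have hsub : Icc 0 d ×ˢ Icc d R ⊆ outerStrip d := fun q hq => ⟨hq.1.1, hq.1.2, hq.2.1⟩
    rw [setIntegral_eq_of_subset_of_ae_sdiff_eq_zero (measurableSet_outerStrip d).nullMeasurableSet
      hsub]
    · refine integral_congr_ae ?_
      filter_upwards [ae_restrict_mem hm, ae_restrict_of_ae (ae_snd_ne d)] with q hq hne
      refine formDensity_congr ?_
      filter_upwards [hloc q (by rw [abs_of_nonneg hq.1.1]; linarith [hq.1.2])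
        (by rw [abs_of_nonneg (by linarith [hq.2.1])]; linarith [hq.2.2]),
        continuous_snd.continuousAt.preimage_mem_nhds
          (lt_mem_nhds (lt_of_le_of_ne hq.2.1 hne.symm))] with y hy hy2
      have hy2 : d < y.2 := hy2
      rw [hy]
      simp only [hW]
      rw [smoothStep_of_le hε hy2.le, Complex.ofReal_zero, zero_mul, add_zero]
    · refine ae_of_all _ fun q hq => ?_
      have hqR : R < q.2 := by
        by_contra h
        exact hq.2 ⟨⟨hq.1.1, hq.1.2.1⟩, hq.1.2.2, not_lt.1 h⟩
      have e : F =ᶠ[𝓝 q] fun _ => 0 := by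
        filter_upwards [continuous_snd.continuousAt.preimage_mem_nhds (lt_mem_nhds hqR)] with y hy
        have hy : R < y.2 := hy
        simp only [hF, hW]
        rw [smoothStep_of_le hε hy.le, smoothStep_of_le hε (hR.trans hy).le]
        simp
      rw [formDensity_congr e, formDensity, pd₁, pd₂]
      simp
  have hE := tupleEnergy_sub_mass hFC hFc hw Λ
  rw [setIntegral_halfStrip_eq_add hint, htip, hout] at hE
  have hlt : tupleEnergy w < 2 * Λ * ‖tupleFun d w‖ ^ 2 := by linarith
  refine ⟨w, hwmem, fun h0 => ?_, hlt⟩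
  rw [h0] at hlt
  have := tupleEnergy_nonneg w
  simp at hlt
  linarith

end Gluing

/-! ### Green's identity for solutions of the Helmholtz equation -/

section Helmholtz

variable {d Λ : ℝ} {f f₁ f₂ : ℝ × ℝ → ℝ}

/-- `f` is a smooth solution of `Δf + Λ f = 0` in the plane, with partial derivatives `f₁`
and `f₂`. -/
structure IsHelmholtz (Λ : ℝ) (f f₁ f₂ : ℝ × ℝ → ℝ) : Prop where
  contDiff : ContDiff ℝ ∞ f
  contDiff₁ : ContDiff ℝ ∞ f₁
  contDiff₂ : ContDiff ℝ ∞ f₂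
  deriv₁ : ∀ s r, HasDerivAt (fun s => f (s, r)) (f₁ (s, r)) s
  deriv₂ : ∀ s r, HasDerivAt (fun r => f (s, r)) (f₂ (s, r)) r
  laplace : ∃ k : ℝ × ℝ → ℝ, ∀ s r, HasDerivAt (fun s => f₁ (s, r)) (k (s, r)) s ∧
    HasDerivAt (fun r => f₂ (s, r)) (-Λ * f (s, r) - k (s, r)) r

lemma IsHelmholtz.sum {N : ℕ} {F F₁ F₂ : ℕ → ℝ × ℝ → ℝ}
    (h : ∀ n, IsHelmholtz Λ (F n) (F₁ n) (F₂ n)) :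
    IsHelmholtz Λ (fun q => ∑ n ∈ Finset.range N, F n q) (fun q => ∑ n ∈ Finset.range N, F₁ n q)
      (fun q => ∑ n ∈ Finset.range N, F₂ n q) where
  contDiff := ContDiff.sum fun n _ => (h n).contDiff
  contDiff₁ := ContDiff.sum fun n _ => (h n).contDiff₁
  contDiff₂ := ContDiff.sum fun n _ => (h n).contDiff₂
  deriv₁ := fun s r => HasDerivAt.fun_sum fun n _ => (h n).deriv₁ s r
  deriv₂ := fun s r => HasDerivAt.fun_sum fun n _ => (h n).deriv₂ s r
  laplace := by
    choose k hk using fun n => (h n).laplace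
    refine ⟨fun q => ∑ n ∈ Finset.range N, k n q, fun s r =>
      ⟨HasDerivAt.fun_sum fun n _ => (hk n s r).1, ?_⟩⟩
    rw [Finset.mul_sum, ← Finset.sum_sub_distrib]
    exact HasDerivAt.fun_sum fun n _ => (hk n s r).2

lemma IsHelmholtz.add {g g₁ g₂ : ℝ × ℝ → ℝ} (h : IsHelmholtz Λ f f₁ f₂)
    (h' : IsHelmholtz Λ g g₁ g₂) :
    IsHelmholtz Λ (fun q => f q + g q) (fun q => f₁ q + g₁ q) (fun q => f₂ q + g₂ q) where
  contDiff := h.contDiff.add h'.contDiff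
  contDiff₁ := h.contDiff₁.add h'.contDiff₁
  contDiff₂ := h.contDiff₂.add h'.contDiff₂
  deriv₁ := fun s r => (h.deriv₁ s r).add (h'.deriv₁ s r)
  deriv₂ := fun s r => (h.deriv₂ s r).add (h'.deriv₂ s r)
  laplace := by
    obtain ⟨k, hk⟩ := h.laplace
    obtain ⟨k', hk'⟩ := h'.laplace
    refine ⟨fun q => k q + k' q, fun s r => ⟨(hk s r).1.add (hk' s r).1, ?_⟩⟩
    refine ((hk s r).2.add (hk' s r).2).congr_deriv ?_
    ring

/-- Separation of variables. -/
lemma isHelmholtz_mul {a a' b b' : ℝ → ℝ} {α β : ℝ} (ha : ContDiff ℝ ∞ a) (ha' : ContDiff ℝ ∞ a')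
    (hb : ContDiff ℝ ∞ b) (hb' : ContDiff ℝ ∞ b') (h1 : ∀ s, HasDerivAt a (a' s) s)
    (h2 : ∀ s, HasDerivAt a' (α * a s) s) (h3 : ∀ r, HasDerivAt b (b' r) r)
    (h4 : ∀ r, HasDerivAt b' (β * b r) r) (hαβ : α + β = -Λ) :
    IsHelmholtz Λ (fun q => a q.1 * b q.2) (fun q => a' q.1 * b q.2)
      (fun q => a q.1 * b' q.2) where
  contDiff := (ha.comp contDiff_fst).mul (hb.comp contDiff_snd)
  contDiff₁ := (ha'.comp contDiff_fst).mul (hb.comp contDiff_snd)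
  contDiff₂ := (ha.comp contDiff_fst).mul (hb'.comp contDiff_snd)
  deriv₁ := fun s r => (h1 s).mul_const (b r)
  deriv₂ := fun s r => (h3 r).const_mul (a s)
  laplace := by
    refine ⟨fun q => α * a q.1 * b q.2, fun s r => ⟨(h2 s).mul_const (b r), ?_⟩⟩
    refine ((h4 r).const_mul (a s)).congr_deriv ?_
    simp only
    rw [← hαβ]
    ring

lemma IsHelmholtz.formDensity_eq (h : IsHelmholtz Λ f f₁ f₂) (q : ℝ × ℝ) :
    formDensity Λ (fun q => (f q : ℂ)) q = f₁ q ^ 2 + f₂ q ^ 2 - Λ * f q ^ 2 := by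
  have hC : ContDiff ℝ ∞ fun q => (f q : ℂ) := Complex.ofRealCLM.contDiff.comp h.contDiff
  have e1 : pd₁ (fun q => (f q : ℂ)) q = f₁ q :=
    (hasDerivAt_fst hC q.2 q.1).unique (h.deriv₁ q.1 q.2).ofReal_comp
  have e2 : pd₂ (fun q => (f q : ℂ)) q = f₂ q :=
    (hasDerivAt_snd hC q.1 q.2).unique (h.deriv₂ q.1 q.2).ofReal_comp
  rw [formDensity, e1, e2]
  simp only [Complex.norm_real, Real.norm_eq_abs, sq_abs]

/-- Green's identity: the form of a solution over a rectangle is a boundary integral. -/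
lemma IsHelmholtz.setIntegral_rectangle (h : IsHelmholtz Λ f f₁ f₂) {a₁ a₂ b₁ b₂ : ℝ}
    (h1 : a₁ ≤ b₁) (h2 : a₂ ≤ b₂) :
    ∫ q in Icc a₁ b₁ ×ˢ Icc a₂ b₂, formDensity Λ (fun q => (f q : ℂ)) q
      = (∫ s in a₁..b₁, f (s, b₂) * f₂ (s, b₂)) - (∫ s in a₁..b₁, f (s, a₂) * f₂ (s, a₂))
        + (∫ r in a₂..b₂, f (b₁, r) * f₁ (b₁, r)) - ∫ r in a₂..b₂, f (a₁, r) * f₁ (a₁, r) := by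
  obtain ⟨k, hk⟩ := h.laplace
  have c1 := h.contDiff.mul h.contDiff₁
  have c2 := h.contDiff.mul h.contDiff₂
  have d1 : ∀ q, HasFDerivAt (f * f₁) (fderiv ℝ (f * f₁) q) q := fun q =>
    (c1.differentiable (by simp) q).hasFDerivAt
  have d2 : ∀ q, HasFDerivAt (f * f₂) (fderiv ℝ (f * f₂) q) q := fun q =>
    (c2.differentiable (by simp) q).hasFDerivAt
  have e1 : ∀ q : ℝ × ℝ, fderiv ℝ (f * f₁) q (1, 0) = f₁ q * f₁ q + f q * k q := fun q => by
    have h3 : HasDerivAt (fun s => (f * f₁) (s, q.2)) (fderiv ℝ (f * f₁) q (1, 0)) q.1 :=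
      (d1 q).comp_hasDerivAt q.1 ((hasDerivAt_id q.1).prodMk (hasDerivAt_const q.1 q.2))
    exact h3.unique ((h.deriv₁ q.1 q.2).mul (hk q.1 q.2).1)
  have e2 : ∀ q : ℝ × ℝ, fderiv ℝ (f * f₂) q (0, 1)
      = f₂ q * f₂ q + f q * (-Λ * f q - k q) := fun q => by
    have h3 : HasDerivAt (fun r => (f * f₂) (q.1, r)) (fderiv ℝ (f * f₂) q (0, 1)) q.2 :=
      (d2 q).comp_hasDerivAt q.2 ((hasDerivAt_const q.2 q.1).prodMk (hasDerivAt_id q.2))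
    exact h3.unique ((h.deriv₂ q.1 q.2).mul (hk q.1 q.2).2)
  have e : ∀ q, fderiv ℝ (f * f₁) q (1, 0) + fderiv ℝ (f * f₂) q (0, 1)
      = formDensity Λ (fun q => (f q : ℂ)) q := fun q => by
    rw [e1, e2, h.formDensity_eq]
    ring
  have hC : ContDiff ℝ ∞ fun q => (f q : ℂ) := Complex.ofRealCLM.contDiff.comp h.contDiff
  have key := integral_divergence_prod_Icc_of_hasFDerivAt_of_le (f * f₁) (f * f₂)
    (fderiv ℝ (f * f₁)) (fderiv ℝ (f * f₂)) (a₁, a₂) (b₁, b₂) ⟨h1, h2⟩ c1.continuous.continuousOn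
    c2.continuous.continuousOn (fun q _ => d1 q) (fun q _ => d2 q) (by
      simp only [e]
      exact (continuous_formDensity Λ hC).continuousOn.integrableOn_compact isCompact_Icc)
  simp only [e] at key
  rw [Icc_prod_Icc, key]
  rfl

/-- The integral of a symmetric function over the tip is half its integral over the square. -/
lemma setIntegral_square_of_symm {G : ℝ × ℝ → ℝ} (hG : Continuous G) (hs : ∀ q, G q.swap = G q) :
    ∫ q in Icc 0 d ×ˢ Icc 0 d, G q = 2 * ∫ q in tipTriangle d, G q := by
  have e : Icc 0 d ×ˢ Icc 0 d = tipTriangle d ∪ Prod.swap ⁻¹' tipTriangle d := by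
    ext ⟨s, r⟩
    simp only [tipTriangle, mem_prod, mem_Icc, mem_union, mem_preimage, mem_ofPred_eq, Prod.swap]
    constructor
    · rintro ⟨⟨h1, h2⟩, h3, h4⟩
      rcases le_total s r with h | h
      · exact Or.inl ⟨h1, h, h4⟩
      · exact Or.inr ⟨h3, h, h2⟩
    · rintro (⟨h1, h2, h3⟩ | ⟨h1, h2, h3⟩)
      · exact ⟨⟨h1, h2.trans h3⟩, h1.trans h2, h3⟩
      · exact ⟨⟨h1.trans h2, h3⟩, h1, h2.trans h3⟩
  have hi : IntegrableOn G (Icc 0 d ×ˢ Icc 0 d) :=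
    hG.continuousOn.integrableOn_compact (isCompact_Icc.prod isCompact_Icc)
  have h2 := setIntegral_swap (tipTriangle d) G
  simp only [hs] at h2
  have h3 : AEDisjoint volume (tipTriangle d) (Prod.swap ⁻¹' tipTriangle d) := by
    refine measure_mono_null ?_ volume_diagonal
    rintro p ⟨⟨_, h, _⟩, ⟨_, h', _⟩⟩
    exact le_antisymm h h'
  rw [e] at hi
  rw [e, setIntegral_union₀ h3
    ((measurableSet_tipTriangle d).preimage measurable_swap).nullMeasurableSet
    hi.left_of_union hi.right_of_union, h2]
  ring

/-- The form of a solution that is symmetric and vanishes on the axes, over the tip. -/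
lemma IsHelmholtz.setIntegral_tip (h : IsHelmholtz Λ f f₁ f₂) (hd : 0 < d)
    (hs : ∀ s r, f (s, r) = f (r, s)) (h0 : ∀ r, f (0, r) = 0) :
    ∫ q in tipTriangle d, formDensity Λ (fun q => (f q : ℂ)) q
      = ∫ s in (0 : ℝ)..d, f (s, d) * f₂ (s, d) := by
  have hC : ContDiff ℝ ∞ fun q => (f q : ℂ) := Complex.ofRealCLM.contDiff.comp h.contDiff
  have e : ∀ s r, f₁ (s, r) = f₂ (r, s) := fun s r => by
    have h1 := h.deriv₁ s r
    simp only [fun s => hs s r] at h1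
    exact h1.unique (h.deriv₂ r s)
  have hsq := setIntegral_square_of_symm (d := d) (continuous_formDensity Λ hC) (by
    rintro ⟨s, r⟩
    simp only [Prod.swap, h.formDensity_eq]
    rw [e r s, ← e s r, hs r s]
    ring)
  rw [h.setIntegral_rectangle hd.le hd.le] at hsq
  simp only [e, h0, fun s => hs s 0, fun r => hs d r, zero_mul, intervalIntegral.integral_zero,
    sub_zero] at hsq
  linarith

/-- The form of a solution that vanishes on three sides of a rectangle. -/
lemma IsHelmholtz.setIntegral_outer (h : IsHelmholtz Λ f f₁ f₂) (hd : 0 < d) {R : ℝ} (hR : d < R)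
    (h0 : ∀ r, f (0, r) = 0) (h1 : ∀ r, f (d, r) = 0) (h2 : ∀ s, f (s, R) = 0) :
    ∫ q in Icc 0 d ×ˢ Icc d R, formDensity Λ (fun q => (f q : ℂ)) q
      = -∫ s in (0 : ℝ)..d, f (s, d) * f₂ (s, d) := by
  rw [h.setIntegral_rectangle hd.le hR.le]
  simp only [h0, h1, h2, zero_mul, intervalIntegral.integral_zero, sub_zero, add_zero, zero_sub]

end Helmholtz

/-! ### Trial functions from the modes of the strip -/

section Modes

variable {d Λ : ℝ}

lemma IsHelmholtz.const_mul {f f₁ f₂ : ℝ × ℝ → ℝ} (h : IsHelmholtz Λ f f₁ f₂) (c : ℝ) :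
    IsHelmholtz Λ (fun q => c * f q) (fun q => c * f₁ q) (fun q => c * f₂ q) where
  contDiff := contDiff_const.mul h.contDiff
  contDiff₁ := contDiff_const.mul h.contDiff₁
  contDiff₂ := contDiff_const.mul h.contDiff₂
  deriv₁ := fun s r => (h.deriv₁ s r).const_mul c
  deriv₂ := fun s r => (h.deriv₂ s r).const_mul c
  laplace := by
    obtain ⟨k, hk⟩ := h.laplace
    refine ⟨fun q => c * k q, fun s r => ⟨(hk s r).1.const_mul c, ?_⟩⟩
    refine ((hk s r).2.const_mul c).congr_deriv ?_
    ring

lemma hasDerivAt_sin_mul (k s : ℝ) :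
    HasDerivAt (fun s => Real.sin (k * s)) (k * Real.cos (k * s)) s := by
  refine ((Real.hasDerivAt_sin (k * s)).comp s ((hasDerivAt_id s).const_mul k)).congr_deriv ?_
  ring

lemma hasDerivAt_cos_mul (k s : ℝ) :
    HasDerivAt (fun s => Real.cos (k * s)) (-(k * Real.sin (k * s))) s := by
  refine ((Real.hasDerivAt_cos (k * s)).comp s ((hasDerivAt_id s).const_mul k)).congr_deriv ?_
  ring

lemma hasDerivAt_sinh_mul (k s : ℝ) :
    HasDerivAt (fun s => Real.sinh (k * s)) (k * Real.cosh (k * s)) s := by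
  refine ((Real.hasDerivAt_sinh (k * s)).comp s ((hasDerivAt_id s).const_mul k)).congr_deriv ?_
  ring

lemma hasDerivAt_cosh_mul (k s : ℝ) :
    HasDerivAt (fun s => Real.cosh (k * s)) (k * Real.sinh (k * s)) s := by
  refine ((Real.hasDerivAt_cosh (k * s)).comp s ((hasDerivAt_id s).const_mul k)).congr_deriv ?_
  ring

lemma isHelmholtz_sin_sinh {k κ : ℝ} (h : κ ^ 2 = k ^ 2 - Λ) :
    IsHelmholtz Λ (fun q => Real.sin (k * q.1) * Real.sinh (κ * q.2))
      (fun q => k * Real.cos (k * q.1) * Real.sinh (κ * q.2))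
      (fun q => Real.sin (k * q.1) * (κ * Real.cosh (κ * q.2))) := by
  refine isHelmholtz_mul (α := -k ^ 2) (β := κ ^ 2) (by fun_prop) (by fun_prop) (by fun_prop)
    (by fun_prop) (hasDerivAt_sin_mul k)
    (fun s => ((hasDerivAt_cos_mul k s).const_mul k).congr_deriv (by ring)) (hasDerivAt_sinh_mul κ)
    (fun s => ((hasDerivAt_cosh_mul κ s).const_mul κ).congr_deriv (by ring)) (by rw [h]; ring)

lemma isHelmholtz_sinh_sin {k κ : ℝ} (h : κ ^ 2 = k ^ 2 - Λ) :
    IsHelmholtz Λ (fun q => Real.sinh (κ * q.1) * Real.sin (k * q.2))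
      (fun q => κ * Real.cosh (κ * q.1) * Real.sin (k * q.2))
      (fun q => Real.sinh (κ * q.1) * (k * Real.cos (k * q.2))) := by
  refine isHelmholtz_mul (α := κ ^ 2) (β := -k ^ 2) (by fun_prop) (by fun_prop) (by fun_prop)
    (by fun_prop) (hasDerivAt_sinh_mul κ)
    (fun s => ((hasDerivAt_cosh_mul κ s).const_mul κ).congr_deriv (by ring)) (hasDerivAt_sin_mul k)
    (fun s => ((hasDerivAt_cos_mul k s).const_mul k).congr_deriv (by ring)) (by rw [h]; ring)

/-- The mode of the outer strip that vanishes at `r = R`. -/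
lemma isHelmholtz_sin_sinh_sub {k κ : ℝ} (h : κ ^ 2 = k ^ 2 - Λ) (R : ℝ) :
    IsHelmholtz Λ (fun q => Real.sin (k * q.1) * Real.sinh (κ * (R - q.2)))
      (fun q => k * Real.cos (k * q.1) * Real.sinh (κ * (R - q.2)))
      (fun q => Real.sin (k * q.1) * -(κ * Real.cosh (κ * (R - q.2)))) := by
  have h1 : ∀ r, HasDerivAt (fun r => Real.sinh (κ * (R - r))) (-(κ * Real.cosh (κ * (R - r)))) r :=
    fun r => (HasDerivAt.comp_const_sub R r (hasDerivAt_sinh_mul κ (R - r)))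
  have h2 : ∀ r, HasDerivAt (fun r => Real.cosh (κ * (R - r))) (-(κ * Real.sinh (κ * (R - r)))) r :=
    fun r => (HasDerivAt.comp_const_sub R r (hasDerivAt_cosh_mul κ (R - r)))
  refine isHelmholtz_mul (α := -k ^ 2) (β := κ ^ 2) (by fun_prop) (by fun_prop) (by fun_prop)
    (by fun_prop) (hasDerivAt_sin_mul k)
    (fun s => ((hasDerivAt_cos_mul k s).const_mul k).congr_deriv (by ring)) h1
    (fun s => ((h2 s).const_mul κ).neg.congr_deriv (by ring)) (by rw [h]; ring)

lemma integral_sin_mul_sin_of_ne {k l : ℝ} (hkl : k ^ 2 ≠ l ^ 2) (hk : Real.sin (k * d) = 0)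
    (hl : Real.sin (l * d) = 0) : ∫ s in (0 : ℝ)..d, Real.sin (k * s) * Real.sin (l * s) = 0 := by
  have hne : k ^ 2 - l ^ 2 ≠ 0 := sub_ne_zero.2 hkl
  have h : ∀ s ∈ uIcc 0 d, HasDerivAt (fun s => (l * (Real.sin (k * s) * Real.cos (l * s))
      - k * (Real.cos (k * s) * Real.sin (l * s))) / (k ^ 2 - l ^ 2))
      (Real.sin (k * s) * Real.sin (l * s)) s := fun s _ => by
    refine (((((hasDerivAt_sin_mul k s).mul (hasDerivAt_cos_mul l s)).const_mul l).sub
      (((hasDerivAt_cos_mul k s).mul (hasDerivAt_sin_mul l s)).const_mul k)).div_const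
      _).congr_deriv ?_
    field_simp
    ring
  rw [intervalIntegral.integral_eq_sub_of_hasDerivAt h
    ((by fun_prop : Continuous _).intervalIntegrable _ _), hk, hl]
  simp

lemma integral_sin_mul_sin_self {k : ℝ} (hk0 : k ≠ 0) (hk : Real.sin (k * d) = 0) :
    ∫ s in (0 : ℝ)..d, Real.sin (k * s) * Real.sin (k * s) = d / 2 := by
  have h : ∀ s ∈ uIcc 0 d, HasDerivAt (fun s => (s - Real.sin (k * s) * Real.cos (k * s) / k) / 2)
      (Real.sin (k * s) * Real.sin (k * s)) s := fun s _ => by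
    refine (((hasDerivAt_id s).sub (((hasDerivAt_sin_mul k s).mul
      (hasDerivAt_cos_mul k s)).div_const k)).div_const 2).congr_deriv ?_
    field_simp
    linear_combination -(Real.sin_sq_add_cos_sq (k * s))
  rw [intervalIntegral.integral_eq_sub_of_hasDerivAt h
    ((by fun_prop : Continuous _).intervalIntegrable _ _), hk]
  simp

lemma integral_sin_mul_sinh {k κ : ℝ} (hk : Real.sin (k * d) = 0) (hκ : κ ^ 2 + k ^ 2 ≠ 0) :
    ∫ s in (0 : ℝ)..d, Real.sin (k * s) * Real.sinh (κ * s)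
      = -(k * Real.cos (k * d) * Real.sinh (κ * d)) / (κ ^ 2 + k ^ 2) := by
  have h : ∀ s ∈ uIcc 0 d, HasDerivAt (fun s => (κ * (Real.sin (k * s) * Real.cosh (κ * s))
      - k * (Real.cos (k * s) * Real.sinh (κ * s))) / (κ ^ 2 + k ^ 2))
      (Real.sin (k * s) * Real.sinh (κ * s)) s := fun s _ => by
    refine (((((hasDerivAt_sin_mul k s).mul (hasDerivAt_cosh_mul κ s)).const_mul κ).sub
      (((hasDerivAt_cos_mul k s).mul (hasDerivAt_sinh_mul κ s)).const_mul k)).div_const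
      _).congr_deriv ?_
    field_simp
    ring
  rw [intervalIntegral.integral_eq_sub_of_hasDerivAt h
    ((by fun_prop : Continuous _).intervalIntegrable _ _), hk]
  simp
  ring

/-- The trial function which is `∑ g n * sin (k n * s)` on the line `r = d`, with
`g n = cos (k n * d) * G n`, and which solves `Δf + Λ f = 0` on either side of this line, symmetrically
in `s` and `r` in the tip. By Green's identity, its form only involves the jump of the normal derivative
on `r = d`, and is the difference of the two sides of `hneg`. The signs `cos (k n * d) = ± 1` are split
off since they make all entries of the matrix on the right side positive. -/
lemma exists_trial_of_modes (hd : 0 < d) {R : ℝ} (hR : d < R) {N : ℕ} {k κ G : ℕ → ℝ}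
    (hk : ∀ n, 0 < k n) (hinj : Function.Injective k) (hsin : ∀ n, Real.sin (k n * d) = 0)
    (hκ : ∀ n, 0 < κ n) (hκk : ∀ n, κ n ^ 2 = k n ^ 2 - Λ)
    (hneg : ∑ n ∈ Finset.range N, κ n * (Real.cosh (κ n * d) / Real.sinh (κ n * d)
        + Real.cosh (κ n * (R - d)) / Real.sinh (κ n * (R - d))) * (d / 2) * G n ^ 2
      < ∑ m ∈ Finset.range N, ∑ n ∈ Finset.range N,
        k m * k n / (κ n ^ 2 + k m ^ 2) * (G m * G n)) :
    ∃ w ∈ formTuples d, tupleFun d w ≠ 0 ∧ tupleEnergy w < 2 * Λ * ‖tupleFun d w‖ ^ 2 := by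
  set g : ℕ → ℝ := fun n => Real.cos (k n * d) * G n with hg
  have hcos : ∀ n, Real.cos (k n * d) ^ 2 = 1 := fun n => by
    have := Real.sin_sq_add_cos_sq (k n * d)
    rw [hsin] at this
    linarith
  have hsh : ∀ n, Real.sinh (κ n * d) ≠ 0 := fun n =>
    (Real.sinh_pos_iff.2 (mul_pos (hκ n) hd)).ne'
  have hsh' : ∀ n, Real.sinh (κ n * (R - d)) ≠ 0 := fun n =>
    (Real.sinh_pos_iff.2 (mul_pos (hκ n) (sub_pos.2 hR))).ne'
  -- the solution in the tip, symmetric under the exchange of `s` and `r`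
  have hin := IsHelmholtz.sum (N := N) fun n =>
    ((isHelmholtz_sin_sinh (hκk n)).add (isHelmholtz_sinh_sin (hκk n))).const_mul
      (g n / Real.sinh (κ n * d))
  -- the solution in the rectangle `d ≤ r ≤ R`, vanishing at its end
  have hout := IsHelmholtz.sum (N := N) fun n =>
    (isHelmholtz_sin_sinh_sub (hκk n) R).const_mul (g n / Real.sinh (κ n * (R - d)))
  have ein : ∀ s, ∑ n ∈ Finset.range N, g n / Real.sinh (κ n * d) *
      (Real.sin (k n * s) * Real.sinh (κ n * d) + Real.sinh (κ n * s) * Real.sin (k n * d))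
      = ∑ n ∈ Finset.range N, g n * Real.sin (k n * s) := fun s => by
    refine Finset.sum_congr rfl fun n _ => ?_
    have := hsh n
    rw [hsin]
    field_simp
    ring
  have eout : ∀ s, ∑ n ∈ Finset.range N, g n / Real.sinh (κ n * (R - d)) *
      (Real.sin (k n * s) * Real.sinh (κ n * (R - d)))
      = ∑ n ∈ Finset.range N, g n * Real.sin (k n * s) := fun s => by
    refine Finset.sum_congr rfl fun n _ => ?_
    have := hsh' n
    field_simp
  refine exists_trial_of_glue hd hR (Complex.ofRealCLM.contDiff.comp hin.contDiff)
    (Complex.ofRealCLM.contDiff.comp hout.contDiff) ?_ ?_ ?_ ?_ ?_ ?_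
  · intro s r
    simp only [Function.comp_apply, Complex.ofRealCLM_apply, mul_neg, Real.sin_neg, Real.sinh_neg,
      neg_mul, ← neg_add, Finset.sum_neg_distrib, Complex.ofReal_neg]
  · intro s r
    simp only [Function.comp_apply, Complex.ofRealCLM_apply, mul_neg, Real.sin_neg,
      neg_mul, Finset.sum_neg_distrib, Complex.ofReal_neg]
  · intro s
    simp only [Function.comp_apply, Complex.ofRealCLM_apply, ein, eout]
  · intro r
    simp only [Function.comp_apply, Complex.ofRealCLM_apply, hsin, zero_mul, mul_zero,
      Finset.sum_const_zero, Complex.ofReal_zero]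
  · intro s
    simp only [Function.comp_apply, Complex.ofRealCLM_apply, sub_self, Real.sinh_zero, mul_zero,
      Finset.sum_const_zero, Complex.ofReal_zero]
  · have q1 := hin.setIntegral_tip hd
      (fun s r => Finset.sum_congr rfl fun n _ => by simp only; ring)
      (fun r => by simp)
    have q2 := hout.setIntegral_outer hd hR (fun r => by simp) (fun r => by simp [hsin])
      (fun s => by simp)
    simp only [Function.comp_def, Complex.ofRealCLM_apply]
    rw [q1, q2]
    simp only [ein, eout]
    have c0 : Continuous fun s => ∑ n ∈ Finset.range N, g n * Real.sin (k n * s) := by fun_prop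
    rw [← sub_eq_add_neg, ← intervalIntegral.integral_sub
      ((by fun_prop : Continuous _).intervalIntegrable _ _)
      ((by fun_prop : Continuous _).intervalIntegrable _ _)]
    have e : ∀ s, (∑ n ∈ Finset.range N, g n * Real.sin (k n * s)) *
          (∑ n ∈ Finset.range N, g n / Real.sinh (κ n * d) *
            (Real.sin (k n * s) * (κ n * Real.cosh (κ n * d))
              + Real.sinh (κ n * s) * (k n * Real.cos (k n * d))))
        - (∑ n ∈ Finset.range N, g n * Real.sin (k n * s)) *
          (∑ n ∈ Finset.range N, g n / Real.sinh (κ n * (R - d)) *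
            (Real.sin (k n * s) * -(κ n * Real.cosh (κ n * (R - d)))))
        = ∑ m ∈ Finset.range N, ∑ n ∈ Finset.range N,
          ((g m * g n * (κ n * (Real.cosh (κ n * d) / Real.sinh (κ n * d)
            + Real.cosh (κ n * (R - d)) / Real.sinh (κ n * (R - d)))))
              * (Real.sin (k m * s) * Real.sin (k n * s))
            + (g m * g n * (k n * Real.cos (k n * d)) / Real.sinh (κ n * d))
              * (Real.sin (k m * s) * Real.sinh (κ n * s))) := fun s => by
      rw [← mul_sub, ← Finset.sum_sub_distrib, Finset.sum_mul_sum]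
      refine Finset.sum_congr rfl fun m _ => Finset.sum_congr rfl fun n _ => ?_
      have := hsh n
      have := hsh' n
      field_simp
      ring
    simp only [e]
    rw [intervalIntegral.integral_finsetSum fun m _ =>
      (by fun_prop : Continuous _).intervalIntegrable _ _]
    -- the sines are orthogonal, and the coupling comes from the second term of the tip solution
    have e2 : ∀ m n, ∫ s in (0 : ℝ)..d,
          ((g m * g n * (κ n * (Real.cosh (κ n * d) / Real.sinh (κ n * d)
            + Real.cosh (κ n * (R - d)) / Real.sinh (κ n * (R - d)))))
              * (Real.sin (k m * s) * Real.sin (k n * s))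
            + (g m * g n * (k n * Real.cos (k n * d)) / Real.sinh (κ n * d))
              * (Real.sin (k m * s) * Real.sinh (κ n * s)))
        = (if m = n then κ n * (Real.cosh (κ n * d) / Real.sinh (κ n * d)
            + Real.cosh (κ n * (R - d)) / Real.sinh (κ n * (R - d))) * (d / 2) * G n ^ 2 else 0)
          - k m * k n / (κ n ^ 2 + k m ^ 2) * (G m * G n) := fun m n => by
      have hne : κ n ^ 2 + k m ^ 2 ≠ 0 := by
        have := hκ n
        positivity
      rw [intervalIntegral.integral_add ((by fun_prop : Continuous _).intervalIntegrable _ _)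
        ((by fun_prop : Continuous _).intervalIntegrable _ _), intervalIntegral.integral_const_mul,
        intervalIntegral.integral_const_mul, integral_sin_mul_sinh (hsin m) hne]
      have e3 : g m * g n * (k n * Real.cos (k n * d)) / Real.sinh (κ n * d) *
          (-(k m * Real.cos (k m * d) * Real.sinh (κ n * d)) / (κ n ^ 2 + k m ^ 2))
          = -(k m * k n / (κ n ^ 2 + k m ^ 2) * (G m * G n)) := by
        have h1 : Real.cos (k m * d) ^ 2 * Real.cos (k n * d) ^ 2 = 1 := by rw [hcos, hcos, one_mul]
        have h2 := hsh n
        simp only [hg]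
        generalize Real.sinh (κ n * d) = S at h2 ⊢
        generalize Real.cos (k n * d) = c at h1 ⊢
        generalize Real.cos (k m * d) = c' at h1 ⊢
        field_simp
        linear_combination -(k m * k n * G m * G n) * h1
      rw [e3]
      split_ifs with hmn
      · subst hmn
        rw [integral_sin_mul_sin_self (hk m).ne' (hsin m)]
        simp only [hg]
        linear_combination (κ m * (Real.cosh (κ m * d) / Real.sinh (κ m * d)
            + Real.cosh (κ m * (R - d)) / Real.sinh (κ m * (R - d))) * (d / 2) * G m ^ 2) * hcos m
      · rw [integral_sin_mul_sin_of_ne (fun h => hmn (hinj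
          ((sq_eq_sq₀ (hk m).le (hk n).le).1 h))) (hsin m) (hsin n)]
        ring
    have e4 : ∀ m ∈ Finset.range N, ∫ s in (0 : ℝ)..d, ∑ n ∈ Finset.range N,
          ((g m * g n * (κ n * (Real.cosh (κ n * d) / Real.sinh (κ n * d)
            + Real.cosh (κ n * (R - d)) / Real.sinh (κ n * (R - d)))))
              * (Real.sin (k m * s) * Real.sin (k n * s))
            + (g m * g n * (k n * Real.cos (k n * d)) / Real.sinh (κ n * d))
              * (Real.sin (k m * s) * Real.sinh (κ n * s)))
        = κ m * (Real.cosh (κ m * d) / Real.sinh (κ m * d)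
            + Real.cosh (κ m * (R - d)) / Real.sinh (κ m * (R - d))) * (d / 2) * G m ^ 2
          - ∑ n ∈ Finset.range N, k m * k n / (κ n ^ 2 + k m ^ 2) * (G m * G n) := fun m hm => by
      rw [intervalIntegral.integral_finsetSum fun n _ =>
        (by fun_prop : Continuous _).intervalIntegrable _ _]
      simp only [e2]
      rw [Finset.sum_sub_distrib, Finset.sum_ite_eq, if_pos hm]
    rw [Finset.sum_congr rfl e4, Finset.sum_sub_distrib]
    linarith

end Modes

/-! ### Numerical values -/

section Numerics

/-- The amplitudes of the modes in the trial function; these are, up to sign, the rounded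
minimizers of the quadratic form of `exists_trial_of_modes`. -/
def trialAmplitude (n : ℕ) : ℝ :=
  (([1000, 112, 52, 31, 21, 15, 11, 9, 7, 6, 5, 4, 4, 3, 3, 3] : List ℝ).getD n 0) / 1000

/-- An upper bound for half of `κ (coth κ + coth (8 κ))` with `κ = π √((n + 1) ^ 2 - 0.93)`. -/
def modeBound (n : ℕ) : ℝ :=
  if n = 0 then 3.1416 * 0.26458 * ((1.4683 + 1.0001) / 2)
  else 3.1416 * ((n + 1) - 0.465 / (n + 1) - 0.108 / (n + 1) ^ 3) * 1.0001

/-- The quadratic form of `exists_trial_of_modes` is negative; the difference of the two sides is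
about `8 * 10⁻⁴`. The smallest constant possible in place of `0.93` is about `0.929`, which is why many
modes are needed. -/
lemma trialAmplitude_form_neg :
    ∑ n ∈ Finset.range 16, modeBound n * trialAmplitude n ^ 2
      < ∑ m ∈ Finset.range 16, ∑ n ∈ Finset.range 16,
        ((m : ℝ) + 1) * (n + 1) / ((n + 1) ^ 2 - 0.93 + (m + 1) ^ 2)
          * (trialAmplitude m * trialAmplitude n) := by
  norm_num [Finset.sum_range_succ, trialAmplitude, modeBound]

lemma cosh_div_sinh_le {x c : ℝ} (hx : 0 < x) (h : c + 1 ≤ (c - 1) * Real.exp (2 * x)) :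
    Real.cosh x / Real.sinh x ≤ c := by
  rw [div_le_iff₀ (Real.sinh_pos_iff.2 hx), Real.cosh_eq, Real.sinh_eq]
  have h1 : Real.exp (2 * x) = Real.exp x * Real.exp x := by rw [← Real.exp_add]; ring_nf
  have h2 : Real.exp x * Real.exp (-x) = 1 := by rw [← Real.exp_add]; simp
  have h3 := mul_le_mul_of_nonneg_right h (Real.exp_pos (-x)).le
  rw [h1, mul_assoc, mul_assoc, h2] at h3
  linarith

lemma cosh_div_sinh_le_of_ge {x : ℝ} (hx : 5.5 ≤ x) : Real.cosh x / Real.sinh x ≤ 1.0001 := by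
  refine cosh_div_sinh_le (by linarith) ?_
  have h1 : (2.7 : ℝ) ^ 11 ≤ Real.exp (2 * x) := by
    calc (2.7 : ℝ) ^ 11 ≤ Real.exp 1 ^ 11 := by
          have := Real.exp_one_gt_d9
          gcongr
          linarith
      _ = Real.exp 11 := by rw [← Real.exp_nat_mul]; norm_num
      _ ≤ Real.exp (2 * x) := Real.exp_le_exp.2 (by linarith)
  norm_num at h1 ⊢
  linarith

/-- The expansion of the square root to second order, with `0.465 = 0.93 / 2` and
`0.108 < 0.93 ^ 2 / 8`. -/
lemma sqrt_le_of_two_le {y : ℝ} (hy : 2 ≤ y) :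
    Real.sqrt (y ^ 2 - 0.93) ≤ y - 0.465 / y - 0.108 / y ^ 3 := by
  have hy0 : 0 < y := by linarith
  have h1 : 0.465 / y ≤ 0.465 / 2 := by gcongr
  have h2 : 0.108 / y ^ 3 ≤ 0.108 / 2 ^ 3 := by gcongr
  refine Real.sqrt_le_iff.2 ⟨by norm_num at h1 h2 ⊢; linarith, ?_⟩
  have h3 : (y - 0.465 / y - 0.108 / y ^ 3) ^ 2
      = y ^ 2 - 0.93 + (0.000225 / y ^ 2 + 0.10044 / y ^ 4 + 0.011664 / y ^ 6) := by
    field_simp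
    ring
  rw [h3]
  have : 0 ≤ 0.000225 / y ^ 2 + 0.10044 / y ^ 4 + 0.011664 / y ^ 6 := by positivity
  linarith

lemma mode_le_modeBound (n : ℕ) {x : ℝ} (hx : x = Real.pi * Real.sqrt (((n : ℝ) + 1) ^ 2 - 0.93)) :
    x * (Real.cosh x / Real.sinh x + Real.cosh (8 * x) / Real.sinh (8 * x)) / 2
      ≤ modeBound n := by
  have hπ := Real.pi_gt_d4
  have hπ' := Real.pi_lt_d4
  rcases Nat.eq_zero_or_pos n with rfl | hn
  · rw [modeBound, if_pos rfl]
    have h1 : Real.sqrt (((0 : ℕ) + 1 : ℝ) ^ 2 - 0.93) ≤ 0.26458 :=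
      Real.sqrt_le_iff.2 ⟨by norm_num, by norm_num⟩
    have h2 : 0.26457 ≤ Real.sqrt (((0 : ℕ) + 1 : ℝ) ^ 2 - 0.93) :=
      Real.le_sqrt_of_sq_le (by norm_num)
    have hlo : 0.831146 ≤ x := by
      calc (0.831146 : ℝ) ≤ 3.1415 * 0.26457 := by norm_num
        _ ≤ x := by rw [hx]; gcongr
    have hup : x ≤ 3.1416 * 0.26458 := by rw [hx]; gcongr
    have c1 : Real.cosh x / Real.sinh x ≤ 1.4683 := by
      refine cosh_div_sinh_le (by linarith) ?_
      have h3 := Real.sum_le_exp_of_nonneg (x := 1.662292) (by norm_num) 12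
      have h4 : Real.exp 1.662292 ≤ Real.exp (2 * x) := Real.exp_le_exp.2 (by linarith)
      have h5 : (5.2711 : ℝ) ≤ Real.exp (2 * x) := by
        refine le_trans ?_ (h3.trans h4)
        norm_num [Finset.sum_range_succ, Nat.factorial]
      norm_num at h5 ⊢
      linarith
    have c2 := cosh_div_sinh_le_of_ge (x := 8 * x) (by linarith)
    have hx0 : 0 ≤ x := by linarith
    calc x * (Real.cosh x / Real.sinh x + Real.cosh (8 * x) / Real.sinh (8 * x)) / 2
        ≤ x * (1.4683 + 1.0001) / 2 := by gcongr
      _ ≤ 3.1416 * 0.26458 * (1.4683 + 1.0001) / 2 := by gcongr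
      _ = _ := by ring
  · rw [modeBound, if_neg hn.ne']
    have hn1 : (1 : ℝ) ≤ n := by exact_mod_cast hn
    have h1 := sqrt_le_of_two_le (y := n + 1) (by linarith)
    have h2 : 1.752 ≤ Real.sqrt (((n : ℝ) + 1) ^ 2 - 0.93) :=
      Real.le_sqrt_of_sq_le (by norm_num; nlinarith)
    have hlo : 5.5 ≤ x := by
      calc (5.5 : ℝ) ≤ 3.1415 * 1.752 := by norm_num
        _ ≤ x := by rw [hx]; gcongr
    have hup : x ≤ 3.1416 * ((n + 1) - 0.465 / (n + 1) - 0.108 / (n + 1) ^ 3) := by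
      rw [hx]
      gcongr
    have c1 := cosh_div_sinh_le_of_ge hlo
    have c2 := cosh_div_sinh_le_of_ge (x := 8 * x) (by linarith)
    have hx0 : 0 ≤ x := by linarith
    calc x * (Real.cosh x / Real.sinh x + Real.cosh (8 * x) / Real.sinh (8 * x)) / 2
        ≤ x * (1.0001 + 1.0001) / 2 := by gcongr
      _ = x * 1.0001 := by ring
      _ ≤ _ := by gcongr

/-- A trial function whose Rayleigh quotient is below `0.93` times the threshold. -/
lemma exists_trial {d : ℝ} (hd : 0 < d) :
    ∃ w ∈ formTuples d, tupleFun d w ≠ 0 ∧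
      tupleEnergy w < 2 * (0.93 * (Real.pi / d) ^ 2) * ‖tupleFun d w‖ ^ 2 := by
  have hπ := Real.pi_pos
  have hpos : ∀ n : ℕ, 0 < ((n : ℝ) + 1) ^ 2 - 0.93 := fun n => by
    have : (0 : ℝ) ≤ n := n.cast_nonneg
    norm_num
    nlinarith
  have hsq : ∀ n : ℕ, Real.sqrt (((n : ℝ) + 1) ^ 2 - 0.93) ^ 2 = ((n : ℝ) + 1) ^ 2 - 0.93 :=
    fun n => Real.sq_sqrt (hpos n).le
  -- the rectangle of length `8 d` is long enough to replace the half-infinite strip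
  refine exists_trial_of_modes hd (R := 9 * d) (by linarith) (N := 16)
    (k := fun n => (n + 1) * (Real.pi / d))
    (κ := fun n => Real.pi / d * Real.sqrt (((n : ℝ) + 1) ^ 2 - 0.93)) (G := trialAmplitude)
    (fun n => by positivity) ?_ ?_ ?_ ?_ ?_
  · intro m n h
    have h1 := mul_right_cancel₀ (by positivity) h
    exact_mod_cast add_right_cancel h1
  · intro n
    have : ((n : ℝ) + 1) * (Real.pi / d) * d = ((n + 1 : ℕ) : ℝ) * Real.pi := by
      push_cast
      field_simp
    rw [this, Real.sin_nat_mul_pi]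
  · intro n
    have := Real.sqrt_pos.2 (hpos n)
    positivity
  · intro n
    rw [mul_pow, hsq]
    ring
  · refine lt_of_le_of_lt (Finset.sum_le_sum fun n _ => ?_) (trialAmplitude_form_neg.trans_eq
      (Finset.sum_congr rfl fun m _ => Finset.sum_congr rfl fun n _ => ?_))
    · have h := mode_le_modeBound n rfl
      have e1 : Real.pi / d * Real.sqrt (((n : ℝ) + 1) ^ 2 - 0.93) * d
          = Real.pi * Real.sqrt (((n : ℝ) + 1) ^ 2 - 0.93) := by field_simp
      have e2 : Real.pi / d * Real.sqrt (((n : ℝ) + 1) ^ 2 - 0.93) * (9 * d - d)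
          = 8 * (Real.pi * Real.sqrt (((n : ℝ) + 1) ^ 2 - 0.93)) := by
        field_simp
        ring
      rw [e1, e2]
      refine le_trans (le_of_eq ?_) (mul_le_mul_of_nonneg_right h (sq_nonneg (trialAmplitude n)))
      field_simp
    · have h1 := hpos n
      rw [mul_pow, hsq]
      congr 1
      field_simp

end Numerics

end PairModel

end

theorem mainTheorem6 (hbar mₑ d : ℝ) (hhbar : 0 < hbar) (hmₑ : 0 < mₑ) (hd : 0 < d) :
    (∀ σ : ℝ → ℝ, MemLp σ ∞ (volume.restrict (Ici (0 : ℝ))) →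
      ∃ A : PairModel.antisymmetricL2 d →ₗ.[ℂ] PairModel.antisymmetricL2 d,
        PairModel.IsPairHamiltonian hbar mₑ d σ A ∧
        PairModel.essentialSpectrum A =
          Complex.ofReal '' Ici (hbar ^ 2 * Real.pi ^ 2 / (mₑ * d ^ 2))) ∧
    ∃ A : PairModel.antisymmetricL2 d →ₗ.[ℂ] PairModel.antisymmetricL2 d,
      PairModel.IsPairHamiltonian hbar mₑ d (fun _ => 0) A ∧
      ∃ E₀ : ℝ, PairModel.discreteSpectrum A = {(E₀ : ℂ)} ∧
        Module.finrank ℂ (PairModel.eigenspace A (E₀ : ℂ)) = 1 ∧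
        0.25 * (hbar ^ 2 * Real.pi ^ 2 / (mₑ * d ^ 2)) ≤ E₀ ∧
        E₀ ≤ 0.93 * (hbar ^ 2 * Real.pi ^ 2 / (mₑ * d ^ 2)) := by
  have ha : 0 < hbar ^ 2 / (2 * mₑ) := by positivity
  have hthr : hbar ^ 2 * Real.pi ^ 2 / (mₑ * d ^ 2)
      = hbar ^ 2 / (2 * mₑ) * (2 * (Real.pi / d) ^ 2) := by
    field_simp
  constructor
  · intro σ hσ
    obtain ⟨T, hT⟩ := PairModel.exists_multiplication (d := d) hσ
    obtain ⟨B, hB⟩ := PairModel.exists_operator (hbar ^ 2 / (2 * mₑ)) T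
    obtain ⟨A, hA, hgraph⟩ := PairModel.exists_isPairHamiltonian hd hhbar hmₑ hT hB
    refine ⟨A, hA, ?_⟩
    rw [hthr]
    exact PairModel.essentialSpectrum_eq_Ici hA.isSelfAdjoint
      (fun μ hμ => PairModel.mem_spec_of_threshold_le hd ha hB hgraph hμ)
      (fun E hE => PairModel.exists_finite_rank_bound hd ha hB hgraph hE)
  · have hT : ∀ b : PairModel.BottomL2 d, (0 : PairModel.BottomL2 d →L[ℂ] PairModel.BottomL2 d) b
        =ᵐ[volume.restrict (Icc 0 d)] fun y => (((fun _ => 0 : ℝ → ℝ) y : ℝ) : ℂ) * b y := by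
      intro b
      filter_upwards [Lp.coeFn_zero ℂ 2 (volume.restrict (Icc 0 d))] with y hy
      rw [zero_apply, hy]
      simp
    obtain ⟨B, hB⟩ := PairModel.exists_operator (hbar ^ 2 / (2 * mₑ))
      (0 : PairModel.BottomL2 d →L[ℂ] PairModel.BottomL2 d)
    obtain ⟨A, hA, hgraph⟩ := PairModel.exists_isPairHamiltonian hd hhbar hmₑ
      (σ := fun _ => 0) hT hB
    obtain ⟨w, hw, hw0, hlt⟩ := PairModel.exists_trial hd
    have hess := PairModel.essentialSpectrum_eq_Ici hA.isSelfAdjoint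
      (fun μ hμ => PairModel.mem_spec_of_threshold_le hd ha hB hgraph hμ)
      (fun E hE => PairModel.exists_finite_rank_bound hd ha hB hgraph hE)
    have hpos : 0 < hbar ^ 2 / (2 * mₑ) * (2 * (Real.pi / d) ^ 2) := by
      have := Real.pi_pos
      positivity
    obtain ⟨E₀, h1, h2, h3, h4⟩ := PairModel.discreteSpectrum_eq_singleton hd ha hB hgraph
      hA.isSelfAdjoint hess (Λ := 0.93 * (hbar ^ 2 / (2 * mₑ) * (2 * (Real.pi / d) ^ 2)))
      (by norm_num at hpos ⊢; linarith) ⟨w, hw, hw0, by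
        have := mul_le_mul_of_nonneg_left hlt.le ha.le
        linarith⟩
    refine ⟨A, hA, E₀, h1, h2, ?_, ?_⟩
    · rw [hthr]
      refine le_trans (le_of_eq ?_) h3
      field_simp
      norm_num
    · rw [hthr]
      exact h4
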